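/- **Setting.** Let $f:\mathbb R\to(0,\infty]$ be even with $f(0)=1$, finite and continuously differentiable on some interval $[-\delta,\delta]$, $\delta>0$, and let there be $c_f\in(0,1)$ with $f(k)\ge 2c_f$ for all $k>0$, such that the functions $b_t(k)=\exp(-k^2(f(k)-c_f)t)$ satisfy $\sup_{t>0}|b_t|_{\mathrm{BV}}<\infty$ (with $e^{-\infty}=0$). Let $h:\mathbb R\to\mathbb R$ be even and bounded, with $h^2/f$ of bounded variation (where $1/\infty=0$), twice differentiable at $0$, $h(0)=1$, $h'(0)=0$. Let $\mu$ be a finite signed Borel measure on $\mathbb R$ with $\mu(\mathbb R)=0$, $\int x\,\mu(dx)=1$ and $\int |x|^2\,|\mu|(dx)<\infty$. Let $W$ be a cylindrical Brownian motion on $L^2([-\pi,\pi];\mathbb R^n)$ and, for $\varepsilon\in(0,1]$, let $$X_\varepsilon(t,x)=\frac1{\sqrt{2\pi}}\sum_{k\in\mathbb Z}e^{ikx}\int_0^t e^{-k^2f(\varepsilon k)(t-s)}\,h(\varepsilon k)\,dw_k(s),$$ where $w_k$ is the $k$-th coefficient of $W$ in the orthonormal basis $(e^{ikx}/\sqrt{2\pi})_{k\in\mathbb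 Z}$; this is the mild solution with $X_\varepsilon(0)=0$ of $dX_\varepsilon=\Delta_\varepsilon X_\varepsilon\,dt+H_\varepsilon\,dW$, with $\widehat{\Delta_\varepsilon u}(k)=-k^2f(\varepsilon k)\hat u(k)$ and $\widehat{H_\varepsilon u}(k)=h(\varepsilon k)\hat u(k)$. Functions on $[-\pi,\pi]$ are extended periodically. The area process $$\mathbf X_\varepsilon(t;x,y)=\int_x^y\big(X_\varepsilon(t,z)-X_\varepsilon(t,x)\big)\otimes d_zX_\varepsilon(t,z)\in\mathbb R^{n\times n},\qquad t\ge0,\ x,y\in\mathbb R,$$ is the version with paths continuous in $(t,x,y)$ of the limit in $L^2(\Omega)$, as $N\to\infty$, of the same integrals for the truncations of the Fourier series of $X_\varepsilon$ to $|k|\le N$; such a version exists. Put $$D_\varepsilon\mathbf X_\varepsilon(t,x)=\frac1\varepsilon\int_{\mathbb R}\mathbf X_\varepsilon(t;x,x+\varepsilon z)\,\mu(dz),$$ $$\Lambda_\varepsilon(t)=\int_{\mathbb R}\frac2\varepsilon\sum_{k\in\mathbb Z\setminus\{0\}}\frac{h(\varepsilon k)^2}{4\pi k^2f(\varepsilon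 k)}\big(1-e^{-2k^2f(\varepsilon k)t}\big)\sin^2\Big(\frac{k\varepsilon z}2\Big)\,\mu(dz),$$ $$\Lambda=\frac1{2\pi}\int_{\mathbb R_+}\int_{\mathbb R}\frac{(1-\cos(yt))\,h(t)^2}{t^2f(t)}\,\mu(dy)\,dt .$$ For a matrix-valued function $u$ on $[-\pi,\pi]$ let $|u|_{H^{-\alpha}}^2=\sum_{m\in\mathbb Z}(1+m^2)^{-\alpha}|\hat u(m)|^2$, with $\hat u(m)=\frac1{2\pi}\int_{-\pi}^{\pi}u(x)e^{-imx}\,dx$ and the Hilbert–Schmidt norm $|\cdot|$ of matrices. **Proposition 4.1.** Let $1\le p<\infty$, $0<\alpha<\frac12$, $T>0$ and $\kappa>0$. There is a constant $C$, independent of $\varepsilon$, such that for all $\varepsilon\in(0,1]$ $$\mathbb E\Big[\sup_{t\in[0,T]}\big|D_\varepsilon\mathbf X_\varepsilon(t,\cdot)-\Lambda_\varepsilon(t)\,\mathrm{Id}\big|_{H^{-\alpha}}^p\Big]^{1/p}\le C\,\varepsilon^{\alpha-\kappa},$$ $$\sup_{t\in[0,T]}t^{\alpha/2}\,\big|\Lambda_\varepsilon(t)-\Lambda\big|\le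 C\,\varepsilon^{\alpha-\kappa}.$$ -/

import Mathlib

open MeasureTheory ProbabilityTheory Set Filter Topology
open scoped ENNReal NNReal

noncomputable section

namespace RoughBurgers

/-! ### The cut-off functions and the measure defining the discrete derivative -/

/-- `b_t(k) = exp (-k² (f k - c) t)`, with `exp (-∞) = 0` where `f k = ∞`. -/
def oscFactor (f : ℝ → ℝ≥0∞) (c t k : ℝ) : ℝ :=
  if f k = ⊤ then 0 else Real.exp (-(k ^ 2 * ((f k).toReal - c) * t))

/-- The quotient `h² / f`, equal to `0` where `f = ∞`. -/
def noiseRatio (f : ℝ → ℝ≥0∞) (h : ℝ → ℝ) (k : ℝ) : ℝ :=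
  h k ^ 2 * ((f k)⁻¹).toReal

/-- The standing assumptions on the function `f : ℝ → (0, ∞]` which defines the approximate
Laplacian, on the function `h` which defines the approximation of the noise, and on the signed
Borel measure `μ` which defines the approximate derivative. -/
structure CutoffAssumptions (f : ℝ → ℝ≥0∞) (h : ℝ → ℝ) (μ : SignedMeasure ℝ) : Prop where
  f_pos : ∀ k, 0 < f k
  f_even : ∀ k, f (-k) = f k
  f_zero : f 0 = 1
  f_C1 : ∃ δ > 0, (∀ k ∈ Icc (-δ) δ, f k ≠ ⊤) ∧
    ContDiffOn ℝ 1 (fun k => (f k).toReal) (Icc (-δ) δ)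
  /-- The lower bound on `f`, and the uniform bound on the variation of the functions `b_t`
  formed with the same constant. -/
  f_lower_bv : ∃ c ∈ Ioo (0 : ℝ) 1, (∀ k > 0, ENNReal.ofReal (2 * c) ≤ f k) ∧
    ∃ B : ℝ≥0, ∀ t > 0, eVariationOn (oscFactor f c t) univ ≤ B
  mu_univ : μ univ = 0
  mu_second_moment : ∫⁻ x, ‖x‖ₑ ^ 2 ∂μ.totalVariation < ⊤
  mu_mean : ∫ᵛ x, x ∂<•μ = 1
  h_even : ∀ k, h (-k) = h k
  h_bdd : ∃ M, ∀ k, |h k| ≤ M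
  h_ratio_bv : eVariationOn (noiseRatio f h) univ < ⊤
  h_zero : h 0 = 1
  h_deriv_zero : HasDerivAt h 0 0
  h_diff_near : ∀ᶠ k in 𝓝 0, DifferentiableAt ℝ h k
  h_twice : DifferentiableAt ℝ (deriv h) 0

/-! ### The constants `Λ` and `Λ_ε(t)` -/

/-- The Fourier multiplier `exp (-k² f(ε k) s)` of the approximate heat semigroup at time `s`,
equal to `0` where `f(ε k) = ∞`. -/
def heatSymbol (f : ℝ → ℝ≥0∞) (ε : ℝ) (k : ℤ) (s : ℝ) : ℝ :=
  if f (ε * k) = ⊤ then 0 else Real.exp (-((k : ℝ) ^ 2 * (f (ε * k)).toReal * s))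

/-- The amplitude `q_ε^k`: it is `h(ε k) / (|k| √(4π f(ε k)))` for `k ≠ 0`, which is `0` where
`f(ε k) = ∞`, and `1 / √(2π)` for `k = 0`. -/
def modeAmplitude (f : ℝ → ℝ≥0∞) (h : ℝ → ℝ) (ε : ℝ) (k : ℤ) : ℝ :=
  if k = 0 then 1 / √(2 * Real.pi)
  else h (ε * k) * √(((f (ε * k))⁻¹).toReal) / (|(k : ℝ)| * √(4 * Real.pi))

/-- The variance `𝒦_k^{t,t}` of the `k`-th normalised Fourier mode at time `t`. -/
def modeVariance (f : ℝ → ℝ≥0∞) (ε : ℝ) (k : ℤ) (t : ℝ) : ℝ :=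
  if k = 0 then t else 1 - heatSymbol f ε k (2 * t)

/-- `Λ_{z,ε}(t)`, the common expectation of the diagonal entries of `ε⁻¹ 𝐗_ε(t; x, x + ε z)`. -/
def LambdaZ (f : ℝ → ℝ≥0∞) (h : ℝ → ℝ) (ε t z : ℝ) : ℝ :=
  2 / ε * ∑' k : ℤ, modeAmplitude f h ε k ^ 2 * modeVariance f ε k t *
    Real.sin (k * ε * z / 2) ^ 2

/-- `Λ_ε(t) = ∫ Λ_{z,ε}(t) μ(dz)`. -/
def LambdaEps (f : ℝ → ℝ≥0∞) (h : ℝ → ℝ) (μ : SignedMeasure ℝ) (ε t : ℝ) : ℝ :=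
  ∫ᵛ z, LambdaZ f h ε t z ∂<•μ

/-- `Λ = (2π)⁻¹ ∫_{ℝ₊} ∫_ℝ (1 - cos (y t)) h(t)² / (t² f(t)) μ(dy) dt`. -/
def LambdaLim (f : ℝ → ℝ≥0∞) (h : ℝ → ℝ) (μ : SignedMeasure ℝ) : ℝ :=
  1 / (2 * Real.pi) * ∫ t in Ioi (0 : ℝ),
    ∫ᵛ y, (1 - Real.cos (y * t)) * noiseRatio f h t / t ^ 2 ∂<•μ

/-! ### The driving noise -/

/-- Lebesgue measure on `[0, ∞) × [-π, π]` (time and space). -/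
def spaceTime : Measure (ℝ × ℝ) :=
  (volume.restrict (Ici (0 : ℝ))).prod (volume.restrict (Icc (-Real.pi) Real.pi))

/-- `W` is the (Wiener integral with respect to the) cylindrical Brownian motion on
`L²([-π, π]; ℝⁿ)`: the centred Gaussian family indexed by the functions in
`L²([0, ∞) × [-π, π]; ℝⁿ)`, given here componentwise, whose covariance is the inner product.
Thus `W i φ` is `∫_0^∞ ⟨φ(s, ·) e_i, dW(s)⟩`. -/
structure IsWhiteNoise {Ω : Type*} [MeasurableSpace Ω] (P : Measure Ω) {n : ℕ}
    (W : Fin n → Lp ℝ 2 spaceTime → Ω → ℝ) : Prop where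
  gaussian : IsGaussianProcess (fun a : Fin n × Lp ℝ 2 spaceTime => W a.1 a.2) P
  centred : ∀ i φ, ∫ ω, W i φ ω ∂P = 0
  cov : ∀ i j φ ψ, ∫ ω, W i φ ω * W j ψ ω ∂P = if i = j then inner ℝ φ ψ else 0

/-- The integrand of the `k`-th Fourier coefficient of `X_ε(t) = ∫_0^t S_ε(t - s) H_ε dW(s)`.
With `w_k(s)` the `k`-th coefficient of `W(s)` in the orthonormal basis `e^{ikx} / √(2π)`, this
coefficient is `(2π)^{-1/2} ∫_0^t exp (-k² f(ε k) (t - s)) h(ε k) dw_k(s)`, and `dw_k(s)` is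
`dW(s)` tested against `e^{-iky} / √(2π)`. -/
def modeKernel (f : ℝ → ℝ≥0∞) (h : ℝ → ℝ) (ε : ℝ) (k : ℤ) (t : ℝ) (z : ℝ × ℝ) : ℂ :=
  (Icc (0 : ℝ) t ×ˢ (univ : Set ℝ)).indicator
    (fun z : ℝ × ℝ => ((h (ε * k) * heatSymbol f ε k (t - z.1) / (2 * Real.pi) : ℝ) : ℂ) *
      Complex.exp (-(Complex.I * k * z.2))) z

theorem memLp_modeKernel (f : ℝ → ℝ≥0∞) (h : ℝ → ℝ) (ε : ℝ) (k : ℤ) (t : ℝ) :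
    MemLp (modeKernel f h ε k t) 2 spaceTime := by
  have hs : MeasurableSet (Icc (0 : ℝ) t ×ˢ (univ : Set ℝ)) :=
    measurableSet_Icc.prod MeasurableSet.univ
  have hfin : spaceTime (Icc (0 : ℝ) t ×ˢ (univ : Set ℝ)) ≠ ⊤ := by
    rw [spaceTime, Measure.prod_prod]
    refine ENNReal.mul_ne_top ?_ ?_
    · exact ((Measure.restrict_apply_le _ _).trans_lt measure_Icc_lt_top).ne
    · rw [Measure.restrict_apply_univ]
      exact measure_Icc_lt_top.ne
  have hmeas : Measurable (fun z : ℝ × ℝ =>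
      ((h (ε * k) * heatSymbol f ε k (t - z.1) / (2 * Real.pi) : ℝ) : ℂ) *
        Complex.exp (-(Complex.I * k * z.2))) := by
    unfold heatSymbol
    split_ifs <;> fun_prop
  have hmem : MemLp ((Icc (0 : ℝ) t ×ˢ (univ : Set ℝ)).indicator
      (fun _ : ℝ × ℝ => (|h (ε * k)| / (2 * Real.pi) : ℝ))) 2 spaceTime :=
    memLp_indicator_const 2 hs _ (Or.inr hfin)
  refine hmem.mono ((hmeas.indicator hs).aestronglyMeasurable) (Eventually.of_forall fun z => ?_)
  have hpi := Real.pi_pos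
  unfold modeKernel
  by_cases hz : z ∈ Icc (0 : ℝ) t ×ˢ (univ : Set ℝ)
  · rw [indicator_of_mem hz, indicator_of_mem hz, norm_mul, Complex.norm_exp, Complex.norm_real]
    have hre : (-(Complex.I * (k : ℂ) * (z.2 : ℂ))).re = 0 := by simp
    have hdec : |heatSymbol f ε k (t - z.1)| ≤ 1 := by
      unfold heatSymbol
      split_ifs
      · simp
      · rw [abs_of_pos (Real.exp_pos _), Real.exp_le_one_iff]
        have : 0 ≤ t - z.1 := sub_nonneg.2 hz.1.2
        have := ENNReal.toReal_nonneg (a := f (ε * k))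
        have h2 : 0 ≤ (k : ℝ) ^ 2 * (f (ε * k)).toReal * (t - z.1) := by positivity
        linarith
    rw [hre, Real.exp_zero, mul_one, Real.norm_eq_abs, Real.norm_eq_abs, abs_div, abs_mul,
      abs_div, abs_abs]
    gcongr
    exact mul_le_of_le_one_right (abs_nonneg _) hdec
  · rw [indicator_of_notMem hz, indicator_of_notMem hz]
    simp

section Area

variable {Ω : Type*} {n : ℕ}

/-- The `k`-th Fourier coefficient (the coefficient of `e^{ikx}`) of the `i`-th component of
`X_ε(t, x)`; it is the product of the amplitude `q_ε^k` and the normalised mode `ξ_ε^k(t)`. -/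
def modeCoeff (W : Fin n → Lp ℝ 2 spaceTime → Ω → ℝ) (f : ℝ → ℝ≥0∞) (h : ℝ → ℝ) (ε : ℝ)
    (k : ℤ) (t : ℝ) (i : Fin n) (ω : Ω) : ℂ :=
  (W i ((memLp_modeKernel f h ε k t).re.toLp _) ω : ℂ) +
    Complex.I * (W i ((memLp_modeKernel f h ε k t).im.toLp _) ω : ℂ)

/-- The `(i, j)` entry of `∫_x^y (X(t, z) - X(t, x)) ⊗ d_z X(t, z)`, where `X` is the truncation
of the Fourier series of `X_ε` to `|k| ≤ N`. -/
def areaPartialSum (W : Fin n → Lp ℝ 2 spaceTime → Ω → ℝ) (f : ℝ → ℝ≥0∞) (h : ℝ → ℝ) (ε : ℝ)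
    (N : ℕ) (t x y : ℝ) (i j : Fin n) (ω : Ω) : ℂ :=
  ∑ k ∈ Finset.Icc (-N : ℤ) N, ∑ l ∈ Finset.Icc (-N : ℤ) N,
    modeCoeff W f h ε k t i ω * modeCoeff W f h ε l t j ω *
      ∫ z in x..y, (Complex.exp (Complex.I * k * z) - Complex.exp (Complex.I * k * x)) *
        (Complex.I * l * Complex.exp (Complex.I * l * z))

/-- `A t x y` is (a version with continuous paths of) the area process `𝐗_ε(t; x, y)`: for fixed
`t, x, y` it is the limit in `L²(Ω)` of the iterated integrals of the truncated Fourier series,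
and almost surely it is jointly continuous in `(t, x, y)`. The space variables range over `ℝ`, so
that functions on the torus are identified with their periodic extensions. -/
structure IsAreaProcess [MeasurableSpace Ω] (P : Measure Ω)
    (W : Fin n → Lp ℝ 2 spaceTime → Ω → ℝ) (f : ℝ → ℝ≥0∞) (h : ℝ → ℝ) (ε : ℝ)
    (A : ℝ → ℝ → ℝ → Ω → Matrix (Fin n) (Fin n) ℝ) : Prop where
  aestronglyMeasurable : ∀ t ≥ 0, ∀ x y i j,
    AEStronglyMeasurable (fun ω => A t x y ω i j) P
  tendsto_L2 : ∀ t ≥ 0, ∀ x y i j,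
    Tendsto (fun N : ℕ => eLpNorm
      (fun ω => (A t x y ω i j : ℂ) - areaPartialSum W f h ε N t x y i j ω) 2 P) atTop (𝓝 0)
  continuous_paths : ∀ᵐ ω ∂P,
    ContinuousOn (fun q : ℝ × ℝ × ℝ => A q.1 q.2.1 q.2.2 ω) (Ici (0 : ℝ) ×ˢ univ)

/-- `D_ε 𝐗(t; y) = ε⁻¹ ∫ 𝐗(t; y, y + ε z) μ(dz)`, entry by entry. -/
def areaDerivative (μ : SignedMeasure ℝ) (ε : ℝ)
    (A : ℝ → ℝ → ℝ → Ω → Matrix (Fin n) (Fin n) ℝ) (t y : ℝ) (ω : Ω) :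
    Matrix (Fin n) (Fin n) ℝ :=
  Matrix.of fun i j => ε⁻¹ * ∫ᵛ z, A t y (y + ε * z) ω i j ∂<•μ

end Area

/-! ### The negative Sobolev norm -/

/-- The norm of `H^s([-π, π])` (periodic), with values in `[0, ∞]`, of a matrix-valued function:
`(∑_m (1 + m²)^s |û(m)|²)^{1/2}` with the Hilbert–Schmidt norm `|·|` of the Fourier
coefficients `û(m) = (2π)⁻¹ ∫_{-π}^π u(x) e^{-imx} dx`. -/
def sobolevNorm {n : ℕ} (s : ℝ) (u : ℝ → Matrix (Fin n) (Fin n) ℝ) : ℝ≥0∞ :=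
  (∑' m : ℤ, ENNReal.ofReal ((1 + (m : ℝ) ^ 2) ^ s) * ∑ i, ∑ j,
    ‖fourierCoeffOn (neg_lt_self Real.pi_pos) (fun x => (u x i j : ℂ)) m‖ₑ ^ 2) ^ (1 / 2 : ℝ)

end RoughBurgers

end

open MeasureTheory ProbabilityTheory Set Filter Topology
open scoped ENNReal NNReal

noncomputable section

namespace RoughBurgers

/-! ### Quadratic forms in independent standard Gaussian variables -/

/-! The Fourier coefficients `Z k t` of `X_ε` form a centred Gaussian family, orthogonal for
different frequencies, with variance `ρ k t ≤ C / k²` for `k ≠ 0`, uniformly in `ε`. The area is a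
quadratic form in them whose coefficients are the iterated integrals `areaKernel k l x y`.
Independence of the components and orthogonality leave only the pairs `l = -k` with `i = j` in its
mean. Averaging over `k ↔ -k` turns this mean into `∑ ρ k t (1 - cos (k (y - x)))`, and integration
against `ε⁻¹ μ` gives exactly `Λ_ε(t)`. The first bound therefore concerns a centred element of the
second Gaussian chaos.

A translation multiplies `areaKernel k l` by `e^{i(k+l)x}`. Hence the `m`-th Fourier coefficient of
`D_ε 𝐗_ε - Λ_ε Id` is a centred quadratic form over the pairs `k + l = m`, with coefficients `ε⁻¹ ∫
areaKernel k l 0 (ε z) μ(dz)`. Wick's formula (`sqMoment_bilinear_sub_integral_le`) bounds its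
variance by a multiple of the sum of the squared coefficients divided by `k² l²`. Over an interval
of length `r` the kernel is at most `|k| |l| r²`, at most `2 |l| r`, and, by oscillation, at most `2
|l| / |m| + 2` for `m ≠ 0`. These bounds produce a variance of order `min ε (1 / max 1 |m|)`
(`sum_derivCoeff_div_le`). A cruder version bounds the variance of time increments by a multiple of
`|t - s|^{1/8} (max 1 |m|)^{1/4}`.

A small power `η` interpolates between the two variance bounds. On the second chaos all moments are
controlled by the second one (`eLpNorm_chaosTwo_le`), so Kolmogorov's criterion controls the
supremum over time of each coefficient (`IsAreaLimit.exists_bound`). Splitting `min ε (1 / |m|)`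
into a power of `ε` and a power of `1 / |m|`, the sum against `(1 + m²)^{-α}` converges with a
factor `ε^{2(α-η)}` (`sobolevWeight_mul_le`); the square root is the claimed rate. Kolmogorov's
theorem in three parameters, with the summability of `areaWeight`, also gives the existence of the
area process.

For the constants, the term with the heat factor is separated. Multiplied by `t^{α/2}` it is
summable, because `t^{α/2} e^{-2k²ft}` is of order `|k|^{-α}`. What remains is a Riemann sum of mesh
`ε` for a function of bounded variation times `sin²(xz/2) / x²`. Its error is of order `ε^{1/2}`,
which is better than `ε^α` (`abs_riemann_sum_sub_le`). -/

theorem integral_pow_four_gaussianReal : ∫ x, x ^ 4 ∂(gaussianReal 0 1) = 3 := by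
  have h := iteratedDeriv_mgf_zero (X := id) (μ := gaussianReal 0 1) (by simp) 4
  rw [mgf_id_gaussianReal] at h
  have e : ∀ x : ℝ, HasDerivAt (fun t : ℝ => Real.exp (t^2/2)) (x * Real.exp (x^2/2)) x := fun x => by
    have := ((hasDerivAt_pow 2 x).div_const 2).exp
    convert this using 1; simp; ring
  have d1 : deriv (fun t : ℝ => Real.exp (t^2/2)) = fun t => t * Real.exp (t^2/2) := by
    funext x; exact (e x).deriv
  have d2 : deriv (fun t : ℝ => t * Real.exp (t^2/2)) = fun t => (1+t^2) * Real.exp (t^2/2) := by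
    funext x
    refine (((hasDerivAt_id x).mul (e x)).congr_deriv ?_).deriv
    simp; ring
  have d3 : deriv (fun t : ℝ => (1+t^2) * Real.exp (t^2/2)) = fun t => (3*t+t^3) * Real.exp (t^2/2) := by
    funext x
    refine ((((hasDerivAt_pow 2 x).const_add 1).mul (e x)).congr_deriv ?_).deriv
    simp; ring
  have d4 : deriv (fun t : ℝ => (3*t+t^3) * Real.exp (t^2/2)) = fun t => (3+6*t^2+t^4) * Real.exp (t^2/2) := by
    funext x
    refine (((((hasDerivAt_id x).const_mul 3).add (hasDerivAt_pow 3 x)).mul (e x)).congr_deriv ?_).deriv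
    simp; ring
  simp only [zero_mul, NNReal.coe_one, one_mul, zero_add] at h
  rw [iteratedDeriv_succ, iteratedDeriv_succ, iteratedDeriv_succ, iteratedDeriv_one, d1, d2, d3, d4] at h
  simpa using h.symm

/-- The Gaussian integral has the explicit value `e^{-s} (1 - 2s)^{-1/2}`, and `-s - log (1 - 2s) /
2` vanishes to second order at `0`. Centring the square is what removes the linear term. -/
theorem integral_exp_mul_sq_sub_one {s : ℝ} (hs : |s| ≤ 1 / 4) :
    Integrable (fun x => Real.exp (s * (x ^ 2 - 1))) (gaussianReal 0 1) ∧
      ∫ x, Real.exp (s * (x ^ 2 - 1)) ∂(gaussianReal 0 1) ≤ Real.exp (4 * s ^ 2) := by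
  have h1 : s ≤ 1 / 4 := (le_abs_self s).trans hs
  have h2 : -(1 / 4) ≤ s := neg_le.1 ((neg_le_abs s).trans hs)
  have hval : ∫ x, Real.exp (s * (x ^ 2 - 1)) ∂(gaussianReal 0 1)
      = Real.exp (-s) * √(1 / (1 - 2 * s)) := by
    rw [integral_gaussianReal_eq_integral_smul one_ne_zero]
    have : ∀ x : ℝ, gaussianPDFReal 0 1 x • Real.exp (s * (x ^ 2 - 1))
        = (√(2 * Real.pi))⁻¹ * Real.exp (-s) * Real.exp (-(1 / 2 - s) * x ^ 2) := fun x => by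
      simp only [gaussianPDFReal_def, smul_eq_mul, NNReal.coe_one, mul_one]
      rw [mul_assoc, mul_assoc, ← Real.exp_add, ← Real.exp_add]
      congr 2
      ring
    simp_rw [this]
    rw [integral_const_mul, integral_gaussian, mul_right_comm, mul_comm]
    congr 1
    rw [← Real.sqrt_inv, ← Real.sqrt_mul (by positivity)]
    congr 1
    have : (1 : ℝ) - 2 * s ≠ 0 := by linarith
    have : (1 / 2 : ℝ) - s ≠ 0 := by linarith
    field_simp
  have hpos : 0 < ∫ x, Real.exp (s * (x ^ 2 - 1)) ∂(gaussianReal 0 1) := by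
    rw [hval]
    have : (0 : ℝ) < 1 - 2 * s := by linarith
    positivity
  -- A non-integrable function has integral `0` by convention, so the positive value already forces
  -- integrability.
  refine ⟨Integrable.of_integral_ne_zero hpos.ne', ?_⟩
  rw [hval]
  have hu : |2 * s| ≤ 1 / 2 := by rw [abs_mul, abs_two]; linarith
  have hlog := Real.abs_log_sub_add_sum_range_le (x := 2 * s) (by linarith) 1
  simp only [Finset.range_one, Finset.sum_singleton, zero_add, pow_one, Nat.cast_zero, div_one]
    at hlog
  have hb : |2 * s| ^ (1 + 1) / (1 - |2 * s|) ≤ 8 * s ^ 2 := by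
    rw [div_le_iff₀ (by linarith)]
    have : |2 * s| ^ (1 + 1) = 4 * s ^ 2 := by rw [one_add_one_eq_two, sq_abs]; ring
    rw [this]
    nlinarith [sq_nonneg s]
  have hlog' := (abs_le.1 (hlog.trans hb)).1
  have hp : (0 : ℝ) < 1 - 2 * s := by linarith
  have : √(1 / (1 - 2 * s)) = Real.exp (-(Real.log (1 - 2 * s)) / 2) := by
    rw [Real.exp_half, Real.exp_neg, Real.exp_log hp, one_div]
  rw [this, ← Real.exp_add, Real.exp_le_exp]
  linarith

theorem integrable_pow_mul_sq_sub_one (n : ℕ) :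
    Integrable (fun x : ℝ => (x ^ 2 - 1) ^ n) (gaussianReal 0 1) := by
  refine integrable_pow_of_integrable_exp_mul (t := 1 / 4) (by norm_num) ?_ ?_ n
  · exact (integral_exp_mul_sq_sub_one (by norm_num)).1
  · exact (integral_exp_mul_sq_sub_one (by norm_num)).1

theorem integral_sq_sub_one : ∫ x, (x ^ 2 - 1) ∂(gaussianReal 0 1) = 0 := by
  have h2 := variance_fun_id_gaussianReal (μ := 0) (v := 1)
  rw [variance_eq_integral (by fun_prop)] at h2
  simp only [integral_id_gaussianReal, sub_zero, NNReal.coe_one] at h2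
  rw [integral_sub _ (integrable_const _), h2]
  · simp
  · exact (memLp_id_gaussianReal' 2 (by simp)).integrable_sq

theorem integral_sq_sub_one_sq : ∫ x, (x ^ 2 - 1) ^ 2 ∂(gaussianReal 0 1) = 2 := by
  have h4 : Integrable (fun x : ℝ => x ^ 4) (gaussianReal 0 1) := by
    have := (memLp_id_gaussianReal' (μ := 0) (v := 1) 4 (by simp)).integrable_norm_pow (by norm_num)
    refine this.congr (Eventually.of_forall fun x => ?_)
    simp [Real.norm_eq_abs, (show Even 4 by decide).pow_abs]
  have h2 : Integrable (fun x : ℝ => x ^ 2 - 1) (gaussianReal 0 1) := by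
    simpa using integrable_pow_mul_sq_sub_one 1
  have : ∀ x : ℝ, (x ^ 2 - 1) ^ 2 = x ^ 4 - 2 * (x ^ 2 - 1) - 1 := fun x => by ring
  simp_rw [this]
  have h3 : Integrable (fun x : ℝ => x ^ 4 - 2 * (x ^ 2 - 1)) (gaussianReal 0 1) :=
    h4.sub (h2.const_mul 2)
  rw [integral_sub h3 (integrable_const _), integral_sub h4 (h2.const_mul 2), integral_const_mul, integral_sq_sub_one, integral_pow_four_gaussianReal]
  norm_num

/-! ### Moments of diagonal quadratic forms in standard Gaussian variables -/

section Diagonal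

variable {ι : Type*} [Fintype ι]

/-- The standard Gaussian measure on `ι → ℝ`. -/
abbrev stdPi (ι : Type*) [Fintype ι] : Measure (ι → ℝ) :=
  Measure.pi fun _ : ι => gaussianReal 0 1

/-- The centred diagonal quadratic form with eigenvalues `d`. -/
def diagForm (d : ι → ℝ) (x : ι → ℝ) : ℝ := ∑ i, d i * (x i ^ 2 - 1)

theorem integral_exp_diagForm {d : ι → ℝ} {s : ℝ} (h : ∀ i, |s * d i| ≤ 1 / 4) :
    Integrable (fun x => Real.exp (s * diagForm d x)) (stdPi ι) ∧
      ∫ x, Real.exp (s * diagForm d x) ∂(stdPi ι) ≤ Real.exp (4 * s ^ 2 * ∑ i, d i ^ 2) := by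
  have heq : ∀ x : ι → ℝ, Real.exp (s * diagForm d x)
      = ∏ i, Real.exp (s * d i * (x i ^ 2 - 1)) := fun x => by
    rw [← Real.exp_sum, diagForm, Finset.mul_sum]
    simp_rw [mul_assoc]
  simp_rw [heq]
  constructor
  · exact Integrable.fintype_prod (f := fun i y => Real.exp (s * d i * (y ^ 2 - 1)))
      fun i => (integral_exp_mul_sq_sub_one (h i)).1
  · rw [integral_fintype_prod_eq_prod (fun i y => Real.exp (s * d i * (y ^ 2 - 1)))]
    calc ∏ i, ∫ y, Real.exp (s * d i * (y ^ 2 - 1)) ∂(gaussianReal 0 1)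
        ≤ ∏ i, Real.exp (4 * (s * d i) ^ 2) :=
          Finset.prod_le_prod (fun i _ => integral_nonneg fun _ => (Real.exp_pos _).le)
            fun i _ => (integral_exp_mul_sq_sub_one (h i)).2
      _ = _ := by
          rw [← Real.exp_sum, Finset.mul_sum]
          congr 1
          exact Finset.sum_congr rfl fun i _ => by ring

/-- Exponential moments at the right scale control all powers. With `s = 1 / (4 √S)` both `exp (± s
Q)` have integral at most `exp (1 / 4) ≤ 2`, and `|y|^{2q} ≤ (2q)! (e^y + e^{-y})`. Dividing by
`s^{2q} = (16 S)^{-q}` gives the constant. -/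
theorem integral_diagForm_pow_le (d : ι → ℝ) (q : ℕ) :
    Integrable (fun x => diagForm d x ^ (2 * q)) (stdPi ι) ∧
      ∫ x, diagForm d x ^ (2 * q) ∂(stdPi ι)
        ≤ 4 * (2 * q).factorial * 16 ^ q * (∑ i, d i ^ 2) ^ q := by
  have hS : 0 ≤ ∑ i, d i ^ 2 := Finset.sum_nonneg fun i _ => sq_nonneg _
  rcases hS.eq_or_lt with h0 | hpos
  · have hd : ∀ i, d i = 0 := fun i => by
      have := (Finset.sum_eq_zero_iff_of_nonneg (fun i _ => sq_nonneg (d i))).1 h0.symm i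
        (Finset.mem_univ i)
      exact pow_eq_zero_iff (two_ne_zero) |>.1 this
    have hz : ∀ x : ι → ℝ, diagForm d x = 0 := fun x => by simp [diagForm, hd]
    simp_rw [hz]
    refine ⟨integrable_const _, ?_⟩
    rcases Nat.eq_zero_or_pos q with rfl | hq
    · simp
    · rw [zero_pow (by omega)]
      simp only [integral_zero]
      positivity
  set S := ∑ i, d i ^ 2
  -- The largest scale for which `|d i| ≤ √S` guarantees `|s d i| ≤ 1 / 4`, the range of the
  -- one-dimensional estimate.
  set s := 1 / (4 * √S) with hs
  have hrS : 0 < √S := Real.sqrt_pos.2 hpos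
  have hspos : 0 < s := by positivity
  have hs2 : s ^ 2 * S = 1 / 16 := by
    rw [hs, div_pow, mul_pow, Real.sq_sqrt hpos.le]
    field_simp
    norm_num
  have hd : ∀ i, |d i| ≤ √S := fun i => by
    apply Real.abs_le_sqrt
    exact Finset.single_le_sum (f := fun i => d i ^ 2) (fun i _ => sq_nonneg _) (Finset.mem_univ i)
  have hsd : ∀ i, |s * d i| ≤ 1 / 4 := fun i => by
    rw [abs_mul, abs_of_pos hspos, hs, div_mul_eq_mul_div, one_mul, div_le_iff₀ (by positivity)]
    linarith [hd i]
  obtain ⟨i1, b1⟩ := integral_exp_diagForm hsd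
  obtain ⟨i2, b2⟩ := integral_exp_diagForm (s := -s) (d := d)
    (fun i => by rw [neg_mul, abs_neg]; exact hsd i)
  have hE : Real.exp (4 * s ^ 2 * S) ≤ 2 := by
    have : 4 * s ^ 2 * S = 1 / 4 := by linarith
    rw [this]
    have := Real.exp_one_lt_d9
    have h4 : Real.exp (1 / 4) ^ 4 = Real.exp 1 := by rw [← Real.exp_nat_mul]; norm_num
    by_contra! hc
    have : (2 : ℝ) ^ 4 < Real.exp (1 / 4) ^ 4 := by gcongr
    linarith
  have hint : Integrable (fun x => diagForm d x ^ (2 * q)) (stdPi ι) :=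
    integrable_pow_of_integrable_exp_mul hspos.ne' i1 i2 _
  refine ⟨hint, ?_⟩
  have hpt : ∀ x, (s * diagForm d x) ^ (2 * q) ≤ (2 * q).factorial *
      (Real.exp (s * diagForm d x) + Real.exp (-s * diagForm d x)) := fun x => by
    have h1 := Real.pow_div_factorial_le_exp |s * diagForm d x| (abs_nonneg _) (2 * q)
    rw [(even_two_mul q).pow_abs, div_le_iff₀ (by positivity)] at h1
    refine h1.trans ?_
    rw [mul_comm]
    gcongr
    refine (Real.exp_abs_le _).trans (le_of_eq ?_)
    rw [neg_mul]
  have hI : s ^ (2 * q) * ∫ x, diagForm d x ^ (2 * q) ∂(stdPi ι) ≤ (2 * q).factorial * 4 := by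
    rw [← integral_const_mul]
    simp_rw [← mul_pow]
    calc _ ≤ ∫ x, (2 * q).factorial *
          (Real.exp (s * diagForm d x) + Real.exp (-s * diagForm d x)) ∂(stdPi ι) := by
            refine integral_mono ?_ ((i1.add i2).const_mul _) hpt
            simp_rw [mul_pow]
            exact hint.const_mul _
      _ ≤ _ := by
            rw [integral_const_mul, integral_add i1 i2]
            have hE' : Real.exp (4 * (-s) ^ 2 * S) ≤ 2 := by rwa [neg_sq]
            gcongr
            linarith
  have hs2q : s ^ (2 * q) * (16 ^ q * S ^ q) = 1 := by
    rw [pow_mul, ← mul_pow, ← mul_pow]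
    have : s ^ 2 * (16 * S) = 1 := by linarith
    rw [this, one_pow]
  have hsq : 0 < s ^ (2 * q) := by positivity
  refine le_of_mul_le_mul_left (hI.trans (le_of_eq ?_)) hsq
  linear_combination (-4 : ℝ) * ((2 * q).factorial : ℝ) * hs2q

theorem measurable_diagForm (d : ι → ℝ) : Measurable (diagForm d) := by
  unfold diagForm
  fun_prop

theorem integral_diagForm_add_const_sq (d : ι → ℝ) (c : ℝ) :
    MemLp (fun x => diagForm d x + c) 2 (stdPi ι) ∧
      ∫ x, (diagForm d x + c) ^ 2 ∂(stdPi ι) = 2 * ∑ i, d i ^ 2 + c ^ 2 := by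
  have hY : ∀ i, MemLp (fun y : ℝ => d i * (y ^ 2 - 1)) 2 (gaussianReal 0 1) := fun i => by
    refine MemLp.const_mul ?_ _
    rw [memLp_two_iff_integrable_sq (by fun_prop)]
    exact integrable_pow_mul_sq_sub_one 2
  have mp : ∀ i, MeasurePreserving (fun x : ι → ℝ => x i) (stdPi ι) (gaussianReal 0 1) := fun i =>
    measurePreserving_eval _ i
  have hY' : ∀ i, MemLp (fun x : ι → ℝ => d i * (x i ^ 2 - 1)) 2 (stdPi ι) := fun i =>
    (hY i).comp_measurePreserving (mp i)
  have hY0 : ∀ i, ∫ x : ι → ℝ, d i * (x i ^ 2 - 1) ∂(stdPi ι) = 0 := fun i => by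
    have := integral_map (μ := stdPi ι) (φ := fun x : ι → ℝ => x i)
      (f := fun y : ℝ => d i * (y ^ 2 - 1)) (mp i).measurable.aemeasurable (by fun_prop)
    rw [← this, (mp i).map_eq, integral_const_mul, integral_sq_sub_one, mul_zero]
  have hD : MemLp (diagForm d) 2 (stdPi ι) := memLp_finsetSum _ fun i _ => hY' i
  have hm : ∫ x, diagForm d x ∂(stdPi ι) = 0 := by
    unfold diagForm
    rw [integral_finsetSum _ fun i _ => (hY' i).integrable (by norm_num)]
    simp [hY0]
  have hv : Var[diagForm d; stdPi ι] = 2 * ∑ i, d i ^ 2 := by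
    have h := variance_sum_pi (μ := fun _ : ι => gaussianReal 0 1) hY
    have e : (∑ i, fun x : ι → ℝ => d i * (x i ^ 2 - 1)) = diagForm d := by
      ext x
      simp [diagForm]
    rw [e] at h
    rw [h, Finset.mul_sum]
    refine Finset.sum_congr rfl fun i _ => ?_
    rw [variance_const_mul, variance_of_integral_eq_zero (by fun_prop) integral_sq_sub_one,
      integral_sq_sub_one_sq, mul_comm]
  have hDc : MemLp (fun x => diagForm d x + c) 2 (stdPi ι) := hD.add (memLp_const c)
  refine ⟨hDc, ?_⟩
  have h1 := variance_eq_sub hDc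
  rw [variance_add_const hD.1, hv, integral_add (hD.integrable (by norm_num)) (integrable_const _),
    hm] at h1
  simp only [integral_const, probReal_univ, smul_eq_mul, one_mul, zero_add,
    Pi.pow_apply] at h1
  linarith

/-- The constant in the comparison of the moments of order `2 * q` and `2` of a quadratic form. -/
def chaosConst (q : ℕ) : ℝ≥0 := 4 * (2 * q).factorial * 16 ^ q + 1

/-- All moments of an inhomogeneous diagonal quadratic form are bounded by the second one. -/
theorem eLpNorm_diagForm_add_const_le {q : ℕ} (hq : 1 ≤ q) (d : ι → ℝ) (c : ℝ) :
    eLpNorm (fun x => diagForm d x + c) (2 * q : ℕ) (stdPi ι)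
      ≤ chaosConst q * eLpNorm (fun x => diagForm d x + c) 2 (stdPi ι) := by
  set S := ∑ i, d i ^ 2 with hS
  have hS0 : 0 ≤ S := Finset.sum_nonneg fun i _ => sq_nonneg _
  set D : ℝ := 4 * (2 * q).factorial * 16 ^ q with hD
  have hD1 : 1 ≤ D := by
    have h1 : (1 : ℝ) ≤ (2 * q).factorial := by exact_mod_cast (Nat.factorial_pos _)
    have h2 : (1 : ℝ) ≤ 16 ^ q := one_le_pow₀ (by norm_num)
    rw [hD]
    nlinarith
  have hpn : ((2 * q : ℕ) : ℝ≥0∞) ≠ 0 := by simp; omega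
  have hpt : ((2 * q : ℕ) : ℝ≥0∞) ≠ ⊤ := ENNReal.natCast_ne_top _
  have hdiag : eLpNorm (diagForm d) (2 * q : ℕ) (stdPi ι) ≤ ENNReal.ofReal (D * √S) := by
    obtain ⟨hi, hb⟩ := integral_diagForm_pow_le d q
    have hmem : MemLp (diagForm d) (2 * q : ℕ) (stdPi ι) := by
      refine (integrable_norm_rpow_iff (measurable_diagForm d).aestronglyMeasurable hpn hpt).1 ?_
      refine hi.congr (Eventually.of_forall fun x => ?_)
      simp only [ENNReal.toReal_natCast, Real.rpow_natCast, Real.norm_eq_abs]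
      rw [(even_two_mul q).pow_abs]
    rw [hmem.eLpNorm_eq_integral_rpow_norm hpn hpt]
    apply ENNReal.ofReal_le_ofReal
    simp only [ENNReal.toReal_natCast, Real.rpow_natCast, Real.norm_eq_abs,
      (even_two_mul q).pow_abs]
    -- The constant `D ≥ 1` is replaced by `D^{2q}`, so that the root of order `2q` can be taken
    -- exactly.
    have hle : ∫ x, diagForm d x ^ (2 * q) ∂(stdPi ι) ≤ (D * √S) ^ (2 * q) := by
      refine hb.trans ?_
      rw [mul_pow, pow_mul (√S), Real.sq_sqrt hS0]
      gcongr
      exact le_self_pow₀ hD1 (by omega)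
    calc _ ≤ ((D * √S) ^ (2 * q)) ^ ((2 * q : ℕ) : ℝ)⁻¹ := by
          refine Real.rpow_le_rpow (integral_nonneg fun x => (even_two_mul q).pow_nonneg _) hle
            (by positivity)
      _ = D * √S := Real.pow_rpow_inv_natCast (by positivity) (by omega)
  obtain ⟨hmem2, hsq⟩ := integral_diagForm_add_const_sq d c
  have hL2 : eLpNorm (fun x => diagForm d x + c) 2 (stdPi ι) = ENNReal.ofReal √(2 * S + c ^ 2) := by
    rw [hmem2.eLpNorm_eq_integral_rpow_norm two_ne_zero (by simp)]
    simp only [ENNReal.toReal_ofNat, Real.rpow_ofNat, Real.norm_eq_abs, sq_abs, hsq]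
    rw [Real.sqrt_eq_rpow, one_div]
  rw [hL2]
  calc eLpNorm (fun x => diagForm d x + c) (2 * q : ℕ) (stdPi ι)
      ≤ eLpNorm (diagForm d) (2 * q : ℕ) (stdPi ι) + eLpNorm (fun _ => c) (2 * q : ℕ) (stdPi ι) :=
        eLpNorm_add_le (measurable_diagForm d).aestronglyMeasurable aestronglyMeasurable_const
          (by exact_mod_cast (by omega : 1 ≤ 2 * q))
    _ ≤ ENNReal.ofReal (D * √S) + ENNReal.ofReal |c| := by
        gcongr
        rw [eLpNorm_const _ hpn (NeZero.ne _)]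
        simp [Real.enorm_eq_ofReal_abs]
    _ = ENNReal.ofReal (D * √S + |c|) := (ENNReal.ofReal_add (by positivity) (abs_nonneg c)).symm
    _ ≤ ENNReal.ofReal ((D + 1) * √(2 * S + c ^ 2)) := by
        apply ENNReal.ofReal_le_ofReal
        have h1 : √S ≤ √(2 * S + c ^ 2) := Real.sqrt_le_sqrt (by nlinarith [sq_nonneg c])
        have h2 : |c| ≤ √(2 * S + c ^ 2) := Real.abs_le_sqrt (by linarith)
        rw [add_mul, one_mul]
        gcongr
    _ = _ := by
        rw [ENNReal.ofReal_mul (by positivity)]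
        congr 1
        rw [← ENNReal.ofReal_coe_nnreal]
        congr 1

end Diagonal

/-! ### Diagonalisation of Gaussian quadratic forms -/

section Law

variable {Ω : Type*} [MeasurableSpace Ω] {P : Measure Ω} {ι : Type*} [Fintype ι]

open scoped MatrixOrder in
/-- A quadratic form in a centred Gaussian vector has the law of a diagonal quadratic form in
independent standard Gaussian variables. -/
theorem exists_map_quadraticForm_eq {X : ι → Ω → ℝ}
    (hX : HasGaussianLaw (fun ω => (X · ω)) P) (h0 : ∀ i, ∫ ω, X i ω ∂P = 0)
    (M : Matrix ι ι ℝ) (c₀ : ℝ) :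
    ∃ (d : ι → ℝ) (c : ℝ), P.map (fun ω => ∑ i, ∑ j, M i j * (X i ω * X j ω) + c₀)
      = (stdPi ι).map (fun x => diagForm d x + c) := by
  classical
  have := hX.isProbabilityMeasure
  have hXi : ∀ i, HasGaussianLaw (X i) P := fun i => hX.eval i
  have hL : HasGaussianLaw (fun ω => WithLp.toLp 2 (X · ω)) P := hX.toLp_pi 2
  set Y : Ω → EuclideanSpace ℝ ι := fun ω => WithLp.toLp 2 (X · ω) with hY
  set S : Matrix ι ι ℝ := Matrix.of fun i j => cov[X i, X j; P] with hS
  have hbil : ∀ x y : EuclideanSpace ℝ ι, covarianceBilin (P.map Y) x y = x.ofLp ⬝ᵥ S.mulVec y.ofLp := by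
    intro x y
    rw [covarianceBilin_apply_pi fun i => (hXi i).memLp_two]
    simp only [dotProduct, Matrix.mulVec, hS, Matrix.of_apply, Finset.mul_sum]
    exact Finset.sum_congr rfl fun i _ => Finset.sum_congr rfl fun j _ => by ring
  have hSpsd : S.PosSemidef := by
    rw [Matrix.posSemidef_iff_dotProduct_mulVec]
    refine ⟨?_, fun x => ?_⟩
    · ext i j
      simp [hS, covariance_comm]
    · have := covarianceBilin_self_nonneg (μ := P.map Y) (WithLp.toLp 2 x)
      rw [hbil] at this
      simpa using this
  have : IsGaussian (P.map Y) := hL.isGaussian_map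
  -- A Gaussian law is determined by its mean and covariance, so the vector has the law of `√S`
  -- applied to a standard Gaussian vector.
  have hlaw : P.map Y = multivariateGaussian 0 S := by
    refine IsGaussian.ext ?_ ?_
    · rw [integral_id_multivariateGaussian', integral_map hL.aemeasurable (by fun_prop)]
      simp only [id]
      ext i
      have hint : Integrable Y P := hL.integrable
      have := ContinuousLinearMap.integral_comp_comm
        (EuclideanSpace.proj i : EuclideanSpace ℝ ι →L[ℝ] ℝ) hint
      exact this.symm.trans (h0 i)
    · ext x y
      rw [hbil, covarianceBilin_multivariateGaussian hSpsd]
  set R := CFC.sqrt S with hR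
  have hRh : R.IsHermitian := (CFC.sqrt_nonneg S).isSelfAdjoint
  -- Only the symmetric part of `M` acts in the quadratic form. After the substitution by `R = √S`
  -- it becomes the symmetric matrix `N`, which has an orthonormal eigenbasis.
  set N : Matrix ι ι ℝ := R * ((1 / 2 : ℝ) • (M + M.transpose)) * R with hN
  have hNh : N.IsHermitian := by
    have hR' : R.transpose = R := by simpa using hRh.eq
    rw [Matrix.IsHermitian, hN]
    simp only [Matrix.conjTranspose_eq_transpose_of_trivial, Matrix.transpose_mul, hR',
      Matrix.transpose_smul, Matrix.transpose_add, Matrix.transpose_transpose, Matrix.mul_assoc,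
      add_comm]
  set b := hNh.eigenvectorBasis
  set e := hNh.eigenvalues
  -- The trace `∑ e i` compensates the centring `x i ^ 2 - 1` in `diagForm`.
  refine ⟨e, ∑ i, e i + c₀, ?_⟩
  set F : EuclideanSpace ℝ ι → ℝ := fun v => ∑ i, ∑ j, M i j * (v i * v j) + c₀ with hF
  have hFm : Measurable F := by
    have : Continuous F := by rw [hF]; fun_prop
    exact this.measurable
  have h1 : P.map (fun ω => ∑ i, ∑ j, M i j * (X i ω * X j ω) + c₀) = (P.map Y).map F := by
    rw [AEMeasurable.map_map_of_aemeasurable hFm.aemeasurable hL.aemeasurable]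
    rfl
  -- By rotation invariance the standard Gaussian law may be written with independent coordinates in
  -- the eigenbasis of `N`.
  rw [h1, hlaw, multivariateGaussian, Measure.map_map hFm (by fun_prop),
    stdGaussian_eq_map_pi_orthonormalBasis b, Measure.map_map (hFm.comp (by fun_prop)) (by fun_prop)]
  congr 1
  funext x
  simp only [Function.comp_apply, zero_add]
  set v := ∑ i, x i • b i with hv
  have hquad : ∀ w : ι → ℝ, ∑ i, ∑ j, M i j * (w i * w j)
      = w ⬝ᵥ ((1 / 2 : ℝ) • (M + M.transpose)).mulVec w := fun w => by
    have hM : w ⬝ᵥ M.mulVec w = ∑ i, ∑ j, M i j * (w i * w j) := by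
      simp only [dotProduct, Matrix.mulVec, Finset.mul_sum]
      exact Finset.sum_congr rfl fun i _ => Finset.sum_congr rfl fun j _ => by ring
    have hMt : w ⬝ᵥ M.transpose.mulVec w = w ⬝ᵥ M.mulVec w := by
      rw [Matrix.mulVec_transpose, dotProduct_comm, ← Matrix.dotProduct_mulVec]
    rw [Matrix.smul_mulVec, dotProduct_smul, Matrix.add_mulVec, dotProduct_add, hMt, hM,
      smul_eq_mul]
    ring
  have hstep : F (Matrix.toEuclideanCLM (𝕜 := ℝ) R v) = v.ofLp ⬝ᵥ N.mulVec v.ofLp + c₀ := by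
    rw [hF]
    simp only
    rw [hquad]
    congr 1
    have hcoe : (Matrix.toEuclideanCLM (𝕜 := ℝ) R v).ofLp = R.mulVec v.ofLp := by
      simp [Matrix.ofLp_toEuclideanCLM]
    rw [hcoe, hN, ← Matrix.mulVec_mulVec, ← Matrix.mulVec_mulVec, Matrix.dotProduct_mulVec v.ofLp R,
      ← Matrix.mulVec_transpose]
    have hR' : R.transpose = R := by simpa using hRh.eq
    rw [hR']
  rw [hstep]
  have hNv : N.mulVec v.ofLp = (∑ i, (x i * e i) • b i : EuclideanSpace ℝ ι).ofLp := by
    rw [hv]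
    simp only [WithLp.ofLp_sum, WithLp.ofLp_smul, Matrix.mulVec_sum, Matrix.mulVec_smul]
    refine Finset.sum_congr rfl fun i _ => ?_
    rw [hNh.mulVec_eigenvectorBasis, smul_smul]
  have hin : v.ofLp ⬝ᵥ N.mulVec v.ofLp = inner ℝ v (∑ i, (x i * e i) • b i) := by
    rw [hNv, EuclideanSpace.inner_eq_star_dotProduct, dotProduct_comm]
    simp
  rw [hin, hv, b.orthonormal.inner_sum]
  simp only [diagForm, conj_trivial]
  rw [← add_assoc, ← Finset.sum_add_distrib]
  congr 1
  exact Finset.sum_congr rfl fun i _ => by ring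

end Law

/-! ### Gaussian chaos of order one and two -/

section Chaos

variable {Ω : Type*} {κ : Type*}

/-- The complex span of a real process. -/
def chaosOne (G : κ → Ω → ℝ) : Submodule ℂ (Ω → ℂ) :=
  Submodule.span ℂ (range fun a ω => (G a ω : ℂ))

/-- The complex quadratic polynomials in a real process, without linear terms. -/
def chaosTwo (G : κ → Ω → ℝ) : Submodule ℂ (Ω → ℂ) :=
  1 ⊔ chaosOne G * chaosOne G

variable {G : κ → Ω → ℝ}

theorem mem_chaosOne (a : κ) : (fun ω => (G a ω : ℂ)) ∈ chaosOne G :=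
  Submodule.subset_span ⟨a, rfl⟩

theorem const_mem_chaosTwo (c : ℂ) : (fun _ => c) ∈ chaosTwo G :=
  Submodule.mem_sup_left (Submodule.mem_one.2 ⟨c, rfl⟩)

theorem mul_mem_chaosTwo {U V : Ω → ℂ} (hU : U ∈ chaosOne G) (hV : V ∈ chaosOne G) :
    (fun ω => U ω * V ω) ∈ chaosTwo G :=
  Submodule.mem_sup_right (Submodule.mul_mem_mul hU hV)

theorem conj_mem_chaosOne {U : Ω → ℂ} (hU : U ∈ chaosOne G) :
    (fun ω => (starRingEnd ℂ) (U ω)) ∈ chaosOne G := by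
  induction hU using Submodule.span_induction with
  | mem x hx =>
    obtain ⟨a, rfl⟩ := hx
    simpa using mem_chaosOne a
  | zero =>
    simp only [Pi.zero_apply, map_zero]
    exact (chaosOne G).zero_mem
  | add x y _ _ hx hy => simpa [Pi.add_def] using (chaosOne G).add_mem hx hy
  | smul c x _ hx => simpa [Pi.smul_def] using (chaosOne G).smul_mem ((starRingEnd ℂ) c) hx

-- The products of two generators span the product submodule, so an element involves finitely many
-- pairs of indices. Collecting both coordinates in one finite set `s` makes it a form in a finite
-- Gaussian vector.
open scoped Pointwise in
theorem exists_quadraticForm_of_mem_chaosTwo {V : Ω → ℂ} (hV : V ∈ chaosTwo G) :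
    ∃ (s : Finset κ) (c : s → s → ℂ) (c₀ : ℂ),
      ∀ ω, V ω = ∑ a, ∑ b, c a b * (G a ω * G b ω) + c₀ := by
  classical
  obtain ⟨y, hy, z, hz, rfl⟩ := Submodule.mem_sup.1 hV
  obtain ⟨c₀, rfl⟩ := Submodule.mem_one.1 hy
  rw [chaosOne, Submodule.span_mul_span] at hz
  have hset : (range fun (a : κ) ω => (G a ω : ℂ)) * (range fun (a : κ) ω => (G a ω : ℂ))
      = range fun (p : κ × κ) ω => (G p.1 ω : ℂ) * (G p.2 ω : ℂ) := by
    ext x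
    simp only [Set.mem_mul, mem_range, Prod.exists]
    constructor
    · rintro ⟨_, ⟨a, rfl⟩, _, ⟨b, rfl⟩, rfl⟩
      exact ⟨a, b, rfl⟩
    · rintro ⟨a, b, rfl⟩
      exact ⟨_, ⟨a, rfl⟩, _, ⟨b, rfl⟩, rfl⟩
  rw [hset, Finsupp.mem_span_range_iff_exists_finsupp] at hz
  obtain ⟨c, rfl⟩ := hz
  set s := c.support.image Prod.fst ∪ c.support.image Prod.snd with hs
  refine ⟨s, fun a b => c (a, b), c₀, fun ω => ?_⟩
  have hsub : c.support ⊆ s ×ˢ s := fun p hp => by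
    simp only [hs, Finset.mem_product, Finset.mem_union, Finset.mem_image]
    exact ⟨Or.inl ⟨p, hp, rfl⟩, Or.inr ⟨p, hp, rfl⟩⟩
  have h1 : (c.sum fun p r => r • fun ω => (G p.1 ω : ℂ) * (G p.2 ω : ℂ)) ω
      = ∑ p ∈ s ×ˢ s, c p * ((G p.1 ω : ℂ) * (G p.2 ω : ℂ)) := by
    rw [Finsupp.sum, Finset.sum_apply]
    refine Finset.sum_subset hsub fun p _ hp => ?_
    rw [Finsupp.notMem_support_iff] at hp
    simp [hp]
  rw [Pi.add_apply, h1, Finset.sum_product, add_comm]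
  congr 1
  rw [← Finset.sum_coe_sort]
  refine Finset.sum_congr rfl fun a _ => ?_
  rw [← Finset.sum_coe_sort]

variable [MeasurableSpace Ω] {P : Measure Ω}

/-- All norms depend only on the law, which is that of a diagonal form with an additive constant. -/
theorem quadraticForm_memLp_and_eLpNorm_le {ι : Type*} [Fintype ι] {X : ι → Ω → ℝ}
    (hX : HasGaussianLaw (fun ω => (X · ω)) P) (h0 : ∀ i, ∫ ω, X i ω ∂P = 0)
    (M : Matrix ι ι ℝ) (c₀ : ℝ) {q : ℕ} (hq : 1 ≤ q) :
    MemLp (fun ω => ∑ i, ∑ j, M i j * (X i ω * X j ω) + c₀) 2 P ∧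
    eLpNorm (fun ω => ∑ i, ∑ j, M i j * (X i ω * X j ω) + c₀) (2 * q : ℕ) P
      ≤ chaosConst q * eLpNorm (fun ω => ∑ i, ∑ j, M i j * (X i ω * X j ω) + c₀) 2 P := by
  obtain ⟨d, c, hlaw⟩ := exists_map_quadraticForm_eq hX h0 M c₀
  set Q : Ω → ℝ := fun ω => ∑ i, ∑ j, M i j * (X i ω * X j ω) + c₀ with hQ
  have hXi : ∀ i, AEMeasurable (X i) P := fun i => (hX.eval i).aemeasurable
  have hQm : AEMeasurable Q P := by
    rw [hQ]
    fun_prop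
  have hdm : Measurable (fun x : ι → ℝ => diagForm d x + c) :=
    (measurable_diagForm d).add_const c
  have h1 : ∀ p, eLpNorm Q p P = eLpNorm (fun x => diagForm d x + c) p (stdPi ι) := fun p => by
    have e1 := eLpNorm_map_measure (p := p) (g := (id : ℝ → ℝ)) (by fun_prop) hQm
    have e2 := eLpNorm_map_measure (p := p) (μ := stdPi ι) (g := (id : ℝ → ℝ)) (by fun_prop)
      hdm.aemeasurable
    rw [hlaw] at e1
    exact e1.symm.trans e2
  refine ⟨⟨hQm.aestronglyMeasurable, ?_⟩, ?_⟩
  · rw [h1]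
    exact (integral_diagForm_add_const_sq d c).1.2
  · rw [h1, h1]
    exact eLpNorm_diagForm_add_const_le hq d c

theorem hasGaussianLaw_finset (hG : IsGaussianProcess G P) (s : Finset κ) :
    HasGaussianLaw (fun ω => (fun a : s => G a ω)) P :=
  hG.hasGaussianLaw s

/-- This is the hypercontractive estimate on the inhomogeneous second chaos, with a constant
independent of the number of Gaussian variables involved. Real and imaginary parts are treated
separately, whence the factor `2`. -/
theorem eLpNorm_chaosTwo_le [IsProbabilityMeasure P] (hG : IsGaussianProcess G P)
    (h0 : ∀ a, ∫ ω, G a ω ∂P = 0) {V : Ω → ℂ} (hV : V ∈ chaosTwo G) {q : ℕ} (hq : 1 ≤ q) :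
    MemLp V 2 P ∧ eLpNorm V (2 * q : ℕ) P ≤ 2 * chaosConst q * eLpNorm V 2 P := by
  obtain ⟨s, c, c₀, hVe⟩ := exists_quadraticForm_of_mem_chaosTwo hV
  have hs := hasGaussianLaw_finset hG s
  obtain ⟨hr2, hrq⟩ := quadraticForm_memLp_and_eLpNorm_le hs (fun a => h0 a)
    (Matrix.of fun a b => (c a b).re) c₀.re hq
  obtain ⟨hi2, hiq⟩ := quadraticForm_memLp_and_eLpNorm_le hs (fun a => h0 a)
    (Matrix.of fun a b => (c a b).im) c₀.im hq
  have hre : (fun ω => ∑ a : s, ∑ b : s, (c a b).re * (G a ω * G b ω) + c₀.re)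
      = fun ω => (V ω).re := by
    funext ω
    rw [hVe]
    simp only [Complex.add_re, Complex.re_sum, ← Complex.ofReal_mul, Complex.re_mul_ofReal]
  have him : (fun ω => ∑ a : s, ∑ b : s, (c a b).im * (G a ω * G b ω) + c₀.im)
      = fun ω => (V ω).im := by
    funext ω
    rw [hVe]
    simp only [Complex.add_im, Complex.im_sum, ← Complex.ofReal_mul, Complex.im_mul_ofReal]
  simp only [Matrix.of_apply] at hr2 hrq hi2 hiq
  rw [hre] at hr2 hrq
  rw [him] at hi2 hiq
  have hV2 : MemLp V 2 P := memLp_re_im_iff.1 ⟨hr2, hi2⟩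
  refine ⟨hV2, ?_⟩
  have hsum : V = (fun ω => ((V ω).re : ℂ)) + fun ω => Complex.I * ((V ω).im : ℂ) := by
    funext ω
    simp [mul_comm Complex.I, Complex.re_add_im]
  have hle1 : ∀ p, eLpNorm (fun ω => ((V ω).re : ℂ)) p P = eLpNorm (fun ω => (V ω).re) p P :=
    fun p => eLpNorm_congr_norm_ae (Eventually.of_forall fun ω => by simp)
  have hle2 : ∀ p, eLpNorm (fun ω => Complex.I * ((V ω).im : ℂ)) p P
      = eLpNorm (fun ω => (V ω).im) p P :=
    fun p => eLpNorm_congr_norm_ae (Eventually.of_forall fun ω => by simp)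
  have hb1 : eLpNorm (fun ω => (V ω).re) 2 P ≤ eLpNorm V 2 P :=
    eLpNorm_mono fun ω => by simpa using Complex.abs_re_le_norm (V ω)
  have hb2 : eLpNorm (fun ω => (V ω).im) 2 P ≤ eLpNorm V 2 P :=
    eLpNorm_mono fun ω => by simpa using Complex.abs_im_le_norm (V ω)
  calc eLpNorm V (2 * q : ℕ) P
      ≤ eLpNorm (fun ω => ((V ω).re : ℂ)) (2 * q : ℕ) P
        + eLpNorm (fun ω => Complex.I * ((V ω).im : ℂ)) (2 * q : ℕ) P := by
        conv_lhs => rw [hsum]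
        refine eLpNorm_add_le ?_ ?_ (by exact_mod_cast (by omega : 1 ≤ 2 * q))
        · exact Complex.continuous_ofReal.comp_aestronglyMeasurable hr2.1
        · exact (Complex.continuous_ofReal.comp_aestronglyMeasurable hi2.1).const_mul _
    _ ≤ chaosConst q * eLpNorm V 2 P + chaosConst q * eLpNorm V 2 P := by
        rw [hle1, hle2]
        exact add_le_add (hrq.trans (by gcongr)) (hiq.trans (by gcongr))
    _ = _ := by ring

theorem memLp_chaosTwo [IsProbabilityMeasure P] (hG : IsGaussianProcess G P)
    (h0 : ∀ a, ∫ ω, G a ω ∂P = 0) {V : Ω → ℂ} (hV : V ∈ chaosTwo G) : MemLp V 2 P :=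
  (eLpNorm_chaosTwo_le hG h0 hV le_rfl).1

theorem memLp_chaosOne (hG : IsGaussianProcess G P) {U : Ω → ℂ} (hU : U ∈ chaosOne G)
    {p : ℝ≥0∞} (hp : p ≠ ⊤) : MemLp U p P := by
  induction hU using Submodule.span_induction with
  | mem x hx =>
    obtain ⟨a, rfl⟩ := hx
    exact ((hG.hasGaussianLaw_eval a).memLp hp).ofReal
  | zero => exact MemLp.zero
  | add x y _ _ hx hy => exact hx.add hy
  | smul c x _ hx => exact hx.const_smul c

theorem integrable_chaosOne_mul (hG : IsGaussianProcess G P) {U V : Ω → ℂ}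
    (hU : U ∈ chaosOne G) (hV : V ∈ chaosOne G) : Integrable (fun ω => U ω * V ω) P :=
  (memLp_chaosOne hG hU (p := 2) (by simp)).integrable_mul
    (memLp_chaosOne hG hV (p := 2) (by simp))

theorem integrable_chaosOne_mul_four [IsProbabilityMeasure P] (hG : IsGaussianProcess G P)
    (h0 : ∀ a, ∫ ω, G a ω ∂P = 0) {U₁ U₂ U₃ U₄ : Ω → ℂ} (h₁ : U₁ ∈ chaosOne G)
    (h₂ : U₂ ∈ chaosOne G) (h₃ : U₃ ∈ chaosOne G) (h₄ : U₄ ∈ chaosOne G) :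
    Integrable (fun ω => (U₁ ω * U₂ ω) * (U₃ ω * U₄ ω)) P :=
  (memLp_chaosTwo hG h0 (mul_mem_chaosTwo h₁ h₂)).integrable_mul
    (memLp_chaosTwo hG h0 (mul_mem_chaosTwo h₃ h₄))

end Chaos

/-! ### Wick's formula for fourth moments -/

section Wick

variable {Ω : Type*} [MeasurableSpace Ω] {P : Measure Ω} {κ : Type*} {G : κ → Ω → ℝ}

/-- The variable has the law of `√v` times a standard Gaussian variable, so the fourth moment scales
as `v ^ 2`; this includes the degenerate case `v = 0`. -/
theorem integral_pow_four_of_hasGaussianLaw {X : Ω → ℝ} (hX : HasGaussianLaw X P)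
    (h0 : ∫ ω, X ω ∂P = 0) : ∫ ω, X ω ^ 4 ∂P = 3 * (∫ ω, X ω ^ 2 ∂P) ^ 2 := by
  have := hX.isProbabilityMeasure
  have hlaw := hX.map_eq_gaussianReal
  set v := Var[X; P] with hv
  have hv0 : 0 ≤ v := variance_nonneg _ _
  have hvar : v = ∫ ω, X ω ^ 2 ∂P := variance_of_integral_eq_zero hX.aemeasurable h0
  have hmul : (gaussianReal 0 1).map (√v * ·) = P.map X := by
    rw [hlaw, gaussianReal_map_const_mul, h0]
    congr 1
    · simp
    · ext
      simp [Real.sq_sqrt hv0, Real.coe_toNNReal _ hv0]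
  have h1 : ∫ ω, X ω ^ 4 ∂P = ∫ x, x ^ 4 ∂(P.map X) :=
    (integral_map hX.aemeasurable (f := fun x : ℝ => x ^ 4) (by fun_prop)).symm
  rw [h1, ← hmul, integral_map (by fun_prop) (by fun_prop), ← hvar]
  simp_rw [mul_pow]
  rw [integral_const_mul, integral_pow_four_gaussianReal]
  have : √v ^ 4 = v ^ 2 := by
    rw [show (4 : ℕ) = 2 * 2 by rfl, pow_mul, Real.sq_sqrt hv0]
  rw [this, mul_comm]

/-- Polarisation: every linear combination `L` of the four variables is Gaussian, so `E L⁴ = 3 (E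
L²)²`. An alternating sum over signs of the coefficients extracts the mixed moment. -/
theorem integral_mul_four_of_isGaussianProcess [IsProbabilityMeasure P] (hG : IsGaussianProcess G P)
    (h0 : ∀ a, ∫ ω, G a ω ∂P = 0) (a₁ a₂ a₃ a₄ : κ) :
    ∫ ω, (G a₁ ω * G a₂ ω) * (G a₃ ω * G a₄ ω) ∂P =
      (∫ ω, G a₁ ω * G a₂ ω ∂P) * (∫ ω, G a₃ ω * G a₄ ω ∂P) +
      (∫ ω, G a₁ ω * G a₃ ω ∂P) * (∫ ω, G a₂ ω * G a₄ ω ∂P) +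
      (∫ ω, G a₁ ω * G a₄ ω ∂P) * (∫ ω, G a₂ ω * G a₃ ω ∂P) := by
  have hmem : ∀ a, MemLp (G a) 2 P := fun a => (hG.hasGaussianLaw_eval a).memLp_two
  have hmul : ∀ a b, Integrable (fun ω => G a ω * G b ω) P := fun a b =>
    (hmem a).integrable_mul (hmem b)
  set Y : Fin 4 → Ω → ℝ := fun t => G (![a₁, a₂, a₃, a₄] t) with hY
  have hYg : IsGaussianProcess Y P := hG.comp_right _
  set L : ℝ → ℝ → ℝ → Ω → ℝ := fun x y z ω => G a₁ ω + x * G a₂ ω + y * G a₃ ω + z * G a₄ ω with hL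
  have hLg : ∀ x y z, HasGaussianLaw (L x y z) P := fun x y z => by
    have h := (hYg.smul ![1, x, y, z]).hasGaussianLaw_fun_sum (I := Finset.univ)
    refine h.congr (Eventually.of_forall fun ω => ?_)
    simp [Fin.sum_univ_four, hY, hL]
  have hint : ∀ a, Integrable (G a) P := fun a => (hmem a).integrable (by norm_num)
  have hL0 : ∀ x y z, ∫ ω, L x y z ω ∂P = 0 := fun x y z => by
    have i2 : Integrable (fun ω => G a₁ ω + x * G a₂ ω) P := (hint _).add ((hint _).const_mul _)
    have i3 : Integrable (fun ω => G a₁ ω + x * G a₂ ω + y * G a₃ ω) P :=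
      i2.add ((hint _).const_mul _)
    simp only [hL]
    rw [integral_add i3 ((hint _).const_mul _), integral_add i2 ((hint _).const_mul _),
      integral_add (hint _) ((hint _).const_mul _)]
    simp [integral_const_mul, h0]
  have hL4i : ∀ x y z, Integrable (fun ω => L x y z ω ^ 4) P := fun x y z => by
    have := ((hLg x y z).memLp (p := 4) (by simp)).integrable_norm_pow (by norm_num)
    refine this.congr (Eventually.of_forall fun ω => ?_)
    simp [Real.norm_eq_abs, (show Even 4 by decide).pow_abs]
  set E : κ → κ → ℝ := fun a b => ∫ ω, G a ω * G b ω ∂P with hE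
  have hL2 : ∀ x y z, ∫ ω, L x y z ω ^ 2 ∂P = E a₁ a₁ + x ^ 2 * E a₂ a₂ + y ^ 2 * E a₃ a₃
      + z ^ 2 * E a₄ a₄ + 2 * x * E a₁ a₂ + 2 * y * E a₁ a₃ + 2 * z * E a₁ a₄
      + 2 * x * y * E a₂ a₃ + 2 * x * z * E a₂ a₄ + 2 * y * z * E a₃ a₄ := fun x y z => by
    simp only [hE, ← integral_const_mul]
    rw [← integral_add (by fun_prop) (by fun_prop), ← integral_add (by fun_prop) (by fun_prop),
      ← integral_add (by fun_prop) (by fun_prop), ← integral_add (by fun_prop) (by fun_prop),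
      ← integral_add (by fun_prop) (by fun_prop), ← integral_add (by fun_prop) (by fun_prop),
      ← integral_add (by fun_prop) (by fun_prop), ← integral_add (by fun_prop) (by fun_prop),
      ← integral_add (by fun_prop) (by fun_prop)]
    refine integral_congr_ae (Eventually.of_forall fun ω => ?_)
    simp only [hL]
    ring
  have h4 : ∀ x y z, ∫ ω, L x y z ω ^ 4 ∂P = 3 * (E a₁ a₁ + x ^ 2 * E a₂ a₂ + y ^ 2 * E a₃ a₃
      + z ^ 2 * E a₄ a₄ + 2 * x * E a₁ a₂ + 2 * y * E a₁ a₃ + 2 * z * E a₁ a₄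
      + 2 * x * y * E a₂ a₃ + 2 * x * z * E a₂ a₄ + 2 * y * z * E a₃ a₄) ^ 2 := fun x y z => by
    rw [integral_pow_four_of_hasGaussianLaw (hLg x y z) (hL0 x y z), hL2]
  -- Keeping the first coefficient equal to `1`, there are eight sign patterns, each weighted by the
  -- product of its signs. The monomial with all four factors has coefficient `4! = 24` in `L⁴`,
  -- hence `192 = 8 * 24`, and the other monomials cancel.
  have hpol : ∀ ω, 192 * ((G a₁ ω * G a₂ ω) * (G a₃ ω * G a₄ ω)) =
      L 1 1 1 ω ^ 4 - L 1 1 (-1) ω ^ 4 - L 1 (-1) 1 ω ^ 4 - L (-1) 1 1 ω ^ 4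
      + L 1 (-1) (-1) ω ^ 4 + L (-1) 1 (-1) ω ^ 4 + L (-1) (-1) 1 ω ^ 4
      - L (-1) (-1) (-1) ω ^ 4 := fun ω => by
    simp only [hL]
    ring
  have hfin : 192 * ∫ ω, (G a₁ ω * G a₂ ω) * (G a₃ ω * G a₄ ω) ∂P =
      (∫ ω, L 1 1 1 ω ^ 4 ∂P) - (∫ ω, L 1 1 (-1) ω ^ 4 ∂P) - (∫ ω, L 1 (-1) 1 ω ^ 4 ∂P)
      - (∫ ω, L (-1) 1 1 ω ^ 4 ∂P) + (∫ ω, L 1 (-1) (-1) ω ^ 4 ∂P)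
      + (∫ ω, L (-1) 1 (-1) ω ^ 4 ∂P) + (∫ ω, L (-1) (-1) 1 ω ^ 4 ∂P)
      - (∫ ω, L (-1) (-1) (-1) ω ^ 4 ∂P) := by
    rw [← integral_const_mul]
    simp_rw [hpol]
    rw [integral_sub (by fun_prop) (by fun_prop), integral_add (by fun_prop) (by fun_prop),
      integral_add (by fun_prop) (by fun_prop), integral_add (by fun_prop) (by fun_prop),
      integral_sub (by fun_prop) (by fun_prop), integral_sub (by fun_prop) (by fun_prop),
      integral_sub (by fun_prop) (by fun_prop)]
  simp only [h4] at hfin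
  change _ = E a₁ a₂ * E a₃ a₄ + E a₁ a₃ * E a₂ a₄ + E a₁ a₄ * E a₂ a₃
  linarith

/-- Wick's formula for four elements of the first chaos. -/
theorem integral_chaosOne_mul_four [IsProbabilityMeasure P] (hG : IsGaussianProcess G P)
    (h0 : ∀ a, ∫ ω, G a ω ∂P = 0) {U₁ U₂ U₃ U₄ : Ω → ℂ} (h₁ : U₁ ∈ chaosOne G)
    (h₂ : U₂ ∈ chaosOne G) (h₃ : U₃ ∈ chaosOne G) (h₄ : U₄ ∈ chaosOne G) :
    ∫ ω, (U₁ ω * U₂ ω) * (U₃ ω * U₄ ω) ∂P =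
      (∫ ω, U₁ ω * U₂ ω ∂P) * (∫ ω, U₃ ω * U₄ ω ∂P) +
      (∫ ω, U₁ ω * U₃ ω ∂P) * (∫ ω, U₂ ω * U₄ ω ∂P) +
      (∫ ω, U₁ ω * U₄ ω ∂P) * (∫ ω, U₂ ω * U₃ ω ∂P) := by
  set Wk : (Ω → ℂ) → (Ω → ℂ) → (Ω → ℂ) → (Ω → ℂ) → Prop := fun U₁ U₂ U₃ U₄ =>
    ∫ ω, (U₁ ω * U₂ ω) * (U₃ ω * U₄ ω) ∂P =
      (∫ ω, U₁ ω * U₂ ω ∂P) * (∫ ω, U₃ ω * U₄ ω ∂P) +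
      (∫ ω, U₁ ω * U₃ ω ∂P) * (∫ ω, U₂ ω * U₄ ω ∂P) +
      (∫ ω, U₁ ω * U₄ ω ∂P) * (∫ ω, U₂ ω * U₃ ω ∂P) with hWk
  -- Wick's formula is invariant under cyclic rotation of its arguments. Linearity in the first slot
  -- therefore suffices to pass from generators to the span, one slot at a time.
  have hcyc : ∀ A B C D : Ω → ℂ, Wk A B C D → Wk B C D A := by
    intro A B C D h
    simp only [hWk] at h ⊢
    have e1 : ∫ ω, (B ω * C ω) * (D ω * A ω) ∂P = ∫ ω, (A ω * B ω) * (C ω * D ω) ∂P :=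
      integral_congr_ae (Eventually.of_forall fun ω => by ring_nf)
    have e2 : ∫ ω, D ω * A ω ∂P = ∫ ω, A ω * D ω ∂P := by simp_rw [mul_comm]
    have e3 : ∫ ω, C ω * A ω ∂P = ∫ ω, A ω * C ω ∂P := by simp_rw [mul_comm]
    have e4 : ∫ ω, B ω * A ω ∂P = ∫ ω, A ω * B ω ∂P := by simp_rw [mul_comm]
    rw [e1, h, e2, e3, e4]
    ring
  have hslot : ∀ {B C D : Ω → ℂ}, B ∈ chaosOne G → C ∈ chaosOne G → D ∈ chaosOne G →
      (∀ a, Wk (fun ω => (G a ω : ℂ)) B C D) → ∀ A ∈ chaosOne G, Wk A B C D := by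
    intro B C D hB hC hD hbase A hA
    induction hA using Submodule.span_induction with
    | mem x hx =>
      obtain ⟨a, rfl⟩ := hx
      exact hbase a
    | zero => simp [hWk]
    | add x y hx hy ihx ihy =>
      simp only [hWk, Pi.add_apply, add_mul] at ihx ihy ⊢
      rw [integral_add (integrable_chaosOne_mul_four hG h0 hx hB hC hD)
          (integrable_chaosOne_mul_four hG h0 hy hB hC hD),
        integral_add (integrable_chaosOne_mul hG hx hB) (integrable_chaosOne_mul hG hy hB),
        integral_add (integrable_chaosOne_mul hG hx hC) (integrable_chaosOne_mul hG hy hC),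
        integral_add (integrable_chaosOne_mul hG hx hD) (integrable_chaosOne_mul hG hy hD),
        ihx, ihy]
      ring
    | smul c x hx ihx =>
      simp only [hWk, Pi.smul_apply, smul_eq_mul, mul_assoc, integral_const_mul] at ihx ⊢
      rw [ihx]
      ring
  have hbase : ∀ a b c d, Wk (fun ω => (G a ω : ℂ)) (fun ω => (G b ω : ℂ))
      (fun ω => (G c ω : ℂ)) (fun ω => (G d ω : ℂ)) := fun a b c d => by
    have := integral_mul_four_of_isGaussianProcess hG h0 a b c d
    simp only [hWk, ← Complex.ofReal_mul, integral_complex_ofReal]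
    exact_mod_cast congrArg (fun r : ℝ => (r : ℂ)) this
  have s1 : ∀ a b c, Wk (fun ω => (G a ω : ℂ)) (fun ω => (G b ω : ℂ)) (fun ω => (G c ω : ℂ)) U₁ :=
    fun a b c => hcyc _ _ _ _ (hslot (mem_chaosOne a) (mem_chaosOne b) (mem_chaosOne c)
      (fun d => hbase d a b c) U₁ h₁)
  have s2 : ∀ a b, Wk (fun ω => (G a ω : ℂ)) (fun ω => (G b ω : ℂ)) U₁ U₂ :=
    fun a b => hcyc _ _ _ _ (hslot (mem_chaosOne a) (mem_chaosOne b) h₁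
      (fun d => s1 d a b) U₂ h₂)
  have s3 : ∀ a, Wk (fun ω => (G a ω : ℂ)) U₁ U₂ U₃ :=
    fun a => hcyc _ _ _ _ (hslot (mem_chaosOne a) h₁ h₂ (fun d => s2 d a) U₃ h₃)
  exact hcyc _ _ _ _ (hslot h₁ h₂ h₃ (fun d => s3 d) U₄ h₄)

/-- The square of the `L²` norm of a complex random variable. -/
def sqMoment (P : Measure Ω) (U : Ω → ℂ) : ℝ := ∫ ω, ‖U ω‖ ^ 2 ∂P

theorem sqMoment_nonneg (U : Ω → ℂ) : 0 ≤ sqMoment P U := integral_nonneg fun _ => sq_nonneg _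

theorem integral_mul_conj_self (U : Ω → ℂ) :
    ∫ ω, U ω * (starRingEnd ℂ) (U ω) ∂P = (sqMoment P U : ℂ) := by
  rw [sqMoment, ← integral_complex_ofReal]
  exact integral_congr_ae (Eventually.of_forall fun ω => by simp [Complex.mul_conj'])

theorem eLpNorm_two_eq {U : Ω → ℂ} (hU : MemLp U 2 P) :
    eLpNorm U 2 P = ENNReal.ofReal √(sqMoment P U) := by
  rw [hU.eLpNorm_eq_integral_rpow_norm two_ne_zero (by simp)]
  simp [sqMoment, Real.sqrt_eq_rpow]

theorem norm_integral_mul_conj_le {U V : Ω → ℂ} (hU : MemLp U 2 P) (hV : MemLp V 2 P) :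
    ‖∫ ω, U ω * (starRingEnd ℂ) (V ω) ∂P‖ ≤ √(sqMoment P U) * √(sqMoment P V) := by
  have h := integral_mul_le_Lp_mul_Lq_of_nonneg (μ := P) (f := fun ω => ‖U ω‖)
    (g := fun ω => ‖V ω‖) Real.HolderConjugate.two_two
    (Eventually.of_forall fun _ => norm_nonneg _) (Eventually.of_forall fun _ => norm_nonneg _)
    (by simpa using hU.norm) (by simpa using hV.norm)
  refine (norm_integral_le_integral_norm _).trans ?_
  simpa [sqMoment, Real.sqrt_eq_rpow] using h

/-- The variance of a bilinear form in two families of orthogonal elements of the first chaos. -/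
theorem sqMoment_bilinear_sub_integral_le [IsProbabilityMeasure P] (hG : IsGaussianProcess G P)
    (h0 : ∀ a, ∫ ω, G a ω ∂P = 0) {K : Type*} {U V : K → Ω → ℂ}
    (hU : ∀ k, U k ∈ chaosOne G) (hV : ∀ k, V k ∈ chaosOne G)
    (oU : ∀ k l, k ≠ l → ∫ ω, U k ω * (starRingEnd ℂ) (U l ω) ∂P = 0)
    (oV : ∀ k l, k ≠ l → ∫ ω, V k ω * (starRingEnd ℂ) (V l ω) ∂P = 0)
    (oUV : ∀ k l, k ≠ l → ∫ ω, U k ω * (starRingEnd ℂ) (V l ω) ∂P = 0)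
    (F : Finset (K × K)) (a : K × K → ℂ) :
    sqMoment P (fun ω => ∑ p ∈ F, a p * (U p.1 ω * V p.2 ω)
        - ∫ ω', ∑ p ∈ F, a p * (U p.1 ω' * V p.2 ω') ∂P)
      ≤ 2 * ∑ p ∈ F, ‖a p‖ ^ 2 * (sqMoment P (U p.1) * sqMoment P (V p.2)) := by
  classical
  set Q : Ω → ℂ := fun ω => ∑ p ∈ F, a p * (U p.1 ω * V p.2 ω) with hQ
  set m := ∫ ω', Q ω' ∂P with hm
  have hUV : ∀ p : K × K, Integrable (fun ω => U p.1 ω * V p.2 ω) P := fun p =>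
    integrable_chaosOne_mul hG (hU _) (hV _)
  have hQi : Integrable Q P := integrable_finsetSum _ fun p _ => (hUV p).const_mul _
  have hQ2 : MemLp Q 2 P := memLp_finsetSum _ fun p _ =>
    (memLp_chaosTwo hG h0 (mul_mem_chaosTwo (hU p.1) (hV p.2))).const_mul _
  have hQc : Integrable (fun ω => (starRingEnd ℂ) (Q ω)) P :=
    (Complex.conjCLE.toContinuousLinearMap.integrable_comp hQi)
  have hQQ : Integrable (fun ω => Q ω * (starRingEnd ℂ) (Q ω)) P := by
    have := hQ2.integrable_norm_pow (by norm_num)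
    refine (this.ofReal (𝕜 := ℂ)).congr (Eventually.of_forall fun ω => ?_)
    simp [Complex.mul_conj']
  have hconj : ∀ f : Ω → ℂ, ∫ ω, (starRingEnd ℂ) (f ω) ∂P = (starRingEnd ℂ) (∫ ω, f ω ∂P) :=
    fun f => integral_conj
  have hvar : (sqMoment P (fun ω => Q ω - m) : ℂ)
      = ∫ ω, Q ω * (starRingEnd ℂ) (Q ω) ∂P - m * (starRingEnd ℂ) m := by
    rw [← integral_mul_conj_self]
    have e : ∀ ω, (Q ω - m) * (starRingEnd ℂ) (Q ω - m) = Q ω * (starRingEnd ℂ) (Q ω)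
        - (starRingEnd ℂ) m * Q ω - m * (starRingEnd ℂ) (Q ω) + m * (starRingEnd ℂ) m := fun ω => by
      rw [map_sub]
      ring
    simp_rw [e]
    have i1 : Integrable (fun ω => Q ω * (starRingEnd ℂ) (Q ω) - (starRingEnd ℂ) m * Q ω) P :=
      hQQ.sub (hQi.const_mul _)
    have i2 : Integrable (fun ω => Q ω * (starRingEnd ℂ) (Q ω) - (starRingEnd ℂ) m * Q ω
        - m * (starRingEnd ℂ) (Q ω)) P := i1.sub (hQc.const_mul _)
    rw [integral_add i2 (integrable_const _), integral_sub i1 (hQc.const_mul _),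
      integral_sub hQQ (hQi.const_mul _), integral_const_mul, integral_const_mul, hconj, ← hm]
    simp only [integral_const, probReal_univ, one_smul]
    ring
  -- Of the three pairings in Wick's formula, the one that pairs each product with itself reproduces
  -- `|m|²` and cancels.
  have hexp : ∫ ω, Q ω * (starRingEnd ℂ) (Q ω) ∂P - m * (starRingEnd ℂ) m
      = ∑ p ∈ F, ∑ r ∈ F, a p * (starRingEnd ℂ) (a r) *
        ((∫ ω, U p.1 ω * (starRingEnd ℂ) (U r.1 ω) ∂P) *
          (∫ ω, V p.2 ω * (starRingEnd ℂ) (V r.2 ω) ∂P) +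
        (∫ ω, U p.1 ω * (starRingEnd ℂ) (V r.2 ω) ∂P) *
          (∫ ω, V p.2 ω * (starRingEnd ℂ) (U r.1 ω) ∂P)) := by
    have e1 : ∀ ω, Q ω * (starRingEnd ℂ) (Q ω) = ∑ p ∈ F, ∑ r ∈ F, a p * (starRingEnd ℂ) (a r) *
        ((U p.1 ω * V p.2 ω) * ((starRingEnd ℂ) (U r.1 ω) * (starRingEnd ℂ) (V r.2 ω))) := by
      intro ω
      rw [hQ]
      simp only
      rw [map_sum, Finset.sum_mul_sum]
      refine Finset.sum_congr rfl fun p _ => Finset.sum_congr rfl fun r _ => ?_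
      simp only [map_mul]
      ring
    have e2 : m = ∑ p ∈ F, a p * ∫ ω, U p.1 ω * V p.2 ω ∂P := by
      rw [hm, hQ, integral_finsetSum _ fun p _ => (hUV p).const_mul _]
      simp_rw [integral_const_mul]
    have hi4 : ∀ p r : K × K, Integrable (fun ω => a p * (starRingEnd ℂ) (a r) *
        ((U p.1 ω * V p.2 ω) * ((starRingEnd ℂ) (U r.1 ω) * (starRingEnd ℂ) (V r.2 ω)))) P :=
      fun p r => (integrable_chaosOne_mul_four hG h0 (hU _) (hV _) (conj_mem_chaosOne (hU _))
        (conj_mem_chaosOne (hV _))).const_mul _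
    simp_rw [e1]
    rw [integral_finsetSum _ fun p _ => integrable_finsetSum _ fun r _ => hi4 p r, e2, map_sum,
      Finset.sum_mul_sum, ← Finset.sum_sub_distrib]
    refine Finset.sum_congr rfl fun p _ => ?_
    rw [integral_finsetSum _ fun r _ => hi4 p r, ← Finset.sum_sub_distrib]
    refine Finset.sum_congr rfl fun r _ => ?_
    rw [integral_const_mul, integral_chaosOne_mul_four hG h0 (hU _) (hV _)
      (conj_mem_chaosOne (hU _)) (conj_mem_chaosOne (hV _)), map_mul, ← hconj]
    simp only [map_mul]
    ring
  set t : K × K → ℝ := fun p => ‖a p‖ * (√(sqMoment P (U p.1)) * √(sqMoment P (V p.2))) with ht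
  have ht2 : ∀ p, t p ^ 2 = ‖a p‖ ^ 2 * (sqMoment P (U p.1) * sqMoment P (V p.2)) := fun p => by
    simp only [ht, mul_pow, Real.sq_sqrt (sqMoment_nonneg _)]
  have mU : ∀ k, MemLp (U k) 2 P := fun k => memLp_chaosOne hG (hU k) (by simp)
  have mV : ∀ k, MemLp (V k) 2 P := fun k => memLp_chaosOne hG (hV k) (by simp)
  -- Orthogonality of different indices leaves only `r = p` in the first pairing and `r = p.swap` in
  -- the second.
  have hterm : ∀ p ∈ F, ‖∑ r ∈ F, a p * (starRingEnd ℂ) (a r) *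
        ((∫ ω, U p.1 ω * (starRingEnd ℂ) (U r.1 ω) ∂P) *
          (∫ ω, V p.2 ω * (starRingEnd ℂ) (V r.2 ω) ∂P) +
        (∫ ω, U p.1 ω * (starRingEnd ℂ) (V r.2 ω) ∂P) *
          (∫ ω, V p.2 ω * (starRingEnd ℂ) (U r.1 ω) ∂P))‖
      ≤ t p ^ 2 + if p.swap ∈ F then t p * t p.swap else 0 := by
    intro p hp
    simp_rw [mul_add, Finset.sum_add_distrib]
    refine (norm_add_le _ _).trans (add_le_add ?_ ?_)
    · rw [Finset.sum_eq_single p]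
      · rw [integral_mul_conj_self, integral_mul_conj_self, ht2]
        simp only [norm_mul, RCLike.norm_conj, Complex.norm_real, Real.norm_eq_abs,
          abs_of_nonneg (sqMoment_nonneg _)]
        rw [sq]
      · intro r _ hr
        by_cases h1 : p.1 = r.1
        · have h2 : p.2 ≠ r.2 := fun h2 => hr (Prod.ext h1.symm h2.symm)
          rw [oV _ _ h2]
          simp
        · rw [oU _ _ h1]
          simp
      · exact fun h => absurd hp h
    · have hz : ∀ r ∈ F, r ≠ p.swap → a p * (starRingEnd ℂ) (a r) *
          ((∫ ω, U p.1 ω * (starRingEnd ℂ) (V r.2 ω) ∂P) *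
          (∫ ω, V p.2 ω * (starRingEnd ℂ) (U r.1 ω) ∂P)) = 0 := by
        intro r _ hr
        by_cases h1 : p.1 = r.2
        · have h2 : r.1 ≠ p.2 := fun h2 => hr (Prod.ext h2 h1.symm)
          have h3 : ∫ ω, V p.2 ω * (starRingEnd ℂ) (U r.1 ω) ∂P = 0 := by
            have := oUV _ _ h2
            rw [← map_eq_zero (starRingEnd ℂ), ← hconj] at this
            rw [← this]
            exact integral_congr_ae (Eventually.of_forall fun ω => by simp [mul_comm])
          rw [h3]
          simp
        · rw [oUV _ _ h1]
          simp
      split_ifs with hs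
      · rw [Finset.sum_eq_single p.swap hz (fun h => absurd hs h)]
        simp only [norm_mul, RCLike.norm_conj, Prod.fst_swap, Prod.snd_swap, ht]
        calc _ ≤ ‖a p‖ * ‖a p.swap‖ * ((√(sqMoment P (U p.1)) * √(sqMoment P (V p.1))) *
              (√(sqMoment P (V p.2)) * √(sqMoment P (U p.2)))) := by
              gcongr
              · exact norm_integral_mul_conj_le (mU _) (mV _)
              · exact norm_integral_mul_conj_le (mV _) (mU _)
          _ = _ := by ring
      · rw [Finset.sum_eq_zero fun r hr => hz r hr fun h => hs (h ▸ hr)]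
        simp
  -- The swap is an involution of the pairs whose mirror image lies in `F`, so `2 t p t p.swap ≤ t p
  -- ² + t p.swap ²` sums to at most the diagonal contribution. This is the factor `2` in the
  -- result.
  have hswap : ∑ p ∈ F, (if p.swap ∈ F then t p * t p.swap else 0) ≤ ∑ p ∈ F, t p ^ 2 := by
    rw [← Finset.sum_filter]
    have h1 : ∑ p ∈ F with p.swap ∈ F, t p.swap ^ 2 = ∑ p ∈ F with p.swap ∈ F, t p ^ 2 :=
      Finset.sum_nbij' Prod.swap Prod.swap (by simp +contextual) (by simp +contextual) (by simp)
        (by simp) (by simp)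
    have h2 : ∑ p ∈ F with p.swap ∈ F, t p ^ 2 ≤ ∑ p ∈ F, t p ^ 2 :=
      Finset.sum_le_sum_of_subset_of_nonneg (Finset.filter_subset _ _) fun p _ _ => sq_nonneg _
    calc _ ≤ ∑ p ∈ F with p.swap ∈ F, (t p ^ 2 + t p.swap ^ 2) / 2 :=
          Finset.sum_le_sum fun p _ => by nlinarith [sq_nonneg (t p - t p.swap)]
      _ = ∑ p ∈ F with p.swap ∈ F, t p ^ 2 := by
          rw [← Finset.sum_div, Finset.sum_add_distrib, h1]
          ring
      _ ≤ _ := h2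
  have hnorm : sqMoment P (fun ω => Q ω - m) = ‖(sqMoment P (fun ω => Q ω - m) : ℂ)‖ := by
    rw [Complex.norm_real, Real.norm_of_nonneg (sqMoment_nonneg _)]
  rw [hnorm, hvar, hexp]
  calc _ ≤ ∑ p ∈ F, (t p ^ 2 + if p.swap ∈ F then t p * t p.swap else 0) :=
        (norm_sum_le _ _).trans (Finset.sum_le_sum hterm)
    _ ≤ ∑ p ∈ F, t p ^ 2 + ∑ p ∈ F, t p ^ 2 := by
        rw [Finset.sum_add_distrib]
        gcongr
    _ = _ := by
        simp_rw [ht2]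
        ring

end Wick

/-! ### Minkowski's inequality and limits of moments -/

section Minkowski

variable {Ω : Type*} [MeasurableSpace Ω] {P : Measure Ω}

theorem lintegral_Lp_finsetSum_le {ι : Type*} {f : ι → Ω → ℝ≥0∞} (hf : ∀ i, AEMeasurable (f i) P)
    {p : ℝ} (hp : 1 ≤ p) (s : Finset ι) :
    (∫⁻ ω, (∑ i ∈ s, f i ω) ^ p ∂P) ^ (1 / p) ≤ ∑ i ∈ s, (∫⁻ ω, f i ω ^ p ∂P) ^ (1 / p) := by
  classical
  induction s using Finset.induction_on with
  | empty =>
    have : 0 < p := by linarith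
    simp [ENNReal.zero_rpow_of_pos this, this]
  | insert a s ha ih =>
    simp_rw [Finset.sum_insert ha]
    refine (ENNReal.lintegral_Lp_add_le (hf a) ?_ hp).trans (add_le_add le_rfl ih)
    exact Finset.aemeasurable_fun_sum s fun i _ => hf i

/-- The infinite sum is the directed supremum of the finite ones, so monotone convergence extends
the finite inequality. -/
theorem lintegral_Lp_tsum_le {ι : Type*} [Countable ι] {f : ι → Ω → ℝ≥0∞}
    (hf : ∀ i, AEMeasurable (f i) P) {p : ℝ} (hp : 1 ≤ p) :
    (∫⁻ ω, (∑' i, f i ω) ^ p ∂P) ^ (1 / p) ≤ ∑' i, (∫⁻ ω, f i ω ^ p ∂P) ^ (1 / p) := by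
  have hp0 : 0 < p := by linarith
  have hmono : Monotone fun x : ℝ≥0∞ => x ^ p := ENNReal.monotone_rpow_of_nonneg hp0.le
  have h1 : ∀ ω, (∑' i, f i ω) ^ p = ⨆ s : Finset ι, (∑ i ∈ s, f i ω) ^ p := fun ω => by
    rw [ENNReal.tsum_eq_iSup_sum]
    exact (ENNReal.orderIsoRpow p hp0).map_iSup _
  simp_rw [h1]
  rw [lintegral_iSup_directed]
  · rw [one_div, ENNReal.rpow_inv_le_iff hp0]
    refine iSup_le fun s => ?_
    rw [← ENNReal.rpow_inv_le_iff hp0, ← one_div]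
    exact (lintegral_Lp_finsetSum_le hf hp s).trans (ENNReal.sum_le_tsum s)
  · exact fun s => (Finset.aemeasurable_fun_sum s fun i _ => hf i).pow_const _
  · intro s t
    classical
    refine ⟨s ∪ t, fun ω => hmono ?_, fun ω => hmono ?_⟩
    · exact Finset.sum_le_sum_of_subset Finset.subset_union_left
    · exact Finset.sum_le_sum_of_subset Finset.subset_union_right

theorem aemeasurable_liminf {f : ℕ → Ω → ℝ≥0∞} (hf : ∀ i, AEMeasurable (f i) P) :
    AEMeasurable (fun ω => liminf (fun i => f i ω) atTop) P := by
  refine ⟨_, Measurable.liminf fun i => (hf i).measurable_mk, ?_⟩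
  filter_upwards [ae_all_iff.2 fun i => (hf i).ae_eq_mk] with ω hω
  simp_rw [hω]

/-- Convergence in `L²` gives almost sure convergence along a subsequence, and Fatou's lemma then
carries a uniform bound in `L^p` to the limit for any exponent `p`. -/
theorem eLpNorm_le_of_tendsto_eLpNorm {E : Type*} [NormedAddCommGroup E] {V : ℕ → Ω → E} {U : Ω → E}
    (hV : ∀ N, AEStronglyMeasurable (V N) P) (hU : AEStronglyMeasurable U P)
    (h : Tendsto (fun N => eLpNorm (V N - U) 2 P) atTop (𝓝 0)) {p c : ℝ≥0∞}
    (hc : ∀ N, eLpNorm (V N) p P ≤ c) : eLpNorm U p P ≤ c := by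
  obtain ⟨ns, -, hns⟩ :=
    (tendstoInMeasure_of_tendsto_eLpNorm two_ne_zero hV hU h).exists_seq_tendsto_ae
  refine (Lp.eLpNorm_lim_le_liminf_eLpNorm (fun n => hV (ns n)) U hns).trans ?_
  exact liminf_le_of_frequently_le' (Frequently.of_forall fun n => hc _)

end Minkowski

/-! ### Kolmogorov's continuity theorem -/

section Kolmogorov

variable {ι : Type*} [Fintype ι]

/-- The point with integer coordinates `n` in the dyadic grid of mesh `2⁻ʲ`. -/
def gridPoint (j : ℕ) (n : ι → ℤ) : ι → ℝ := fun i => n i / 2 ^ j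

/-- The integer coordinates of `u` rounded down to the dyadic grid of mesh `2⁻ʲ`. -/
def gridFloor (j : ℕ) (u : ι → ℝ) : ι → ℤ := fun i => ⌊u i * 2 ^ j⌋

/-- The point of the dyadic grid of mesh `2⁻ʲ` which is obtained by rounding down `u`. -/
def roundDown (j : ℕ) (u : ι → ℝ) : ι → ℝ := gridPoint j (gridFloor j u)

theorem norm_roundDown_sub_le (j : ℕ) (u : ι → ℝ) : ‖roundDown j u - u‖ ≤ (2 ^ j)⁻¹ := by
  rw [pi_norm_le_iff_of_nonneg (by positivity)]
  intro i
  have h2 : (0 : ℝ) < 2 ^ j := by positivity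
  have h1 := Int.floor_le (u i * 2 ^ j)
  have h3 := Int.lt_floor_add_one (u i * 2 ^ j)
  simp only [Pi.sub_apply, roundDown, gridPoint, gridFloor, Real.norm_eq_abs]
  rw [abs_le, neg_le_sub_iff_le_add, sub_le_iff_le_add]
  constructor
  · rw [← sub_le_iff_le_add, le_div_iff₀ h2, sub_mul, inv_mul_cancel₀ h2.ne']
    linarith
  · rw [div_le_iff₀ h2, add_mul, inv_mul_cancel₀ h2.ne']
    linarith

theorem tendsto_roundDown (u : ι → ℝ) : Tendsto (fun j => roundDown j u) atTop (𝓝 u) := by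
  rw [tendsto_iff_norm_sub_tendsto_zero]
  refine squeeze_zero (fun _ => norm_nonneg _) (fun j => norm_roundDown_sub_le j u) ?_
  simp_rw [← inv_pow]
  exact tendsto_pow_atTop_nhds_zero_of_lt_one (by norm_num) (by norm_num)

omit [Fintype ι] in
theorem abs_roundDown_le {R : ℕ} {u : ι → ℝ} (hu : ∀ i, |u i| ≤ R) (j : ℕ) (i : ι) :
    |gridFloor j u i| ≤ R * 2 ^ j := by
  have h2 : (0 : ℝ) < 2 ^ j := by positivity
  obtain ⟨h1, h3⟩ := abs_le.1 (hu i)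
  rw [abs_le]
  constructor
  · rw [gridFloor, Int.le_floor]
    push_cast
    nlinarith
  · have h4 : ((gridFloor j u i : ℤ) : ℝ) ≤ R * 2 ^ j :=
      (Int.floor_le _).trans (by gcongr)
    exact_mod_cast h4

variable {Ω : Type*} [MeasurableSpace Ω] {P : Measure Ω} {E : Type*} [NormedAddCommGroup E]

/-- The coordinates of the points of the grid of mesh `2⁻ʲ` in the cube `[-R, R]^ι`. -/
def gridBox (ι : Type*) [Fintype ι] (R j : ℕ) : Finset (ι → ℤ) :=
  open scoped Classical in
  Fintype.piFinset fun _ => Finset.Icc (-(R * 2 ^ j : ℤ)) (R * 2 ^ j)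

/-- The steps between neighbouring points of a grid. -/
def gridSteps (ι : Type*) [Fintype ι] : Finset (ι → ℤ) :=
  open scoped Classical in
  Fintype.piFinset fun _ => Finset.Icc (-1 : ℤ) 1

/-- The sum of the `p`-th powers of the increments of `V` between neighbours in the dyadic grid. -/
def gridOsc (V : (ι → ℝ) → Ω → E) (p : ℝ) (R j : ℕ) (ω : Ω) : ℝ≥0∞ :=
  ∑ n ∈ gridBox ι R j, ∑ e ∈ gridSteps ι,
    ‖V (gridPoint j (n + e)) ω - V (gridPoint j n) ω‖ₑ ^ p

theorem enorm_sub_le_gridOsc (V : (ι → ℝ) → Ω → E) {p : ℝ} (hp : 0 < p) {R j : ℕ}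
    {n e : ι → ℤ} (hn : ∀ i, |n i| ≤ R * 2 ^ j) (he : ∀ i, |e i| ≤ 1) (ω : Ω) :
    ‖V (gridPoint j (n + e)) ω - V (gridPoint j n) ω‖ₑ ≤ gridOsc V p R j ω ^ (1 / p) := by
  rw [← ENNReal.rpow_le_rpow_iff hp, ← ENNReal.rpow_mul, one_div_mul_cancel hp.ne',
    ENNReal.rpow_one]
  have hn' : n ∈ gridBox ι R j := by
    simp only [gridBox, Fintype.mem_piFinset, Finset.mem_Icc]
    exact fun i => abs_le.1 (hn i)
  have he' : e ∈ gridSteps ι := by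
    simp only [gridSteps, Fintype.mem_piFinset, Finset.mem_Icc]
    exact fun i => abs_le.1 (he i)
  calc _ ≤ ∑ e ∈ gridSteps ι, ‖V (gridPoint j (n + e)) ω - V (gridPoint j n) ω‖ₑ ^ p :=
        Finset.single_le_sum (f := fun e => ‖V (gridPoint j (n + e)) ω - V (gridPoint j n) ω‖ₑ ^ p)
          (fun _ _ => zero_le) he'
    _ ≤ _ := Finset.single_le_sum (f := fun n => ∑ e ∈ gridSteps ι,
          ‖V (gridPoint j (n + e)) ω - V (gridPoint j n) ω‖ₑ ^ p) (fun _ _ => zero_le) hn'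

/-- On the finer grid the coarse rounding has coordinates `2⌊a⌋`, and `⌊2a⌋ - 2⌊a⌋` is `0` or `1`.
Consecutive roundings are thus neighbours on the finer grid. -/
theorem enorm_roundDown_succ_sub_le (V : (ι → ℝ) → Ω → E) {p : ℝ} (hp : 0 < p) {R : ℕ}
    {u : ι → ℝ} (hu : ∀ i, |u i| ≤ R) (j : ℕ) (ω : Ω) :
    ‖V (roundDown (j + 1) u) ω - V (roundDown j u) ω‖ₑ ≤ gridOsc V p R (j + 1) ω ^ (1 / p) := by
  have h1 : roundDown j u = gridPoint (j + 1) (2 * gridFloor j u) := by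
    funext i
    simp only [roundDown, gridPoint, Pi.mul_apply, Pi.ofNat_apply, Int.cast_mul, Int.cast_ofNat,
      pow_succ]
    field_simp
  set e : ι → ℤ := gridFloor (j + 1) u - 2 * gridFloor j u with he
  have h2 : roundDown (j + 1) u = gridPoint (j + 1) (2 * gridFloor j u + e) := by
    rw [he, add_sub_cancel]
    rfl
  rw [h1, h2]
  refine enorm_sub_le_gridOsc V hp (fun i => ?_) (fun i => ?_) ω
  · have := abs_roundDown_le hu j i
    simp only [Pi.mul_apply, Pi.ofNat_apply, abs_mul, pow_succ, abs_two]
    linarith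
  · simp only [he, Pi.sub_apply, Pi.mul_apply, Pi.ofNat_apply, gridFloor]
    have a1 := Int.floor_le (u i * 2 ^ j)
    have a2 := Int.lt_floor_add_one (u i * 2 ^ j)
    have b1 := Int.floor_le (u i * 2 ^ (j + 1))
    have b2 := Int.lt_floor_add_one (u i * 2 ^ (j + 1))
    rw [pow_succ] at b1 b2 ⊢
    rw [← mul_assoc] at b1 b2 ⊢
    have c1 : (⌊u i * 2 ^ j * 2⌋ : ℝ) < 2 * ⌊u i * 2 ^ j⌋ + 2 := by linarith
    have c2 : (2 * ⌊u i * 2 ^ j⌋ : ℝ) < ⌊u i * 2 ^ j * 2⌋ + 1 := by linarith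
    have c1' : ⌊u i * 2 ^ j * 2⌋ < 2 * ⌊u i * 2 ^ j⌋ + 2 := by exact_mod_cast c1
    have c2' : 2 * ⌊u i * 2 ^ j⌋ < ⌊u i * 2 ^ j * 2⌋ + 1 := by exact_mod_cast c2
    rw [abs_le]
    omega

/-- Points at distance at most one mesh have integer parts which differ by at most one in each
coordinate. -/
theorem enorm_roundDown_sub_le (V : (ι → ℝ) → Ω → E) {p : ℝ} (hp : 0 < p) {R : ℕ}
    {u v : ι → ℝ} (hu : ∀ i, |u i| ≤ R) {j : ℕ} (huv : ‖v - u‖ ≤ (2 ^ j)⁻¹) (ω : Ω) :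
    ‖V (roundDown j v) ω - V (roundDown j u) ω‖ₑ ≤ gridOsc V p R j ω ^ (1 / p) := by
  have h2 : roundDown j v = gridPoint j (gridFloor j u + (gridFloor j v - gridFloor j u)) := by
    rw [add_sub_cancel]
    rfl
  rw [h2]
  refine enorm_sub_le_gridOsc V hp (abs_roundDown_le hu j) (fun i => ?_) ω
  have hi := (norm_le_pi_norm (v - u) i).trans huv
  rw [Real.norm_eq_abs, Pi.sub_apply, ← div_one (2 ^ j)⁻¹, ← one_div, div_div, mul_one,
    le_div_iff₀ (by positivity)] at hi
  have hi' : |v i * 2 ^ j - u i * 2 ^ j| ≤ 1 := by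
    rwa [← sub_mul, abs_mul, abs_of_pos (show (0 : ℝ) < 2 ^ j by positivity)]
  rw [abs_le] at hi'
  simp only [Pi.sub_apply, gridFloor]
  have a1 := Int.floor_le (u i * 2 ^ j)
  have a2 := Int.lt_floor_add_one (u i * 2 ^ j)
  have b1 := Int.floor_le (v i * 2 ^ j)
  have b2 := Int.lt_floor_add_one (v i * 2 ^ j)
  have c1 : (⌊v i * 2 ^ j⌋ : ℝ) < ⌊u i * 2 ^ j⌋ + 2 := by linarith
  have c2 : (⌊u i * 2 ^ j⌋ : ℝ) < ⌊v i * 2 ^ j⌋ + 2 := by linarith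
  have c1' : ⌊v i * 2 ^ j⌋ < ⌊u i * 2 ^ j⌋ + 2 := by exact_mod_cast c1
  have c2' : ⌊u i * 2 ^ j⌋ < ⌊v i * 2 ^ j⌋ + 2 := by exact_mod_cast c2
  rw [abs_le]
  omega

/-- The moment bound of Kolmogorov's criterion on the cube `[-R, R]^ι`, for close points. -/
def KolmogorovOn (P : Measure Ω) (V : (ι → ℝ) → Ω → E) (p : ℝ) (K : ℝ≥0∞) (R : ℕ) : Prop :=
  ∀ u v : ι → ℝ, (∀ i, |u i| ≤ R) → (∀ i, |v i| ≤ R) → ‖u - v‖ ≤ 1 →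
    ∫⁻ ω, ‖V u ω - V v ω‖ₑ ^ p ∂P ≤ K * ENNReal.ofReal (‖u - v‖ ^ (Fintype.card ι + 1))

theorem aemeasurable_gridOsc {V : (ι → ℝ) → Ω → E} (hV : ∀ u, AEStronglyMeasurable (V u) P)
    (p : ℝ) (R j : ℕ) : AEMeasurable (gridOsc V p R j) P :=
  Finset.aemeasurable_fun_sum _ fun n _ => Finset.aemeasurable_fun_sum _ fun e _ =>
    (((hV _).sub (hV _)).enorm).pow_const _

/-- A cube in dimension `d` has of order `2^{jd}` pairs of neighbours, each contributing at most a
multiple of `2^{-j(d+1)}`; one factor `2^{-j}` is left. The moment bound is needed on the cube of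
size `R + 1`, since neighbours of points of the smaller cube may leave it. -/
theorem lintegral_gridOsc_le {V : (ι → ℝ) → Ω → E} (hV : ∀ u, AEStronglyMeasurable (V u) P)
    {p : ℝ} {K : ℝ≥0∞} {R : ℕ} (h : KolmogorovOn P V p K (R + 1)) (j : ℕ) :
    ∫⁻ ω, gridOsc V p R j ω ∂P
      ≤ ENNReal.ofReal ((3 * (2 * R + 1)) ^ Fintype.card ι) * K * ENNReal.ofReal ((2 ^ j)⁻¹) := by
  classical
  set d := Fintype.card ι
  have hterm : ∀ n ∈ gridBox ι R j, ∀ e ∈ gridSteps ι,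
      ∫⁻ ω, ‖V (gridPoint j (n + e)) ω - V (gridPoint j n) ω‖ₑ ^ p ∂P
        ≤ K * ENNReal.ofReal (((2 ^ j)⁻¹) ^ (d + 1)) := by
    intro n hn e he
    simp only [gridBox, gridSteps, Fintype.mem_piFinset, Finset.mem_Icc, ← abs_le] at hn he
    have h2 : (1 : ℝ) ≤ 2 ^ j := one_le_pow₀ (by norm_num)
    have hnorm : ‖gridPoint j (n + e) - gridPoint j n‖ ≤ (2 ^ j)⁻¹ := by
      rw [pi_norm_le_iff_of_nonneg (by positivity)]
      intro i
      have : ((|e i| : ℤ) : ℝ) ≤ 1 := by exact_mod_cast he i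
      rw [Pi.sub_apply, gridPoint, gridPoint, ← sub_div, Pi.add_apply, Int.cast_add, add_sub_cancel_left,
        Real.norm_eq_abs, abs_div, abs_of_pos (show (0 : ℝ) < 2 ^ j by positivity),
        div_le_iff₀ (by positivity), inv_mul_cancel₀ (by positivity), ← Int.cast_abs]
      exact this
    have hn1 : ∀ i, |gridPoint j n i| ≤ R := fun i => by
      have : ((|n i| : ℤ) : ℝ) ≤ R * 2 ^ j := by exact_mod_cast hn i
      rw [gridPoint, abs_div, abs_of_pos (show (0 : ℝ) < 2 ^ j by positivity),
        div_le_iff₀ (by positivity), ← Int.cast_abs]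
      exact this
    have hle1 : ‖gridPoint j (n + e) - gridPoint j n‖ ≤ 1 := hnorm.trans (inv_le_one_of_one_le₀ h2)
    have hn2 : ∀ i, |gridPoint j (n + e) i| ≤ R + 1 := fun i => by
      have h3 := (norm_le_pi_norm (gridPoint j (n + e) - gridPoint j n) i).trans hle1
      have h4 := abs_add_le (gridPoint j n i) (gridPoint j (n + e) i - gridPoint j n i)
      rw [add_sub_cancel] at h4
      rw [Real.norm_eq_abs, Pi.sub_apply] at h3
      linarith [hn1 i]
    refine (h _ _ (by exact_mod_cast hn2) (fun i => ?_) hle1).trans ?_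
    · push_cast
      linarith [hn1 i]
    · gcongr
  have hc1 : ((gridBox ι R j).card : ℝ) ≤ ((2 * R + 1) * 2 ^ j) ^ d := by
    have h2 : (1 : ℝ) ≤ 2 ^ j := one_le_pow₀ (by norm_num)
    rw [gridBox, Fintype.card_piFinset]
    simp only [Int.card_Icc, Finset.prod_const, Finset.card_univ]
    push_cast
    have : (((R * 2 ^ j + 1 - -(R * 2 ^ j) : ℤ).toNat : ℕ) : ℝ) = 2 * R * 2 ^ j + 1 := by
      have h0 : (0 : ℤ) ≤ R * 2 ^ j + 1 - -(R * 2 ^ j) := by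
        rw [sub_neg_eq_add]
        positivity
      have : (((R * 2 ^ j + 1 - -(R * 2 ^ j) : ℤ).toNat : ℤ) : ℝ)
          = ((R * 2 ^ j + 1 - -(R * 2 ^ j) : ℤ) : ℝ) := by rw [Int.toNat_of_nonneg h0]
      rw [Int.cast_natCast] at this
      rw [this]
      push_cast
      ring
    rw [this]
    gcongr
    nlinarith
  have hc2 : ((gridSteps ι).card : ℝ) = 3 ^ d := by
    rw [gridSteps, Fintype.card_piFinset]
    simp [d]
  calc ∫⁻ ω, gridOsc V p R j ω ∂P
      = ∑ n ∈ gridBox ι R j, ∑ e ∈ gridSteps ι,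
        ∫⁻ ω, ‖V (gridPoint j (n + e)) ω - V (gridPoint j n) ω‖ₑ ^ p ∂P := by
        have hm : ∀ n e : ι → ℤ, AEMeasurable
            (fun ω => ‖V (gridPoint j (n + e)) ω - V (gridPoint j n) ω‖ₑ ^ p) P :=
          fun n e => (((hV _).sub (hV _)).enorm).pow_const _
        unfold gridOsc
        rw [lintegral_finsetSum' _ fun n _ => Finset.aemeasurable_fun_sum _ fun e _ => hm n e]
        exact Finset.sum_congr rfl fun n _ => lintegral_finsetSum' _ fun e _ => hm n e
    _ ≤ ∑ n ∈ gridBox ι R j, ∑ e ∈ gridSteps ι, K * ENNReal.ofReal (((2 ^ j)⁻¹) ^ (d + 1)) :=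
        Finset.sum_le_sum fun n hn => Finset.sum_le_sum fun e he => hterm n hn e he
    _ = K * (ENNReal.ofReal ((gridBox ι R j).card * (gridSteps ι).card * ((2 ^ j)⁻¹) ^ (d + 1))) := by
        simp only [Finset.sum_const, nsmul_eq_mul]
        rw [ENNReal.ofReal_mul (by positivity), ENNReal.ofReal_mul (by positivity),
          ENNReal.ofReal_natCast, ENNReal.ofReal_natCast]
        ring
    _ ≤ K * ENNReal.ofReal ((3 * (2 * R + 1)) ^ d * (2 ^ j)⁻¹) := by
        refine mul_le_mul_right (ENNReal.ofReal_le_ofReal ?_) _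
        rw [hc2]
        calc _ ≤ ((2 * R + 1 : ℝ) * 2 ^ j) ^ d * 3 ^ d * ((2 ^ j)⁻¹) ^ (d + 1) := by
              refine mul_le_mul_of_nonneg_right ?_ (by positivity)
              exact mul_le_mul_of_nonneg_right hc1 (by positivity)
          _ = _ := by
            rw [pow_succ, mul_pow, mul_pow, inv_pow]
            field_simp
    _ = _ := by
        rw [ENNReal.ofReal_mul (by positivity)]
        ring

/-- The sum over all scales of the oscillations between neighbours in the dyadic grid. -/
def gridSup (V : (ι → ℝ) → Ω → E) (p : ℝ) (R : ℕ) (ω : Ω) : ℝ≥0∞ :=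
  ∑' j, gridOsc V p R j ω ^ (1 / p)

theorem aemeasurable_gridSup {V : (ι → ℝ) → Ω → E} (hV : ∀ u, AEStronglyMeasurable (V u) P)
    (p : ℝ) (R : ℕ) : AEMeasurable (gridSup V p R) P :=
  AEMeasurable.tsum fun j => (aemeasurable_gridOsc hV p R j).pow_const _

/-- The constant in the bound of the moments of `gridSup`. -/
def chainConst (d R : ℕ) (p : ℝ) : ℝ≥0∞ :=
  ∑' j : ℕ, (ENNReal.ofReal ((3 * (2 * R + 1)) ^ d) * ENNReal.ofReal ((2 ^ j)⁻¹)) ^ (1 / p)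

/-- The series over scales is geometric with ratio `2^{-1/p} < 1`. -/
theorem chainConst_lt_top (d R : ℕ) {p : ℝ} (hp : 1 ≤ p) : chainConst d R p < ⊤ := by
  have hp0 : 0 < p := by linarith
  have h1 : ∀ j : ℕ, (ENNReal.ofReal ((3 * (2 * R + 1)) ^ d) * ENNReal.ofReal ((2 ^ j)⁻¹)) ^ (1 / p)
      = ENNReal.ofReal ((3 * (2 * R + 1)) ^ d) ^ (1 / p) * ((2⁻¹ : ℝ≥0∞) ^ (1 / p)) ^ j := fun j => by
    rw [ENNReal.mul_rpow_of_nonneg _ _ (by positivity)]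
    congr 1
    rw [← inv_pow, ENNReal.ofReal_pow (by positivity), ENNReal.ofReal_inv_of_pos (by norm_num)]
    simp only [ENNReal.ofReal_ofNat]
    rw [← ENNReal.rpow_natCast, ← ENNReal.rpow_natCast, ← ENNReal.rpow_mul, ← ENNReal.rpow_mul,
      mul_comm]
  simp_rw [chainConst, h1]
  rw [ENNReal.tsum_mul_left, ENNReal.tsum_geometric]
  refine ENNReal.mul_lt_top (ENNReal.rpow_lt_top_of_nonneg (by positivity) ENNReal.ofReal_ne_top) ?_
  rw [ENNReal.inv_lt_top, tsub_pos_iff_lt]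
  exact ENNReal.rpow_lt_one (by simp) (by positivity)

theorem lintegral_gridSup_le {V : (ι → ℝ) → Ω → E} (hV : ∀ u, AEStronglyMeasurable (V u) P)
    {p : ℝ} (hp : 1 ≤ p) {K : ℝ≥0∞} {R : ℕ} (h : KolmogorovOn P V p K (R + 1)) :
    (∫⁻ ω, gridSup V p R ω ^ p ∂P) ^ (1 / p) ≤ chainConst (Fintype.card ι) R p * K ^ (1 / p) := by
  have hp0 : 0 < p := by linarith
  refine (lintegral_Lp_tsum_le (fun j => (aemeasurable_gridOsc hV p R j).pow_const _) hp).trans ?_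
  rw [chainConst, ← ENNReal.tsum_mul_right]
  refine ENNReal.tsum_le_tsum fun j => ?_
  rw [← ENNReal.mul_rpow_of_nonneg _ _ (by positivity)]
  refine ENNReal.rpow_le_rpow ?_ (by positivity)
  simp_rw [← ENNReal.rpow_mul, one_div_mul_cancel hp0.ne', ENNReal.rpow_one]
  refine (lintegral_gridOsc_le hV h j).trans (le_of_eq ?_)
  ring

/-- Once the oscillations are summable, the values on the dyadic grids converge at an explicit
rate. -/
theorem edist_roundDown_le_tsum (V : (ι → ℝ) → Ω → E) {p : ℝ} (hp : 0 < p) {R : ℕ}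
    {u : ι → ℝ} (hu : ∀ i, |u i| ≤ R) (ω : Ω) {j k : ℕ} (hjk : j ≤ k) :
    ‖V (roundDown k u) ω - V (roundDown j u) ω‖ₑ
      ≤ ∑' i, gridOsc V p R (i + j) ω ^ (1 / p) := by
  have key : ∀ m, ‖V (roundDown (j + m) u) ω - V (roundDown j u) ω‖ₑ
      ≤ ∑ i ∈ Finset.range (m + 1), gridOsc V p R (i + j) ω ^ (1 / p) := by
    intro m
    induction m with
    | zero => simp
    | succ m ih =>
      rw [Finset.sum_range_succ]
      have : V (roundDown (j + (m + 1)) u) ω - V (roundDown j u) ω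
          = (V (roundDown (j + m) u) ω - V (roundDown j u) ω)
            + (V (roundDown (j + m + 1) u) ω - V (roundDown (j + m) u) ω) := by
        rw [← add_assoc]
        abel
      rw [this]
      refine (enorm_add_le _ _).trans (add_le_add ih ?_)
      have := enorm_roundDown_succ_sub_le V hp hu (j + m) ω
      rwa [show m + 1 + j = j + m + 1 by ring]
  obtain ⟨m, rfl⟩ := Nat.exists_eq_add_of_le hjk
  exact (key m).trans (ENNReal.sum_le_tsum _)

/-- **Kolmogorov's continuity theorem**. -/
theorem exists_continuous_modification [CompleteSpace E] {V : (ι → ℝ) → Ω → E}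
    (hV : ∀ u, AEStronglyMeasurable (V u) P) {p : ℝ} (hp : 1 ≤ p)
    (h : ∀ R : ℕ, ∃ K : ℝ≥0∞, K < ⊤ ∧ KolmogorovOn P V p K R) :
    ∃ U : (ι → ℝ) → Ω → E, (∀ u, U u =ᵐ[P] V u) ∧ ∀ ω, Continuous fun u => U u ω := by
  classical
  have hp0 : 0 < p := by linarith
  -- A finite `p`-th moment of `gridSup` makes it finite almost surely, for all cubes of integer
  -- size simultaneously.
  have hfin : ∀ᵐ ω ∂P, ∀ R : ℕ, gridSup V p R ω < ⊤ := by
    rw [ae_all_iff]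
    intro R
    obtain ⟨K, hK, hKR⟩ := h (R + 1)
    have hlt : ∫⁻ ω, gridSup V p R ω ^ p ∂P < ⊤ := by
      have h1 := (lintegral_gridSup_le hV hp hKR).trans_lt
        (ENNReal.mul_lt_top (chainConst_lt_top (Fintype.card ι) R hp)
          (ENNReal.rpow_lt_top_of_nonneg (by positivity) hK.ne))
      rwa [ENNReal.rpow_lt_top_iff_of_pos (by positivity)] at h1
    filter_upwards [ae_lt_top' ((aemeasurable_gridSup hV p R).pow_const p) hlt.ne] with ω hω
    rwa [ENNReal.rpow_lt_top_iff_of_pos hp0] at hω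
  set good : Ω → Prop := fun ω => ∀ R : ℕ, gridSup V p R ω < ⊤ with hgood
  have hbox : ∀ u : ι → ℝ, ∃ R : ℕ, ∀ i, |u i| ≤ R := fun u => by
    obtain ⟨R, hR⟩ := exists_nat_ge ‖u‖
    exact ⟨R, fun i => (norm_le_pi_norm u i).trans hR⟩
  have htail : ∀ ω, good ω → ∀ R : ℕ,
      Tendsto (fun j => ∑' i, gridOsc V p R (i + j) ω ^ (1 / p)) atTop (𝓝 0) := fun ω hω R =>
    ENNReal.tendsto_sum_nat_add _ (hω R).ne
  have hconv : ∀ ω, good ω → ∀ u, ∃ x, Tendsto (fun j => V (roundDown j u) ω) atTop (𝓝 x) := by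
    intro ω hω u
    obtain ⟨R, hR⟩ := hbox u
    refine cauchySeq_tendsto_of_complete (EMetric.cauchySeq_iff'.2 fun ε hε => ?_)
    obtain ⟨j, hj⟩ := ((htail ω hω R).eventually_lt_const hε).exists
    refine ⟨j, fun k hk => lt_of_le_of_lt ?_ hj⟩
    rw [edist_eq_enorm_sub]
    exact edist_roundDown_le_tsum V hp0 hR ω hk
  choose! lim hlim using hconv
  have hlimle : ∀ ω, good ω → ∀ (R : ℕ) (u : ι → ℝ), (∀ i, |u i| ≤ R) → ∀ j,
      ‖lim ω u - V (roundDown j u) ω‖ₑ ≤ ∑' i, gridOsc V p R (i + j) ω ^ (1 / p) := by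
    intro ω hω R u hu j
    refine le_of_tendsto ((hlim ω hω u).sub_const _).enorm ?_
    filter_upwards [eventually_ge_atTop j] with k hk
    exact edist_roundDown_le_tsum V hp0 hu ω hk
  -- The modification is the limit along dyadic roundings where all oscillations are summable, and
  -- zero on the exceptional set.
  refine ⟨fun u ω => if good ω then lim ω u else 0, fun u => ?_, fun ω => ?_⟩
  · obtain ⟨R, hR⟩ := hbox u
    obtain ⟨K, hK, hKR⟩ := h (R + 1)
    -- By Fatou's lemma and the moment bound, the roundings approach `V u` along a subsequence
    -- almost surely. The pathwise limit must then be `V u`.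
    have hzero : ∫⁻ ω, liminf (fun j => ‖V (roundDown j u) ω - V u ω‖ₑ ^ p) atTop ∂P = 0 := by
      refine le_antisymm ?_ zero_le
      refine (lintegral_liminf_le' fun j => ((hV _).sub (hV _)).enorm.pow_const _).trans ?_
      refine (liminf_le_liminf (v := fun j : ℕ => K * ENNReal.ofReal ((2 ^ j)⁻¹))
        (Eventually.of_forall fun j => ?_)).trans (le_of_eq ?_)
      · have h2 : (1 : ℝ) ≤ 2 ^ j := one_le_pow₀ (by norm_num)
        have hn := norm_roundDown_sub_le j u
        have hn1 := hn.trans (inv_le_one_of_one_le₀ h2)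
        refine (hKR _ _ (fun i => ?_) (fun i => ?_) hn1).trans ?_
        · have h3 := (norm_le_pi_norm (roundDown j u - u) i).trans hn1
          have h4 := abs_add_le (u i) (roundDown j u i - u i)
          rw [add_sub_cancel] at h4
          rw [Real.norm_eq_abs, Pi.sub_apply] at h3
          push_cast
          linarith [hR i]
        · push_cast
          linarith [hR i]
        · gcongr
          calc ‖roundDown j u - u‖ ^ (Fintype.card ι + 1) ≤ ‖roundDown j u - u‖ :=
                pow_le_of_le_one (norm_nonneg _) hn1 (by omega)
            _ ≤ _ := hn
      · refine Tendsto.liminf_eq ?_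
        rw [← mul_zero K, ← ENNReal.ofReal_zero]
        refine ENNReal.Tendsto.const_mul (ENNReal.tendsto_ofReal ?_) (Or.inr hK.ne)
        simp_rw [← inv_pow]
        exact tendsto_pow_atTop_nhds_zero_of_lt_one (by norm_num) (by norm_num)
    have hmeas : AEMeasurable
        (fun ω => liminf (fun j => ‖V (roundDown j u) ω - V u ω‖ₑ ^ p) atTop) P :=
      aemeasurable_liminf fun j => ((hV _).sub (hV _)).enorm.pow_const _
    filter_upwards [(lintegral_eq_zero_iff' hmeas).1 hzero, hfin] with ω hω hg
    have hg' : good ω := hg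
    have ht : Tendsto (fun j => ‖V (roundDown j u) ω - V u ω‖ₑ ^ p) atTop
        (𝓝 (‖lim ω u - V u ω‖ₑ ^ p)) :=
      ((ENNReal.continuous_rpow_const).tendsto _).comp ((hlim ω hg' u).sub_const _).enorm
    rw [ht.liminf_eq, Pi.zero_apply, ENNReal.rpow_eq_zero_iff_of_pos hp0, enorm_eq_zero,
      sub_eq_zero] at hω
    rw [if_pos hg', hω]
  · by_cases hg : good ω
    · simp only [if_pos hg]
      rw [continuous_iff_continuousAt]
      intro u
      obtain ⟨R, hR⟩ := hbox u
      rw [ContinuousAt, EMetric.tendsto_nhds]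
      intro ε hε
      have hε3 : 0 < ε / 3 := ENNReal.div_pos hε.ne' (by simp)
      -- One scale `j` serves for both points and for the step between their roundings. The cube of
      -- size `R + 1` contains every point within distance one of `u`.
      obtain ⟨j, hj⟩ := ((htail ω hg (R + 1)).eventually_lt_const hε3).exists
      have hnear : ∀ᶠ v in 𝓝 u, ‖v - u‖ ≤ (2 ^ j)⁻¹ := by
        filter_upwards [Metric.ball_mem_nhds u (show (0 : ℝ) < (2 ^ j)⁻¹ by positivity)] with v hv
        rw [mem_ball_iff_norm] at hv
        exact hv.le
      filter_upwards [hnear] with v hv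
      have hu1 : ∀ i, |u i| ≤ ((R + 1 : ℕ) : ℝ) := fun i => by
        push_cast
        linarith [hR i]
      have hv1 : ∀ i, |v i| ≤ ((R + 1 : ℕ) : ℝ) := fun i => by
        have h2 : (1 : ℝ) ≤ 2 ^ j := one_le_pow₀ (by norm_num)
        have h3 := (norm_le_pi_norm (v - u) i).trans (hv.trans (inv_le_one_of_one_le₀ h2))
        have h4 := abs_add_le (u i) (v i - u i)
        rw [add_sub_cancel] at h4
        rw [Real.norm_eq_abs, Pi.sub_apply] at h3
        push_cast
        linarith [hR i]
      have hadj : ‖V (roundDown j v) ω - V (roundDown j u) ω‖ₑ < ε / 3 := by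
        refine ((enorm_roundDown_sub_le V hp0 hu1 hv ω).trans ?_).trans_lt hj
        have := ENNReal.le_tsum (f := fun i => gridOsc V p (R + 1) (i + j) ω ^ (1 / p)) 0
        simpa using this
      have e1 : lim ω v - lim ω u = (lim ω v - V (roundDown j v) ω)
          + (V (roundDown j v) ω - V (roundDown j u) ω) + (V (roundDown j u) ω - lim ω u) := by abel
      rw [edist_eq_enorm_sub, e1]
      refine ((enorm_add_le _ _).trans (add_le_add (enorm_add_le _ _) le_rfl)).trans_lt ?_
      rw [enorm_sub_rev (V (roundDown j u) ω)]
      calc _ < ε / 3 + ε / 3 + ε / 3 := by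
            refine ENNReal.add_lt_add (ENNReal.add_lt_add ?_ hadj) ?_
            · exact (hlimle ω hg _ v hv1 j).trans_lt hj
            · exact (hlimle ω hg _ u hu1 j).trans_lt hj
        _ = ε := ENNReal.add_thirds ε
    · simp only [if_neg hg]
      exact continuous_const

/-- The maximal inequality which comes with Kolmogorov's criterion, for a process started from
zero. -/
theorem exists_bound_of_kolmogorov {p : ℝ} (hp : 1 ≤ p) : ∃ C : ℝ≥0∞, C < ⊤ ∧
    ∀ (K : ℝ≥0∞) (Y : ℝ → Ω → E), (∀ t ∈ Icc (0 : ℝ) 1, AEStronglyMeasurable (Y t) P) →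
      (∀ s ∈ Icc (0 : ℝ) 1, ∀ t ∈ Icc (0 : ℝ) 1,
        ∫⁻ ω, ‖Y s ω - Y t ω‖ₑ ^ p ∂P ≤ K * ENNReal.ofReal (|s - t| ^ 2)) →
      (∀ᵐ ω ∂P, ContinuousOn (fun t => Y t ω) (Icc 0 1)) → (∀ᵐ ω ∂P, Y 0 ω = 0) →
      ∃ S : Ω → ℝ≥0∞, AEMeasurable S P ∧ (∀ᵐ ω ∂P, ∀ t ∈ Icc (0 : ℝ) 1, ‖Y t ω‖ₑ ≤ S ω) ∧
        (∫⁻ ω, S ω ^ p ∂P) ^ (1 / p) ≤ C * K ^ (1 / p) := by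
  have hp0 : 0 < p := by linarith
  refine ⟨1 + chainConst 1 1 p, ENNReal.add_lt_top.2 ⟨by simp, chainConst_lt_top 1 1 hp⟩, ?_⟩
  intro K Y hY hK hcont h0
  -- Projection onto `[0, 1]` is a contraction, so it extends the process to the line without loss
  -- in the increment bound; the index set `Unit` gives dimension one.
  set cl : ℝ → ℝ := fun t => max 0 (min t 1) with hcl
  have hcl01 : ∀ t, cl t ∈ Icc (0 : ℝ) 1 := fun t =>
    ⟨le_max_left _ _, max_le zero_le_one (min_le_right _ _)⟩
  have hclid : ∀ t ∈ Icc (0 : ℝ) 1, cl t = t := fun t ht => by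
    rw [hcl]
    simp only
    rw [min_eq_left ht.2, max_eq_right ht.1]
  have hclip : ∀ s t, |cl s - cl t| ≤ |s - t| := fun s t =>
    (abs_max_sub_max_le_max _ _ _ _).trans (by
      rw [sub_self, abs_zero]
      refine max_le (abs_nonneg _) ((abs_min_sub_min_le_max _ _ _ _).trans ?_)
      simp)
  set V : (Unit → ℝ) → Ω → E := fun u => Y (cl (u ())) with hVdef
  have hVm : ∀ u, AEStronglyMeasurable (V u) P := fun u => hY _ (hcl01 _)
  have hKol : KolmogorovOn P V p K (1 + 1) := by
    intro u v _ _ _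
    refine (hK _ (hcl01 _) _ (hcl01 _)).trans ?_
    gcongr
    calc |cl (u ()) - cl (v ())| ^ 2 ≤ ‖u - v‖ ^ 2 := by
          gcongr
          exact (hclip _ _).trans (norm_le_pi_norm (u - v) ())
      _ = _ := by simp
  have hbound := lintegral_gridSup_le hVm hp hKol
  rw [Fintype.card_unit] at hbound
  -- On the coarsest grid every `t < 1` rounds down to `0`, where the process vanishes, and only `t
  -- = 1` rounds to `1`. Hence `‖Y 1‖` is the only starting value to add to the chain of
  -- oscillations.
  refine ⟨fun ω => ‖Y 1 ω‖ₑ + gridSup V p 1 ω, ?_, ?_, ?_⟩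
  · exact (hY 1 (by simp)).enorm.add (aemeasurable_gridSup hVm p 1)
  · filter_upwards [hcont, h0] with ω hω h0ω t ht
    set u : Unit → ℝ := fun _ => t with hu
    have hu1 : ∀ i, |u i| ≤ ((1 : ℕ) : ℝ) := fun i => by
      rw [abs_of_nonneg ht.1]
      simpa using ht.2
    have hr0 : ‖V (roundDown 0 u) ω‖ₑ ≤ ‖Y 1 ω‖ₑ := by
      have hfl : roundDown 0 u () = ⌊t⌋ := by simp [roundDown, gridPoint, gridFloor, hu]
      have hV0 : V (roundDown 0 u) ω = Y (cl ⌊t⌋) ω := by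
        simp only [hVdef]
        rw [hfl]
      rw [hV0]
      rcases ht.2.eq_or_lt with h1 | h1
      · rw [h1, Int.floor_one, Int.cast_one, hclid 1 (by simp)]
      · have : ⌊t⌋ = 0 := Int.floor_eq_zero_iff.2 ⟨ht.1, h1⟩
        rw [this, Int.cast_zero, hclid 0 (by simp), h0ω]
        simp
    have hclc : Continuous cl := by
      rw [hcl]
      fun_prop
    have hlim : Tendsto (fun j => V (roundDown j u) ω) atTop (𝓝 (Y t ω)) := by
      have h1 : Continuous fun s => Y (cl s) ω := by
        rw [← continuousOn_univ]
        exact hω.comp hclc.continuousOn fun s _ => hcl01 s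
      have h2 : Tendsto (fun j => roundDown j u ()) atTop (𝓝 t) :=
        ((continuous_apply ()).tendsto u).comp (tendsto_roundDown u)
      have h3 := (h1.tendsto t).comp h2
      rwa [hclid t ht] at h3
    refine le_of_tendsto hlim.enorm (Eventually.of_forall fun j => ?_)
    have h4 := edist_roundDown_le_tsum V hp0 hu1 ω (Nat.zero_le j)
    have e1 : V (roundDown j u) ω = V (roundDown 0 u) ω
        + (V (roundDown j u) ω - V (roundDown 0 u) ω) := by abel
    rw [e1]
    exact (enorm_add_le _ _).trans (add_le_add hr0 h4)
  · refine (ENNReal.lintegral_Lp_add_le (hY 1 (by simp)).enorm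
      (aemeasurable_gridSup hVm p 1) hp).trans ?_
    rw [add_mul, one_mul]
    refine add_le_add (ENNReal.rpow_le_rpow ?_ (by positivity)) hbound
    calc ∫⁻ ω, ‖Y 1 ω‖ₑ ^ p ∂P = ∫⁻ ω, ‖Y 1 ω - Y 0 ω‖ₑ ^ p ∂P := by
          refine lintegral_congr_ae ?_
          filter_upwards [h0] with ω hω
          rw [hω, sub_zero]
      _ ≤ K * ENNReal.ofReal (|1 - 0| ^ 2) := hK 1 (by simp) 0 (by simp)
      _ = K := by simp

end Kolmogorov

/-! ### Integrals with respect to a signed measure -/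

/-- By the Hahn decomposition the two Jordan parts live on disjoint sets, and `σ` is the density of
the signed measure with respect to its total variation. This replaces signed integrals by ordinary
ones with a unimodular factor. -/
theorem exists_sign_integral {X : Type*} [MeasurableSpace X] (μ : SignedMeasure X) :
    ∃ σ : X → ℝ, Measurable σ ∧ (∀ x, |σ x| = 1) ∧
      ∀ g : X → ℝ, ∫ᵛ x, g x ∂<•μ = ∫ x, σ x * g x ∂μ.totalVariation := by
  classical
  obtain ⟨S, hS, hpos, hneg⟩ := μ.toJordanDecomposition.mutuallySingular
  set μp := μ.toJordanDecomposition.posPart with hμp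
  set μn := μ.toJordanDecomposition.negPart with hμn
  have hσm : Measurable (S.piecewise (fun _ => (-1 : ℝ)) fun _ => 1) :=
    Measurable.piecewise hS measurable_const measurable_const
  refine ⟨S.piecewise (fun _ => -1) fun _ => 1, hσm, fun x => ?_, fun g => ?_⟩
  · by_cases hx : x ∈ S <;> simp [hx]
  have hp : ∀ᵐ x ∂μp, x ∉ S := measure_eq_zero_iff_ae_notMem.1 hpos
  have hn : ∀ᵐ x ∂μn, x ∈ S := by
    have := measure_eq_zero_iff_ae_notMem.1 hneg
    filter_upwards [this] with x hx
    simpa using hx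
  by_cases hg : Integrable g μ.totalVariation
  · have hgp : Integrable g μp := hg.mono_measure (Measure.le_add_right le_rfl)
    have hgn : Integrable g μn := hg.mono_measure (Measure.le_add_left le_rfl)
    have e1 : ∫ᵛ x, g x ∂<•μ = ∫ x, g x ∂μp - ∫ x, g x ∂μn := by
      conv_lhs => rw [← μ.toSignedMeasure_toJordanDecomposition]
      rw [JordanDecomposition.toSignedMeasure, VectorMeasure.integral_sub_vectorMeasure,
        VectorMeasure.integral_toSignedMeasure, VectorMeasure.integral_toSignedMeasure]
      · simpa [VectorMeasure.Integrable] using hgp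
      · simpa [VectorMeasure.Integrable] using hgn
    have h1 : (fun x => S.piecewise (fun _ => (-1 : ℝ)) (fun _ => 1) x * g x) =ᵐ[μp] g := by
      filter_upwards [hp] with x hx
      simp [hx]
    have h2 : (fun x => S.piecewise (fun _ => (-1 : ℝ)) (fun _ => 1) x * g x)
        =ᵐ[μn] fun x => -g x := by
      filter_upwards [hn] with x hx
      simp [hx]
    rw [e1, SignedMeasure.totalVariation, integral_add_measure (hgp.congr h1.symm)
      (hgn.neg.congr h2.symm), integral_congr_ae h1, integral_congr_ae h2, integral_neg,
      sub_eq_add_neg]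
  -- For a non-integrable `g` both integrals have the default value `0`; since `|σ| = 1`,
  -- integrability of `σ g` and of `g` agree.
  · rw [VectorMeasure.integral_undef, integral_undef]
    · intro h
      refine hg ((integrable_norm_iff ?_).1 (h.norm.congr (Eventually.of_forall fun x => ?_)))
      · have := h.aestronglyMeasurable
        refine (hσm.aestronglyMeasurable.mul this).congr (Eventually.of_forall fun x => ?_)
        by_cases hx : x ∈ S <;> simp [hx]
      · by_cases hx : x ∈ S <;> simp [hx]
    · rwa [VectorMeasure.Integrable, ← SignedMeasure.totalVariation_eq_variation]

/-! ### Joint measurability of processes with continuous paths -/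

/-- Outside one measurable null set the paths are continuous and agree with measurable
representatives on a countable dense set. Cutting to zero on that null set makes each variable a
pointwise limit of measurable ones. -/
theorem exists_stronglyMeasurable_continuous_version {Ω ι E : Type*} [MeasurableSpace Ω]
    {P : Measure Ω} [TopologicalSpace ι] [TopologicalSpace.MetrizableSpace ι]
    [SecondCountableTopology ι]
    [NormedAddCommGroup E] {V : ι → Ω → E}
    (hV : ∀ u, AEStronglyMeasurable (V u) P) (hc : ∀ᵐ ω ∂P, Continuous fun u => V u ω) :
    ∃ U : ι → Ω → E, (∀ u, StronglyMeasurable (U u)) ∧ (∀ ω, Continuous fun u => U u ω) ∧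
      ∀ᵐ ω ∂P, ∀ u, U u ω = V u ω := by
  classical
  rcases isEmpty_or_nonempty ι with hι | hι
  · exact ⟨V, fun u => (IsEmpty.false u).elim, fun ω => continuous_of_discreteTopology,
      Eventually.of_forall fun ω u => (IsEmpty.false u).elim⟩
  have hgood : ∀ᵐ ω ∂P, (Continuous fun u => V u ω) ∧
      ∀ n, V (TopologicalSpace.denseSeq ι n) ω = (hV (TopologicalSpace.denseSeq ι n)).mk _ ω := by
    filter_upwards [hc, ae_all_iff.2 fun n => (hV (TopologicalSpace.denseSeq ι n)).ae_eq_mk]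
      with ω h1 h2 using ⟨h1, h2⟩
  obtain ⟨N, hNsub, hNm, hN0⟩ := exists_measurable_superset_of_null hgood
  have hNc : ∀ ω, ω ∉ N → (Continuous fun u => V u ω) ∧
      ∀ n, V (TopologicalSpace.denseSeq ι n) ω = (hV (TopologicalSpace.denseSeq ι n)).mk _ ω := by
    intro ω hω
    by_contra h
    exact hω (hNsub h)
  set U : ι → Ω → E := fun u => Nᶜ.indicator (V u) with hU
  have hUc : ∀ ω, Continuous fun u => U u ω := by
    intro ω
    by_cases hω : ω ∈ N
    · have : (fun u => U u ω) = fun _ => 0 := by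
        funext u
        simp [hU, hω]
      rw [this]
      exact continuous_const
    · have : (fun u => U u ω) = fun u => V u ω := by
        funext u
        simp [hU, hω]
      rw [this]
      exact (hNc ω hω).1
  refine ⟨U, fun u => ?_, hUc, ?_⟩
  · obtain ⟨x, hx, hlim⟩ := mem_closure_iff_seq_limit.1
      (TopologicalSpace.denseRange_denseSeq ι u)
    refine stronglyMeasurable_of_tendsto atTop (f := fun n => U (x n)) (fun n => ?_)
      (tendsto_pi_nhds.2 fun ω => ((hUc ω).tendsto u).comp hlim)
    obtain ⟨m, hm⟩ := hx n
    rw [← hm]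
    have : U (TopologicalSpace.denseSeq ι m)
        = Nᶜ.indicator ((hV (TopologicalSpace.denseSeq ι m)).mk _) := by
      funext ω
      by_cases hω : ω ∈ N
      · simp [hU, hω]
      · simp [hU, hω, (hNc ω hω).2 m]
    rw [this]
    exact (hV _).stronglyMeasurable_mk.indicator hNm.compl
  · filter_upwards [measure_eq_zero_iff_ae_notMem.1 hN0] with ω hω u
    simp [hU, hω]

theorem aestronglyMeasurable_prod_of_continuous {Ω ι E : Type*} [MeasurableSpace Ω]
    {P : Measure Ω} [SFinite P] [TopologicalSpace ι] [TopologicalSpace.MetrizableSpace ι]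
    [SecondCountableTopology ι] [MeasurableSpace ι] [OpensMeasurableSpace ι]
    [NormedAddCommGroup E] {V : ι → Ω → E} (hV : ∀ u, AEStronglyMeasurable (V u) P)
    (hc : ∀ᵐ ω ∂P, Continuous fun u => V u ω) (ρ : Measure ι) [SFinite ρ] :
    AEStronglyMeasurable (fun z : Ω × ι => V z.2 z.1) (P.prod ρ) := by
  obtain ⟨U, hUm, hUc, hUV⟩ := exists_stronglyMeasurable_continuous_version hV hc
  have h := (stronglyMeasurable_uncurry_of_continuous_of_stronglyMeasurable hUc hUm)
  refine ⟨fun z => U z.2 z.1, h.comp_measurable measurable_swap, ?_⟩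
  have := Measure.quasiMeasurePreserving_fst (μ := P) (ν := ρ) |>.ae hUV
  filter_upwards [this] with z hz
  exact (hz z.2).symm

/-! ### The covariance of the Fourier modes -/

section Covariance

variable {Ω : Type*} [MeasurableSpace Ω] {P : Measure Ω} {n : ℕ}
  {W : Fin n → Lp ℝ 2 spaceTime → Ω → ℝ}

/-- The white noise, as a family of random variables. -/
def noiseFamily (W : Fin n → Lp ℝ 2 spaceTime → Ω → ℝ) :
    Fin n × Lp ℝ 2 spaceTime → Ω → ℝ := fun a => W a.1 a.2

/-- The white noise tested against a complex function. -/
def complexNoise (W : Fin n → Lp ℝ 2 spaceTime → Ω → ℝ) (i : Fin n) {φ : ℝ × ℝ → ℂ}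
    (hφ : MemLp φ 2 spaceTime) (ω : Ω) : ℂ :=
  (W i (hφ.re.toLp _) ω : ℂ) + Complex.I * (W i (hφ.im.toLp _) ω : ℂ)

theorem complexNoise_mem_chaosOne (i : Fin n) {φ : ℝ × ℝ → ℂ} (hφ : MemLp φ 2 spaceTime) :
    complexNoise W i hφ ∈ chaosOne (noiseFamily W) :=
  (chaosOne (noiseFamily W)).add_mem (mem_chaosOne (G := noiseFamily W) (i, _))
    ((chaosOne (noiseFamily W)).smul_mem Complex.I (mem_chaosOne (G := noiseFamily W) (i, _)))

theorem IsWhiteNoise.memLp (hW : IsWhiteNoise P W) (i : Fin n) (φ : Lp ℝ 2 spaceTime) :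
    MemLp (W i φ) 2 P :=
  (hW.gaussian.hasGaussianLaw_eval (i, φ)).memLp (by simp)

/-- Linearity of the noise is contained in its covariance: the second moment of `W (-φ) + W φ`
expands to zero. -/
theorem IsWhiteNoise.neg (hW : IsWhiteNoise P W) (i : Fin n) (φ : Lp ℝ 2 spaceTime) :
    W i (-φ) =ᵐ[P] -W i φ := by
  have h1 := hW.memLp i φ
  have h2 := hW.memLp i (-φ)
  have h3 : ∫ ω, (W i (-φ) ω + W i φ ω) ^ 2 ∂P = 0 := by
    have e : ∀ ω, (W i (-φ) ω + W i φ ω) ^ 2 = W i (-φ) ω * W i (-φ) ω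
        + W i (-φ) ω * W i φ ω + W i φ ω * W i (-φ) ω + W i φ ω * W i φ ω := fun ω => by ring
    simp_rw [e]
    have hi : ∀ {φ ψ}, MemLp (W i φ) 2 P → MemLp (W i ψ) 2 P →
        Integrable (fun ω => W i φ ω * W i ψ ω) P := fun ha hb => ha.integrable_mul hb
    rw [integral_add (((hi h2 h2).fun_add (hi h2 h1)).fun_add (hi h1 h2)) (hi h1 h1),
      integral_add ((hi h2 h2).fun_add (hi h2 h1)) (hi h1 h2), integral_add (hi h2 h2) (hi h2 h1)]
    simp [hW.cov, inner_neg_left, inner_neg_right]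
  have h4 := (integral_eq_zero_iff_of_nonneg (fun ω => sq_nonneg _)
    (by simpa using (h2.add h1).integrable_sq)).1 h3
  filter_upwards [h4] with ω hω
  have : W i (-φ) ω + W i φ ω = 0 := by simpa using hω
  simp only [Pi.neg_apply]
  linarith

theorem IsWhiteNoise.integral_mul_toLp (hW : IsWhiteNoise P W) (i j : Fin n) {φ ψ : ℝ × ℝ → ℝ}
    (hφ : MemLp φ 2 spaceTime) (hψ : MemLp ψ 2 spaceTime) :
    ∫ ω, W i (hφ.toLp _) ω * W j (hψ.toLp _) ω ∂P
      = if i = j then ∫ z, φ z * ψ z ∂spaceTime else 0 := by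
  rw [hW.cov]
  congr 1
  rw [L2.inner_def]
  refine integral_congr_ae ?_
  filter_upwards [hφ.coeFn_toLp, hψ.coeFn_toLp] with z h1 h2
  rw [h1, h2]
  simp [mul_comm]

theorem integral_re_add_im_mul_conj {Y : Type*} [MeasurableSpace Y] (ρ : Measure Y)
    {a b c d : Y → ℝ} (ha : MemLp a 2 ρ) (hb : MemLp b 2 ρ) (hc : MemLp c 2 ρ)
    (hd : MemLp d 2 ρ) :
    ∫ y, ((a y : ℂ) + Complex.I * (b y : ℂ)) *
        (starRingEnd ℂ) ((c y : ℂ) + Complex.I * (d y : ℂ)) ∂ρ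
      = ((∫ y, a y * c y ∂ρ + ∫ y, b y * d y ∂ρ : ℝ) : ℂ)
        + Complex.I * ((∫ y, b y * c y ∂ρ - ∫ y, a y * d y ∂ρ : ℝ) : ℂ) := by
  have e : ∀ y, ((a y : ℂ) + Complex.I * (b y : ℂ)) *
      (starRingEnd ℂ) ((c y : ℂ) + Complex.I * (d y : ℂ))
      = ((a y * c y + b y * d y : ℝ) : ℂ) + Complex.I * ((b y * c y - a y * d y : ℝ) : ℂ) := by
    intro y
    simp only [map_add, map_mul, Complex.conj_ofReal, Complex.conj_I]
    push_cast
    linear_combination (-(b y : ℂ) * d y) * Complex.I_sq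
  simp_rw [e]
  have i1 := (ha.integrable_mul hc).add (hb.integrable_mul hd)
  have i2 := (hb.integrable_mul hc).sub (ha.integrable_mul hd)
  rw [integral_add i1.ofReal (i2.ofReal.const_mul _), integral_const_mul,
    integral_complex_ofReal, integral_complex_ofReal]
  congr 2
  · exact_mod_cast integral_add (ha.integrable_mul hc) (hb.integrable_mul hd)
  · exact_mod_cast integral_sub (hb.integrable_mul hc) (ha.integrable_mul hd)

/-- Expanding into real and imaginary parts gives the same algebraic expression for the noise and
for its kernels, so the real isometry implies the sesquilinear one. -/
theorem IsWhiteNoise.integral_complexNoise_mul_conj (hW : IsWhiteNoise P W) (i j : Fin n)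
    {φ ψ : ℝ × ℝ → ℂ} (hφ : MemLp φ 2 spaceTime) (hψ : MemLp ψ 2 spaceTime) :
    ∫ ω, complexNoise W i hφ ω * (starRingEnd ℂ) (complexNoise W j hψ ω) ∂P
      = if i = j then ∫ z, φ z * (starRingEnd ℂ) (ψ z) ∂spaceTime else 0 := by
  have hsplit : ∀ φ : ℝ × ℝ → ℂ, ∀ z, φ z = ((RCLike.re (φ z) : ℝ) : ℂ)
      + Complex.I * ((RCLike.im (φ z) : ℝ) : ℂ) := fun φ z => by
    rw [mul_comm Complex.I]
    exact (Complex.re_add_im _).symm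
  unfold complexNoise
  rw [integral_re_add_im_mul_conj P (hW.memLp _ _) (hW.memLp _ _) (hW.memLp _ _) (hW.memLp _ _)]
  simp_rw [hW.integral_mul_toLp]
  split_ifs with hij
  · have : ∫ z, φ z * (starRingEnd ℂ) (ψ z) ∂spaceTime
        = ∫ z, (((RCLike.re (φ z) : ℝ) : ℂ) + Complex.I * ((RCLike.im (φ z) : ℝ) : ℂ)) *
          (starRingEnd ℂ) (((RCLike.re (ψ z) : ℝ) : ℂ)
            + Complex.I * ((RCLike.im (ψ z) : ℝ) : ℂ)) ∂spaceTime :=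
      integral_congr_ae (Eventually.of_forall fun z => by
        simp only
        rw [← hsplit φ z, ← hsplit ψ z])
    rw [this, integral_re_add_im_mul_conj spaceTime hφ.re hφ.im hψ.re hψ.im]
  · simp

end Covariance

/-! ### Families of Fourier modes -/

/-- The properties of the Fourier modes of `X_ε` which are used in the sequel: they belong to the
first chaos of `G`, are orthogonal, and satisfy the bounds on the covariance which hold uniformly
in `ε`. -/
structure IsModeFamily {Ω : Type*} [MeasurableSpace Ω] (P : Measure Ω) {κ : Type*}
    (G : κ → Ω → ℝ) {n : ℕ} (Z : ℤ → ℝ → Fin n → Ω → ℂ) (ρ : ℤ → ℝ → ℝ) (C : ℝ) : Prop where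
  gaussian : IsGaussianProcess G P
  centred : ∀ a, ∫ ω, G a ω ∂P = 0
  mem : ∀ k t i, Z k t i ∈ chaosOne G
  orthogonal : ∀ k l t s i j, 0 ≤ t → 0 ≤ s → k ≠ l →
    ∫ ω, Z k t i ω * (starRingEnd ℂ) (Z l s j ω) ∂P = 0
  uncorrelated : ∀ k l t s i j, 0 ≤ t → 0 ≤ s → i ≠ j →
    ∫ ω, Z k t i ω * (starRingEnd ℂ) (Z l s j ω) ∂P = 0
  conj_eq : ∀ k t i, ∀ᵐ ω ∂P, (starRingEnd ℂ) (Z k t i ω) = Z (-k) t i ω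
  sqMoment_eq : ∀ k t i, k ≠ 0 → 0 ≤ t → sqMoment P (Z k t i) = ρ k t
  symm : ∀ k t, ρ (-k) t = ρ k t
  zero : ∀ k, k ≠ 0 → ρ k 0 = 0
  continuousOn : ∀ k, ContinuousOn (ρ k) (Ici 0)
  nonneg : ∀ k t, 0 ≤ t → 0 ≤ ρ k t
  le : ∀ k t, k ≠ 0 → 0 ≤ t → ρ k t ≤ C / (k : ℝ) ^ 2
  sqMoment_sub_le : ∀ k t s i, k ≠ 0 → 0 ≤ t → 0 ≤ s →
    sqMoment P (fun ω => Z k t i ω - Z k s i ω)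
      ≤ C * |(k : ℝ)| ^ (-(7 / 4) : ℝ) * |t - s| ^ (1 / 8 : ℝ)

/-! ### The modes of the stochastic heat equation -/

section Modes

variable {f : ℝ → ℝ≥0∞} {h : ℝ → ℝ} {ε : ℝ}

/-- The covariance of the `k`-th Fourier mode at the times `t` and `s`. -/
def modeCov (f : ℝ → ℝ≥0∞) (h : ℝ → ℝ) (ε : ℝ) (k : ℤ) (t s : ℝ) : ℝ :=
  h (ε * k) ^ 2 / (2 * Real.pi) *
    ∫ u in Icc 0 (min t s), heatSymbol f ε k (t - u) * heatSymbol f ε k (s - u)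

theorem integral_exp_int_mul (m : ℤ) :
    ∫ y in Icc (-Real.pi) Real.pi, Complex.exp (Complex.I * m * y)
      = if m = 0 then 2 * Real.pi else 0 := by
  rw [integral_Icc_eq_integral_Ioc, ← intervalIntegral.integral_of_le (by linarith [Real.pi_pos])]
  split_ifs with hm
  · simp only [hm, Int.cast_zero, mul_zero, zero_mul, Complex.exp_zero,
      intervalIntegral.integral_const, sub_neg_eq_add]
    rw [Complex.real_smul, mul_one]
    push_cast
    ring
  · have hc : Complex.I * (m : ℂ) ≠ 0 := mul_ne_zero Complex.I_ne_zero (by exact_mod_cast hm)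
    rw [integral_exp_mul_complex hc]
    have : Complex.exp (Complex.I * m * Real.pi) = Complex.exp (Complex.I * m * (-Real.pi : ℝ)) := by
      rw [Complex.exp_eq_exp_iff_exists_int]
      exact ⟨m, by push_cast; ring⟩
    rw [this, sub_self, zero_div, Complex.ofReal_zero]

/-- The kernels are products of a function of time and a function of space. The space integral is
the orthogonality of the exponentials, and the time integral runs over the common interval `[0, min
t s]`. -/
theorem integral_modeKernel_mul_conj (k l : ℤ) (t s : ℝ) :
    ∫ z, modeKernel f h ε k t z * (starRingEnd ℂ) (modeKernel f h ε l s z) ∂spaceTime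
      = if k = l then (modeCov f h ε k t s : ℂ) else 0 := by
  set A : ℝ → ℂ := fun u => (((Icc (0 : ℝ) (min t s)).indicator (fun u =>
    (h (ε * k) * heatSymbol f ε k (t - u) / (2 * Real.pi)) *
      (h (ε * l) * heatSymbol f ε l (s - u) / (2 * Real.pi))) u : ℝ) : ℂ) with hA
  set B : ℝ → ℂ := fun y => Complex.exp (Complex.I * (l - k : ℤ) * y) with hB
  have e : ∀ z, modeKernel f h ε k t z * (starRingEnd ℂ) (modeKernel f h ε l s z)
      = A z.1 * B z.2 := by
    intro z
    have hexp : Complex.exp (-(Complex.I * k * z.2)) *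
        (starRingEnd ℂ) (Complex.exp (-(Complex.I * l * z.2))) = B z.2 := by
      rw [← Complex.exp_conj, ← Complex.exp_add]
      congr 1
      simp only [map_neg, map_mul, Complex.conj_I, Complex.conj_ofReal, map_intCast]
      push_cast
      ring
    rw [← hexp]
    unfold modeKernel
    by_cases h1 : z.1 ∈ Icc 0 t
    · by_cases h2 : z.1 ∈ Icc 0 s
      · have h3 : z.1 ∈ Icc 0 (min t s) := ⟨h1.1, le_min h1.2 h2.2⟩
        rw [indicator_of_mem (by exact ⟨h1, mem_univ _⟩), indicator_of_mem (by exact ⟨h2, mem_univ _⟩)]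
        simp only [hA]
        rw [indicator_of_mem h3, map_mul, Complex.conj_ofReal]
        push_cast
        ring
      · have h3 : z.1 ∉ Icc 0 (min t s) := fun h3 => h2 ⟨h3.1, h3.2.trans (min_le_right _ _)⟩
        rw [indicator_of_notMem (s := Icc (0 : ℝ) s ×ˢ univ) (fun hz => h2 hz.1)]
        simp only [hA]
        rw [indicator_of_notMem h3]
        simp
    · have h3 : z.1 ∉ Icc 0 (min t s) := fun h3 => h1 ⟨h3.1, h3.2.trans (min_le_left _ _)⟩
      rw [indicator_of_notMem (s := Icc (0 : ℝ) t ×ˢ univ) (fun hz => h1 hz.1)]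
      simp only [hA]
      rw [indicator_of_notMem h3]
      simp
  simp_rw [e]
  rw [spaceTime, integral_prod_mul, hB, integral_exp_int_mul]
  by_cases hkl : k = l
  · subst hkl
    rw [sub_self, if_pos rfl, if_pos rfl, hA, integral_complex_ofReal,
      integral_indicator measurableSet_Icc, Measure.restrict_restrict measurableSet_Icc,
      inter_eq_left.2 (Icc_subset_Ici_self), modeCov]
    rw [← integral_const_mul]
    norm_cast
    rw [← integral_mul_const]
    refine integral_congr_ae (Eventually.of_forall fun u => ?_)
    have := Real.pi_pos
    simp only
    field_simp
  · rw [if_neg hkl, if_neg (by omega), Complex.ofReal_zero, mul_zero]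

theorem modeAmplitude_sq {k : ℤ} (hk : k ≠ 0) :
    modeAmplitude f h ε k ^ 2 = noiseRatio f h (ε * k) / (4 * Real.pi * (k : ℝ) ^ 2) := by
  rw [modeAmplitude, if_neg hk, noiseRatio, div_pow, mul_pow, mul_pow,
    Real.sq_sqrt ENNReal.toReal_nonneg, Real.sq_sqrt (by positivity), sq_abs]
  ring

theorem modeCov_comm (k : ℤ) (t s : ℝ) : modeCov f h ε k t s = modeCov f h ε k s t := by
  rw [modeCov, modeCov, min_comm]
  simp_rw [mul_comm (heatSymbol f ε k (t - _))]

/-- The product of the two decay factors is a single exponential in `u` with an explicit primitive.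
Where `f = ∞` both sides are zero by the conventions for `e^{-∞}` and `1 / ∞`. -/
theorem modeCov_eq {k : ℤ} (hk : k ≠ 0) (hf : 0 < f (ε * k)) {t s : ℝ} (hs : 0 ≤ s) (hst : s ≤ t) :
    modeCov f h ε k t s
      = modeAmplitude f h ε k ^ 2 * (heatSymbol f ε k (t - s) - heatSymbol f ε k (t + s)) := by
  rw [modeAmplitude_sq hk, modeCov, noiseRatio]
  by_cases htop : f (ε * k) = ⊤
  · simp [heatSymbol, htop]
  · have hf' : 0 < (f (ε * k)).toReal := ENNReal.toReal_pos hf.ne' htop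
    have hk' : (k : ℝ) ≠ 0 := by exact_mod_cast hk
    have hpi := Real.pi_pos
    rw [min_eq_right hst, integral_Icc_eq_integral_Ioc, ← intervalIntegral.integral_of_le hs]
    simp only [heatSymbol, if_neg htop, ENNReal.toReal_inv]
    set L := (k : ℝ) ^ 2 * (f (ε * k)).toReal with hL
    have hL0 : 0 < L := by positivity
    have hint : ∫ u in (0 : ℝ)..s, Real.exp (-(L * (t - u))) * Real.exp (-(L * (s - u)))
        = (Real.exp (-(L * (t - s))) - Real.exp (-(L * (t + s)))) / (2 * L) := by
      have hd : ∀ u ∈ uIcc 0 s, HasDerivAt (fun u => Real.exp (-(L * (t + s)) + 2 * L * u) / (2 * L))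
          (Real.exp (-(L * (t - u))) * Real.exp (-(L * (s - u)))) u := by
        intro u _
        have h1 : HasDerivAt (fun u : ℝ => -(L * (t + s)) + 2 * L * u) (2 * L) u := by
          simpa using ((hasDerivAt_id u).const_mul (2 * L)).const_add (-(L * (t + s)))
        have h2 := h1.exp.div_const (2 * L)
        refine h2.congr_deriv ?_
        rw [← Real.exp_add]
        field_simp
        congr 1
        ring
      rw [intervalIntegral.integral_eq_sub_of_hasDerivAt hd (by
        apply Continuous.intervalIntegrable
        fun_prop), ← sub_div]
      congr 3 <;> ring
    rw [hint, hL]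
    field_simp
    ring

theorem modeCov_self {k : ℤ} (hk : k ≠ 0) (hf : 0 < f (ε * k)) {t : ℝ} (ht : 0 ≤ t) :
    modeCov f h ε k t t = modeAmplitude f h ε k ^ 2 * modeVariance f ε k t := by
  rw [modeCov_eq hk hf ht le_rfl, modeVariance, if_neg hk, sub_self, ← two_mul]
  by_cases htop : f (ε * k) = ⊤
  · rw [modeAmplitude_sq hk, noiseRatio, htop]
    simp
  · simp [heatSymbol, htop]

theorem heatSymbol_nonneg (k : ℤ) (s : ℝ) : 0 ≤ heatSymbol f ε k s := by
  unfold heatSymbol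
  split_ifs
  · exact le_rfl
  · positivity

theorem heatSymbol_le_one (k : ℤ) {s : ℝ} (hs : 0 ≤ s) : heatSymbol f ε k s ≤ 1 := by
  unfold heatSymbol
  split_ifs
  · exact zero_le_one
  · rw [Real.exp_le_one_iff]
    have := ENNReal.toReal_nonneg (a := f (ε * k))
    have : 0 ≤ (k : ℝ) ^ 2 * (f (ε * k)).toReal * s := by positivity
    linarith

theorem noiseRatio_nonneg (x : ℝ) : 0 ≤ noiseRatio f h x :=
  mul_nonneg (sq_nonneg _) ENNReal.toReal_nonneg

theorem modeVariance_nonneg (k : ℤ) {t : ℝ} (ht : 0 ≤ t) : 0 ≤ modeVariance f ε k t := by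
  unfold modeVariance
  split_ifs
  · exact ht
  · exact sub_nonneg.2 (heatSymbol_le_one k (by linarith))

theorem modeVariance_le_one {k : ℤ} (hk : k ≠ 0) (t : ℝ) : modeVariance f ε k t ≤ 1 := by
  rw [modeVariance, if_neg hk]
  linarith [heatSymbol_nonneg (f := f) (ε := ε) k (2 * t)]

theorem one_sub_exp_neg_le_rpow {x : ℝ} (hx : 0 ≤ x) {θ : ℝ} (h0 : 0 ≤ θ) (h1 : θ ≤ 1) :
    1 - Real.exp (-x) ≤ x ^ θ := by
  rcases le_or_gt x 1 with h | h
  · have := Real.add_one_le_exp (-x)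
    have h2 : x ^ (1 : ℝ) ≤ x ^ θ := by
      rcases hx.eq_or_lt with rfl | hx0
      · rw [Real.zero_rpow one_ne_zero]
        exact Real.rpow_nonneg le_rfl _
      · exact Real.rpow_le_rpow_of_exponent_ge hx0 h h1
    rw [Real.rpow_one] at h2
    linarith
  · have := Real.one_le_rpow h.le h0
    linarith [Real.exp_pos (-x)]

/-- The constants in the bounds of `f` and `h`. -/
theorem CutoffAssumptions.exists_bounds {μ : SignedMeasure ℝ} (hyp : CutoffAssumptions f h μ) :
    ∃ c > 0, ∃ M > 0, (∀ x ≠ 0, ENNReal.ofReal c ≤ f x) ∧ ∀ x, |h x| ≤ M := by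
  obtain ⟨c, hc, hcf, -⟩ := hyp.f_lower_bv
  obtain ⟨M, hM⟩ := hyp.h_bdd
  refine ⟨2 * c, by linarith [hc.1], max M 1, by positivity, fun x hx => ?_, fun x =>
    (hM x).trans (le_max_left _ _)⟩
  rcases hx.lt_or_gt with h | h
  · rw [← hyp.f_even]
    exact hcf _ (by linarith)
  · exact hcf _ h

theorem noiseRatio_le {c M : ℝ} (hc : 0 < c) {x : ℝ} (hf : ENNReal.ofReal c ≤ f x)
    (hM : |h x| ≤ M) : noiseRatio f h x ≤ M ^ 2 / c := by
  have h1 : ((f x)⁻¹).toReal ≤ c⁻¹ := by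
    rw [← ENNReal.toReal_ofReal (show 0 ≤ c⁻¹ by positivity), ENNReal.ofReal_inv_of_pos hc]
    refine ENNReal.toReal_mono ?_ (ENNReal.inv_le_inv.2 hf)
    exact ENNReal.inv_ne_top.2 (by simpa using hc)
  have h2 : h x ^ 2 ≤ M ^ 2 := by
    rw [← sq_abs]
    gcongr
  rw [noiseRatio, div_eq_mul_inv]
  gcongr

/-- With `L = k² f(ε k)`, the variance of the increment is the squared amplitude times `2 (1 -
e^{-L(t-s)})` minus a square. Since the squared amplitude is of order `1 / L`, the inequality `1 -
e^{-x} ≤ x^{1/8}` leaves `L^{-7/8}`, and the lower bound on `f` turns this into `|k|^{-7/4}`. A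
small Hölder exponent in time thus costs only a factor `|k|^{1/4}` against the stationary decay
`k⁻²`. -/
theorem modeCov_incr_le {c M : ℝ} (hc : 0 < c) {k : ℤ} (hk : k ≠ 0)
    (hf : ENNReal.ofReal c ≤ f (ε * k)) (hM : |h (ε * k)| ≤ M) {t s : ℝ} (hs : 0 ≤ s)
    (hst : s ≤ t) :
    modeCov f h ε k t t + modeCov f h ε k s s - 2 * modeCov f h ε k t s
      ≤ M ^ 2 / (2 * Real.pi) * c ^ (-(7 / 8) : ℝ) * |(k : ℝ)| ^ (-(7 / 4) : ℝ)
        * |t - s| ^ (1 / 8 : ℝ) := by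
  have hf0 : 0 < f (ε * k) := (ENNReal.ofReal_pos.2 hc).trans_le hf
  have hM0 : 0 ≤ M := (abs_nonneg _).trans hM
  have hpi := Real.pi_pos
  rw [modeCov_self hk hf0 (hs.trans hst), modeCov_self hk hf0 hs, modeCov_eq hk hf0 hs hst,
    modeVariance, modeVariance, if_neg hk, if_neg hk]
  by_cases htop : f (ε * k) = ⊤
  · rw [modeAmplitude_sq hk, noiseRatio, htop]
    simp only [ENNReal.inv_top, ENNReal.toReal_zero, mul_zero, zero_div, zero_mul, add_zero,
      sub_zero]
    positivity
  have hk' : 0 < |(k : ℝ)| := abs_pos.2 (by exact_mod_cast hk)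
  have hcf : c ≤ (f (ε * k)).toReal := by
    rw [← ENNReal.toReal_ofReal hc.le]
    exact ENNReal.toReal_mono htop hf
  have hf' : 0 < (f (ε * k)).toReal := hc.trans_le hcf
  simp only [heatSymbol, if_neg htop]
  set L := (k : ℝ) ^ 2 * (f (ε * k)).toReal with hL
  have hL0 : 0 < L := by
    rw [hL, ← sq_abs]
    positivity
  have hamp : modeAmplitude f h ε k ^ 2 = h (ε * k) ^ 2 / (4 * Real.pi * L) := by
    rw [modeAmplitude_sq hk, noiseRatio, ENNReal.toReal_inv, hL]
    field_simp
  have hsq : Real.exp (-(L * (2 * t))) + Real.exp (-(L * (2 * s))) - 2 * Real.exp (-(L * (t + s)))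
      = (Real.exp (-(L * t)) - Real.exp (-(L * s))) ^ 2 := by
    have e1 : Real.exp (-(L * (2 * t))) = Real.exp (-(L * t)) ^ 2 := by
      rw [← Real.exp_nat_mul]
      congr 1
      push_cast
      ring
    have e2 : Real.exp (-(L * (2 * s))) = Real.exp (-(L * s)) ^ 2 := by
      rw [← Real.exp_nat_mul]
      congr 1
      push_cast
      ring
    have e3 : Real.exp (-(L * (t + s))) = Real.exp (-(L * t)) * Real.exp (-(L * s)) := by
      rw [← Real.exp_add]
      congr 1
      ring
    rw [e1, e2, e3]
    ring
  have hτ : 0 ≤ t - s := sub_nonneg.2 hst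
  have h1 : 1 - Real.exp (-(L * (t - s))) ≤ (L * (t - s)) ^ (1 / 8 : ℝ) :=
    one_sub_exp_neg_le_rpow (by positivity) (by norm_num) (by norm_num)
  have hpow : (L * (t - s)) ^ (1 / 8 : ℝ) / L = L ^ (-(7 / 8) : ℝ) * (t - s) ^ (1 / 8 : ℝ) := by
    rw [Real.mul_rpow hL0.le hτ, show (-(7 / 8) : ℝ) = 1 / 8 - 1 by norm_num,
      Real.rpow_sub_one hL0.ne']
    ring
  have hLle : L ^ (-(7 / 8) : ℝ) ≤ c ^ (-(7 / 8) : ℝ) * |(k : ℝ)| ^ (-(7 / 4) : ℝ) := by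
    have e : |(k : ℝ)| ^ (-(7 / 4) : ℝ) = (|(k : ℝ)| ^ 2) ^ (-(7 / 8) : ℝ) := by
      rw [← Real.rpow_natCast, ← Real.rpow_mul hk'.le]
      norm_num
    rw [e, ← Real.mul_rpow hc.le (by positivity)]
    refine Real.rpow_le_rpow_of_nonpos (by positivity) ?_ (by norm_num)
    rw [hL, sq_abs, mul_comm]
    gcongr
  have hh : h (ε * k) ^ 2 ≤ M ^ 2 := by
    rw [← sq_abs]
    gcongr
  calc _ = modeAmplitude f h ε k ^ 2 * (2 * (1 - Real.exp (-(L * (t - s))))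
          - (Real.exp (-(L * t)) - Real.exp (-(L * s))) ^ 2) := by
        rw [← hsq]
        ring
    _ ≤ modeAmplitude f h ε k ^ 2 * (2 * (L * (t - s)) ^ (1 / 8 : ℝ)) := by
        refine mul_le_mul_of_nonneg_left ?_ (sq_nonneg _)
        nlinarith [sq_nonneg (Real.exp (-(L * t)) - Real.exp (-(L * s)))]
    _ = h (ε * k) ^ 2 / (2 * Real.pi) * ((L * (t - s)) ^ (1 / 8 : ℝ) / L) := by
        rw [hamp]
        field_simp
        ring
    _ ≤ M ^ 2 / (2 * Real.pi) * (c ^ (-(7 / 8) : ℝ) * |(k : ℝ)| ^ (-(7 / 4) : ℝ)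
          * (t - s) ^ (1 / 8 : ℝ)) := by
        rw [hpow]
        gcongr
    _ = _ := by
        rw [abs_of_nonneg hτ]
        ring

variable {Ω : Type*} [MeasurableSpace Ω] {P : Measure Ω} {n : ℕ}
  {W : Fin n → Lp ℝ 2 spaceTime → Ω → ℝ} {μ : SignedMeasure ℝ}

theorem modeCoeff_eq (k : ℤ) (t : ℝ) (i : Fin n) :
    modeCoeff W f h ε k t i = complexNoise W i (memLp_modeKernel f h ε k t) := rfl

theorem integral_modeCoeff_mul_conj (hW : IsWhiteNoise P W) (k l : ℤ) (t s : ℝ) (i j : Fin n) :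
    ∫ ω, modeCoeff W f h ε k t i ω * (starRingEnd ℂ) (modeCoeff W f h ε l s j ω) ∂P
      = if i = j then if k = l then (modeCov f h ε k t s : ℂ) else 0 else 0 := by
  rw [modeCoeff_eq, modeCoeff_eq, hW.integral_complexNoise_mul_conj, integral_modeKernel_mul_conj]

theorem modeKernel_neg (hyp : CutoffAssumptions f h μ) (k : ℤ) (t : ℝ) (z : ℝ × ℝ) :
    modeKernel f h ε (-k) t z = (starRingEnd ℂ) (modeKernel f h ε k t z) := by
  have e : ε * ((-k : ℤ) : ℝ) = -(ε * k) := by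
    push_cast
    ring
  unfold modeKernel heatSymbol
  rw [e, hyp.h_even, hyp.f_even]
  by_cases hz : z ∈ Icc (0 : ℝ) t ×ˢ (univ : Set ℝ)
  · rw [indicator_of_mem hz, indicator_of_mem hz, map_mul, Complex.conj_ofReal, ← Complex.exp_conj]
    congr 2
    · push_cast
      ring
    · simp
  · rw [indicator_of_notMem hz, indicator_of_notMem hz, map_zero]

/-- Since `f` and `h` are even, changing the sign of the frequency conjugates the kernel: the real
part is unchanged and the imaginary part changes sign. The identity holds only almost surely because
`W (-φ) = -W φ` does. -/
theorem conj_modeCoeff (hW : IsWhiteNoise P W) (hyp : CutoffAssumptions f h μ) (k : ℤ) (t : ℝ)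
    (i : Fin n) : ∀ᵐ ω ∂P,
      (starRingEnd ℂ) (modeCoeff W f h ε k t i ω) = modeCoeff W f h ε (-k) t i ω := by
  have h1 : (memLp_modeKernel f h ε (-k) t).re.toLp _ = (memLp_modeKernel f h ε k t).re.toLp _ :=
    MemLp.toLp_congr _ _ (Eventually.of_forall fun z => by
      simp only
      rw [modeKernel_neg hyp]
      exact Complex.conj_re _)
  have h2 : (memLp_modeKernel f h ε (-k) t).im.toLp _
      = -(memLp_modeKernel f h ε k t).im.toLp _ := by
    rw [← MemLp.toLp_neg]
    refine MemLp.toLp_congr _ _ (Eventually.of_forall fun z => ?_)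
    simp only [Pi.neg_apply]
    rw [modeKernel_neg hyp]
    exact Complex.conj_im _
  filter_upwards [hW.neg i ((memLp_modeKernel f h ε k t).im.toLp _)] with ω hω
  rw [modeCoeff, modeCoeff, h1, h2, hω]
  simp only [map_add, map_mul, Complex.conj_ofReal, Complex.conj_I, Pi.neg_apply]
  push_cast
  ring

theorem sqMoment_sub_eq {U V : Ω → ℂ} (hU : MemLp U 2 P) (hV : MemLp V 2 P) :
    (sqMoment P (fun ω => U ω - V ω) : ℂ)
      = sqMoment P U + sqMoment P V - ∫ ω, U ω * (starRingEnd ℂ) (V ω) ∂P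
        - ∫ ω, V ω * (starRingEnd ℂ) (U ω) ∂P := by
  have hU' : MemLp (fun ω => (starRingEnd ℂ) (U ω)) 2 P := hU.star
  have hV' : MemLp (fun ω => (starRingEnd ℂ) (V ω)) 2 P := hV.star
  have i1 : Integrable (fun ω => U ω * (starRingEnd ℂ) (U ω)) P := hU.integrable_mul hU'
  have i2 : Integrable (fun ω => V ω * (starRingEnd ℂ) (V ω)) P := hV.integrable_mul hV'
  have i3 : Integrable (fun ω => U ω * (starRingEnd ℂ) (V ω)) P := hU.integrable_mul hV'
  have i4 : Integrable (fun ω => V ω * (starRingEnd ℂ) (U ω)) P := hV.integrable_mul hU'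
  have i5 : Integrable (fun ω => U ω * (starRingEnd ℂ) (U ω) + V ω * (starRingEnd ℂ) (V ω)) P :=
    i1.add i2
  have i6 : Integrable (fun ω => U ω * (starRingEnd ℂ) (U ω) + V ω * (starRingEnd ℂ) (V ω)
      - U ω * (starRingEnd ℂ) (V ω)) P := i5.sub i3
  rw [← integral_mul_conj_self, ← integral_mul_conj_self, ← integral_mul_conj_self,
    ← integral_add i1 i2, ← integral_sub i5 i3, ← integral_sub i6 i4]
  refine integral_congr_ae (Eventually.of_forall fun ω => ?_)
  simp only [map_sub]
  ring

/-- The lower bound on `f` and the bound on `h` are global, so the constants do not depend on `ε`.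
From here on the probabilistic estimates use the modes only through these properties. -/
theorem exists_isModeFamily (hW : IsWhiteNoise P W) (hyp : CutoffAssumptions f h μ) :
    ∃ C > 0, ∀ ε ∈ Ioc (0 : ℝ) 1, IsModeFamily P (noiseFamily W)
      (fun k t i => modeCoeff W f h ε k t i)
      (fun k t => modeAmplitude f h ε k ^ 2 * modeVariance f ε k t) C := by
  obtain ⟨c, hc, M, hM0, hcf, hM⟩ := hyp.exists_bounds
  have hpi := Real.pi_pos
  -- The first constant serves for the variances, the second for the time increments.
  refine ⟨max (M ^ 2 / c / (4 * Real.pi)) (M ^ 2 / (2 * Real.pi) * c ^ (-(7 / 8) : ℝ)),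
    lt_max_of_lt_left (by positivity), fun ε hε => ?_⟩
  have hmem : ∀ k t i, modeCoeff W f h ε k t i ∈ chaosOne (noiseFamily W) := fun k t i =>
    complexNoise_mem_chaosOne i (memLp_modeKernel f h ε k t)
  have hG : IsGaussianProcess (noiseFamily W) P := hW.gaussian
  have hL2 : ∀ k t i, MemLp (modeCoeff W f h ε k t i) 2 P := fun k t i =>
    memLp_chaosOne hG (hmem k t i) (by simp)
  have hf0 : ∀ k : ℤ, 0 < f (ε * k) := fun k => hyp.f_pos _
  have hεk : ∀ k : ℤ, k ≠ 0 → ENNReal.ofReal c ≤ f (ε * k) := fun k hk =>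
    hcf _ (mul_ne_zero hε.1.ne' (by exact_mod_cast hk))
  have hsq : ∀ k t i, sqMoment P (modeCoeff W f h ε k t i) = modeCov f h ε k t t := fun k t i => by
    have := integral_modeCoeff_mul_conj (f := f) (h := h) (ε := ε) hW k k t t i i
    rw [integral_mul_conj_self, if_pos rfl, if_pos rfl] at this
    exact_mod_cast this
  have hincr : ∀ k t s i, sqMoment P (fun ω => modeCoeff W f h ε k t i ω
      - modeCoeff W f h ε k s i ω)
      = modeCov f h ε k t t + modeCov f h ε k s s - 2 * modeCov f h ε k t s := by
    intro k t s i
    have := sqMoment_sub_eq (hL2 k t i) (hL2 k s i)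
    rw [integral_modeCoeff_mul_conj hW, integral_modeCoeff_mul_conj hW, hsq, hsq, if_pos rfl,
      if_pos rfl, if_pos rfl, if_pos rfl, modeCov_comm k s t] at this
    have h2 : (sqMoment P (fun ω => modeCoeff W f h ε k t i ω - modeCoeff W f h ε k s i ω) : ℂ)
        = ((modeCov f h ε k t t + modeCov f h ε k s s - 2 * modeCov f h ε k t s : ℝ) : ℂ) := by
      rw [this]
      push_cast
      ring
    exact_mod_cast h2
  refine ⟨hG, fun a => hW.centred _ _, hmem, ?_, ?_, ?_, ?_, ?_, ?_, ?_, ?_, ?_, ?_⟩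
  · intro k l t s i j _ _ hkl
    rw [integral_modeCoeff_mul_conj hW, if_neg hkl, ite_self]
  · intro k l t s i j _ _ hij
    rw [integral_modeCoeff_mul_conj hW, if_neg hij]
  · exact fun k t i => conj_modeCoeff hW hyp k t i
  · intro k t i hk ht
    rw [hsq, modeCov_self hk (hf0 k) ht]
  · intro k t
    simp only [modeAmplitude, modeVariance, heatSymbol, mul_neg, hyp.f_even, hyp.h_even, neg_eq_zero,
      Int.cast_neg, abs_neg, even_two, Even.neg_pow]
  · intro k hk
    rw [← modeCov_self hk (hf0 k) le_rfl, modeCov_eq hk (hf0 k) le_rfl le_rfl]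
    simp
  · intro k
    refine Continuous.continuousOn ?_
    unfold modeVariance heatSymbol
    split_ifs <;> fun_prop
  · exact fun k t ht => mul_nonneg (sq_nonneg _) (modeVariance_nonneg k ht)
  · intro k t hk ht
    have hk' : 0 < |(k : ℝ)| := abs_pos.2 (by exact_mod_cast hk)
    rw [modeAmplitude_sq hk]
    calc _ ≤ noiseRatio f h (ε * k) / (4 * Real.pi * (k : ℝ) ^ 2) * 1 := by
          refine mul_le_mul_of_nonneg_left (modeVariance_le_one hk t) ?_
          exact div_nonneg (noiseRatio_nonneg _) (by positivity)
      _ ≤ (M ^ 2 / c) / (4 * Real.pi * (k : ℝ) ^ 2) := by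
          rw [mul_one]
          gcongr
          exact noiseRatio_le hc (hεk k hk) (hM _)
      _ = M ^ 2 / c / (4 * Real.pi) / (k : ℝ) ^ 2 := by rw [div_div _ _ ((k : ℝ) ^ 2)]
      _ ≤ _ := by
          gcongr
          exact le_max_left _ _
  · intro k t s i hk ht hs
    have hk' : 0 < |(k : ℝ)| := abs_pos.2 (by exact_mod_cast hk)
    rw [hincr]
    have hb : ∀ {t s : ℝ}, 0 ≤ s → s ≤ t →
        modeCov f h ε k t t + modeCov f h ε k s s - 2 * modeCov f h ε k t s
          ≤ max (M ^ 2 / c / (4 * Real.pi)) (M ^ 2 / (2 * Real.pi) * c ^ (-(7 / 8) : ℝ))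
            * |(k : ℝ)| ^ (-(7 / 4) : ℝ) * |t - s| ^ (1 / 8 : ℝ) := fun hs hst =>
      (modeCov_incr_le hc hk (hεk k hk) (hM _) hs hst).trans (by
        gcongr
        exact le_max_right _ _)
    rcases le_total s t with hst | hst
    · exact hb hs hst
    · have := hb ht hst
      rw [abs_sub_comm, modeCov_comm k t s]
      linarith

end Modes

/-! ### The iterated integrals of the Fourier basis -/

/-- The iterated integral of `e^{ikx}` against `e^{ilx}`. -/
def areaKernel (k l : ℤ) (x y : ℝ) : ℂ :=
  ∫ z in x..y, (Complex.exp (Complex.I * k * z) - Complex.exp (Complex.I * k * x)) *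
    (Complex.I * l * Complex.exp (Complex.I * l * z))

/-- The function `e^{ikx}`. -/
def wave (k : ℤ) (x : ℝ) : ℂ := Complex.exp (Complex.I * k * x)

theorem continuous_wave (k : ℤ) : Continuous (wave k) := by
  unfold wave
  fun_prop

theorem norm_wave (k : ℤ) (x : ℝ) : ‖wave k x‖ = 1 := by
  rw [wave, Complex.norm_exp]
  simp

theorem wave_add (k : ℤ) (x y : ℝ) : wave k (x + y) = wave k x * wave k y := by
  rw [wave, wave, wave, ← Complex.exp_add]
  push_cast
  ring_nf

theorem wave_mul (k l : ℤ) (x : ℝ) : wave k x * wave l x = wave (k + l) x := by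
  rw [wave, wave, wave, ← Complex.exp_add]
  push_cast
  ring_nf

theorem wave_zero (k : ℤ) : wave k 0 = 1 := by simp [wave]

theorem zero_wave (x : ℝ) : wave 0 x = 1 := by simp [wave]

theorem conj_wave (k : ℤ) (x : ℝ) : (starRingEnd ℂ) (wave k x) = wave (-k) x := by
  rw [wave, wave, ← Complex.exp_conj]
  simp

theorem periodic_wave (k : ℤ) : Function.Periodic (wave k) (2 * Real.pi) := by
  intro x
  rw [wave_add]
  have : wave k (2 * Real.pi) = 1 := by
    rw [wave, Complex.exp_eq_one_iff]
    exact ⟨k, by push_cast; ring⟩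
  rw [this, mul_one]

theorem hasDerivAt_wave (k : ℤ) (x : ℝ) :
    HasDerivAt (wave k) (Complex.I * k * wave k x) x := by
  have h1 : HasDerivAt (fun z : ℂ => Complex.exp (Complex.I * k * z))
      (Complex.exp (Complex.I * k * x) * (Complex.I * k * 1)) (x : ℂ) :=
    ((hasDerivAt_id (x : ℂ)).const_mul _).cexp
  have h2 := h1.comp_ofReal
  refine h2.congr_deriv ?_
  rw [wave]
  ring

theorem integral_wave_deriv (k : ℤ) (x y : ℝ) :
    ∫ z in x..y, Complex.I * k * wave k z = wave k y - wave k x :=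
  intervalIntegral.integral_eq_sub_of_hasDerivAt (fun z _ => hasDerivAt_wave k z)
    (((continuous_wave k).const_mul _).intervalIntegrable _ _)

theorem norm_wave_sub_le (k : ℤ) (x y : ℝ) : ‖wave k y - wave k x‖ ≤ |(k : ℝ)| * |y - x| := by
  rw [← integral_wave_deriv]
  refine intervalIntegral.norm_integral_le_of_norm_le_const fun z _ => ?_
  simp [norm_wave]

theorem norm_wave_sub_le_two (k : ℤ) (x y : ℝ) : ‖wave k y - wave k x‖ ≤ 2 := by
  refine (norm_sub_le _ _).trans ?_
  rw [norm_wave, norm_wave]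
  norm_num

theorem areaKernel_eq_integral (k l : ℤ) (x y : ℝ) : areaKernel k l x y
    = ∫ z in x..y, (wave k z - wave k x) * (Complex.I * l * wave l z) := rfl

theorem areaKernel_eq (k l : ℤ) (x y : ℝ) : areaKernel k l x y
    = Complex.I * l * (∫ z in x..y, wave (k + l) z) - wave k x * (wave l y - wave l x) := by
  rw [areaKernel_eq_integral, ← integral_wave_deriv, ← intervalIntegral.integral_const_mul,
    ← intervalIntegral.integral_const_mul, ← intervalIntegral.integral_sub]
  · congr 1
    funext z
    rw [← wave_mul]
    ring
  · exact ((continuous_wave _).const_mul _).intervalIntegrable _ _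
  · exact (((continuous_wave _).const_mul _).const_mul _).intervalIntegrable _ _

/-- A shift of the base point multiplies each exponential by a phase. Consequently the pairs with `k
+ l = m`, and no others, contribute to the `m`-th Fourier coefficient in `x`. -/
theorem areaKernel_add (k l : ℤ) (x r : ℝ) :
    areaKernel k l x (x + r) = wave (k + l) x * areaKernel k l 0 r := by
  have h := intervalIntegral.integral_comp_add_left
    (fun z => (wave k z - wave k x) * (Complex.I * l * wave l z)) (a := 0) (b := r) x
  rw [add_zero] at h
  rw [areaKernel_eq_integral, areaKernel_eq_integral, ← h,
    ← intervalIntegral.integral_const_mul]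
  congr 1
  funext z
  rw [wave_add, wave_add, wave_zero, ← wave_mul]
  ring

theorem areaKernel_zero_left (l : ℤ) (x y : ℝ) : areaKernel 0 l x y = 0 := by
  simp [areaKernel]

theorem areaKernel_zero_right (k : ℤ) (x y : ℝ) : areaKernel k 0 x y = 0 := by
  simp [areaKernel]

theorem norm_areaKernel_le_linear (k l : ℤ) (x y : ℝ) :
    ‖areaKernel k l x y‖ ≤ 2 * |(l : ℝ)| * |y - x| := by
  rw [areaKernel_eq_integral]
  refine intervalIntegral.norm_integral_le_of_norm_le_const fun z _ => ?_
  rw [norm_mul, norm_mul, norm_mul, norm_wave, Complex.norm_I, one_mul, mul_one,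
    Complex.norm_intCast]
  gcongr
  exact norm_wave_sub_le_two _ _ _

theorem norm_areaKernel_le_sq (k l : ℤ) (x y : ℝ) :
    ‖areaKernel k l x y‖ ≤ |(k : ℝ)| * |(l : ℝ)| * (y - x) ^ 2 := by
  rw [areaKernel_eq_integral]
  have : |(k : ℝ)| * |(l : ℝ)| * (y - x) ^ 2 = (|(k : ℝ)| * |y - x|) * |(l : ℝ)| * |y - x| := by
    rw [← sq_abs (y - x)]
    ring
  rw [this]
  refine intervalIntegral.norm_integral_le_of_norm_le_const fun z hz => ?_
  rw [norm_mul, norm_mul, norm_mul, norm_wave, Complex.norm_I, one_mul, mul_one,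
    Complex.norm_intCast]
  gcongr
  refine (norm_wave_sub_le _ _ _).trans ?_
  gcongr 1
  exact abs_sub_left_of_mem_uIcc (uIoc_subset_uIcc hz)

theorem norm_integral_wave_le {m : ℤ} (hm : m ≠ 0) (x y : ℝ) :
    ‖∫ z in x..y, wave m z‖ ≤ 2 / |(m : ℝ)| := by
  have hm' : 0 < |(m : ℝ)| := abs_pos.2 (by exact_mod_cast hm)
  have h := norm_wave_sub_le_two m x y
  rw [← integral_wave_deriv, intervalIntegral.integral_const_mul, norm_mul, norm_mul,
    Complex.norm_I, one_mul, Complex.norm_intCast] at h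
  rwa [le_div_iff₀ hm', mul_comm]

/-- Oscillation of `e^{i(k+l)z}` bounds its integral by `2 / |k + l|`, whatever the length of the
interval. -/
theorem norm_areaKernel_le_div {k l : ℤ} (hm : k + l ≠ 0) (x y : ℝ) :
    ‖areaKernel k l x y‖ ≤ 2 * |(l : ℝ)| / |((k + l : ℤ) : ℝ)| + 2 := by
  rw [areaKernel_eq]
  refine (norm_sub_le _ _).trans (add_le_add ?_ ?_)
  · rw [norm_mul, norm_mul, Complex.norm_I, one_mul, Complex.norm_intCast, mul_comm 2, mul_div_assoc]
    gcongr
    exact norm_integral_wave_le hm x y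
  · rw [norm_mul, norm_wave, one_mul]
    exact norm_wave_sub_le_two _ _ _

/-- The integrand is periodic, so each further period adds the same amount, which depends neither on
`x` nor on `y`. This yields the linear growth of the area in the length of the interval. -/
theorem areaKernel_add_two_pi (k l : ℤ) (x y : ℝ) :
    areaKernel k l x (y + 2 * Real.pi) = areaKernel k l x y + areaKernel k l 0 (2 * Real.pi) := by
  have hi : ∀ a b, IntervalIntegrable (wave (k + l)) volume a b := fun a b =>
    (continuous_wave _).intervalIntegrable _ _
  have h1 := intervalIntegral.integral_add_adjacent_intervals (hi x y) (hi y (y + 2 * Real.pi))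
  have h2 := (periodic_wave (k + l)).intervalIntegral_add_eq y 0
  rw [zero_add] at h2
  have h3 := periodic_wave l 0
  rw [zero_add] at h3
  rw [areaKernel_eq, areaKernel_eq, areaKernel_eq, ← h1, h2, periodic_wave l, h3]
  ring

theorem conj_areaKernel (k l : ℤ) (x y : ℝ) :
    (starRingEnd ℂ) (areaKernel k l x y) = areaKernel (-k) (-l) x y := by
  rw [areaKernel_eq_integral, areaKernel_eq_integral, intervalIntegral, intervalIntegral, map_sub,
    ← integral_conj, ← integral_conj]
  simp only [map_mul, map_sub, conj_wave, Complex.conj_I, map_intCast, Int.cast_neg, neg_mul,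
    mul_neg]

/-- In the symmetrised sum the terms linear in `y - x` cancel, which leaves the real quantity that
enters the mean. -/
theorem areaKernel_neg_add (k : ℤ) (x y : ℝ) :
    areaKernel k (-k) x y + areaKernel (-k) k x y = ((2 * (1 - Real.cos (k * (y - x))) : ℝ) : ℂ) := by
  have e : ∀ m : ℤ, wave m x * wave (-m) y = wave (-m) (y - x) := fun m => by
    rw [wave, wave, wave, ← Complex.exp_add]
    push_cast
    ring_nf
  have e0 : ∀ m : ℤ, wave m x * wave (-m) x = 1 := fun m => by
    rw [wave_mul, add_neg_cancel, zero_wave]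
  have hcos : wave k (y - x) + wave (-k) (y - x) = 2 * Complex.cos ((k : ℂ) * (y - x : ℝ)) := by
    rw [Complex.two_cos, wave, wave]
    congr 2 <;> push_cast <;> ring
  rw [areaKernel_eq, areaKernel_eq, add_neg_cancel, neg_add_cancel]
  have e1 := e k
  have e2 := e (-k)
  have e3 := e0 k
  have e4 := e0 (-k)
  rw [neg_neg] at e2 e4
  push_cast
  rw [mul_sub, mul_sub, e1, e2, e3, e4]
  rw [Complex.ofReal_sub] at hcos
  linear_combination -hcos

/-- A change of `y` alters only the domain of integration. A change of `x` is read off from the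
explicit formula `areaKernel_eq`, in which every term is Lipschitz in `x` with constant linear in
the frequencies. -/
theorem norm_areaKernel_sub_le (k l : ℤ) (x y x' y' : ℝ) :
    ‖areaKernel k l x y - areaKernel k l x' y'‖
      ≤ 2 * (|(k : ℝ)| + |(l : ℝ)|) * (|x - x'| + |y - y'|) := by
  have hi : ∀ a b, IntervalIntegrable (wave (k + l)) volume a b := fun a b =>
    (continuous_wave _).intervalIntegrable _ _
  have hy : ‖areaKernel k l x y - areaKernel k l x y'‖ ≤ 2 * |(l : ℝ)| * |y - y'| := by
    have hc : Continuous fun z => (wave k z - wave k x) * (Complex.I * l * wave l z) :=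
      ((continuous_wave k).sub continuous_const).mul ((continuous_wave l).const_mul _)
    rw [areaKernel_eq_integral, areaKernel_eq_integral,
      intervalIntegral.integral_interval_sub_left (hc.intervalIntegrable _ _)
        (hc.intervalIntegrable _ _)]
    refine intervalIntegral.norm_integral_le_of_norm_le_const fun z _ => ?_
    rw [norm_mul, norm_mul, norm_mul, norm_wave, Complex.norm_I, one_mul, mul_one,
      Complex.norm_intCast]
    gcongr
    exact norm_wave_sub_le_two _ _ _
  have hx : ‖areaKernel k l x y' - areaKernel k l x' y'‖
      ≤ 2 * (|(k : ℝ)| + |(l : ℝ)|) * |x - x'| := by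
    have h2 := intervalIntegral.integral_interval_sub_interval_comm (hi x y') (hi x' y') (hi x x')
    rw [intervalIntegral.integral_same, sub_zero] at h2
    have e : areaKernel k l x y' - areaKernel k l x' y'
        = Complex.I * l * (∫ z in x..x', wave (k + l) z) - (wave k x - wave k x') * wave l y'
          + (wave (k + l) x - wave (k + l) x') := by
      rw [areaKernel_eq, areaKernel_eq, ← wave_mul k l x, ← wave_mul k l x', ← h2]
      ring
    rw [e]
    have b1 : ‖∫ z in x..x', wave (k + l) z‖ ≤ 1 * |x' - x| :=
      intervalIntegral.norm_integral_le_of_norm_le_const fun z _ => (norm_wave _ _).le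
    have b2 := norm_wave_sub_le k x' x
    have b3 := norm_wave_sub_le (k + l) x' x
    have b4 : |((k + l : ℤ) : ℝ)| ≤ |(k : ℝ)| + |(l : ℝ)| := by
      push_cast
      exact abs_add_le _ _
    refine (norm_add_le _ _).trans ((add_le_add (norm_sub_le _ _) le_rfl).trans ?_)
    rw [norm_mul, norm_mul, norm_mul, norm_wave, Complex.norm_I, one_mul, mul_one,
      Complex.norm_intCast]
    rw [abs_sub_comm x' x, one_mul] at b1
    calc _ ≤ |(l : ℝ)| * |x - x'| + |(k : ℝ)| * |x - x'|
          + (|(k : ℝ)| + |(l : ℝ)|) * |x - x'| := by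
          gcongr
          exact b3.trans (by gcongr)
      _ = _ := by ring
  calc _ ≤ ‖areaKernel k l x y - areaKernel k l x y'‖
        + ‖areaKernel k l x y' - areaKernel k l x' y'‖ := norm_sub_le_norm_sub_add_norm_sub _ _ _
    _ ≤ 2 * |(l : ℝ)| * |y - y'| + 2 * (|(k : ℝ)| + |(l : ℝ)|) * |x - x'| := add_le_add hy hx
    _ ≤ 2 * (|(k : ℝ)| + |(l : ℝ)|) * |y - y'| + 2 * (|(k : ℝ)| + |(l : ℝ)|) * |x - x'| := by
        gcongr
        linarith [abs_nonneg (k : ℝ)]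
    _ = _ := by ring

theorem continuous_areaKernel (k l : ℤ) : Continuous fun q : ℝ × ℝ => areaKernel k l q.1 q.2 := by
  rw [continuous_iff_continuousAt]
  intro q
  rw [ContinuousAt, tendsto_iff_norm_sub_tendsto_zero]
  refine squeeze_zero (fun _ => norm_nonneg _)
    (fun q' => norm_areaKernel_sub_le k l q'.1 q'.2 q.1 q.2) ?_
  have : Continuous fun q' : ℝ × ℝ =>
      2 * (|(k : ℝ)| + |(l : ℝ)|) * (|q'.1 - q.1| + |q'.2 - q.2|) := by fun_prop
  convert this.tendsto q using 2
  simp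

/-- The maximum of `1` and `|m|`. -/
def bracket (m : ℤ) : ℝ := max 1 |(m : ℝ)|

theorem one_le_bracket (m : ℤ) : 1 ≤ bracket m := le_max_left _ _

theorem bracket_pos (m : ℤ) : 0 < bracket m := zero_lt_one.trans_le (one_le_bracket m)

theorem abs_le_bracket (m : ℤ) : |(m : ℝ)| ≤ bracket m := le_max_right _ _

theorem bracket_of_ne_zero {m : ℤ} (hm : m ≠ 0) : bracket m = |(m : ℝ)| := by
  refine max_eq_right ?_
  exact_mod_cast Int.one_le_abs hm

theorem norm_areaKernel_le (k l : ℤ) (x y : ℝ) :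
    ‖areaKernel k l x y‖ ≤ 2 * (1 + |y - x|) * (1 + |(l : ℝ)| / bracket (k + l)) := by
  have hb := bracket_pos (k + l)
  by_cases hm : k + l = 0
  · have : bracket (k + l) = 1 := by simp [hm, bracket]
    rw [this, div_one]
    refine (norm_areaKernel_le_linear k l x y).trans ?_
    nlinarith [abs_nonneg (l : ℝ), abs_nonneg (y - x)]
  · refine (norm_areaKernel_le_div hm x y).trans ?_
    rw [bracket_of_ne_zero hm]
    have h1 : 0 ≤ |(l : ℝ)| / |((k + l : ℤ) : ℝ)| := by positivity
    rw [mul_div_assoc]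
    nlinarith [abs_nonneg (y - x), mul_nonneg h1 (abs_nonneg (y - x))]

/-! ### Convergence of the series -/

theorem summable_abs_rpow {s : ℝ} (hs : 1 < s) : Summable fun k : ℤ => |(k : ℝ)| ^ (-s) :=
  Real.summable_abs_int_rpow hs

theorem summable_bracket_rpow {s : ℝ} (hs : 1 < s) : Summable fun k : ℤ => bracket k ^ (-s) := by
  refine ((summable_abs_rpow hs).add (summable_of_hasFiniteSupport (f := fun k : ℤ =>
    if k = 0 then (1 : ℝ) else 0) ((finite_singleton (0 : ℤ)).subset fun k hk => ?_))).congr fun k => ?_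
  · by_contra hk0
    exact hk (if_neg hk0)
  · by_cases hk : k = 0
    · subst hk
      have : (-s) ≠ 0 := by linarith
      simp [bracket, Real.zero_rpow this]
    · rw [bracket_of_ne_zero hk, if_neg hk, add_zero]

/-- The weight in the double series which bounds the area process. -/
def areaWeight (p : ℤ × ℤ) : ℝ :=
  |(p.1 : ℝ)| ^ (-(7 / 4) : ℝ) * |(p.2 : ℝ)| ^ (-(7 / 4) : ℝ) *
    (1 + |(p.2 : ℝ)| / bracket (p.1 + p.2)) ^ 2

theorem areaWeight_nonneg (p : ℤ × ℤ) : 0 ≤ areaWeight p := by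
  unfold areaWeight
  positivity

theorem abs_le_two_mul_bracket {k : ℤ} (hk : k ≠ 0) (l : ℤ) :
    |(l : ℝ)| ≤ 2 * (|(k : ℝ)| * bracket (k + l)) := by
  have h1 : 1 ≤ |(k : ℝ)| := by exact_mod_cast Int.one_le_abs hk
  have h2 := one_le_bracket (k + l)
  have h3 := abs_le_bracket (k + l)
  have h4 : |(l : ℝ)| ≤ |((k + l : ℤ) : ℝ)| + |(k : ℝ)| := by
    have := abs_sub ((k + l : ℤ) : ℝ) (k : ℝ)
    push_cast at this ⊢
    simpa using this
  nlinarith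

/-- Expanding the square gives a product of convergent series and a term in `|k|^{-7/4} |l|^{1/4}
⟨k+l⟩^{-2}`. The growth in `l` is absorbed by `|l| ≤ 2 |k| ⟨k+l⟩`, which leaves `|k|^{-3/2}
⟨k+l⟩^{-7/4}`, summable in the variables `k` and `k + l`. -/
theorem summable_areaWeight : Summable areaWeight := by
  have h1 : Summable fun p : ℤ × ℤ =>
      2 * (|(p.1 : ℝ)| ^ (-(7 / 4) : ℝ) * |(p.2 : ℝ)| ^ (-(7 / 4) : ℝ)) :=
    ((summable_abs_rpow (s := 7 / 4) (by norm_num)).mul_of_nonneg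
      (summable_abs_rpow (s := 7 / 4) (by norm_num)) (fun _ => by positivity)
      fun _ => by positivity).mul_left 2
  have h2 : Summable fun p : ℤ × ℤ =>
      4 * (|(p.1 : ℝ)| ^ (-(3 / 2) : ℝ) * bracket (p.1 + p.2) ^ (-(7 / 4) : ℝ)) := by
    have h3 : Summable fun p : ℤ × ℤ =>
        4 * (|(p.1 : ℝ)| ^ (-(3 / 2) : ℝ) * bracket p.2 ^ (-(7 / 4) : ℝ)) :=
      ((summable_abs_rpow (s := 3 / 2) (by norm_num)).mul_of_nonneg
        (summable_bracket_rpow (s := 7 / 4) (by norm_num)) (fun _ => by positivity)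
        fun m => Real.rpow_nonneg (bracket_pos m).le _).mul_left 4
    -- The shear `(k, l) ↦ (k, k + l)` turns the series into a product.
    let e : ℤ × ℤ ≃ ℤ × ℤ := Equiv.prodShear (Equiv.refl ℤ) fun k => Equiv.addLeft k
    exact (e.summable_iff (f := fun p : ℤ × ℤ =>
      4 * (|(p.1 : ℝ)| ^ (-(3 / 2) : ℝ) * bracket p.2 ^ (-(7 / 4) : ℝ)))).2 h3
  refine Summable.of_nonneg_of_le areaWeight_nonneg (fun p => ?_) (h1.add h2)
  obtain ⟨k, l⟩ := p
  have hb := bracket_pos (k + l)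
  unfold areaWeight
  simp only
  by_cases hk : k = 0
  · simp [hk]
  by_cases hl : l = 0
  · have := Real.rpow_nonneg (bracket_pos k).le (-(7 / 4))
    simp only [hl, Int.cast_zero, abs_zero, zero_div, add_zero]
    rw [Real.zero_rpow (by norm_num)]
    simp only [mul_zero, zero_mul, zero_add]
    positivity
  have hk' : 0 < |(k : ℝ)| := abs_pos.2 (by exact_mod_cast hk)
  have hl' : 0 < |(l : ℝ)| := abs_pos.2 (by exact_mod_cast hl)
  have hsq : (1 + |(l : ℝ)| / bracket (k + l)) ^ 2
      ≤ 2 + 2 * (|(l : ℝ)| ^ (2 : ℝ) * bracket (k + l) ^ (-2 : ℝ)) := by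
    have : |(l : ℝ)| ^ (2 : ℝ) * bracket (k + l) ^ (-2 : ℝ) = (|(l : ℝ)| / bracket (k + l)) ^ 2 := by
      rw [Real.rpow_neg hb.le, Real.rpow_two, Real.rpow_two, div_pow, div_eq_mul_inv]
    rw [this]
    nlinarith [sq_nonneg (1 - |(l : ℝ)| / bracket (k + l))]
  have hl14 : |(l : ℝ)| ^ (1 / 4 : ℝ) ≤ 2 * (|(k : ℝ)| ^ (1 / 4 : ℝ) * bracket (k + l) ^ (1 / 4 : ℝ)) := by
    calc |(l : ℝ)| ^ (1 / 4 : ℝ) ≤ (2 * (|(k : ℝ)| * bracket (k + l))) ^ (1 / 4 : ℝ) :=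
          Real.rpow_le_rpow hl'.le (abs_le_two_mul_bracket hk l) (by norm_num)
      _ = 2 ^ (1 / 4 : ℝ) * (|(k : ℝ)| ^ (1 / 4 : ℝ) * bracket (k + l) ^ (1 / 4 : ℝ)) := by
          rw [Real.mul_rpow (by norm_num) (by positivity), Real.mul_rpow hk'.le hb.le]
      _ ≤ _ := by
          gcongr
          calc (2 : ℝ) ^ (1 / 4 : ℝ) ≤ 2 ^ (1 : ℝ) :=
                Real.rpow_le_rpow_of_exponent_le (by norm_num) (by norm_num)
            _ = 2 := Real.rpow_one 2
  calc _ ≤ |(k : ℝ)| ^ (-(7 / 4) : ℝ) * |(l : ℝ)| ^ (-(7 / 4) : ℝ) *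
        (2 + 2 * (|(l : ℝ)| ^ (2 : ℝ) * bracket (k + l) ^ (-2 : ℝ))) := by gcongr
    _ = 2 * (|(k : ℝ)| ^ (-(7 / 4) : ℝ) * |(l : ℝ)| ^ (-(7 / 4) : ℝ))
        + 2 * (|(k : ℝ)| ^ (-(7 / 4) : ℝ) * |(l : ℝ)| ^ (1 / 4 : ℝ)
          * bracket (k + l) ^ (-2 : ℝ)) := by
        rw [show (1 / 4 : ℝ) = -(7 / 4) + 2 by norm_num, Real.rpow_add hl']
        ring
    _ ≤ 2 * (|(k : ℝ)| ^ (-(7 / 4) : ℝ) * |(l : ℝ)| ^ (-(7 / 4) : ℝ))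
        + 2 * (|(k : ℝ)| ^ (-(7 / 4) : ℝ)
          * (2 * (|(k : ℝ)| ^ (1 / 4 : ℝ) * bracket (k + l) ^ (1 / 4 : ℝ)))
          * bracket (k + l) ^ (-2 : ℝ)) := by gcongr
    _ = _ := by
        rw [show (-(3 / 2) : ℝ) = -(7 / 4) + 1 / 4 by norm_num, Real.rpow_add hk',
          show bracket (k + l) ^ (-(7 / 4) : ℝ)
            = bracket (k + l) ^ (1 / 4 : ℝ) * bracket (k + l) ^ (-2 : ℝ) by
            rw [← Real.rpow_add hb]; norm_num]
        ring

/-- A sum of squares of minima, bounded through a telescoping series. -/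
theorem tsum_min_sq_le {a b : ℝ} (ha : 0 < a) (hb : 0 < b) :
    Summable (fun k : ℕ => min a (b / (k + 1)) ^ 2) ∧
      ∑' k : ℕ, min a (b / (k + 1)) ^ 2 ≤ 4 * a * b := by
  set c := b / a with hc
  have hc0 : 0 < c := by positivity
  have hbc : b = c * a := by rw [hc]; field_simp
  -- The minimum changes branch at `k + 1 = c`. On either side it is comparable with a multiple of
  -- `1 / ((k + c)(k + 1 + c))`, which telescopes to `1 / c`.
  have hterm : ∀ k : ℕ, min a (b / (k + 1)) ^ 2
      ≤ 4 * a ^ 2 * c ^ 2 * (1 / (k + c) - 1 / ((k + 1 : ℕ) + c)) := by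
    intro k
    have hk : (0 : ℝ) ≤ k := Nat.cast_nonneg k
    have e : 1 / ((k : ℝ) + c) - 1 / ((k + 1 : ℕ) + c) = 1 / ((k + c) * (k + 1 + c)) := by
      push_cast
      field_simp
      ring
    rw [e, mul_one_div, le_div_iff₀ (by positivity)]
    rcases le_total ((k : ℝ) + 1) c with h | h
    · calc min a (b / (k + 1)) ^ 2 * ((k + c) * (k + 1 + c)) ≤ a ^ 2 * ((c + c) * (c + c)) := by
            gcongr
            · exact min_le_left _ _
            · linarith
        _ = _ := by ring
    · calc min a (b / (k + 1)) ^ 2 * ((k + c) * (k + 1 + c))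
          ≤ (b / (k + 1)) ^ 2 * (((k + 1) + (k + 1)) * ((k + 1) + (k + 1))) := by
            gcongr
            · exact min_le_right _ _
            · linarith
        _ = _ := by
            rw [hbc]
            field_simp
            ring
  have hsum : ∀ N : ℕ, ∑ k ∈ Finset.range N, min a (b / (k + 1)) ^ 2 ≤ 4 * a * b := by
    intro N
    refine (Finset.sum_le_sum fun k _ => hterm k).trans ?_
    rw [← Finset.mul_sum, Finset.sum_range_sub' (fun k : ℕ => 1 / ((k : ℝ) + c))]
    have : 0 ≤ 1 / ((N : ℝ) + c) := by positivity
    calc _ ≤ 4 * a ^ 2 * c ^ 2 * (1 / ((0 : ℕ) + c)) := by gcongr; linarith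
      _ = 4 * a * b := by
        rw [hbc]
        push_cast
        field_simp
        ring
  have hs := summable_of_sum_range_le (fun k => sq_nonneg (min a (b / ((k : ℝ) + 1)))) hsum
  exact ⟨hs, hs.tsum_le_of_sum_range_le hsum⟩

theorem sum_min_sq_le {a b : ℝ} (ha : 0 < a) (hb : 0 < b) (F : Finset ℤ) :
    ∑ k ∈ F, (if k = 0 then 0 else min a (b / |(k : ℝ)|) ^ 2) ≤ 8 * a * b := by
  set g : ℤ → ℝ := fun k => if k = 0 then 0 else min a (b / |(k : ℝ)|) ^ 2 with hg
  have hg0 : ∀ k, 0 ≤ g k := fun k => by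
    simp only [hg]
    split_ifs
    · exact le_rfl
    · positivity
  obtain ⟨hs, hle⟩ := tsum_min_sq_le ha hb
  have e1 : ∀ n : ℕ, g ((n + 1 : ℕ) : ℤ) = min a (b / (n + 1)) ^ 2 := fun n => by
    simp only [hg]
    rw [if_neg (by omega)]
    push_cast
    rw [abs_of_nonneg (by positivity)]
  have e2 : ∀ n : ℕ, g (-(n + 1 : ℤ)) = min a (b / (n + 1)) ^ 2 := fun n => by
    simp only [hg]
    rw [if_neg (by omega)]
    push_cast
    rw [abs_neg, abs_of_nonneg (by positivity)]
  have s1 : Summable fun n : ℕ => g n := by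
    rw [← summable_nat_add_iff 1]
    simpa only [e1] using hs
  have s2 : Summable fun n : ℕ => g (-(n + 1 : ℤ)) := by simpa only [e2] using hs
  have t1 : ∑' n : ℕ, g n = ∑' n : ℕ, min a (b / (n + 1)) ^ 2 := by
    rw [s1.tsum_eq_zero_add]
    simp only [e1]
    simp [hg]
  refine ((Summable.of_nat_of_neg_add_one s1 s2).sum_le_tsum F fun k _ => hg0 k).trans ?_
  rw [tsum_of_nat_of_neg_add_one s1 s2, t1]
  simp only [e2]
  linarith

/-! ### Bilinear forms in the Fourier modes -/

theorem sqMoment_add_le {Ω : Type*} [MeasurableSpace Ω] {P : Measure Ω} {U V : Ω → ℂ}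
    (hU : MemLp U 2 P) (hV : MemLp V 2 P) :
    sqMoment P (fun ω => U ω + V ω) ≤ 2 * sqMoment P U + 2 * sqMoment P V := by
  have iU : Integrable (fun ω => ‖U ω‖ ^ 2) P := hU.integrable_norm_pow two_ne_zero
  have iV : Integrable (fun ω => ‖V ω‖ ^ 2) P := hV.integrable_norm_pow two_ne_zero
  have iUV : Integrable (fun ω => ‖U ω + V ω‖ ^ 2) P := (hU.add hV).integrable_norm_pow two_ne_zero
  rw [sqMoment, sqMoment, sqMoment, ← integral_const_mul, ← integral_const_mul,
    ← integral_add (iU.const_mul 2) (iV.const_mul 2)]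
  refine integral_mono iUV ((iU.const_mul 2).add (iV.const_mul 2)) fun ω => ?_
  have h := norm_add_le (U ω) (V ω)
  nlinarith [sq_nonneg (‖U ω‖ - ‖V ω‖), norm_nonneg (U ω + V ω), norm_nonneg (U ω),
    norm_nonneg (V ω)]

section Quad

variable {Ω : Type*} [MeasurableSpace Ω] {P : Measure Ω} {κ : Type*} {G : κ → Ω → ℝ} {n : ℕ}
  {Z : ℤ → ℝ → Fin n → Ω → ℂ} {ρ : ℤ → ℝ → ℝ} {C : ℝ}

/-- The bilinear form with coefficients `a` in two components of the modes. -/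
def quad (Z : ℤ → ℝ → Fin n → Ω → ℂ) (F : Finset (ℤ × ℤ)) (a : ℤ × ℤ → ℂ) (t : ℝ) (i j : Fin n)
    (ω : Ω) : ℂ :=
  ∑ p ∈ F, a p * (Z p.1 t i ω * Z p.2 t j ω)

/-- The bilinear form `quad`, centred. -/
def centredQuad (P : Measure Ω) (Z : ℤ → ℝ → Fin n → Ω → ℂ) (F : Finset (ℤ × ℤ)) (a : ℤ × ℤ → ℂ)
    (t : ℝ) (i j : Fin n) (ω : Ω) : ℂ :=
  quad Z F a t i j ω - ∫ ω', quad Z F a t i j ω' ∂P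

namespace IsModeFamily

variable (hZ : IsModeFamily P G Z ρ C)

include hZ

theorem memLp_two (k : ℤ) (t : ℝ) (i : Fin n) : MemLp (Z k t i) 2 P :=
  memLp_chaosOne hZ.gaussian (hZ.mem k t i) (by simp)

theorem quad_mem (F : Finset (ℤ × ℤ)) (a : ℤ × ℤ → ℂ) (t : ℝ) (i j : Fin n) :
    quad Z F a t i j ∈ chaosTwo G := by
  have : quad Z F a t i j = ∑ p ∈ F, a p • fun ω => Z p.1 t i ω * Z p.2 t j ω := by
    funext ω
    simp [quad]
  rw [this]
  exact Submodule.sum_mem _ fun p _ => Submodule.smul_mem _ _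
    (mul_mem_chaosTwo (hZ.mem _ _ _) (hZ.mem _ _ _))

theorem centredQuad_mem (F : Finset (ℤ × ℤ)) (a : ℤ × ℤ → ℂ) (t : ℝ) (i j : Fin n) :
    centredQuad P Z F a t i j ∈ chaosTwo G :=
  Submodule.sub_mem _ (hZ.quad_mem F a t i j) (const_mem_chaosTwo _)

theorem integrable_mul (k l : ℤ) (t s : ℝ) (i j : Fin n) :
    Integrable (fun ω => Z k t i ω * Z l s j ω) P :=
  integrable_chaosOne_mul hZ.gaussian (hZ.mem _ _ _) (hZ.mem _ _ _)

theorem integrable_quad (F : Finset (ℤ × ℤ)) (a : ℤ × ℤ → ℂ) (t : ℝ) (i j : Fin n) :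
    Integrable (quad Z F a t i j) P :=
  integrable_finsetSum _ fun p _ => (hZ.integrable_mul _ _ _ _ _ _).const_mul _

theorem const_nonneg : 0 ≤ C := by
  have h1 := hZ.le 1 0 one_ne_zero le_rfl
  have h2 := hZ.nonneg 1 0 le_rfl
  simpa using h2.trans h1

theorem centredQuad_sub (F : Finset (ℤ × ℤ)) (a b : ℤ × ℤ → ℂ) (t : ℝ) (i j : Fin n) (ω : Ω) :
    centredQuad P Z F a t i j ω - centredQuad P Z F b t i j ω
      = centredQuad P Z F (fun p => a p - b p) t i j ω := by
  have e : ∀ ω, quad Z F (fun p => a p - b p) t i j ω = quad Z F a t i j ω - quad Z F b t i j ω :=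
    fun ω => by
      simp only [quad]
      rw [← Finset.sum_sub_distrib]
      exact Finset.sum_congr rfl fun p _ => by ring
  simp only [centredQuad]
  simp_rw [e]
  rw [integral_sub (hZ.integrable_quad _ _ _ _ _) (hZ.integrable_quad _ _ _ _ _)]
  ring

/-- Bounds on the variances are required for nonzero frequencies only: the coefficients in use
vanish as soon as one frequency is zero, so the zero mode does not contribute. -/
theorem sqMoment_bilinear_le [IsProbabilityMeasure P] {U V : ℤ → Ω → ℂ}
    (hU : ∀ k, U k ∈ chaosOne G) (hV : ∀ k, V k ∈ chaosOne G)
    (oU : ∀ k l, k ≠ l → ∫ ω, U k ω * (starRingEnd ℂ) (U l ω) ∂P = 0)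
    (oV : ∀ k l, k ≠ l → ∫ ω, V k ω * (starRingEnd ℂ) (V l ω) ∂P = 0)
    (oUV : ∀ k l, k ≠ l → ∫ ω, U k ω * (starRingEnd ℂ) (V l ω) ∂P = 0)
    (F : Finset (ℤ × ℤ)) {a : ℤ × ℤ → ℂ} (ha : ∀ p, p.1 = 0 ∨ p.2 = 0 → a p = 0)
    {u v : ℤ → ℝ} (hu : ∀ k, k ≠ 0 → sqMoment P (U k) ≤ u k)
    (hv : ∀ k, k ≠ 0 → sqMoment P (V k) ≤ v k) :
    sqMoment P (fun ω => ∑ p ∈ F, a p * (U p.1 ω * V p.2 ω)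
        - ∫ ω', ∑ p ∈ F, a p * (U p.1 ω' * V p.2 ω') ∂P)
      ≤ 2 * ∑ p ∈ F, ‖a p‖ ^ 2 * (u p.1 * v p.2) := by
  refine (sqMoment_bilinear_sub_integral_le hZ.gaussian hZ.centred hU hV oU oV oUV F a).trans ?_
  gcongr 2 * ?_
  refine Finset.sum_le_sum fun p _ => ?_
  by_cases hp : p.1 = 0 ∨ p.2 = 0
  · rw [ha p hp]
    simp
  · push Not at hp
    exact mul_le_mul_of_nonneg_left (mul_le_mul (hu _ hp.1) (hv _ hp.2) (sqMoment_nonneg _)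
      ((sqMoment_nonneg _).trans (hu _ hp.1))) (sq_nonneg _)

theorem sqMoment_le {k : ℤ} (hk : k ≠ 0) {t : ℝ} (ht : 0 ≤ t) (i : Fin n) :
    sqMoment P (Z k t i) ≤ C / (k : ℝ) ^ 2 := by
  rw [hZ.sqMoment_eq k t i hk ht]
  exact hZ.le k t hk ht

theorem sqMoment_centredQuad_le [IsProbabilityMeasure P] (F : Finset (ℤ × ℤ)) {a : ℤ × ℤ → ℂ}
    (ha : ∀ p, p.1 = 0 ∨ p.2 = 0 → a p = 0) {t : ℝ} (ht : 0 ≤ t) (i j : Fin n) :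
    sqMoment P (centredQuad P Z F a t i j)
      ≤ 2 * C ^ 2 * ∑ p ∈ F, ‖a p‖ ^ 2 / ((p.1 : ℝ) ^ 2 * (p.2 : ℝ) ^ 2) := by
  refine (hZ.sqMoment_bilinear_le
    (U := fun k => Z k t i) (V := fun k => Z k t j) (fun _ => hZ.mem _ _ _) (fun _ => hZ.mem _ _ _)
    (fun k l => hZ.orthogonal k l t t i i ht ht) (fun k l => hZ.orthogonal k l t t j j ht ht)
    (fun k l => hZ.orthogonal k l t t i j ht ht) F ha (fun k hk => hZ.sqMoment_le hk ht i)
    (fun k hk => hZ.sqMoment_le hk ht j)).trans (le_of_eq ?_)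
  rw [mul_assoc, Finset.mul_sum _ _ (C ^ 2)]
  congr 1
  exact Finset.sum_congr rfl fun p _ => by ring

theorem integral_sub_mul_conj_eq_zero {k l : ℤ} (hkl : k ≠ l) {t s r : ℝ} (ht : 0 ≤ t)
    (hs : 0 ≤ s) (hr : 0 ≤ r) (i j : Fin n) :
    ∫ ω, (Z k t i ω - Z k s i ω) * (starRingEnd ℂ) (Z l r j ω) ∂P = 0 := by
  have hi : ∀ t, Integrable (fun ω => Z k t i ω * (starRingEnd ℂ) (Z l r j ω)) P := fun t =>
    (hZ.memLp_two k t i).integrable_mul (hZ.memLp_two l r j).star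
  simp only [sub_mul]
  rw [integral_sub (hi t) (hi s), hZ.orthogonal k l t r i j ht hr hkl,
    hZ.orthogonal k l s r i j hs hr hkl, sub_zero]

theorem integral_sub_mul_conj_sub_eq_zero {k l : ℤ} (hkl : k ≠ l) {t s : ℝ} (ht : 0 ≤ t)
    (hs : 0 ≤ s) (i j : Fin n) :
    ∫ ω, (Z k t i ω - Z k s i ω) * (starRingEnd ℂ) (Z l t j ω - Z l s j ω) ∂P = 0 := by
  have hi : ∀ r, Integrable
      (fun ω => (Z k t i ω - Z k s i ω) * (starRingEnd ℂ) (Z l r j ω)) P := fun r =>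
    ((hZ.memLp_two k t i).sub (hZ.memLp_two k s i)).integrable_mul (hZ.memLp_two l r j).star
  simp only [map_sub, mul_sub]
  rw [integral_sub (hi t) (hi s), hZ.integral_sub_mul_conj_eq_zero hkl ht hs ht,
    hZ.integral_sub_mul_conj_eq_zero hkl ht hs hs, sub_zero]

theorem memLp_centred_bilinear [IsProbabilityMeasure P] {U V : ℤ → Ω → ℂ}
    (hU : ∀ k, U k ∈ chaosOne G) (hV : ∀ k, V k ∈ chaosOne G) (F : Finset (ℤ × ℤ))
    (a : ℤ × ℤ → ℂ) : MemLp (fun ω => ∑ p ∈ F, a p * (U p.1 ω * V p.2 ω)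
        - ∫ ω', ∑ p ∈ F, a p * (U p.1 ω' * V p.2 ω') ∂P) 2 P := by
  have e : (fun ω => ∑ p ∈ F, a p * (U p.1 ω * V p.2 ω))
      = ∑ p ∈ F, a p • fun ω => U p.1 ω * V p.2 ω := by
    funext ω
    simp
  have h : (fun ω => ∑ p ∈ F, a p * (U p.1 ω * V p.2 ω)) ∈ chaosTwo G := by
    rw [e]
    exact Submodule.sum_mem _ fun p _ => Submodule.smul_mem _ _ (mul_mem_chaosTwo (hU _) (hV _))
  exact memLp_chaosTwo hZ.gaussian hZ.centred (Submodule.sub_mem _ h (const_mem_chaosTwo _))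

/-- The increment of a product is `(Z_t - Z_s) Z_t + Z_s (Z_t - Z_s)`. Each part is a bilinear form
in two orthogonal families, one of which carries the small increment variance. The constant is `2`
from Wick's formula times `2` from the square of a sum. -/
theorem sqMoment_centredQuad_incr_le [IsProbabilityMeasure P] (F : Finset (ℤ × ℤ))
    {a : ℤ × ℤ → ℂ} (ha : ∀ p, p.1 = 0 ∨ p.2 = 0 → a p = 0) {t s : ℝ} (ht : 0 ≤ t) (hs : 0 ≤ s)
    (i j : Fin n) :
    sqMoment P (fun ω => centredQuad P Z F a t i j ω - centredQuad P Z F a s i j ω)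
      ≤ 4 * C ^ 2 * |t - s| ^ (1 / 8 : ℝ) * ∑ p ∈ F, ‖a p‖ ^ 2 *
        (|(p.1 : ℝ)| ^ (-(7 / 4) : ℝ) / (p.2 : ℝ) ^ 2
          + |(p.2 : ℝ)| ^ (-(7 / 4) : ℝ) / (p.1 : ℝ) ^ 2) := by
  have hDm : ∀ k i, (fun ω => Z k t i ω - Z k s i ω) ∈ chaosOne G := fun k i =>
    Submodule.sub_mem _ (hZ.mem k t i) (hZ.mem k s i)
  have hconj : ∀ {U V : Ω → ℂ}, ∫ ω, U ω * (starRingEnd ℂ) (V ω) ∂P = 0 →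
      ∫ ω, V ω * (starRingEnd ℂ) (U ω) ∂P = 0 := by
    intro U V h
    have := congrArg (starRingEnd ℂ) h
    rw [← integral_conj, map_zero] at this
    rw [← this]
    congr 1
    funext ω
    simp [mul_comm]
  have hD2 : ∀ i, ∀ k ≠ 0, sqMoment P (fun ω => Z k t i ω - Z k s i ω)
      ≤ C * |(k : ℝ)| ^ (-(7 / 4) : ℝ) * |t - s| ^ (1 / 8 : ℝ) := fun i k hk =>
    hZ.sqMoment_sub_le k t s i hk ht hs
  have hb1 := hZ.sqMoment_bilinear_le (U := fun k ω => Z k t i ω - Z k s i ω)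
    (V := fun k => Z k t j) (fun _ => hDm _ _) (fun _ => hZ.mem _ _ _)
    (fun k l h => hZ.integral_sub_mul_conj_sub_eq_zero h ht hs i i)
    (fun k l => hZ.orthogonal k l t t j j ht ht)
    (fun k l h => hZ.integral_sub_mul_conj_eq_zero h ht hs ht i j) F ha (hD2 i)
    (fun k hk => hZ.sqMoment_le hk ht j)
  have hb2 := hZ.sqMoment_bilinear_le (U := fun k => Z k s i)
    (V := fun k ω => Z k t j ω - Z k s j ω) (fun _ => hZ.mem _ _ _) (fun _ => hDm _ _)
    (fun k l => hZ.orthogonal k l s s i i hs hs)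
    (fun k l h => hZ.integral_sub_mul_conj_sub_eq_zero h ht hs j j)
    (fun k l h => hconj (hZ.integral_sub_mul_conj_eq_zero h.symm ht hs hs j i)) F ha
    (fun k hk => hZ.sqMoment_le hk hs i) (hD2 j)
  have hm1 := hZ.memLp_centred_bilinear (U := fun k ω => Z k t i ω - Z k s i ω)
    (V := fun k => Z k t j) (fun _ => hDm _ _) (fun _ => hZ.mem _ _ _) F a
  have hm2 := hZ.memLp_centred_bilinear (U := fun k => Z k s i)
    (V := fun k ω => Z k t j ω - Z k s j ω) (fun _ => hZ.mem _ _ _) (fun _ => hDm _ _) F a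
  have hi1 : Integrable (fun ω => ∑ p ∈ F, a p * ((Z p.1 t i ω - Z p.1 s i ω) * Z p.2 t j ω)) P :=
    integrable_finsetSum _ fun p _ =>
      (integrable_chaosOne_mul hZ.gaussian (hDm _ _) (hZ.mem _ _ _)).const_mul _
  have hi2 : Integrable (fun ω => ∑ p ∈ F, a p * (Z p.1 s i ω * (Z p.2 t j ω - Z p.2 s j ω))) P :=
    integrable_finsetSum _ fun p _ =>
      (integrable_chaosOne_mul hZ.gaussian (hZ.mem _ _ _) (hDm _ _)).const_mul _
  have hsplit : ∀ ω, quad Z F a t i j ω - quad Z F a s i j ω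
      = ∑ p ∈ F, a p * ((Z p.1 t i ω - Z p.1 s i ω) * Z p.2 t j ω)
        + ∑ p ∈ F, a p * (Z p.1 s i ω * (Z p.2 t j ω - Z p.2 s j ω)) := fun ω => by
    simp only [quad]
    rw [← Finset.sum_sub_distrib, ← Finset.sum_add_distrib]
    exact Finset.sum_congr rfl fun p _ => by ring
  have hint := integral_sub (hZ.integrable_quad F a t i j) (hZ.integrable_quad F a s i j)
  simp_rw [hsplit] at hint
  rw [integral_add hi1 hi2] at hint
  have hsum := sqMoment_add_le hm1 hm2
  have e : ∀ ω, centredQuad P Z F a t i j ω - centredQuad P Z F a s i j ω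
      = (∑ p ∈ F, a p * ((Z p.1 t i ω - Z p.1 s i ω) * Z p.2 t j ω)
          - ∫ ω', ∑ p ∈ F, a p * ((Z p.1 t i ω' - Z p.1 s i ω') * Z p.2 t j ω') ∂P)
        + (∑ p ∈ F, a p * (Z p.1 s i ω * (Z p.2 t j ω - Z p.2 s j ω))
          - ∫ ω', ∑ p ∈ F, a p * (Z p.1 s i ω' * (Z p.2 t j ω' - Z p.2 s j ω')) ∂P) := by
    intro ω
    have h2 := hsplit ω
    simp only [centredQuad]
    linear_combination h2 + hint
  simp_rw [e]
  refine (hsum.trans (add_le_add (mul_le_mul_of_nonneg_left hb1 zero_le_two)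
    (mul_le_mul_of_nonneg_left hb2 zero_le_two))).trans (le_of_eq ?_)
  rw [← mul_assoc, ← mul_assoc, ← mul_add, ← Finset.sum_add_distrib, Finset.mul_sum,
    Finset.mul_sum]
  exact Finset.sum_congr rfl fun p _ => by ring

end IsModeFamily

end Quad

/-! ### The truncated area process -/

/-- The pairs of frequencies which are at most `N`. -/
def freqBox (N : ℕ) : Finset (ℤ × ℤ) := Finset.Icc (-N : ℤ) N ×ˢ Finset.Icc (-N : ℤ) N

theorem freqBox_mono {N M : ℕ} (h : N ≤ M) : freqBox N ⊆ freqBox M := by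
  intro p hp
  simp only [freqBox, Finset.mem_product, Finset.mem_Icc] at hp ⊢
  omega

theorem tendsto_freqBox : Tendsto freqBox atTop atTop := by
  refine tendsto_atTop_finset_of_monotone (fun N M h => freqBox_mono h) fun p => ?_
  refine ⟨max p.1.natAbs p.2.natAbs, ?_⟩
  simp only [freqBox, Finset.mem_product, Finset.mem_Icc]
  omega

/-- The coefficients of the area process, as a bilinear form in the modes. -/
def areaCoeff (x y : ℝ) (p : ℤ × ℤ) : ℂ := areaKernel p.1 p.2 x y

theorem areaCoeff_eq_zero (x y : ℝ) (p : ℤ × ℤ) (hp : p.1 = 0 ∨ p.2 = 0) : areaCoeff x y p = 0 := by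
  rcases hp with hp | hp
  · rw [areaCoeff, hp, areaKernel_zero_left]
  · rw [areaCoeff, hp, areaKernel_zero_right]

theorem one_div_sq_le_rpow (k : ℤ) : 1 / (k : ℝ) ^ 2 ≤ |(k : ℝ)| ^ (-(7 / 4) : ℝ) := by
  by_cases hk : k = 0
  · subst hk
    rw [Int.cast_zero, abs_zero, Real.zero_rpow (by norm_num)]
    simp
  · have h1 : 1 ≤ |(k : ℝ)| := by exact_mod_cast Int.one_le_abs hk
    calc 1 / (k : ℝ) ^ 2 = |(k : ℝ)| ^ (-2 : ℝ) := by
          rw [Real.rpow_neg (abs_nonneg _), Real.rpow_two, sq_abs, one_div]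
      _ ≤ _ := Real.rpow_le_rpow_of_exponent_le h1 (by norm_num)

theorem norm_areaCoeff_sq_le (x y : ℝ) (p : ℤ × ℤ) :
    ‖areaCoeff x y p‖ ^ 2
      ≤ 4 * (1 + |y - x|) ^ 2 * (1 + |(p.2 : ℝ)| / bracket (p.1 + p.2)) ^ 2 := by
  calc ‖areaCoeff x y p‖ ^ 2
      ≤ (2 * (1 + |y - x|) * (1 + |(p.2 : ℝ)| / bracket (p.1 + p.2))) ^ 2 := by
        gcongr
        exact norm_areaKernel_le _ _ _ _
    _ = _ := by ring

theorem norm_areaCoeff_sq_mul_le (x y : ℝ) (p : ℤ × ℤ) {w : ℝ}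
    (hw : w ≤ |(p.1 : ℝ)| ^ (-(7 / 4) : ℝ) * |(p.2 : ℝ)| ^ (-(7 / 4) : ℝ)) :
    ‖areaCoeff x y p‖ ^ 2 * w ≤ 4 * (1 + |y - x|) ^ 2 * areaWeight p := by
  calc ‖areaCoeff x y p‖ ^ 2 * w
      ≤ ‖areaCoeff x y p‖ ^ 2 * (|(p.1 : ℝ)| ^ (-(7 / 4) : ℝ) * |(p.2 : ℝ)| ^ (-(7 / 4) : ℝ)) := by
        gcongr
    _ ≤ 4 * (1 + |y - x|) ^ 2 * (1 + |(p.2 : ℝ)| / bracket (p.1 + p.2)) ^ 2 *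
        (|(p.1 : ℝ)| ^ (-(7 / 4) : ℝ) * |(p.2 : ℝ)| ^ (-(7 / 4) : ℝ)) := by
        gcongr
        exact norm_areaCoeff_sq_le x y p
    _ = _ := by
        rw [areaWeight]
        ring

theorem one_div_sq_mul_sq_le (p : ℤ × ℤ) : 1 / ((p.1 : ℝ) ^ 2 * (p.2 : ℝ) ^ 2)
    ≤ |(p.1 : ℝ)| ^ (-(7 / 4) : ℝ) * |(p.2 : ℝ)| ^ (-(7 / 4) : ℝ) := by
  rw [← one_div_mul_one_div]
  exact mul_le_mul (one_div_sq_le_rpow _) (one_div_sq_le_rpow _) (by positivity) (by positivity)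

/-- Interpolation: in `v² = v^{7/4} v^{1/4}` the first factor is estimated by the uniform bound and
the second by the Lipschitz bound. The resulting loss `(|k| |l|)^{1/4}` turns `k⁻² l⁻²` into the
powers `-7/4` of `areaWeight`. -/
theorem norm_areaCoeff_sub_sq_le {R : ℝ} {x y x' y' : ℝ} (h : |y - x| ≤ R) (h' : |y' - x'| ≤ R)
    (p : ℤ × ℤ) :
    ‖areaCoeff x y p - areaCoeff x' y' p‖ ^ 2 * (1 / ((p.1 : ℝ) ^ 2 * (p.2 : ℝ) ^ 2))
      ≤ 32 * (1 + R) ^ 2 * (|x - x'| + |y - y'|) ^ (1 / 4 : ℝ) * areaWeight p := by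
  obtain ⟨k, l⟩ := p
  simp only [areaCoeff]
  have hR : 0 ≤ R := (abs_nonneg _).trans h
  set D := |x - x'| + |y - y'| with hD
  have hD0 : 0 ≤ D := by positivity
  have hw0 := areaWeight_nonneg (k, l)
  by_cases hk : k = 0
  · subst hk
    rw [areaKernel_zero_left, areaKernel_zero_left]
    rw [sub_zero, norm_zero, zero_pow two_ne_zero, zero_mul]
    positivity
  by_cases hl : l = 0
  · subst hl
    rw [areaKernel_zero_right, areaKernel_zero_right]
    rw [sub_zero, norm_zero, zero_pow two_ne_zero, zero_mul]
    positivity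
  have hk1 : 1 ≤ |(k : ℝ)| := by exact_mod_cast Int.one_le_abs hk
  have hl1 : 1 ≤ |(l : ℝ)| := by exact_mod_cast Int.one_le_abs hl
  have hb := bracket_pos (k + l)
  set w := 1 + |(l : ℝ)| / bracket (k + l) with hw
  have hw1 : 1 ≤ w := by
    rw [hw]
    have : 0 ≤ |(l : ℝ)| / bracket (k + l) := by positivity
    linarith
  set v := ‖areaKernel k l x y - areaKernel k l x' y'‖ with hv
  have hv0 : 0 ≤ v := norm_nonneg _
  set X := 4 * (1 + R) * w with hX
  have hX1 : 1 ≤ X := by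
    rw [hX]
    nlinarith
  have hvX : v ≤ X := by
    calc v ≤ ‖areaKernel k l x y‖ + ‖areaKernel k l x' y'‖ := norm_sub_le _ _
      _ ≤ 2 * (1 + |y - x|) * w + 2 * (1 + |y' - x'|) * w :=
          add_le_add (norm_areaKernel_le _ _ _ _) (norm_areaKernel_le _ _ _ _)
      _ ≤ 2 * (1 + R) * w + 2 * (1 + R) * w := by gcongr
      _ = X := by rw [hX]; ring
  -- Both frequencies are at least `1` in modulus, so `|k| + |l| ≤ 2 |k| |l|`.
  have hvY : v ≤ 4 * (|(k : ℝ)| * |(l : ℝ)|) * D := by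
    refine (norm_areaKernel_sub_le k l x y x' y').trans ?_
    refine mul_le_mul_of_nonneg_right ?_ hD0
    nlinarith
  have hv2 : v ^ 2 ≤ X ^ 2 * (4 * (|(k : ℝ)| * |(l : ℝ)|) * D) ^ (1 / 4 : ℝ) := by
    rcases hv0.eq_or_lt with h0 | h0
    · rw [← h0]
      simp only [ne_eq, OfNat.ofNat_ne_zero, not_false_eq_true, zero_pow]
      positivity
    calc v ^ 2 = v ^ (7 / 4 : ℝ) * v ^ (1 / 4 : ℝ) := by
          rw [← Real.rpow_add h0, ← Real.rpow_two]
          norm_num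
      _ ≤ X ^ (7 / 4 : ℝ) * (4 * (|(k : ℝ)| * |(l : ℝ)|) * D) ^ (1 / 4 : ℝ) := by
          gcongr
      _ ≤ X ^ 2 * (4 * (|(k : ℝ)| * |(l : ℝ)|) * D) ^ (1 / 4 : ℝ) := by
          gcongr
          rw [← Real.rpow_two]
          exact Real.rpow_le_rpow_of_exponent_le hX1 (by norm_num)
  have h4 : (4 : ℝ) ^ (1 / 4 : ℝ) ≤ 2 := by
    calc (4 : ℝ) ^ (1 / 4 : ℝ) ≤ 4 ^ (1 / 2 : ℝ) :=
          Real.rpow_le_rpow_of_exponent_le (by norm_num) (by norm_num)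
      _ = 2 := by
          rw [← Real.sqrt_eq_rpow, show (4 : ℝ) = 2 ^ 2 by norm_num, Real.sqrt_sq (by norm_num)]
  have hpow : ∀ m : ℤ, 1 ≤ |(m : ℝ)| →
      |(m : ℝ)| ^ (1 / 4 : ℝ) * (1 / (m : ℝ) ^ 2) = |(m : ℝ)| ^ (-(7 / 4) : ℝ) := fun m hm => by
    rw [show (-(7 / 4) : ℝ) = 1 / 4 - 2 by norm_num, Real.rpow_sub (by linarith), Real.rpow_two,
      sq_abs, mul_one_div]
  calc v ^ 2 * (1 / ((k : ℝ) ^ 2 * (l : ℝ) ^ 2))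
      ≤ X ^ 2 * (4 * (|(k : ℝ)| * |(l : ℝ)|) * D) ^ (1 / 4 : ℝ)
        * (1 / ((k : ℝ) ^ 2 * (l : ℝ) ^ 2)) := by gcongr
    _ = 4 ^ (1 / 4 : ℝ) * (X ^ 2 * D ^ (1 / 4 : ℝ)
        * ((|(k : ℝ)| ^ (1 / 4 : ℝ) * (1 / (k : ℝ) ^ 2))
          * (|(l : ℝ)| ^ (1 / 4 : ℝ) * (1 / (l : ℝ) ^ 2)))) := by
        rw [Real.mul_rpow (by positivity) hD0, Real.mul_rpow (by norm_num) (by positivity),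
          Real.mul_rpow (by positivity) (by positivity)]
        field_simp
    _ ≤ 2 * (X ^ 2 * D ^ (1 / 4 : ℝ)
        * ((|(k : ℝ)| ^ (1 / 4 : ℝ) * (1 / (k : ℝ) ^ 2))
          * (|(l : ℝ)| ^ (1 / 4 : ℝ) * (1 / (l : ℝ) ^ 2)))) := by gcongr
    _ = _ := by
        rw [hpow k hk1, hpow l hl1, hX, areaWeight]
        ring

/-- The part of the double series `areaWeight` outside of the box of frequencies at most `N`. -/
def weightTail (N : ℕ) : ℝ := ∑' p : { p // p ∉ freqBox N }, areaWeight p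

theorem tendsto_weightTail : Tendsto weightTail atTop (𝓝 0) :=
  (tendsto_tsum_compl_atTop_zero areaWeight).comp tendsto_freqBox

theorem sum_areaWeight_le_weightTail (N : ℕ) (F : Finset (ℤ × ℤ)) :
    ∑ p ∈ F with p ∉ freqBox N, areaWeight p ≤ weightTail N := by
  rw [← Finset.sum_subtype_of_mem (p := fun p => p ∉ freqBox N) _
    fun p hp => (Finset.mem_filter.1 hp).2]
  exact (summable_areaWeight.subtype _).sum_le_tsum _ fun _ _ => areaWeight_nonneg _

/-! ### Mean and variance of the truncated area -/

section Area

variable {Ω : Type*} [MeasurableSpace Ω] {P : Measure Ω} {κ : Type*} {G : κ → Ω → ℝ} {n : ℕ}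
  {Z : ℤ → ℝ → Fin n → Ω → ℂ} {ρ : ℤ → ℝ → ℝ} {C : ℝ}

theorem areaPartialSum_eq {W : Fin n → Lp ℝ 2 spaceTime → Ω → ℝ} {f : ℝ → ℝ≥0∞} {h : ℝ → ℝ}
    {ε : ℝ} (N : ℕ) (t x y : ℝ) (i j : Fin n) :
    areaPartialSum W f h ε N t x y i j
      = quad (fun k t i => modeCoeff W f h ε k t i) (freqBox N) (areaCoeff x y) t i j := by
  funext ω
  rw [areaPartialSum, quad, freqBox, Finset.sum_product]
  refine Finset.sum_congr rfl fun k _ => Finset.sum_congr rfl fun l _ => ?_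
  rw [mul_comm]
  rfl

/-- The truncated area process, centred. -/
def centredArea (P : Measure Ω) (Z : ℤ → ℝ → Fin n → Ω → ℂ) (N : ℕ) (t x y : ℝ) (i j : Fin n) :
    Ω → ℂ := centredQuad P Z (freqBox N) (areaCoeff x y) t i j

/-- The mean of the diagonal entries of the truncated area process. -/
def truncatedMean (ρ : ℤ → ℝ → ℝ) (N : ℕ) (t r : ℝ) : ℝ :=
  ∑ k ∈ Finset.Icc (-N : ℤ) N, ρ k t * (1 - Real.cos (k * r))

/-- The mean of the diagonal entries of the area process. -/
def areaMean (ρ : ℤ → ℝ → ℝ) (t r : ℝ) : ℝ := ∑' k : ℤ, ρ k t * (1 - Real.cos (k * r))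

theorem quad_subset {F F' : Finset (ℤ × ℤ)} (hF : F ⊆ F') (a : ℤ × ℤ → ℂ) (t : ℝ) (i j : Fin n) :
    quad Z F a t i j = quad Z F' (fun p => if p ∈ F then a p else 0) t i j := by
  funext ω
  simp only [quad, ite_mul, zero_mul]
  rw [← Finset.sum_filter, Finset.filter_mem_eq_inter, Finset.inter_eq_right.2 hF]

theorem centredQuad_subset {F F' : Finset (ℤ × ℤ)} (hF : F ⊆ F') (a : ℤ × ℤ → ℂ) (t : ℝ)
    (i j : Fin n) :
    centredQuad P Z F a t i j = centredQuad P Z F' (fun p => if p ∈ F then a p else 0) t i j := by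
  funext ω
  simp only [centredQuad]
  rw [quad_subset hF]

namespace IsModeFamily

variable (hZ : IsModeFamily P G Z ρ C)

include hZ

/-- Reality of the process identifies `Z l` with the conjugate of `Z (-l)`, so orthogonality leaves
only the opposite frequency in the same component. -/
theorem integral_mul_eq {k l : ℤ} (hk : k ≠ 0) {t : ℝ} (ht : 0 ≤ t) (i j : Fin n) :
    ∫ ω, Z k t i ω * Z l t j ω ∂P = if i = j ∧ l = -k then (ρ k t : ℂ) else 0 := by
  have e : ∫ ω, Z k t i ω * Z l t j ω ∂P = ∫ ω, Z k t i ω * (starRingEnd ℂ) (Z (-l) t j ω) ∂P := by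
    refine integral_congr_ae ?_
    filter_upwards [hZ.conj_eq (-l) t j] with ω hω
    rw [hω, neg_neg]
  rw [e]
  split_ifs with hc
  · obtain ⟨rfl, rfl⟩ := hc
    rw [neg_neg, integral_mul_conj_self, hZ.sqMoment_eq k t i hk ht]
  · by_cases hij : i = j
    · exact hZ.orthogonal _ _ _ _ _ _ ht ht fun hkl => hc ⟨hij, by omega⟩
    · exact hZ.uncorrelated _ _ _ _ _ _ ht ht hij

theorem integral_quad_areaCoeff (N : ℕ) {t : ℝ} (ht : 0 ≤ t) (x y : ℝ) (i j : Fin n) :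
    ∫ ω, quad Z (freqBox N) (areaCoeff x y) t i j ω ∂P
      = if i = j then (truncatedMean ρ N t (y - x) : ℂ) else 0 := by
  have e1 : ∫ ω, quad Z (freqBox N) (areaCoeff x y) t i j ω ∂P
      = ∑ k ∈ Finset.Icc (-N : ℤ) N, ∑ l ∈ Finset.Icc (-N : ℤ) N,
        if i = j ∧ l = -k then areaKernel k (-k) x y * ρ k t else 0 := by
    simp only [quad]
    rw [integral_finsetSum _ fun p _ => (hZ.integrable_mul _ _ _ _ _ _).const_mul _, freqBox,
      Finset.sum_product]
    refine Finset.sum_congr rfl fun k _ => Finset.sum_congr rfl fun l _ => ?_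
    rw [integral_const_mul]
    by_cases hk : k = 0
    · rw [areaCoeff_eq_zero _ _ _ (Or.inl hk), hk, areaKernel_zero_left]
      simp
    · rw [hZ.integral_mul_eq hk ht]
      split_ifs with hc
      · obtain ⟨-, rfl⟩ := hc
        rfl
      · rw [mul_zero]
  rw [e1]
  split_ifs with hij
  · have e2 : ∀ k ∈ Finset.Icc (-N : ℤ) N, (∑ l ∈ Finset.Icc (-N : ℤ) N,
        if i = j ∧ l = -k then areaKernel k (-k) x y * (ρ k t : ℂ) else 0)
        = areaKernel k (-k) x y * ρ k t := by
      intro k hk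
      simp only [hij, true_and]
      rw [Finset.sum_ite_eq', if_pos]
      rw [Finset.mem_Icc] at hk ⊢
      omega
    rw [Finset.sum_congr rfl e2]
    have e3 : ∑ k ∈ Finset.Icc (-N : ℤ) N, areaKernel k (-k) x y * (ρ k t : ℂ)
        = ∑ k ∈ Finset.Icc (-N : ℤ) N, areaKernel (-k) k x y * (ρ k t : ℂ) := by
      refine Finset.sum_nbij' (fun k => -k) (fun k => -k) ?_ ?_ ?_ ?_ ?_
      · intro k hk
        rw [Finset.mem_Icc] at hk ⊢
        omega
      · intro k hk
        rw [Finset.mem_Icc] at hk ⊢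
        omega
      · intro k _
        exact neg_neg k
      · intro k _
        exact neg_neg k
      · intro k _
        rw [neg_neg, hZ.symm]
    -- The sum is averaged with its image under `k ↦ -k`, which preserves both the box and the
    -- variances.
    have e4 : 2 * ∑ k ∈ Finset.Icc (-N : ℤ) N, areaKernel k (-k) x y * (ρ k t : ℂ)
        = 2 * (truncatedMean ρ N t (y - x) : ℂ) := by
      nth_rewrite 1 [two_mul]
      nth_rewrite 2 [e3]
      rw [← Finset.sum_add_distrib, truncatedMean, Complex.ofReal_sum, Finset.mul_sum]
      refine Finset.sum_congr rfl fun k _ => ?_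
      rw [← add_mul, areaKernel_neg_add]
      push_cast
      ring
    exact mul_left_cancel₀ two_ne_zero e4
  · simp [hij]

theorem quad_eq_centredArea_add (N : ℕ) {t : ℝ} (ht : 0 ≤ t) (x y : ℝ) (i j : Fin n) (ω : Ω) :
    quad Z (freqBox N) (areaCoeff x y) t i j ω
      = centredArea P Z N t x y i j ω + if i = j then (truncatedMean ρ N t (y - x) : ℂ) else 0 := by
  rw [centredArea, centredQuad, hZ.integral_quad_areaCoeff N ht]
  ring

theorem centredArea_mem (N : ℕ) (t x y : ℝ) (i j : Fin n) :
    centredArea P Z N t x y i j ∈ chaosTwo G := hZ.centredQuad_mem _ _ _ _ _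

/-- The difference of two truncations is a quadratic form supported outside the smaller box, so its
variance is controlled by the tail of `areaWeight`. The growth in `|y - x|` is kept explicit because
the shifts are later integrated over the whole line. -/
theorem sqMoment_centredArea_sub_le [IsProbabilityMeasure P] {N M : ℕ} (hNM : N ≤ M) {t : ℝ}
    (ht : 0 ≤ t) (x y : ℝ) (i j : Fin n) :
    sqMoment P (fun ω => centredArea P Z M t x y i j ω - centredArea P Z N t x y i j ω)
      ≤ 8 * C ^ 2 * (1 + |y - x|) ^ 2 * weightTail N := by
  have e : ∀ ω, centredArea P Z M t x y i j ω - centredArea P Z N t x y i j ω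
      = centredQuad P Z (freqBox M)
        (fun p => areaCoeff x y p - if p ∈ freqBox N then areaCoeff x y p else 0) t i j ω := by
    intro ω
    rw [← hZ.centredQuad_sub, ← centredQuad_subset (freqBox_mono hNM)]
    rfl
  simp_rw [e]
  refine (hZ.sqMoment_centredQuad_le _ (fun p hp => ?_) ht i j).trans ?_
  · simp [areaCoeff_eq_zero _ _ p hp]
  have hterm : ∀ p ∈ freqBox M, ‖areaCoeff x y p - if p ∈ freqBox N then areaCoeff x y p else 0‖ ^ 2
      / ((p.1 : ℝ) ^ 2 * (p.2 : ℝ) ^ 2)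
      ≤ if p ∉ freqBox N then 4 * (1 + |y - x|) ^ 2 * areaWeight p else 0 := by
    intro p _
    by_cases hp : p ∈ freqBox N
    · simp [hp]
    · rw [if_neg hp, if_pos hp, sub_zero, div_eq_mul_one_div]
      exact norm_areaCoeff_sq_mul_le x y p (one_div_sq_mul_sq_le p)
  have h2 := Finset.sum_le_sum hterm
  rw [← Finset.sum_filter, ← Finset.mul_sum] at h2
  have h3 := sum_areaWeight_le_weightTail N (freqBox M)
  calc _ ≤ 2 * C ^ 2 * (4 * (1 + |y - x|) ^ 2 * weightTail N) := by
        refine mul_le_mul_of_nonneg_left (h2.trans ?_) (by positivity)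
        gcongr
    _ = _ := by ring

theorem sqMoment_centredArea_incr_le [IsProbabilityMeasure P] (N : ℕ) {R : ℝ} {t s x y x' y' : ℝ}
    (ht : 0 ≤ t) (hs : 0 ≤ s) (h : |y - x| ≤ R) (h' : |y' - x'| ≤ R) (i j : Fin n) :
    sqMoment P (fun ω => centredArea P Z N t x y i j ω - centredArea P Z N s x' y' i j ω)
      ≤ 64 * C ^ 2 * (1 + R) ^ 2 * (∑' p, areaWeight p) *
        (|t - s| ^ (1 / 8 : ℝ) + 2 * (|x - x'| + |y - y'|) ^ (1 / 4 : ℝ)) := by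
  have hR : 0 ≤ R := (abs_nonneg _).trans h
  have hmem : ∀ t x y, MemLp (centredArea P Z N t x y i j) 2 P := fun t x y =>
    memLp_chaosTwo hZ.gaussian hZ.centred (hZ.centredArea_mem N t x y i j)
  have e : ∀ ω, centredArea P Z N t x y i j ω - centredArea P Z N s x' y' i j ω
      = (centredArea P Z N t x y i j ω - centredArea P Z N s x y i j ω)
        + (centredArea P Z N s x y i j ω - centredArea P Z N s x' y' i j ω) := fun ω => by ring
  have hS : ∑ p ∈ freqBox N, areaWeight p ≤ ∑' p, areaWeight p :=
    summable_areaWeight.sum_le_tsum _ fun _ _ => areaWeight_nonneg _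
  have b1 : sqMoment P (fun ω => centredArea P Z N t x y i j ω - centredArea P Z N s x y i j ω)
      ≤ 32 * C ^ 2 * (1 + R) ^ 2 * (∑' p, areaWeight p) * |t - s| ^ (1 / 8 : ℝ) := by
    refine (hZ.sqMoment_centredQuad_incr_le (freqBox N) (areaCoeff_eq_zero x y) ht hs i j).trans ?_
    have hterm : ∀ p ∈ freqBox N, ‖areaCoeff x y p‖ ^ 2 *
        (|(p.1 : ℝ)| ^ (-(7 / 4) : ℝ) / (p.2 : ℝ) ^ 2
          + |(p.2 : ℝ)| ^ (-(7 / 4) : ℝ) / (p.1 : ℝ) ^ 2)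
        ≤ 8 * (1 + R) ^ 2 * areaWeight p := by
      intro p _
      have hw1 : |(p.1 : ℝ)| ^ (-(7 / 4) : ℝ) / (p.2 : ℝ) ^ 2
          ≤ |(p.1 : ℝ)| ^ (-(7 / 4) : ℝ) * |(p.2 : ℝ)| ^ (-(7 / 4) : ℝ) := by
        rw [div_eq_mul_one_div]
        gcongr
        exact one_div_sq_le_rpow _
      have hw2 : |(p.2 : ℝ)| ^ (-(7 / 4) : ℝ) / (p.1 : ℝ) ^ 2
          ≤ |(p.1 : ℝ)| ^ (-(7 / 4) : ℝ) * |(p.2 : ℝ)| ^ (-(7 / 4) : ℝ) := by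
        rw [div_eq_mul_one_div, mul_comm]
        gcongr
        exact one_div_sq_le_rpow _
      rw [mul_add]
      have a1 := norm_areaCoeff_sq_mul_le x y p hw1
      have a2 := norm_areaCoeff_sq_mul_le x y p hw2
      have a3 : 4 * (1 + |y - x|) ^ 2 * areaWeight p ≤ 4 * (1 + R) ^ 2 * areaWeight p := by
        have := areaWeight_nonneg p
        gcongr
      linarith
    have h2 := Finset.sum_le_sum hterm
    rw [← Finset.mul_sum] at h2
    calc _ ≤ 4 * C ^ 2 * |t - s| ^ (1 / 8 : ℝ) * (8 * (1 + R) ^ 2 * ∑' p, areaWeight p) := by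
          refine mul_le_mul_of_nonneg_left (h2.trans ?_) (by positivity)
          gcongr
      _ = _ := by ring
  have b2 : sqMoment P (fun ω => centredArea P Z N s x y i j ω - centredArea P Z N s x' y' i j ω)
      ≤ 64 * C ^ 2 * (1 + R) ^ 2 * (∑' p, areaWeight p) * (|x - x'| + |y - y'|) ^ (1 / 4 : ℝ) := by
    have e2 : ∀ ω, centredArea P Z N s x y i j ω - centredArea P Z N s x' y' i j ω
        = centredQuad P Z (freqBox N) (fun p => areaCoeff x y p - areaCoeff x' y' p) s i j ω :=
      fun ω => hZ.centredQuad_sub _ _ _ _ _ _ _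
    simp_rw [e2]
    refine (hZ.sqMoment_centredQuad_le _ (fun p hp => ?_) hs i j).trans ?_
    · rw [areaCoeff_eq_zero _ _ p hp, areaCoeff_eq_zero _ _ p hp, sub_zero]
    have h2 := Finset.sum_le_sum fun p (_ : p ∈ freqBox N) => norm_areaCoeff_sub_sq_le h h' p
    simp_rw [mul_one_div] at h2
    rw [← Finset.mul_sum] at h2
    calc _ ≤ 2 * C ^ 2 * (32 * (1 + R) ^ 2 * (|x - x'| + |y - y'|) ^ (1 / 4 : ℝ)
          * ∑' p, areaWeight p) := by
          refine mul_le_mul_of_nonneg_left (h2.trans ?_) (by positivity)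
          gcongr
      _ = _ := by ring
  simp_rw [e]
  refine (sqMoment_add_le ((hmem _ _ _).sub (hmem _ _ _)) ((hmem _ _ _).sub (hmem _ _ _))).trans ?_
  calc _ ≤ _ := add_le_add (mul_le_mul_of_nonneg_left b1 zero_le_two)
        (mul_le_mul_of_nonneg_left b2 zero_le_two)
    _ = _ := by ring

end IsModeFamily

end Area

/-! ### Existence of the area process -/

theorem norm_mul_one_sub_cos_le {ρ : ℤ → ℝ → ℝ} {C : ℝ} (h0 : ∀ k t, 0 ≤ t → 0 ≤ ρ k t)
    (hle : ∀ k t, k ≠ 0 → 0 ≤ t → ρ k t ≤ C / (k : ℝ) ^ 2) (hC : 0 ≤ C) (k : ℤ) {t : ℝ}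
    (ht : 0 ≤ t) (r : ℝ) :
    ‖ρ k t * (1 - Real.cos (k * r))‖ ≤ 2 * C * |(k : ℝ)| ^ (-2 : ℝ) := by
  by_cases hk : k = 0
  · subst hk
    simp only [Int.cast_zero, zero_mul, Real.cos_zero, sub_self, mul_zero, norm_zero]
    positivity
  have hcos : ‖1 - Real.cos (k * r)‖ ≤ 2 := by
    rw [Real.norm_eq_abs, abs_le]
    constructor <;> linarith [Real.cos_le_one (k * r), Real.neg_one_le_cos (k * r)]
  rw [norm_mul, Real.norm_of_nonneg (h0 k t ht)]
  calc ρ k t * ‖1 - Real.cos (k * r)‖ ≤ C / (k : ℝ) ^ 2 * 2 := by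
        refine mul_le_mul (hle k t hk ht) hcos (norm_nonneg _) (by positivity)
    _ = _ := by
        rw [Real.rpow_neg (abs_nonneg _), Real.rpow_two, sq_abs]
        ring

/-- The terms are dominated by a multiple of `k⁻²` uniformly in time and space, so the series is a
uniform limit of continuous functions. -/
theorem continuousOn_areaMean_of_summable {ρ : ℤ → ℝ → ℝ} {C : ℝ}
    (hc : ∀ k, ContinuousOn (ρ k) (Ici 0)) (h0 : ∀ k t, 0 ≤ t → 0 ≤ ρ k t)
    (hle : ∀ k t, k ≠ 0 → 0 ≤ t → ρ k t ≤ C / (k : ℝ) ^ 2) (hC : 0 ≤ C) :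
    ContinuousOn (fun q : ℝ × ℝ => areaMean ρ q.1 q.2) (Ici 0 ×ˢ univ) ∧
      ∀ t ≥ 0, ∀ r, Tendsto (fun N => truncatedMean ρ N t r) atTop (𝓝 (areaMean ρ t r)) := by
  have hs : Summable fun k : ℤ => 2 * C * |(k : ℝ)| ^ (-2 : ℝ) :=
    (summable_abs_rpow (by norm_num)).mul_left _
  have hb := fun k t (ht : (0 : ℝ) ≤ t) => norm_mul_one_sub_cos_le h0 hle hC k ht
  refine ⟨?_, fun t ht r => ?_⟩
  · refine continuousOn_tsum (fun k => ?_) hs fun k q hq => hb k q.1 hq.1 q.2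
    refine ContinuousOn.mul ((hc k).comp continuousOn_fst fun q hq => hq.1) ?_
    fun_prop
  · have hsum : Summable fun k : ℤ => ρ k t * (1 - Real.cos (k * r)) :=
      Summable.of_norm_bounded hs fun k => hb k t ht r
    have hIcc : Tendsto (fun N : ℕ => Finset.Icc (-N : ℤ) N) atTop atTop := by
      refine tendsto_atTop_finset_of_monotone (fun N M h k hk => ?_) fun k => ⟨k.natAbs, ?_⟩
      · rw [Finset.mem_Icc] at hk ⊢
        omega
      · rw [Finset.mem_Icc]
        omega
    exact hsum.hasSum.comp hIcc

/-! ### Limits in the second chaos -/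

section Chaos

variable {Ω : Type*} [MeasurableSpace Ω] {P : Measure Ω} {κ : Type*} {G : κ → Ω → ℝ}

/-- The limit need not be a polynomial in finitely many Gaussian variables, but the hypercontractive
bound is uniform along the sequence and survives the passage to the limit. -/
theorem lintegral_enorm_rpow_le_of_tendsto [IsProbabilityMeasure P] (hG : IsGaussianProcess G P)
    (h0 : ∀ a, ∫ ω, G a ω ∂P = 0) {V : ℕ → Ω → ℂ} (hV : ∀ N, V N ∈ chaosTwo G) {U : Ω → ℂ}
    (hU : AEStronglyMeasurable U P)
    (h : Tendsto (fun N => eLpNorm (fun ω => V N ω - U ω) 2 P) atTop (𝓝 0)) {b : ℝ}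
    (hb : ∀ N, sqMoment P (V N) ≤ b) {q : ℕ} (hq : 1 ≤ q) :
    ∫⁻ ω, ‖U ω‖ₑ ^ (2 * q : ℝ) ∂P
      ≤ (2 * chaosConst q : ℝ≥0∞) ^ (2 * q : ℝ) * ENNReal.ofReal (b ^ q) := by
  have hb0 : 0 ≤ b := (sqMoment_nonneg _).trans (hb 0)
  have h1 : eLpNorm U (2 * q : ℕ) P ≤ 2 * chaosConst q * ENNReal.ofReal √b := by
    refine eLpNorm_le_of_tendsto_eLpNorm (fun N => (memLp_chaosTwo hG h0 (hV N)).1) hU h fun N => ?_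
    refine (eLpNorm_chaosTwo_le hG h0 (hV N) hq).2.trans ?_
    rw [eLpNorm_two_eq (memLp_chaosTwo hG h0 (hV N))]
    gcongr
    exact hb N
  have hp : ((2 * q : ℕ) : ℝ≥0) ≠ 0 := by
    have : (0 : ℝ≥0) < (2 * q : ℕ) := by exact_mod_cast (by omega : 0 < 2 * q)
    exact this.ne'
  have h2 := eLpNorm_nnreal_pow_eq_lintegral (μ := P) (f := U) hp
  have e : (((2 * q : ℕ) : ℝ≥0) : ℝ) = 2 * q := by push_cast; ring
  rw [e] at h2
  rw [← h2]
  have e2 : (((2 * q : ℕ) : ℝ≥0) : ℝ≥0∞) = ((2 * q : ℕ) : ℝ≥0∞) := by push_cast; ring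
  rw [e2]
  calc _ ≤ (2 * chaosConst q * ENNReal.ofReal √b) ^ (2 * q : ℝ) := by gcongr
    _ = _ := by
        rw [ENNReal.mul_rpow_of_nonneg _ _ (by positivity),
          ENNReal.ofReal_rpow_of_nonneg (Real.sqrt_nonneg _) (by positivity)]
        congr 2
        rw [Real.rpow_mul (Real.sqrt_nonneg _), Real.rpow_two, Real.sq_sqrt hb0, Real.rpow_natCast]

theorem exists_tendsto_eLpNorm_of_sub_le {V : ℕ → Ω → ℂ} (hV : ∀ N, MemLp (V N) 2 P) {b : ℕ → ℝ}
    (hb : Tendsto b atTop (𝓝 0))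
    (h : ∀ N M, N ≤ M → eLpNorm (fun ω => V M ω - V N ω) 2 P ≤ ENNReal.ofReal (b N)) :
    ∃ U : Ω → ℂ, AEStronglyMeasurable U P ∧
      Tendsto (fun N => eLpNorm (fun ω => V N ω - U ω) 2 P) atTop (𝓝 0) := by
  have hc : CauchySeq fun N => (hV N).toLp (V N) := by
    refine cauchySeq_of_le_tendsto_0' (fun N => max (b N) 0) (fun N M hNM => ?_) ?_
    · rw [dist_comm, dist_edist, Lp.edist_toLp_toLp]
      refine ENNReal.toReal_le_of_le_ofReal (le_max_right _ _) ((h N M hNM).trans ?_)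
      exact ENNReal.ofReal_le_ofReal (le_max_left _ _)
    · simpa using hb.max (tendsto_const_nhds (x := (0 : ℝ)))
  obtain ⟨L, hL⟩ := cauchySeq_tendsto_of_complete hc
  refine ⟨L, Lp.aestronglyMeasurable L, ?_⟩
  rw [Lp.tendsto_Lp_iff_tendsto_eLpNorm'] at hL
  refine hL.congr fun N => eLpNorm_congr_ae ?_
  filter_upwards [(hV N).coeFn_toLp] with ω hω
  simp [hω]

end Chaos

/-! ### Continuous version of the area -/

section Area

variable {Ω : Type*} [MeasurableSpace Ω] {P : Measure Ω} {κ : Type*} {G : κ → Ω → ℝ} {n : ℕ}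
  {Z : ℤ → ℝ → Fin n → Ω → ℂ} {ρ : ℤ → ℝ → ℝ} {C : ℝ}

/-- The rate of convergence of the truncated area process. -/
def tailRate (C : ℝ) (N : ℕ) : ℝ := √(8 * C ^ 2 * weightTail N)

theorem tendsto_tailRate (C : ℝ) : Tendsto (tailRate C) atTop (𝓝 0) := by
  have := (tendsto_weightTail.const_mul (8 * C ^ 2)).sqrt
  rw [mul_zero, Real.sqrt_zero] at this
  exact this

namespace IsModeFamily

variable (hZ : IsModeFamily P G Z ρ C)

include hZ

theorem memLp_centredArea [IsProbabilityMeasure P] (N : ℕ) (t x y : ℝ) (i j : Fin n) :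
    MemLp (centredArea P Z N t x y i j) 2 P :=
  memLp_chaosTwo hZ.gaussian hZ.centred (hZ.centredArea_mem N t x y i j)

theorem eLpNorm_centredArea_sub_le [IsProbabilityMeasure P] {N M : ℕ} (hNM : N ≤ M) {t : ℝ}
    (ht : 0 ≤ t) (x y : ℝ) (i j : Fin n) :
    eLpNorm (fun ω => centredArea P Z M t x y i j ω - centredArea P Z N t x y i j ω) 2 P
      ≤ ENNReal.ofReal ((1 + |y - x|) * tailRate C N) := by
  have hm : MemLp (fun ω => centredArea P Z M t x y i j ω - centredArea P Z N t x y i j ω) 2 P :=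
    (hZ.memLp_centredArea M t x y i j).sub (hZ.memLp_centredArea N t x y i j)
  rw [eLpNorm_two_eq hm]
  refine ENNReal.ofReal_le_ofReal ?_
  refine (Real.sqrt_le_sqrt (hZ.sqMoment_centredArea_sub_le hNM ht x y i j)).trans (le_of_eq ?_)
  rw [show 8 * C ^ 2 * (1 + |y - x|) ^ 2 * weightTail N
    = (1 + |y - x|) ^ 2 * (8 * C ^ 2 * weightTail N) by ring, Real.sqrt_mul (by positivity),
    Real.sqrt_sq (by positivity), tailRate]

/-- The truncations are Cauchy in `L²`, and Kolmogorov's theorem in three parameters provides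
continuous paths. Writing `|u 0|` for the time extends the process to all of `ℝ³`, so that no
boundary has to be treated. -/
theorem exists_centredArea_limit [IsProbabilityMeasure P] (i j : Fin n) :
    ∃ U : (Fin 3 → ℝ) → Ω → ℂ, (∀ u, AEStronglyMeasurable (U u) P) ∧
      (∀ ω, Continuous fun u => U u ω) ∧
      ∀ u, Tendsto (fun N => eLpNorm (fun ω => centredArea P Z N |u 0| (u 1) (u 2) i j ω - U u ω) 2 P)
        atTop (𝓝 0) := by
  have hex : ∀ u : Fin 3 → ℝ, ∃ V : Ω → ℂ, AEStronglyMeasurable V P ∧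
      Tendsto (fun N => eLpNorm (fun ω => centredArea P Z N |u 0| (u 1) (u 2) i j ω - V ω) 2 P)
        atTop (𝓝 0) := fun u =>
    exists_tendsto_eLpNorm_of_sub_le (fun N => hZ.memLp_centredArea N _ _ _ i j)
      (b := fun N => (1 + |u 2 - u 1|) * tailRate C N)
      (by simpa using (tendsto_tailRate C).const_mul (1 + |u 2 - u 1|))
      fun N M hNM => hZ.eLpNorm_centredArea_sub_le hNM (abs_nonneg _) _ _ i j
  choose V hVm hV using hex
  have hC := hZ.const_nonneg
  have hS : 0 ≤ ∑' p, areaWeight p := tsum_nonneg areaWeight_nonneg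
  -- The variance of an increment of size `δ` is of order `δ^{1/8}`. The moment of order `64 = 2 *
  -- 32` is then of order `δ^{32/8} = δ^4`, exactly the exponent `3 + 1` required in dimension
  -- three.
  have hkol : ∀ R : ℕ, ∃ K : ℝ≥0∞, K < ⊤ ∧ KolmogorovOn P V (2 * (32 : ℕ)) K R := by
    intro R
    -- The factor is `320 = 64 * 5`: a time increment counts once, and the space increments count `2
    -- * 2` times after the replacement of `(2 δ)^{1/4}` by `2 δ^{1/8}`.
    set B : ℝ := 320 * C ^ 2 * (1 + 2 * R) ^ 2 * ∑' p, areaWeight p with hB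
    refine ⟨(2 * chaosConst 32 : ℝ≥0∞) ^ (2 * (32 : ℕ) : ℝ) * ENNReal.ofReal (B ^ 32), ?_, ?_⟩
    · refine ENNReal.mul_lt_top (ENNReal.rpow_lt_top_of_nonneg (by positivity) ?_)
        ENNReal.ofReal_lt_top
      exact ENNReal.mul_ne_top (by simp) (by simp)
    · intro u v hu hv huv
      set δ := ‖u - v‖ with hδ
      have hδ0 : 0 ≤ δ := norm_nonneg _
      have hcoord : ∀ i, |u i - v i| ≤ δ := fun i => norm_le_pi_norm (u - v) i
      have hR : ∀ w : Fin 3 → ℝ, (∀ i, |w i| ≤ R) → |w 2 - w 1| ≤ 2 * R := fun w hw => by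
        have := abs_sub (w 2) (w 1)
        linarith [hw 1, hw 2]
      have hb : ∀ N, sqMoment P (fun ω => centredArea P Z N |u 0| (u 1) (u 2) i j ω
          - centredArea P Z N |v 0| (v 1) (v 2) i j ω) ≤ B * δ ^ (1 / 8 : ℝ) := by
        intro N
        refine (hZ.sqMoment_centredArea_incr_le N (abs_nonneg _) (abs_nonneg _) (hR u hu) (hR v hv)
          i j).trans ?_
        have t1 : |(|u 0|) - (|v 0|)| ^ (1 / 8 : ℝ) ≤ δ ^ (1 / 8 : ℝ) := by
          gcongr
          exact (abs_abs_sub_abs_le_abs_sub _ _).trans (hcoord 0)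
        have t2 : (|u 1 - v 1| + |u 2 - v 2|) ^ (1 / 4 : ℝ) ≤ 2 * δ ^ (1 / 8 : ℝ) := by
          calc (|u 1 - v 1| + |u 2 - v 2|) ^ (1 / 4 : ℝ) ≤ (2 * δ) ^ (1 / 4 : ℝ) := by
                gcongr
                linarith [hcoord 1, hcoord 2]
            _ = 2 ^ (1 / 4 : ℝ) * δ ^ (1 / 4 : ℝ) := Real.mul_rpow (by norm_num) hδ0
            _ ≤ 2 ^ (1 : ℝ) * δ ^ (1 / 8 : ℝ) := by
                refine mul_le_mul ?_ ?_ (by positivity) (by positivity)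
                · exact Real.rpow_le_rpow_of_exponent_le (by norm_num) (by norm_num)
                · exact Real.rpow_le_rpow_of_exponent_ge' hδ0 huv (by norm_num) (by norm_num)
            _ = _ := by rw [Real.rpow_one]
        calc _ ≤ 64 * C ^ 2 * (1 + 2 * R) ^ 2 * (∑' p, areaWeight p) *
              (δ ^ (1 / 8 : ℝ) + 2 * (2 * δ ^ (1 / 8 : ℝ))) := by gcongr
          _ = _ := by
              rw [hB]
              ring
      have hlim : Tendsto (fun N => eLpNorm (fun ω =>
          (centredArea P Z N |u 0| (u 1) (u 2) i j ω - centredArea P Z N |v 0| (v 1) (v 2) i j ω)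
            - (V u ω - V v ω)) 2 P) atTop (𝓝 0) := by
        have hsum := (hV u).add (hV v)
        rw [add_zero] at hsum
        refine tendsto_of_tendsto_of_tendsto_of_le_of_le tendsto_const_nhds hsum
          (fun _ => zero_le) fun N => ?_
        have hm : ∀ w, AEStronglyMeasurable
            (fun ω => centredArea P Z N |w 0| (w 1) (w 2) i j ω - V w ω) P := fun w =>
          (hZ.memLp_centredArea N _ _ _ i j).1.sub (hVm w)
        have e : (fun ω => (centredArea P Z N |u 0| (u 1) (u 2) i j ω
            - centredArea P Z N |v 0| (v 1) (v 2) i j ω) - (V u ω - V v ω))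
            = (fun ω => centredArea P Z N |u 0| (u 1) (u 2) i j ω - V u ω)
              - fun ω => centredArea P Z N |v 0| (v 1) (v 2) i j ω - V v ω := by
          funext ω
          simp only [Pi.sub_apply]
          ring
        simp only
        rw [e]
        exact eLpNorm_sub_le (hm u) (hm v) (by norm_num)
      refine (lintegral_enorm_rpow_le_of_tendsto hZ.gaussian hZ.centred (fun N =>
        Submodule.sub_mem _ (hZ.centredArea_mem N _ _ _ i j) (hZ.centredArea_mem N _ _ _ i j))
        ((hVm u).sub (hVm v)) hlim hb (q := 32) (by norm_num)).trans (le_of_eq ?_)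
      rw [mul_assoc ((2 * chaosConst 32 : ℝ≥0∞) ^ (2 * (32 : ℕ) : ℝ)),
        ← ENNReal.ofReal_mul (by positivity)]
      congr 2
      rw [mul_pow, ← Real.rpow_natCast (δ ^ (1 / 8 : ℝ)), ← Real.rpow_mul hδ0, Fintype.card_fin,
        ← Real.rpow_natCast δ]
      norm_num
  obtain ⟨U, hUV, hUc⟩ := exists_continuous_modification hVm (p := 2 * (32 : ℕ)) (by norm_num) hkol
  refine ⟨U, fun u => (hVm u).congr (hUV u).symm, hUc, fun u => ?_⟩
  refine (hV u).congr fun N => eLpNorm_congr_ae ?_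
  filter_upwards [hUV u] with ω hω
  rw [hω]

theorem conj_quad_areaCoeff (N : ℕ) (t x y : ℝ) (i j : Fin n) :
    ∀ᵐ ω ∂P, (starRingEnd ℂ) (quad Z (freqBox N) (areaCoeff x y) t i j ω)
      = quad Z (freqBox N) (areaCoeff x y) t i j ω := by
  filter_upwards [ae_all_iff.2 fun k => hZ.conj_eq k t i, ae_all_iff.2 fun k => hZ.conj_eq k t j]
    with ω h1 h2
  simp only [quad, map_sum, map_mul, h1, h2, areaCoeff, conj_areaKernel]
  refine Finset.sum_nbij' (fun p => -p) (fun p => -p) ?_ ?_ ?_ ?_ ?_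
  · intro p hp
    simp only [freqBox, Finset.mem_product, Finset.mem_Icc, Prod.fst_neg, Prod.snd_neg] at hp ⊢
    omega
  · intro p hp
    simp only [freqBox, Finset.mem_product, Finset.mem_Icc, Prod.fst_neg, Prod.snd_neg] at hp ⊢
    omega
  · intro p _
    exact neg_neg p
  · intro p _
    exact neg_neg p
  · intro p _
    rfl

end IsModeFamily

/-- The centred truncations are almost surely real, so the real part of their continuous limit is
again a limit. Adding back the deterministic mean, which is continuous on its own, gives the area.
-/
theorem exists_isAreaProcess [IsProbabilityMeasure P] {W : Fin n → Lp ℝ 2 spaceTime → Ω → ℝ}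
    {f : ℝ → ℝ≥0∞} {h : ℝ → ℝ} {ε : ℝ} {ρ : ℤ → ℝ → ℝ}
    (hZ : IsModeFamily P G (fun k t i => modeCoeff W f h ε k t i) ρ C) :
    ∃ A, IsAreaProcess P W f h ε A := by
  set Z : ℤ → ℝ → Fin n → Ω → ℂ := fun k t i => modeCoeff W f h ε k t i with hZdef
  have hex := fun ij : Fin n × Fin n => hZ.exists_centredArea_limit ij.1 ij.2
  choose U hUm hUc hU using hex
  obtain ⟨hmc, hml⟩ := continuousOn_areaMean_of_summable hZ.continuousOn hZ.nonneg hZ.le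
    hZ.const_nonneg
  refine ⟨fun t x y ω => Matrix.of fun i j => (U (i, j) ![t, x, y] ω).re
    + if i = j then areaMean ρ t (y - x) else 0, fun t _ x y i j => ?_, fun t ht x y i j => ?_,
    Eventually.of_forall fun ω => ?_⟩
  · exact (Complex.continuous_re.comp_aestronglyMeasurable (hUm (i, j) _)).add
      aestronglyMeasurable_const
  · have hlim := hU (i, j) ![t, x, y]
    have e0 : |(![t, x, y] : Fin 3 → ℝ) 0| = t := abs_of_nonneg ht
    have e1 : (![t, x, y] : Fin 3 → ℝ) 1 = x := rfl
    have e2 : (![t, x, y] : Fin 3 → ℝ) 2 = y := rfl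
    simp only [e0, e1, e2] at hlim
    have hmean : Tendsto (fun N => ENNReal.ofReal
        |areaMean ρ t (y - x) - truncatedMean ρ N t (y - x)|) atTop (𝓝 0) := by
      have h1 := ((hml t ht (y - x)).const_sub (areaMean ρ t (y - x))).abs
      rw [sub_self, abs_zero] at h1
      simpa using ENNReal.tendsto_ofReal h1
    have hsum := hlim.add hmean
    rw [add_zero] at hsum
    refine tendsto_of_tendsto_of_tendsto_of_le_of_le tendsto_const_nhds hsum
      (fun _ => zero_le) fun N => ?_
    have hBm : AEStronglyMeasurable (fun ω => centredArea P Z N t x y i j ω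
        - U (i, j) ![t, x, y] ω) P :=
      (hZ.memLp_centredArea N _ _ _ i j).1.sub (hUm (i, j) _)
    have hle : ∀ᵐ ω ∂P, ‖((Matrix.of fun i j => (U (i, j) ![t, x, y] ω).re
        + if i = j then areaMean ρ t (y - x) else 0) i j : ℂ) - areaPartialSum W f h ε N t x y i j ω‖
        ≤ ‖(‖centredArea P Z N t x y i j ω - U (i, j) ![t, x, y] ω‖
          + |areaMean ρ t (y - x) - truncatedMean ρ N t (y - x)| : ℝ)‖ := by
      filter_upwards [hZ.conj_quad_areaCoeff N t x y i j] with ω hω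
      rw [Real.norm_of_nonneg (by positivity), areaPartialSum_eq]
      have hd := hZ.quad_eq_centredArea_add N ht x y i j ω
      have hreal : ((centredArea P Z N t x y i j ω).re : ℂ) = centredArea P Z N t x y i j ω := by
        refine Complex.conj_eq_iff_re.1 ?_
        rw [hd, map_add] at hω
        split_ifs at hω with hij
        · rw [Complex.conj_ofReal] at hω
          exact add_right_cancel hω
        · simpa using hω
      rw [← hZdef, hd, Matrix.of_apply]
      have e3 : (((U (i, j) ![t, x, y] ω).re + if i = j then areaMean ρ t (y - x) else 0 : ℝ) : ℂ)
          - (centredArea P Z N t x y i j ω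
            + if i = j then (truncatedMean ρ N t (y - x) : ℂ) else 0)
          = -(((centredArea P Z N t x y i j ω - U (i, j) ![t, x, y] ω).re : ℝ) : ℂ)
            + if i = j then ((areaMean ρ t (y - x) - truncatedMean ρ N t (y - x) : ℝ) : ℂ)
              else 0 := by
        rw [Complex.sub_re]
        nth_rewrite 1 [← hreal]
        split_ifs <;> push_cast <;> ring
      rw [e3]
      refine (norm_add_le _ _).trans (add_le_add ?_ ?_)
      · rw [norm_neg, Complex.norm_real]
        exact Complex.abs_re_le_norm _
      · split_ifs
        · rw [Complex.norm_real, Real.norm_eq_abs]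
        · simp
    refine (eLpNorm_mono_ae hle).trans ?_
    refine (eLpNorm_add_le (f := fun ω => ‖centredArea P Z N t x y i j ω
      - U (i, j) ![t, x, y] ω‖) (g := fun _ => |areaMean ρ t (y - x) - truncatedMean ρ N t (y - x)|)
      hBm.norm aestronglyMeasurable_const (by norm_num)).trans ?_
    refine add_le_add (le_of_eq (eLpNorm_norm _)) (le_of_eq ?_)
    rw [eLpNorm_const _ two_ne_zero (IsProbabilityMeasure.ne_zero P)]
    simp [Real.enorm_eq_ofReal_abs]
  · refine continuousOn_pi.2 fun i => continuousOn_pi.2 fun j => ?_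
    simp only [Matrix.of_apply]
    refine ContinuousOn.add ?_ ?_
    · refine Continuous.continuousOn ?_
      refine Complex.continuous_re.comp ((hUc (i, j) ω).comp ?_)
      refine continuous_pi fun m => ?_
      fin_cases m <;> simp <;> fun_prop
    · split_ifs
      · exact hmc.comp (f := fun q : ℝ × ℝ × ℝ => (q.1, q.2.2 - q.2.1)) (by fun_prop)
          fun q hq => ⟨hq.1, mem_univ _⟩
      · exact continuousOn_const

end Area

/-! ### The Fourier coefficients of the discrete derivative of the area process -/

/-- The coefficients, as a bilinear form in the modes, of the `m`-th Fourier coefficient of the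
discrete derivative of the area process. -/
def derivCoeff (ν : Measure ℝ) (σ : ℝ → ℝ) (ε : ℝ) (m : ℤ) (p : ℤ × ℤ) : ℂ :=
  if p.1 + p.2 = m then ∫ z, (ε⁻¹ * σ z : ℝ) * areaKernel p.1 p.2 0 (ε * z) ∂ν else 0

/-- The expected order of magnitude of the variance of the `m`-th Fourier coefficient. -/
def modeBound (ε : ℝ) (m : ℤ) : ℝ := min ε (1 / bracket m)

theorem modeBound_pos {ε : ℝ} (hε : 0 < ε) (m : ℤ) : 0 < modeBound ε m :=
  lt_min hε (one_div_pos.2 (bracket_pos m))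

section DerivCoeff

variable {ν : Measure ℝ} {σ : ℝ → ℝ} {ε : ℝ}

theorem derivCoeff_eq_zero (m : ℤ) (p : ℤ × ℤ) (hp : p.1 = 0 ∨ p.2 = 0) :
    derivCoeff ν σ ε m p = 0 := by
  rw [derivCoeff]
  split_ifs
  · rcases hp with hp | hp
    · simp [hp, areaKernel_zero_left]
    · simp [hp, areaKernel_zero_right]
  · rfl

/-- Each pointwise bound on the kernel over intervals of length `ε |z|` is integrated in the same
way, with the second moment of the measure absorbing growth up to order `z²`. -/
theorem norm_derivCoeff_le (hσ : ∀ z, |σ z| = 1) (hν : Integrable (fun z : ℝ => 1 + z ^ 2) ν)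
    (hε : 0 < ε) (m : ℤ) (p : ℤ × ℤ) {b : ℝ}
    (hb : ∀ z, ‖areaKernel p.1 p.2 0 (ε * z)‖ ≤ ε * b * (1 + z ^ 2)) :
    ‖derivCoeff ν σ ε m p‖ ≤ b * ∫ z, (1 + z ^ 2) ∂ν := by
  have hb0 : 0 ≤ b := by
    have := (norm_nonneg _).trans (hb 0)
    simp only [ne_eq, OfNat.ofNat_ne_zero, not_false_eq_true, zero_pow, add_zero, mul_one] at this
    exact nonneg_of_mul_nonneg_right this hε
  rw [derivCoeff]
  split_ifs
  · rw [← integral_const_mul]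
    refine norm_integral_le_of_norm_le (hν.const_mul b) (Eventually.of_forall fun z => ?_)
    rw [norm_mul, Complex.norm_real, norm_mul, Real.norm_eq_abs (σ z), hσ, mul_one, norm_inv,
      Real.norm_of_nonneg hε.le, inv_mul_le_iff₀ hε, ← mul_assoc]
    exact hb z
  · rw [norm_zero]
    exact mul_nonneg hb0 (integral_nonneg fun z => by positivity)

theorem abs_le_one_add_sq (z : ℝ) : |z| ≤ 1 + z ^ 2 := by
  rw [← sq_abs z]
  nlinarith [sq_nonneg (|z| - 1), abs_nonneg z]

variable (hσ : ∀ z, |σ z| = 1) (hν : Integrable (fun z : ℝ => 1 + z ^ 2) ν) (hε : 0 < ε)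

include hσ hν hε

theorem norm_derivCoeff_le_sq (m : ℤ) (p : ℤ × ℤ) :
    ‖derivCoeff ν σ ε m p‖ ≤ |(p.1 : ℝ)| * |(p.2 : ℝ)| * ε * ∫ z, (1 + z ^ 2) ∂ν := by
  refine norm_derivCoeff_le hσ hν hε m p fun z => ?_
  refine (norm_areaKernel_le_sq _ _ _ _).trans ?_
  rw [sub_zero, mul_pow]
  calc _ = ε * (|(p.1 : ℝ)| * |(p.2 : ℝ)| * ε) * z ^ 2 := by ring
    _ ≤ _ := by gcongr; linarith

theorem norm_derivCoeff_le_linear (m : ℤ) (p : ℤ × ℤ) :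
    ‖derivCoeff ν σ ε m p‖ ≤ 2 * |(p.2 : ℝ)| * ∫ z, (1 + z ^ 2) ∂ν := by
  refine norm_derivCoeff_le hσ hν hε m p fun z => ?_
  refine (norm_areaKernel_le_linear _ _ _ _).trans ?_
  rw [sub_zero, abs_mul, abs_of_pos hε]
  calc _ = ε * (2 * |(p.2 : ℝ)|) * |z| := by ring
    _ ≤ _ := by gcongr; exact abs_le_one_add_sq z

theorem norm_derivCoeff_le_div {m : ℤ} (hm : m ≠ 0) (p : ℤ × ℤ) :
    ‖derivCoeff ν σ ε m p‖ ≤ (2 * |(p.2 : ℝ)| / |(m : ℝ)| + 2) / ε * ∫ z, (1 + z ^ 2) ∂ν := by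
  by_cases hp : p.1 + p.2 = m
  · refine norm_derivCoeff_le hσ hν hε m p fun z => ?_
    refine (norm_areaKernel_le_div (by rwa [hp]) _ _).trans ?_
    rw [hp, mul_div_cancel₀ _ hε.ne']
    refine le_mul_of_one_le_right (by positivity) ?_
    nlinarith [sq_nonneg z]
  · rw [derivCoeff, if_neg hp, norm_zero]
    have : 0 ≤ ∫ z, (1 + z ^ 2) ∂ν := integral_nonneg fun z => by positivity
    positivity

end DerivCoeff

/-- On the line `k + l = m` one coordinate determines the other, so a sum over pairs is a sum over a
set of single frequencies. -/
theorem sum_antidiagonal_fst_le {g : ℤ → ℝ} {B : ℝ} (hg : ∀ S : Finset ℤ, ∑ k ∈ S, g k ≤ B)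
    (F : Finset (ℤ × ℤ)) (m : ℤ) : ∑ p ∈ F with p.1 + p.2 = m, g p.1 ≤ B := by
  have hinj : Set.InjOn Prod.fst (F.filter fun p => p.1 + p.2 = m : Set (ℤ × ℤ)) := by
    intro p hp q hq hpq
    have h1 := (Finset.mem_filter.1 (Finset.mem_coe.1 hp)).2
    have h2 := (Finset.mem_filter.1 (Finset.mem_coe.1 hq)).2
    exact Prod.ext hpq (by omega)
  rw [← Finset.sum_image (f := g) hinj]
  exact hg _

theorem sum_antidiagonal_snd_le {g : ℤ → ℝ} {B : ℝ} (hg : ∀ S : Finset ℤ, ∑ k ∈ S, g k ≤ B)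
    (F : Finset (ℤ × ℤ)) (m : ℤ) : ∑ p ∈ F with p.1 + p.2 = m, g p.2 ≤ B := by
  have hinj : Set.InjOn Prod.snd (F.filter fun p => p.1 + p.2 = m : Set (ℤ × ℤ)) := by
    intro p hp q hq hpq
    have h1 := (Finset.mem_filter.1 (Finset.mem_coe.1 hp)).2
    have h2 := (Finset.mem_filter.1 (Finset.mem_coe.1 hq)).2
    exact Prod.ext (by omega) hpq
  rw [← Finset.sum_image (f := g) hinj]
  exact hg _

theorem min_add_le {a x y : ℝ} (ha : 0 ≤ a) (hx : 0 ≤ x) (hy : 0 ≤ y) :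
    min a (x + y) ≤ min a x + min a y := by
  rcases le_total a x with h | h
  · rw [min_eq_left h]
    exact (min_le_left _ _).trans (le_add_of_nonneg_right (le_min ha hy))
  · rcases le_total a y with h' | h'
    · rw [min_eq_left h']
      exact (min_le_left _ _).trans (le_add_of_nonneg_left (le_min ha hx))
    · rw [min_eq_right h, min_eq_right h']
      exact min_le_right _ _

/-! ### Variance sums along an antidiagonal -/

section Sums

variable {ν : Measure ℝ} {σ : ℝ → ℝ} {ε : ℝ}

theorem sum_derivCoeff_filter (m : ℤ) (F : Finset (ℤ × ℤ)) (w : ℤ × ℤ → ℝ) :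
    ∑ p ∈ F, ‖derivCoeff ν σ ε m p‖ ^ 2 * w p
      = ∑ p ∈ F with p.1 + p.2 = m, ‖derivCoeff ν σ ε m p‖ ^ 2 * w p := by
  rw [Finset.sum_filter]
  refine Finset.sum_congr rfl fun p _ => ?_
  split_ifs with hp
  · rfl
  · rw [derivCoeff, if_neg hp]
    simp

variable (hσ : ∀ z, |σ z| = 1) (hν : Integrable (fun z : ℝ => 1 + z ^ 2) ν) (hε : 0 < ε)

include hσ hν hε

theorem norm_derivCoeff_div_le_min {m k l : ℤ} (hk : k ≠ 0) (hl : l ≠ 0) :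
    ‖derivCoeff ν σ ε m (k, l)‖ / (|(k : ℝ)| * |(l : ℝ)|)
      ≤ (∫ z, (1 + z ^ 2) ∂ν) * min ε (2 / |(k : ℝ)|) := by
  have hk' : 0 < |(k : ℝ)| := abs_pos.2 (by exact_mod_cast hk)
  have hl' : 0 < |(l : ℝ)| := abs_pos.2 (by exact_mod_cast hl)
  have hM0 : 0 ≤ ∫ z, (1 + z ^ 2) ∂ν := integral_nonneg fun z => by positivity
  rw [mul_min_of_nonneg _ _ hM0, le_min_iff]
  constructor
  · rw [div_le_iff₀ (by positivity)]
    exact (norm_derivCoeff_le_sq hσ hν hε m (k, l)).trans (le_of_eq (by ring))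
  · rw [div_le_iff₀ (by positivity)]
    exact (norm_derivCoeff_le_linear hσ hν hε m (k, l)).trans (le_of_eq (by field_simp))

/-- The oscillatory bound divided by `|k| |l|` is at most `4 (|k| + |l|) / (ε |m| |k| |l|)`, because
`|m| ≤ |k| + |l|`. This quotient splits into one term in `1 / |k|` and one in `1 / |l|`, each of
which can be summed separately. -/
theorem norm_derivCoeff_div_le_add {m k l : ℤ} (hm : m ≠ 0) (hk : k ≠ 0) (hl : l ≠ 0)
    (hkl : k + l = m) :
    ‖derivCoeff ν σ ε m (k, l)‖ / (|(k : ℝ)| * |(l : ℝ)|)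
      ≤ (∫ z, (1 + z ^ 2) ∂ν) * (min ε (4 / (ε * |(m : ℝ)|) / |(k : ℝ)|)
        + min ε (4 / (ε * |(m : ℝ)|) / |(l : ℝ)|)) := by
  have hk' : 0 < |(k : ℝ)| := abs_pos.2 (by exact_mod_cast hk)
  have hl' : 0 < |(l : ℝ)| := abs_pos.2 (by exact_mod_cast hl)
  have hm' : 0 < |(m : ℝ)| := abs_pos.2 (by exact_mod_cast hm)
  have hM0 : 0 ≤ ∫ z, (1 + z ^ 2) ∂ν := integral_nonneg fun z => by positivity
  have hadd : |(m : ℝ)| ≤ |(k : ℝ)| + |(l : ℝ)| := by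
    rw [← hkl]
    push_cast
    exact abs_add_le _ _
  refine le_trans ?_ (mul_le_mul_of_nonneg_left (min_add_le hε.le (by positivity) (by positivity)) hM0)
  rw [mul_min_of_nonneg _ _ hM0, le_min_iff, div_le_iff₀ (by positivity), div_le_iff₀ (by positivity)]
  constructor
  · exact (norm_derivCoeff_le_sq hσ hν hε m (k, l)).trans (le_of_eq (by ring))
  · refine (norm_derivCoeff_le_div hσ hν hε hm (k, l)).trans ?_
    rw [mul_comm, mul_assoc]
    refine mul_le_mul_of_nonneg_left ?_ hM0
    have e : (4 / (ε * |(m : ℝ)|) / |(k : ℝ)| + 4 / (ε * |(m : ℝ)|) / |(l : ℝ)|)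
        * (|(k : ℝ)| * |(l : ℝ)|) = 4 * (|(k : ℝ)| + |(l : ℝ)|) / (ε * |(m : ℝ)|) := by
      field_simp
      ring
    have e2 : (2 * |(l : ℝ)| / |(m : ℝ)| + 2) / ε = (2 * |(l : ℝ)| + 2 * |(m : ℝ)|) / (ε * |(m : ℝ)|) := by
      field_simp
    rw [e]
    simp only
    rw [e2]
    gcongr
    linarith

/-- This is the estimate that decides the rate. Sums of `(min a (b / |k|))²` are at most `8 a b`:
with `a = ε` and `b = 2` this gives the order `ε`, while `b = 4 / (ε |m|)` gives `1 / |m|`, the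
powers of `ε` cancelling. -/
theorem sum_derivCoeff_div_le (hε1 : ε ≤ 1) (m : ℤ) (F : Finset (ℤ × ℤ)) :
    ∑ p ∈ F, ‖derivCoeff ν σ ε m p‖ ^ 2 / ((p.1 : ℝ) ^ 2 * (p.2 : ℝ) ^ 2)
      ≤ 128 * (∫ z, (1 + z ^ 2) ∂ν) ^ 2 * modeBound ε m := by
  simp only [div_eq_mul_inv]
  rw [sum_derivCoeff_filter m F fun p => ((p.1 : ℝ) ^ 2 * (p.2 : ℝ) ^ 2)⁻¹]
  set M := ∫ z, (1 + z ^ 2) ∂ν with hM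
  have hsq : ∀ p : ℤ × ℤ, ‖derivCoeff ν σ ε m p‖ ^ 2 * ((p.1 : ℝ) ^ 2 * (p.2 : ℝ) ^ 2)⁻¹
      = (‖derivCoeff ν σ ε m p‖ / (|(p.1 : ℝ)| * |(p.2 : ℝ)|)) ^ 2 := fun p => by
    rw [div_pow, mul_pow, sq_abs, sq_abs, div_eq_mul_inv]
  have hA : ∑ p ∈ F with p.1 + p.2 = m,
      ‖derivCoeff ν σ ε m p‖ ^ 2 * ((p.1 : ℝ) ^ 2 * (p.2 : ℝ) ^ 2)⁻¹ ≤ 128 * M ^ 2 * ε := by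
    calc _ ≤ ∑ p ∈ F with p.1 + p.2 = m,
          (fun k : ℤ => M ^ 2 * if k = 0 then 0 else min ε (2 / |(k : ℝ)|) ^ 2) p.1 := by
          refine Finset.sum_le_sum fun p _ => ?_
          obtain ⟨k, l⟩ := p
          by_cases hz : k = 0 ∨ l = 0
          · rw [derivCoeff_eq_zero m (k, l) hz]
            simp only [norm_zero, ne_eq, OfNat.ofNat_ne_zero, not_false_eq_true, zero_pow, zero_mul]
            split_ifs <;> positivity
          · push Not at hz
            rw [hsq]
            simp only [hz.1, if_false]
            rw [← mul_pow]
            gcongr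
            exact norm_derivCoeff_div_le_min hσ hν hε hz.1 hz.2
      _ ≤ M ^ 2 * (8 * ε * 2) := by
          refine sum_antidiagonal_fst_le (g := fun k : ℤ =>
            M ^ 2 * if k = 0 then 0 else min ε (2 / |(k : ℝ)|) ^ 2) (fun S => ?_) F m
          rw [← Finset.mul_sum]
          exact mul_le_mul_of_nonneg_left (sum_min_sq_le hε two_pos S) (sq_nonneg _)
      _ ≤ _ := by nlinarith [mul_nonneg (sq_nonneg M) hε.le]
  rw [modeBound, mul_min_of_nonneg _ _ (by positivity), le_min_iff]
  refine ⟨hA, ?_⟩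
  -- For `m = 0` there is no oscillation, but `1 / bracket m = 1 ≥ ε` and the first bound suffices.
  by_cases hm : m = 0
  · have hb : bracket m = 1 := by simp [hm, bracket]
    rw [hb]
    refine hA.trans ?_
    gcongr
    simpa using hε1
  have hm' : 0 < |(m : ℝ)| := abs_pos.2 (by exact_mod_cast hm)
  set b : ℝ := 4 / (ε * |(m : ℝ)|) with hb
  have hb0 : 0 < b := by positivity
  set g : ℤ → ℝ := fun k => 2 * M ^ 2 * if k = 0 then 0 else min ε (b / |(k : ℝ)|) ^ 2 with hg
  have hgS : ∀ S : Finset ℤ, ∑ k ∈ S, g k ≤ 64 * M ^ 2 / |(m : ℝ)| := by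
    intro S
    rw [hg, ← Finset.mul_sum]
    refine (mul_le_mul_of_nonneg_left (sum_min_sq_le hε hb0 S) (by positivity)).trans (le_of_eq ?_)
    rw [hb]
    field_simp
    ring
  calc _ ≤ ∑ p ∈ F with p.1 + p.2 = m, (g p.1 + g p.2) := by
        refine Finset.sum_le_sum fun p hp => ?_
        obtain ⟨k, l⟩ := p
        have hkl : k + l = m := (Finset.mem_filter.1 hp).2
        by_cases hz : k = 0 ∨ l = 0
        · rw [derivCoeff_eq_zero m (k, l) hz]
          simp only [norm_zero, ne_eq, OfNat.ofNat_ne_zero, not_false_eq_true, zero_pow, zero_mul, hg]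
          split_ifs <;> positivity
        · push Not at hz
          rw [hsq]
          simp only [hg, hz.1, hz.2, if_false]
          calc _ ≤ (M * (min ε (b / |(k : ℝ)|) + min ε (b / |(l : ℝ)|))) ^ 2 := by
                gcongr
                exact norm_derivCoeff_div_le_add hσ hν hε hm hz.1 hz.2 hkl
            _ ≤ _ := by
                rw [mul_pow, mul_assoc, mul_assoc, ← mul_add, ← mul_add, mul_left_comm]
                refine mul_le_mul_of_nonneg_left ?_ (sq_nonneg _)
                exact add_sq_le
    _ = ∑ p ∈ F with p.1 + p.2 = m, g p.1 + ∑ p ∈ F with p.1 + p.2 = m, g p.2 :=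
        Finset.sum_add_distrib
    _ ≤ 64 * M ^ 2 / |(m : ℝ)| + 64 * M ^ 2 / |(m : ℝ)| :=
        add_le_add (sum_antidiagonal_fst_le hgS F m) (sum_antidiagonal_snd_le hgS F m)
    _ = _ := by
        rw [bracket_of_ne_zero hm]
        ring

-- The growth `|l|^{1/4}` left over in the second summand is shared between `k` and `m` through `|l|
-- ≤ 2 |k| ⟨m⟩`, so that the decay in `k` stays summable.
omit hσ hν hε in
theorem sq_mul_rpow_div_le {k l m : ℤ} (hk : k ≠ 0) (hl : l ≠ 0) (hkl : k + l = m) :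
    |(l : ℝ)| ^ 2 * (|(k : ℝ)| ^ (-(7 / 4) : ℝ) / (l : ℝ) ^ 2
      + |(l : ℝ)| ^ (-(7 / 4) : ℝ) / (k : ℝ) ^ 2)
      ≤ 3 * bracket m ^ (1 / 4 : ℝ) * |(k : ℝ)| ^ (-(7 / 4) : ℝ) := by
  have hk' : 0 < |(k : ℝ)| := abs_pos.2 (by exact_mod_cast hk)
  have hl' : 0 < |(l : ℝ)| := abs_pos.2 (by exact_mod_cast hl)
  have hb : 1 ≤ bracket m ^ (1 / 4 : ℝ) := Real.one_le_rpow (one_le_bracket m) (by norm_num)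
  have hK : 0 ≤ |(k : ℝ)| ^ (-(7 / 4) : ℝ) := by positivity
  rw [mul_add]
  have e1 : |(l : ℝ)| ^ 2 * (|(k : ℝ)| ^ (-(7 / 4) : ℝ) / (l : ℝ) ^ 2) = |(k : ℝ)| ^ (-(7 / 4) : ℝ) := by
    rw [← sq_abs (l : ℝ)]
    field_simp
  have e2 : |(l : ℝ)| ^ 2 * (|(l : ℝ)| ^ (-(7 / 4) : ℝ) / (k : ℝ) ^ 2)
      = |(l : ℝ)| ^ (1 / 4 : ℝ) * |(k : ℝ)| ^ (-2 : ℝ) := by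
    rw [mul_div_assoc', ← Real.rpow_two, ← Real.rpow_add hl', Real.rpow_neg (abs_nonneg _),
      Real.rpow_two, sq_abs, div_eq_mul_inv]
    norm_num
  have e3 : |(l : ℝ)| ^ (1 / 4 : ℝ) ≤ 2 * (|(k : ℝ)| ^ (1 / 4 : ℝ) * bracket m ^ (1 / 4 : ℝ)) := by
    calc |(l : ℝ)| ^ (1 / 4 : ℝ) ≤ (2 * (|(k : ℝ)| * bracket m)) ^ (1 / 4 : ℝ) := by
          gcongr
          rw [← hkl]
          exact abs_le_two_mul_bracket hk l
      _ = 2 ^ (1 / 4 : ℝ) * (|(k : ℝ)| ^ (1 / 4 : ℝ) * bracket m ^ (1 / 4 : ℝ)) := by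
          rw [Real.mul_rpow (by norm_num) (mul_nonneg hk'.le (bracket_pos m).le),
            Real.mul_rpow hk'.le (bracket_pos m).le]
      _ ≤ 2 ^ (1 : ℝ) * (|(k : ℝ)| ^ (1 / 4 : ℝ) * bracket m ^ (1 / 4 : ℝ)) := by
          have := (bracket_pos m).le
          gcongr
          · norm_num
          · norm_num
      _ = _ := by rw [Real.rpow_one]
  have e4 : |(k : ℝ)| ^ (1 / 4 : ℝ) * |(k : ℝ)| ^ (-2 : ℝ) = |(k : ℝ)| ^ (-(7 / 4) : ℝ) := by
    rw [← Real.rpow_add hk']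
    norm_num
  rw [e1, e2]
  calc _ ≤ |(k : ℝ)| ^ (-(7 / 4) : ℝ) * bracket m ^ (1 / 4 : ℝ)
        + 2 * (|(k : ℝ)| ^ (1 / 4 : ℝ) * bracket m ^ (1 / 4 : ℝ)) * |(k : ℝ)| ^ (-2 : ℝ) := by
        gcongr
        exact le_mul_of_one_le_right hK hb
    _ = |(k : ℝ)| ^ (-(7 / 4) : ℝ) * bracket m ^ (1 / 4 : ℝ)
        + 2 * (|(k : ℝ)| ^ (1 / 4 : ℝ) * |(k : ℝ)| ^ (-2 : ℝ)) * bracket m ^ (1 / 4 : ℝ) := by ring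
    _ = _ := by
        rw [e4]
        ring

/-- The linear bound on the coefficients suffices here. No smallness in `ε` is gained, and the price
is a power `1/4` of the frequency; both are harmless because the increment estimate is only used
with a small exponent. -/
theorem sum_derivCoeff_mul_rpow_le (m : ℤ) (F : Finset (ℤ × ℤ)) :
    ∑ p ∈ F, ‖derivCoeff ν σ ε m p‖ ^ 2 * (|(p.1 : ℝ)| ^ (-(7 / 4) : ℝ) / (p.2 : ℝ) ^ 2
      + |(p.2 : ℝ)| ^ (-(7 / 4) : ℝ) / (p.1 : ℝ) ^ 2)
      ≤ 12 * (∫ z, (1 + z ^ 2) ∂ν) ^ 2 * (∑' k : ℤ, |(k : ℝ)| ^ (-(7 / 4) : ℝ))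
        * bracket m ^ (1 / 4 : ℝ) := by
  rw [sum_derivCoeff_filter m F]
  set M := ∫ z, (1 + z ^ 2) ∂ν with hM
  have hb := (bracket_pos m).le
  calc _ ≤ ∑ p ∈ F with p.1 + p.2 = m, (fun k : ℤ => 12 * M ^ 2 * bracket m ^ (1 / 4 : ℝ)
          * |(k : ℝ)| ^ (-(7 / 4) : ℝ)) p.1 := by
        refine Finset.sum_le_sum fun p hp => ?_
        obtain ⟨k, l⟩ := p
        have hkl : k + l = m := (Finset.mem_filter.1 hp).2
        by_cases hz : k = 0 ∨ l = 0
        · rw [derivCoeff_eq_zero m (k, l) hz]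
          simp only [norm_zero, ne_eq, OfNat.ofNat_ne_zero, not_false_eq_true, zero_pow, zero_mul]
          positivity
        · push Not at hz
          calc _ ≤ (2 * |(l : ℝ)| * M) ^ 2 * (|(k : ℝ)| ^ (-(7 / 4) : ℝ) / (l : ℝ) ^ 2
                + |(l : ℝ)| ^ (-(7 / 4) : ℝ) / (k : ℝ) ^ 2) := by
                gcongr
                exact norm_derivCoeff_le_linear hσ hν hε m (k, l)
            _ = 4 * M ^ 2 * (|(l : ℝ)| ^ 2 * (|(k : ℝ)| ^ (-(7 / 4) : ℝ) / (l : ℝ) ^ 2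
                + |(l : ℝ)| ^ (-(7 / 4) : ℝ) / (k : ℝ) ^ 2)) := by ring
            _ ≤ 4 * M ^ 2 * (3 * bracket m ^ (1 / 4 : ℝ) * |(k : ℝ)| ^ (-(7 / 4) : ℝ)) := by
                exact mul_le_mul_of_nonneg_left (sq_mul_rpow_div_le hz.1 hz.2 hkl) (by positivity)
            _ = _ := by ring
    _ ≤ 12 * M ^ 2 * bracket m ^ (1 / 4 : ℝ) * ∑' k : ℤ, |(k : ℝ)| ^ (-(7 / 4) : ℝ) := by
        refine sum_antidiagonal_fst_le (g := fun k : ℤ => 12 * M ^ 2 * bracket m ^ (1 / 4 : ℝ)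
          * |(k : ℝ)| ^ (-(7 / 4) : ℝ)) (fun S => ?_) F m
        rw [← Finset.mul_sum]
        refine mul_le_mul_of_nonneg_left ?_ (by positivity)
        exact (summable_abs_rpow (by norm_num)).sum_le_tsum S fun k _ => by positivity
    _ = _ := by ring

end Sums

section Moments

variable {Ω : Type*} [MeasurableSpace Ω] {P : Measure Ω} [IsProbabilityMeasure P] {κ : Type*}
  {G : κ → Ω → ℝ} {n : ℕ} {Z : ℤ → ℝ → Fin n → Ω → ℂ} {ρ : ℤ → ℝ → ℝ} {C : ℝ}
  {ν : Measure ℝ} {σ : ℝ → ℝ} {ε : ℝ}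

theorem IsModeFamily.sqMoment_derivCoeff_le (hZ : IsModeFamily P G Z ρ C) (hσ : ∀ z, |σ z| = 1)
    (hν : Integrable (fun z : ℝ => 1 + z ^ 2) ν) (hε : 0 < ε) (hε1 : ε ≤ 1) (m : ℤ)
    (F : Finset (ℤ × ℤ)) {t : ℝ} (ht : 0 ≤ t) (i j : Fin n) :
    sqMoment P (centredQuad P Z F (derivCoeff ν σ ε m) t i j)
      ≤ 256 * C ^ 2 * (∫ z, (1 + z ^ 2) ∂ν) ^ 2 * modeBound ε m := by
  refine (hZ.sqMoment_centredQuad_le F (derivCoeff_eq_zero m) ht i j).trans ?_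
  refine (mul_le_mul_of_nonneg_left (sum_derivCoeff_div_le hσ hν hε hε1 m F)
    (by positivity)).trans (le_of_eq (by ring))

theorem IsModeFamily.sqMoment_derivCoeff_incr_le (hZ : IsModeFamily P G Z ρ C)
    (hσ : ∀ z, |σ z| = 1) (hν : Integrable (fun z : ℝ => 1 + z ^ 2) ν) (hε : 0 < ε) (m : ℤ)
    (F : Finset (ℤ × ℤ)) {t s : ℝ} (ht : 0 ≤ t) (hs : 0 ≤ s) (i j : Fin n) :
    sqMoment P (fun ω => centredQuad P Z F (derivCoeff ν σ ε m) t i j ω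
        - centredQuad P Z F (derivCoeff ν σ ε m) s i j ω)
      ≤ 48 * C ^ 2 * (∫ z, (1 + z ^ 2) ∂ν) ^ 2 * (∑' k : ℤ, |(k : ℝ)| ^ (-(7 / 4) : ℝ))
        * |t - s| ^ (1 / 8 : ℝ) * bracket m ^ (1 / 4 : ℝ) := by
  refine (hZ.sqMoment_centredQuad_incr_le F (derivCoeff_eq_zero m) ht hs i j).trans ?_
  refine (mul_le_mul_of_nonneg_left (sum_derivCoeff_mul_rpow_le hσ hν hε m F)
    (by positivity)).trans (le_of_eq (by ring))

end Moments

/-! ### The discrete derivative of the centred area process -/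

/-- `V` is a version with continuous paths of the limit of the centred truncated areas. -/
structure IsAreaLimit {Ω : Type*} [MeasurableSpace Ω] (P : Measure Ω) {n : ℕ}
    (Z : ℤ → ℝ → Fin n → Ω → ℂ) (i j : Fin n) (V : ℝ → ℝ → ℝ → Ω → ℂ) : Prop where
  aestronglyMeasurable : ∀ t ≥ 0, ∀ x y, AEStronglyMeasurable (V t x y) P
  tendsto : ∀ t ≥ 0, ∀ x y, Tendsto
    (fun N => eLpNorm (fun ω => centredArea P Z N t x y i j ω - V t x y ω) 2 P) atTop (𝓝 0)
  continuous_paths : ∀ᵐ ω ∂P,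
    ContinuousOn (fun q : ℝ × ℝ × ℝ => V q.1 q.2.1 q.2.2 ω) (Ici (0 : ℝ) ×ˢ univ)

section Limit

variable {Ω : Type*} [MeasurableSpace Ω] {P : Measure Ω} [IsProbabilityMeasure P] {κ : Type*}
  {G : κ → Ω → ℝ} {n : ℕ} {Z : ℤ → ℝ → Fin n → Ω → ℂ} {ρ : ℤ → ℝ → ℝ} {C : ℝ}

/-- The area process, centred. -/
def centredPath (A : ℝ → ℝ → ℝ → Ω → Matrix (Fin n) (Fin n) ℝ) (ρ : ℤ → ℝ → ℝ) (i j : Fin n)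
    (t x y : ℝ) (ω : Ω) : ℂ :=
  ((A t x y ω i j - if i = j then areaMean ρ t (y - x) else 0 : ℝ) : ℂ)

omit [IsProbabilityMeasure P] in
theorem centredQuad_eq_sum (hZ : IsModeFamily P G Z ρ C) (F : Finset (ℤ × ℤ)) (a : ℤ × ℤ → ℂ)
    (t : ℝ) (i j : Fin n) (ω : Ω) : centredQuad P Z F a t i j ω
      = ∑ p ∈ F, a p * (Z p.1 t i ω * Z p.2 t j ω - ∫ ω', Z p.1 t i ω' * Z p.2 t j ω' ∂P) := by
  simp only [centredQuad, quad]
  rw [integral_finsetSum _ fun p _ => (hZ.integrable_mul _ _ _ _ _ _).const_mul _,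
    ← Finset.sum_sub_distrib]
  refine Finset.sum_congr rfl fun p _ => ?_
  rw [integral_const_mul, mul_sub]

/-- The truncated means converge to `areaMean`, so subtracting the respective means preserves
convergence in `L²`, and the continuity of the mean preserves that of the paths. -/
theorem IsAreaProcess.isAreaLimit {W : Fin n → Lp ℝ 2 spaceTime → Ω → ℝ} {f : ℝ → ℝ≥0∞}
    {h : ℝ → ℝ} {ε : ℝ} (hZ : IsModeFamily P G (fun k t i => modeCoeff W f h ε k t i) ρ C)
    {A : ℝ → ℝ → ℝ → Ω → Matrix (Fin n) (Fin n) ℝ} (hA : IsAreaProcess P W f h ε A) (i j : Fin n) :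
    IsAreaLimit P (fun k t i => modeCoeff W f h ε k t i) i j (centredPath A ρ i j) := by
  obtain ⟨hmc, hml⟩ := continuousOn_areaMean_of_summable hZ.continuousOn hZ.nonneg hZ.le
    hZ.const_nonneg
  refine ⟨fun t ht x y => ?_, fun t ht x y => ?_, ?_⟩
  · exact Complex.continuous_ofReal.comp_aestronglyMeasurable
      ((hA.aestronglyMeasurable t ht x y i j).sub aestronglyMeasurable_const)
  · have hmean : Tendsto (fun N => ENNReal.ofReal
        |areaMean ρ t (y - x) - truncatedMean ρ N t (y - x)|) atTop (𝓝 0) := by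
      have h1 := ((hml t ht (y - x)).const_sub (areaMean ρ t (y - x))).abs
      rw [sub_self, abs_zero] at h1
      simpa using ENNReal.tendsto_ofReal h1
    have hsum := (hA.tendsto_L2 t ht x y i j).add hmean
    rw [add_zero] at hsum
    refine tendsto_of_tendsto_of_tendsto_of_le_of_le tendsto_const_nhds hsum
      (fun _ => zero_le) fun N => ?_
    have hm : AEStronglyMeasurable (fun ω => (A t x y ω i j : ℂ)
        - areaPartialSum W f h ε N t x y i j ω) P := by
      refine (Complex.continuous_ofReal.comp_aestronglyMeasurable
        (hA.aestronglyMeasurable t ht x y i j)).sub ?_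
      have : areaPartialSum W f h ε N t x y i j
          = quad (fun k t i => modeCoeff W f h ε k t i) (freqBox N) (areaCoeff x y) t i j :=
        areaPartialSum_eq N t x y i j
      rw [this]
      exact (hZ.integrable_quad _ _ _ _ _).1
    set d : ℂ := if i = j then ((areaMean ρ t (y - x) - truncatedMean ρ N t (y - x) : ℝ) : ℂ) else 0
    have hd : ‖d‖ₑ ≤ ENNReal.ofReal |areaMean ρ t (y - x) - truncatedMean ρ N t (y - x)| := by
      simp only [d]
      split_ifs
      · rw [← ofReal_norm, Complex.norm_real, Real.norm_eq_abs]
      · simp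
    have e : (fun ω => centredArea P (fun k t i => modeCoeff W f h ε k t i) N t x y i j ω
        - centredPath A ρ i j t x y ω)
        = (fun _ => d) - fun ω => (A t x y ω i j : ℂ) - areaPartialSum W f h ε N t x y i j ω := by
      funext ω
      have h1 := hZ.quad_eq_centredArea_add N ht x y i j ω
      have h2 : areaPartialSum W f h ε N t x y i j ω = _ :=
        congrFun (areaPartialSum_eq N t x y i j) ω
      simp only [Pi.sub_apply]
      rw [h2, h1]
      simp only [centredPath, d]
      split_ifs <;> push_cast <;> ring
    simp only
    rw [e]
    refine (eLpNorm_sub_le aestronglyMeasurable_const hm (by norm_num)).trans ?_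
    rw [add_comm]
    refine add_le_add le_rfl ?_
    rw [eLpNorm_const _ two_ne_zero (IsProbabilityMeasure.ne_zero P)]
    simpa using hd
  · filter_upwards [hA.continuous_paths] with ω hω
    refine Complex.continuous_ofReal.comp_continuousOn (ContinuousOn.sub ?_ ?_)
    · exact continuousOn_pi.1 (continuousOn_pi.1 hω i) j
    · split_ifs
      · exact hmc.comp (f := fun q : ℝ × ℝ × ℝ => (q.1, q.2.2 - q.2.1)) (by fun_prop)
          fun q hq => ⟨hq.1, mem_univ _⟩
      · exact continuousOn_const

variable {i j : Fin n} {V : ℝ → ℝ → ℝ → Ω → ℂ}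

namespace IsAreaLimit

variable (hZ : IsModeFamily P G Z ρ C) (hV : IsAreaLimit P Z i j V)

include hZ hV

theorem eLpNorm_sub_le (N : ℕ) {t : ℝ} (ht : 0 ≤ t) (x y : ℝ) :
    eLpNorm (fun ω => centredArea P Z N t x y i j ω - V t x y ω) 2 P
      ≤ ENNReal.ofReal ((1 + |y - x|) * tailRate C N) := by
  have hB := fun N => (hZ.memLp_centredArea N t x y i j).1
  have hVm := hV.aestronglyMeasurable t ht x y
  refine eLpNorm_le_of_tendsto_eLpNorm (V := fun M ω => centredArea P Z N t x y i j ω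
    - centredArea P Z (M + N) t x y i j ω) (fun M => (hB N).sub (hB (M + N))) ((hB N).sub hVm)
    ?_ fun M => ?_
  · refine ((tendsto_add_atTop_iff_nat N).2 (hV.tendsto t ht x y)).congr fun M => ?_
    rw [← eLpNorm_neg]
    congr 1
    funext ω
    simp only [Pi.neg_apply, Pi.sub_apply]
    ring
  · refine le_trans (le_of_eq ?_) (hZ.eLpNorm_centredArea_sub_le (Nat.le_add_left N M) ht x y i j)
    rw [← eLpNorm_neg]
    congr 1
    funext ω
    simp

/-- The additivity over a period is an algebraic identity for every truncation, and it survives in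
the `L²` limit. -/
theorem ae_add_two_pi {t : ℝ} (ht : 0 ≤ t) (x y : ℝ) :
    ∀ᵐ ω ∂P, V t x (y + 2 * Real.pi) ω - V t x y ω - V t 0 (2 * Real.pi) ω = 0 := by
  have hB := fun N x y => (hZ.memLp_centredArea N t x y i j).1
  have hVm := fun x y => hV.aestronglyMeasurable t ht x y
  have hzero : eLpNorm (fun ω => V t x (y + 2 * Real.pi) ω - V t x y ω - V t 0 (2 * Real.pi) ω) 2 P
      ≤ 0 := by
    have hsum := ((hV.tendsto t ht x (y + 2 * Real.pi)).add (hV.tendsto t ht x y)).add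
      (hV.tendsto t ht 0 (2 * Real.pi))
    simp only [add_zero] at hsum
    refine ge_of_tendsto' hsum fun N => ?_
    have e : (fun ω => V t x (y + 2 * Real.pi) ω - V t x y ω - V t 0 (2 * Real.pi) ω)
        = (fun ω => centredArea P Z N t x y i j ω - V t x y ω)
          - (fun ω => centredArea P Z N t x (y + 2 * Real.pi) i j ω - V t x (y + 2 * Real.pi) ω)
          + fun ω => centredArea P Z N t 0 (2 * Real.pi) i j ω - V t 0 (2 * Real.pi) ω := by
      funext ω
      have : centredArea P Z N t x (y + 2 * Real.pi) i j ω
          = centredArea P Z N t x y i j ω + centredArea P Z N t 0 (2 * Real.pi) i j ω := by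
        simp only [centredArea, centredQuad_eq_sum hZ, areaCoeff, areaKernel_add_two_pi, add_mul,
          Finset.sum_add_distrib]
      simp only [Pi.sub_apply, Pi.add_apply, this]
      ring
    rw [e]
    refine (eLpNorm_add_le (((hB _ _ _).sub (hVm _ _)).sub ((hB _ _ _).sub (hVm _ _)))
      ((hB _ _ _).sub (hVm _ _)) (by norm_num)).trans (add_le_add ?_ le_rfl)
    refine (MeasureTheory.eLpNorm_sub_le ((hB _ _ _).sub (hVm _ _)) ((hB _ _ _).sub (hVm _ _))
      (by norm_num)).trans (le_of_eq (add_comm _ _))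
  exact (eLpNorm_eq_zero_iff (((hVm _ _).sub (hVm _ _)).sub (hVm _ _)) two_ne_zero).1
    (le_antisymm hzero zero_le)

/-- A countable dense set of parameters has a common exceptional null set, and continuity of the
paths extends the identity to all parameters. The absolute value keeps the time nonnegative on that
dense set. -/
theorem ae_forall_add_two_pi : ∀ᵐ ω ∂P, ∀ t ≥ 0, ∀ x y,
    V t x (y + 2 * Real.pi) ω = V t x y ω + V t 0 (2 * Real.pi) ω := by
  obtain ⟨s, hsc, hsd⟩ := TopologicalSpace.exists_countable_dense (ℝ × ℝ × ℝ)
  have h1 : ∀ᵐ ω ∂P, ∀ q ∈ s, V |q.1| q.2.1 (q.2.2 + 2 * Real.pi) ω - V |q.1| q.2.1 q.2.2 ω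
      - V |q.1| 0 (2 * Real.pi) ω = 0 :=
    (ae_ball_iff hsc).2 fun q _ => hV.ae_add_two_pi hZ (abs_nonneg q.1) q.2.1 q.2.2
  filter_upwards [h1, hV.continuous_paths] with ω h1 hc t ht x y
  have hcomp : ∀ g : ℝ × ℝ × ℝ → ℝ × ℝ, Continuous g →
      Continuous fun q : ℝ × ℝ × ℝ => V |q.1| (g q).1 (g q).2 ω := fun g hg =>
    hc.comp_continuous (f := fun q : ℝ × ℝ × ℝ => (|q.1|, g q)) (by fun_prop)
      fun q => ⟨abs_nonneg q.1, mem_univ _⟩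
  have hcont : Continuous fun q : ℝ × ℝ × ℝ => V |q.1| q.2.1 (q.2.2 + 2 * Real.pi) ω
      - V |q.1| q.2.1 q.2.2 ω - V |q.1| 0 (2 * Real.pi) ω :=
    ((hcomp (fun q => (q.2.1, q.2.2 + 2 * Real.pi)) (by fun_prop)).sub
      (hcomp (fun q => (q.2.1, q.2.2)) (by fun_prop))).sub
      (hcomp (fun _ => (0, 2 * Real.pi)) (by fun_prop))
  have h0 := congrFun (hcont.ext_on hsd continuous_const (g := fun _ => (0 : ℂ)) h1) (t, x, y)
  simp only [abs_of_nonneg ht] at h0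
  linear_combination h0

/-- Continuity bounds the area on the compact set covering one period, and every further period adds
the same amount. The linear growth makes the area integrable against the measure of the shifts,
which has a second moment. -/
theorem ae_exists_bound (T : ℝ) : ∀ᵐ ω ∂P, ∃ K ≥ 0, ∀ t ∈ Icc 0 T,
    ∀ x ∈ Icc (-Real.pi) Real.pi, ∀ r, ‖V t x (x + r) ω‖ ≤ K * (1 + |r|) := by
  filter_upwards [hV.ae_forall_add_two_pi hZ, hV.continuous_paths] with ω hq hc
  have hcpt : IsCompact (Icc 0 T ×ˢ Icc (-Real.pi) Real.pi ×ˢ Icc (-Real.pi) (3 * Real.pi)) :=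
    isCompact_Icc.prod (isCompact_Icc.prod isCompact_Icc)
  obtain ⟨K, hK⟩ := hcpt.exists_bound_of_continuousOn
    (hc.mono (prod_mono (fun t ht => ht.1) (subset_univ _)))
  have hpi := Real.pi_pos
  have hK0 : 0 ≤ max K 0 := le_max_right _ _
  refine ⟨3 * max K 0, by positivity, fun t ht x hx r => ?_⟩
  have hper : ∀ (m : ℤ) (y : ℝ), V t x (y + m * (2 * Real.pi)) ω
      = V t x y ω + m * V t 0 (2 * Real.pi) ω := by
    intro m y
    induction m with
    | zero => simp
    | succ m ih =>
      have := hq t ht.1 x (y + m * (2 * Real.pi))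
      push_cast at ih ⊢
      rw [show y + (m + 1) * (2 * Real.pi) = y + m * (2 * Real.pi) + 2 * Real.pi by ring, this, ih]
      ring
    | pred m ih =>
      have := hq t ht.1 x (y + (-m - 1) * (2 * Real.pi))
      push_cast at ih ⊢
      rw [show y + (-m - 1) * (2 * Real.pi) + 2 * Real.pi = y + -m * (2 * Real.pi) by ring, ih]
        at this
      linear_combination -this
  set m : ℤ := ⌊r / (2 * Real.pi)⌋ with hm
  set r0 := r - m * (2 * Real.pi) with hr0
  have h1 : 0 ≤ r0 := by
    have := (le_div_iff₀ (by positivity)).1 (Int.floor_le (r / (2 * Real.pi)))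
    rw [hr0]
    linarith
  have h2 : r0 ≤ 2 * Real.pi := by
    have := (div_lt_iff₀ (by positivity)).1 (Int.lt_floor_add_one (r / (2 * Real.pi)))
    rw [hr0]
    linarith
  have hmr : |(m : ℝ)| ≤ 1 + |r| := by
    have hd : |r / (2 * Real.pi)| ≤ |r| := by
      rw [abs_div, abs_of_pos (by positivity : 0 < 2 * Real.pi)]
      refine div_le_self (abs_nonneg _) ?_
      linarith [Real.pi_gt_three]
    have f1 := Int.floor_le (r / (2 * Real.pi))
    have f2 := Int.lt_floor_add_one (r / (2 * Real.pi))
    rw [abs_le] at hd ⊢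
    constructor <;> linarith
  have e : x + r = x + r0 + m * (2 * Real.pi) := by rw [hr0]; ring
  rw [e, hper]
  have b1 : ‖V t x (x + r0) ω‖ ≤ max K 0 :=
    (hK (t, x, x + r0) ⟨ht, hx, by constructor <;> linarith [hx.1, hx.2]⟩).trans (le_max_left _ _)
  have b2 : ‖V t 0 (2 * Real.pi) ω‖ ≤ max K 0 :=
    (hK (t, 0, 2 * Real.pi) ⟨ht, ⟨by linarith, by linarith⟩, by constructor <;> linarith⟩).trans
      (le_max_left _ _)
  calc _ ≤ ‖V t x (x + r0) ω‖ + |(m : ℝ)| * ‖V t 0 (2 * Real.pi) ω‖ := by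
        refine (norm_add_le _ _).trans (add_le_add le_rfl (le_of_eq ?_))
        rw [norm_mul, Complex.norm_intCast]
    _ ≤ max K 0 + (1 + |r|) * max K 0 := by gcongr
    _ ≤ _ := by nlinarith [abs_nonneg r]

end IsAreaLimit

end Limit

/-! ### The Fourier coefficients of the discrete derivative -/

/-- The weight which extracts the `m`-th Fourier coefficient of the discrete derivative. -/
def modeWeight (σ : ℝ → ℝ) (ε : ℝ) (m : ℤ) (u : ℝ × ℝ) : ℂ :=
  (((2 * Real.pi)⁻¹ : ℝ) * wave (-m) u.1) * ((ε⁻¹ * σ u.2 : ℝ) : ℂ)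

/-- The measure on the torus and the shifts. -/
def modeMeasure (ν : Measure ℝ) : Measure (ℝ × ℝ) :=
  (volume.restrict (Ioc (-Real.pi) Real.pi)).prod ν

/-- The `m`-th Fourier coefficient of the discrete derivative of `V`. -/
def derivMode {Ω : Type*} (ν : Measure ℝ) (σ : ℝ → ℝ) (ε : ℝ) (m : ℤ)
    (V : ℝ → ℝ → ℝ → Ω → ℂ) (t : ℝ) (ω : Ω) : ℂ :=
  ∫ u, modeWeight σ ε m u * V t u.1 (u.1 + ε * u.2) ω ∂modeMeasure ν

section Weight

variable {ν : Measure ℝ} {σ : ℝ → ℝ} {ε : ℝ}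

theorem measurable_modeWeight (hσm : Measurable σ) (m : ℤ) : Measurable (modeWeight σ ε m) := by
  have := (continuous_wave (-m)).measurable
  unfold modeWeight
  fun_prop

theorem norm_modeWeight_le (hσ : ∀ z, |σ z| = 1) (hε : 0 < ε) (m : ℤ) (u : ℝ × ℝ) :
    ‖modeWeight σ ε m u‖ ≤ ε⁻¹ := by
  rw [modeWeight, norm_mul, norm_mul, norm_wave, Complex.norm_real, Complex.norm_real, norm_mul,
    Real.norm_eq_abs (σ u.2), hσ, mul_one, mul_one, Real.norm_of_nonneg (by positivity),
    Real.norm_of_nonneg (by positivity)]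
  refine mul_le_of_le_one_left (by positivity) (inv_le_one_of_one_le₀ ?_)
  linarith [Real.pi_gt_three]

theorem ae_modeMeasure_mem [SFinite ν] :
    ∀ᵐ u ∂modeMeasure ν, u.1 ∈ Icc (-Real.pi) Real.pi :=
  Measure.quasiMeasurePreserving_fst.ae
    ((ae_restrict_mem measurableSet_Ioc).mono fun _ hx => Ioc_subset_Icc_self hx)

theorem integrable_growth [IsFiniteMeasure ν] (hν : Integrable (fun z : ℝ => 1 + z ^ 2) ν) :
    Integrable (fun u : ℝ × ℝ => 1 + u.2 ^ 2) (modeMeasure ν) := by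
  have : Integrable (fun _ : ℝ => (1 : ℝ)) (volume.restrict (Ioc (-Real.pi) Real.pi)) :=
    integrable_const _
  simpa [modeMeasure] using this.mul_prod hν

/-- Translation separates the base point from the shift. The integral over the base point is then
that of `e^{i(k+l-m)x}`, which selects `k + l = m`. -/
theorem integral_modeWeight_mul [IsFiniteMeasure ν] (m : ℤ) (p : ℤ × ℤ) :
    ∫ u, modeWeight σ ε m u * areaKernel p.1 p.2 u.1 (u.1 + ε * u.2) ∂modeMeasure ν
      = derivCoeff ν σ ε m p := by
  have e : ∀ u : ℝ × ℝ, modeWeight σ ε m u * areaKernel p.1 p.2 u.1 (u.1 + ε * u.2)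
      = (((2 * Real.pi)⁻¹ : ℝ) * wave (p.1 + p.2 - m) u.1)
        * (((ε⁻¹ * σ u.2 : ℝ) : ℂ) * areaKernel p.1 p.2 0 (ε * u.2)) := fun u => by
    rw [modeWeight, areaKernel_add, show p.1 + p.2 - m = -m + (p.1 + p.2) by ring,
      ← wave_mul (-m) (p.1 + p.2)]
    ring
  simp only [e]
  have hp := integral_prod_mul (μ := volume.restrict (Ioc (-Real.pi) Real.pi)) (ν := ν)
    (fun x => (((2 * Real.pi)⁻¹ : ℝ) * wave (p.1 + p.2 - m) x))
    (fun z => ((ε⁻¹ * σ z : ℝ) : ℂ) * areaKernel p.1 p.2 0 (ε * z))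
  rw [modeMeasure, hp, integral_const_mul, ← integral_Icc_eq_integral_Ioc]
  have h2 := integral_exp_int_mul (p.1 + p.2 - m)
  have h3 : ∫ x in Icc (-Real.pi) Real.pi, wave (p.1 + p.2 - m) x
      = if p.1 + p.2 - m = 0 then 2 * Real.pi else 0 := by
    rw [← h2]
    rfl
  rw [h3, derivCoeff]
  have hpi := Real.pi_ne_zero
  by_cases hpm : p.1 + p.2 = m
  · rw [if_pos hpm, if_pos (sub_eq_zero.2 hpm)]
    have : (((2 * Real.pi)⁻¹ : ℝ) : ℂ) * ((2 * Real.pi : ℝ) : ℂ) = 1 := by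
      rw [← Complex.ofReal_mul, inv_mul_cancel₀ (by positivity), Complex.ofReal_one]
    rw [this, one_mul]
  · rw [if_neg hpm, if_neg (sub_ne_zero.2 hpm)]
    simp

end Weight

/-! ### Fourier coefficients of the limiting area -/

section Modes

variable {Ω : Type*} [MeasurableSpace Ω] {P : Measure Ω} [IsProbabilityMeasure P] {κ : Type*}
  {G : κ → Ω → ℝ} {n : ℕ} {Z : ℤ → ℝ → Fin n → Ω → ℂ} {ρ : ℤ → ℝ → ℝ} {C : ℝ}
  {i j : Fin n} {V : ℝ → ℝ → ℝ → Ω → ℂ} {ν : Measure ℝ} {σ : ℝ → ℝ} {ε : ℝ}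

theorem continuous_centredArea (hZ : IsModeFamily P G Z ρ C) (N : ℕ) (t : ℝ) (i j : Fin n) (ω : Ω) :
    Continuous fun q : ℝ × ℝ => centredArea P Z N t q.1 q.2 i j ω := by
  simp only [centredArea, centredQuad_eq_sum hZ, areaCoeff]
  exact continuous_finsetSum _ fun p _ => (continuous_areaKernel p.1 p.2).mul continuous_const

theorem integrable_modeWeight_mul_areaKernel [IsFiniteMeasure ν] (hσm : Measurable σ)
    (hσ : ∀ z, |σ z| = 1) (hν : Integrable (fun z : ℝ => 1 + z ^ 2) ν) (hε : 0 < ε) (m : ℤ)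
    (p : ℤ × ℤ) :
    Integrable (fun u : ℝ × ℝ => modeWeight σ ε m u * areaKernel p.1 p.2 u.1 (u.1 + ε * u.2))
      (modeMeasure ν) := by
  refine ((integrable_growth hν).const_mul (2 * |(p.2 : ℝ)|)).mono' ?_
    (Eventually.of_forall fun u => ?_)
  · refine (measurable_modeWeight hσm m).aestronglyMeasurable.mul ?_
    exact ((continuous_areaKernel p.1 p.2).comp (f := fun u : ℝ × ℝ => (u.1, u.1 + ε * u.2))
      (by fun_prop)).aestronglyMeasurable
  · rw [norm_mul]
    calc _ ≤ ε⁻¹ * (2 * |(p.2 : ℝ)| * |u.1 + ε * u.2 - u.1|) :=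
          mul_le_mul (norm_modeWeight_le hσ hε m u) (norm_areaKernel_le_linear _ _ _ _)
            (norm_nonneg _) (by positivity)
      _ = 2 * |(p.2 : ℝ)| * |u.2| := by
          rw [add_sub_cancel_left, abs_mul, abs_of_pos hε]
          field_simp
      _ ≤ _ := by
          gcongr
          exact abs_le_one_add_sq _

theorem derivMode_centredArea [IsFiniteMeasure ν] (hZ : IsModeFamily P G Z ρ C)
    (hσm : Measurable σ) (hσ : ∀ z, |σ z| = 1) (hν : Integrable (fun z : ℝ => 1 + z ^ 2) ν)
    (hε : 0 < ε) (N : ℕ) (m : ℤ) (t : ℝ) (ω : Ω) :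
    Integrable (fun u : ℝ × ℝ =>
      modeWeight σ ε m u * centredArea P Z N t u.1 (u.1 + ε * u.2) i j ω) (modeMeasure ν) ∧
    derivMode ν σ ε m (fun t x y ω => centredArea P Z N t x y i j ω) t ω
      = centredQuad P Z (freqBox N) (derivCoeff ν σ ε m) t i j ω := by
  have hi := fun p => integrable_modeWeight_mul_areaKernel hσm hσ hν hε m p
  have e : ∀ u : ℝ × ℝ, modeWeight σ ε m u * centredArea P Z N t u.1 (u.1 + ε * u.2) i j ω
      = ∑ p ∈ freqBox N, (modeWeight σ ε m u * areaKernel p.1 p.2 u.1 (u.1 + ε * u.2))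
        * (Z p.1 t i ω * Z p.2 t j ω - ∫ ω', Z p.1 t i ω' * Z p.2 t j ω' ∂P) := fun u => by
    rw [centredArea, centredQuad_eq_sum hZ, Finset.mul_sum]
    simp only [areaCoeff, mul_assoc]
  simp only [derivMode, e]
  refine ⟨integrable_finsetSum _ fun p _ => (hi p).mul_const _, ?_⟩
  rw [integral_finsetSum _ fun p _ => (hi p).mul_const _, centredQuad_eq_sum hZ]
  refine Finset.sum_congr rfl fun p _ => ?_
  rw [integral_mul_const, integral_modeWeight_mul]

namespace IsAreaLimit

variable [IsFiniteMeasure ν] (hZ : IsModeFamily P G Z ρ C) (hV : IsAreaLimit P Z i j V)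
  (hσm : Measurable σ) (hσ : ∀ z, |σ z| = 1) (hν : Integrable (fun z : ℝ => 1 + z ^ 2) ν)
  (hε : 0 < ε)

include hV in
omit [IsProbabilityMeasure P] [IsFiniteMeasure ν] in
theorem ae_continuous_slice : ∀ᵐ ω ∂P, ∀ t ≥ 0,
    Continuous fun u : ℝ × ℝ => V t u.1 (u.1 + ε * u.2) ω := by
  filter_upwards [hV.continuous_paths] with ω hω t ht
  exact hω.comp_continuous (f := fun u : ℝ × ℝ => (t, u.1, u.1 + ε * u.2)) (by fun_prop)
    fun u => ⟨ht, mem_univ _⟩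

include hV in
theorem aestronglyMeasurable_prod {t : ℝ} (ht : 0 ≤ t) :
    AEStronglyMeasurable (fun q : Ω × (ℝ × ℝ) => V t q.2.1 (q.2.1 + ε * q.2.2) q.1)
      (P.prod (modeMeasure ν)) := by
  have : SFinite (modeMeasure ν) := by unfold modeMeasure; infer_instance
  refine aestronglyMeasurable_prod_of_continuous
    (V := fun u : ℝ × ℝ => V t u.1 (u.1 + ε * u.2))
    (fun u => hV.aestronglyMeasurable t ht _ _) ?_ (modeMeasure ν)
  exact (hV.ae_continuous_slice (ε := ε)).mono fun ω hω => hω t ht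

include hV hσm in
theorem aestronglyMeasurable_derivMode (m : ℤ) {t : ℝ} (ht : 0 ≤ t) :
    AEStronglyMeasurable (derivMode ν σ ε m V t) P := by
  have : SFinite (modeMeasure ν) := by unfold modeMeasure; infer_instance
  have h1 : AEStronglyMeasurable (fun q : Ω × (ℝ × ℝ) => modeWeight σ ε m q.2
      * V t q.2.1 (q.2.1 + ε * q.2.2) q.1) (P.prod (modeMeasure ν)) :=
    ((measurable_modeWeight hσm m).comp measurable_snd).aestronglyMeasurable.mul
      (hV.aestronglyMeasurable_prod ht)
  exact h1.integral_prod_right'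

include hZ hV hσm hσ hν hε in
theorem ae_integrable (m : ℤ) (T : ℝ) : ∀ᵐ ω ∂P, ∀ t ∈ Icc 0 T,
    Integrable (fun u : ℝ × ℝ => modeWeight σ ε m u * V t u.1 (u.1 + ε * u.2) ω)
      (modeMeasure ν) := by
  filter_upwards [hV.ae_exists_bound hZ T, hV.ae_continuous_slice (ε := ε)] with ω hb hc t ht
  obtain ⟨K, hK0, hK⟩ := hb
  refine ((integrable_growth hν).const_mul (ε⁻¹ * (K * (1 + ε)))).mono' ?_ ?_
  · exact (measurable_modeWeight hσm m).aestronglyMeasurable.mul (hc t ht.1).aestronglyMeasurable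
  · filter_upwards [ae_modeMeasure_mem] with u hu
    rw [norm_mul, mul_assoc]
    refine mul_le_mul (norm_modeWeight_le hσ hε m u) ?_ (norm_nonneg _) (by positivity)
    refine (hK t ht u.1 hu (ε * u.2)).trans ?_
    rw [abs_mul, abs_of_pos hε, mul_assoc]
    refine mul_le_mul_of_nonneg_left ?_ hK0
    nlinarith [abs_le_one_add_sq u.2, sq_nonneg u.2]

include hZ hV hσm hσ hν hε in
theorem ae_continuousOn_derivMode (m : ℤ) (T : ℝ) :
    ∀ᵐ ω ∂P, ContinuousOn (fun t => derivMode ν σ ε m V t ω) (Icc 0 T) := by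
  filter_upwards [hV.ae_exists_bound hZ T, hV.ae_continuous_slice (ε := ε), hV.continuous_paths]
    with ω hb hc hp
  obtain ⟨K, hK0, hK⟩ := hb
  refine continuousOn_of_dominated (bound := fun u : ℝ × ℝ => ε⁻¹ * (K * (1 + ε)) * (1 + u.2 ^ 2))
    (fun t ht => ?_) (fun t ht => ?_) ((integrable_growth hν).const_mul _)
    (Eventually.of_forall fun u => ?_)
  · exact (measurable_modeWeight hσm m).aestronglyMeasurable.mul (hc t ht.1).aestronglyMeasurable
  · filter_upwards [ae_modeMeasure_mem] with u hu
    rw [norm_mul, mul_assoc]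
    refine mul_le_mul (norm_modeWeight_le hσ hε m u) ?_ (norm_nonneg _) (by positivity)
    refine (hK t ht u.1 hu (ε * u.2)).trans ?_
    rw [abs_mul, abs_of_pos hε, mul_assoc]
    refine mul_le_mul_of_nonneg_left ?_ hK0
    nlinarith [abs_le_one_add_sq u.2, sq_nonneg u.2]
  · refine continuousOn_const.mul ?_
    exact hp.comp (f := fun t : ℝ => (t, u.1, u.1 + ε * u.2)) (by fun_prop)
      fun t ht => ⟨ht.1, mem_univ _⟩

-- Cauchy–Schwarz in the base point and the shift, followed by Tonelli's theorem, reduces the claim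
-- to the `L²` rate at fixed points. That rate grows linearly in the shift, so its square is
-- integrable.
include hZ hV hσm hσ hν hε in
theorem tendsto_derivMode (m : ℤ) {t : ℝ} (ht : 0 ≤ t) :
    Tendsto (fun N => eLpNorm (fun ω => centredQuad P Z (freqBox N) (derivCoeff ν σ ε m) t i j ω
      - derivMode ν σ ε m V t ω) 2 P) atTop (𝓝 0) := by
  have hfin : IsFiniteMeasure (modeMeasure ν) := by unfold modeMeasure; infer_instance
  set S : ℝ≥0∞ := ENNReal.ofReal ε⁻¹ * (∫⁻ u : ℝ × ℝ, ENNReal.ofReal (1 + |ε * u.2|) ^ 2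
    ∂modeMeasure ν) ^ (1 / 2 : ℝ) * (modeMeasure ν univ) ^ (1 / 2 : ℝ) with hS
  have hSfin : S ≠ ⊤ := by
    refine ENNReal.mul_ne_top (ENNReal.mul_ne_top ENNReal.ofReal_ne_top ?_) ?_
    · refine ENNReal.rpow_ne_top_of_nonneg (by norm_num) (ne_of_lt ?_)
      refine lt_of_le_of_lt (lintegral_mono fun u => ?_)
        ((integrable_growth hν).const_mul (2 * (1 + ε ^ 2))).lintegral_lt_top
      rw [← ENNReal.ofReal_pow (by positivity)]
      refine ENNReal.ofReal_le_ofReal ?_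
      rw [abs_mul, abs_of_pos hε]
      nlinarith [sq_nonneg (1 - ε * |u.2|), sq_abs u.2, sq_nonneg ε, sq_nonneg u.2]
    · exact ENNReal.rpow_ne_top_of_nonneg (by norm_num) (measure_ne_top _ _)
  have hbound : ∀ N, eLpNorm (fun ω => centredQuad P Z (freqBox N) (derivCoeff ν σ ε m) t i j ω
      - derivMode ν σ ε m V t ω) 2 P ≤ S * ENNReal.ofReal (tailRate C N) := by
    intro N
    set D : ℝ × ℝ → Ω → ℂ := fun u ω => centredArea P Z N t u.1 (u.1 + ε * u.2) i j ω
      - V t u.1 (u.1 + ε * u.2) ω with hD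
    have hDm : AEStronglyMeasurable (fun q : Ω × (ℝ × ℝ) => D q.2 q.1)
        (P.prod (modeMeasure ν)) := by
      refine aestronglyMeasurable_prod_of_continuous (V := D) (fun u => ?_) ?_ (modeMeasure ν)
      · exact (hZ.memLp_centredArea N t _ _ i j).1.sub (hV.aestronglyMeasurable t ht _ _)
      · filter_upwards [hV.ae_continuous_slice (ε := ε)] with ω hω
        exact ((continuous_centredArea hZ N t i j ω).comp
          (f := fun u : ℝ × ℝ => (u.1, u.1 + ε * u.2)) (by fun_prop)).sub (hω t ht)
    have hpt : ∀ᵐ ω ∂P, ‖centredQuad P Z (freqBox N) (derivCoeff ν σ ε m) t i j ω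
        - derivMode ν σ ε m V t ω‖ₑ ^ (2 : ℝ) ≤ (ENNReal.ofReal ε⁻¹ *
          (modeMeasure ν univ) ^ (1 / 2 : ℝ)) ^ (2 : ℝ) * ∫⁻ u, ‖D u ω‖ₑ ^ (2 : ℝ) ∂modeMeasure ν := by
      filter_upwards [hV.ae_integrable hZ hσm hσ hν hε m t, hV.ae_continuous_slice (ε := ε)]
        with ω hi hc
      have hDc : Continuous fun u => D u ω := ((continuous_centredArea hZ N t i j ω).comp
          (f := fun u : ℝ × ℝ => (u.1, u.1 + ε * u.2)) (by fun_prop)).sub (hc t ht)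
      obtain ⟨hiB, heB⟩ := derivMode_centredArea (i := i) (j := j) hZ hσm hσ hν hε N m t ω
      rw [← heB, derivMode, derivMode, ← integral_sub hiB (hi t ⟨ht, le_rfl⟩)]
      have h1 : ‖∫ u, (modeWeight σ ε m u * centredArea P Z N t u.1 (u.1 + ε * u.2) i j ω
          - modeWeight σ ε m u * V t u.1 (u.1 + ε * u.2) ω) ∂modeMeasure ν‖ₑ
          ≤ ENNReal.ofReal ε⁻¹ * eLpNorm (fun u => D u ω) 1 (modeMeasure ν) := by
        rw [eLpNorm_one_eq_lintegral_enorm, ← lintegral_const_mul' _ _ ENNReal.ofReal_ne_top]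
        refine (enorm_integral_le_lintegral_enorm _).trans (lintegral_mono fun u => ?_)
        rw [← mul_sub, enorm_mul]
        gcongr
        rw [← ofReal_norm]
        exact ENNReal.ofReal_le_ofReal (norm_modeWeight_le hσ hε m u)
      have h2 := eLpNorm_le_eLpNorm_mul_rpow_measure_univ (p := 1) (q := 2) (by norm_num)
        (hDc.aestronglyMeasurable (μ := modeMeasure ν))
      have h3 : eLpNorm (fun u => D u ω) 2 (modeMeasure ν) ^ (2 : ℝ)
          = ∫⁻ u, ‖D u ω‖ₑ ^ (2 : ℝ) ∂modeMeasure ν := by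
        have := eLpNorm_nnreal_pow_eq_lintegral (μ := modeMeasure ν) (f := fun u => D u ω)
          (p := 2) two_ne_zero
        simpa using this
      rw [← h3, ← ENNReal.mul_rpow_of_nonneg _ _ (by norm_num)]
      refine ENNReal.rpow_le_rpow (h1.trans ?_) (by norm_num)
      rw [mul_assoc]
      gcongr
      rw [mul_comm]
      refine h2.trans (le_of_eq ?_)
      norm_num
    have hsq : eLpNorm (fun ω => centredQuad P Z (freqBox N) (derivCoeff ν σ ε m) t i j ω
        - derivMode ν σ ε m V t ω) 2 P ^ (2 : ℝ) ≤ (S * ENNReal.ofReal (tailRate C N)) ^ (2 : ℝ) := by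
      have e1 := eLpNorm_nnreal_pow_eq_lintegral (μ := P) (p := 2) (f := fun ω =>
        centredQuad P Z (freqBox N) (derivCoeff ν σ ε m) t i j ω - derivMode ν σ ε m V t ω)
        two_ne_zero
      simp only [NNReal.coe_ofNat, ENNReal.coe_ofNat] at e1
      rw [e1]
      refine (lintegral_mono_ae hpt).trans ?_
      rw [lintegral_const_mul' _ _ (ENNReal.rpow_ne_top_of_nonneg (by norm_num)
        (ENNReal.mul_ne_top ENNReal.ofReal_ne_top
          (ENNReal.rpow_ne_top_of_nonneg (by norm_num) (measure_ne_top _ _)))),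
        lintegral_lintegral_swap (hDm.enorm.pow_const 2)]
      have h4 : ∀ u : ℝ × ℝ, ∫⁻ ω, ‖D u ω‖ₑ ^ (2 : ℝ) ∂P
          ≤ ENNReal.ofReal (1 + |ε * u.2|) ^ 2 * ENNReal.ofReal (tailRate C N) ^ 2 := by
        intro u
        have e2 := eLpNorm_nnreal_pow_eq_lintegral (μ := P) (p := 2) (f := D u) two_ne_zero
        simp only [NNReal.coe_ofNat, ENNReal.coe_ofNat] at e2
        rw [← e2, ← mul_pow, ← ENNReal.ofReal_mul (by positivity), ← ENNReal.rpow_two]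
        refine ENNReal.rpow_le_rpow ?_ (by norm_num)
        refine (hV.eLpNorm_sub_le hZ N ht u.1 (u.1 + ε * u.2)).trans (le_of_eq ?_)
        rw [add_sub_cancel_left]
      refine (mul_le_mul_right (lintegral_mono h4) _).trans (le_of_eq ?_)
      rw [lintegral_mul_const' _ _ (by simp), hS]
      simp only [ENNReal.mul_rpow_of_nonneg _ _ (by norm_num : (0 : ℝ) ≤ 2), ← ENNReal.rpow_mul]
      norm_num
      ring
    exact (ENNReal.rpow_le_rpow_iff (by norm_num)).1 hsq
  refine tendsto_of_tendsto_of_tendsto_of_le_of_le tendsto_const_nhds ?_ (fun _ => zero_le) hbound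
  have h1 := ENNReal.Tendsto.const_mul (a := S) (ENNReal.tendsto_ofReal (tendsto_tailRate C))
    (Or.inr hSfin)
  simpa using h1

end IsAreaLimit

end Modes

/-! ### The maximal inequality for the Fourier coefficients -/

section Sup

variable {Ω : Type*} [MeasurableSpace Ω] {P : Measure Ω} [IsProbabilityMeasure P] {κ : Type*}
  {G : κ → Ω → ℝ} {n : ℕ} {Z : ℤ → ℝ → Fin n → Ω → ℂ} {ρ : ℤ → ℝ → ℝ} {C : ℝ}
  {i j : Fin n} {V : ℝ → ℝ → ℝ → Ω → ℂ} {ν : Measure ℝ} {σ : ℝ → ℝ} {ε : ℝ}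

theorem min_le_rpow_mul_rpow {a b η : ℝ} (ha : 0 ≤ a) (hb : 0 ≤ b) (h0 : 0 ≤ η) (h1 : η ≤ 1) :
    min a b ≤ a ^ (1 - η) * b ^ η := by
  have hm : 0 ≤ min a b := le_min ha hb
  calc min a b = min a b ^ (1 - η) * min a b ^ η := by
        rw [← Real.rpow_add_of_nonneg hm (by linarith) h0]
        norm_num
    _ ≤ a ^ (1 - η) * b ^ η := by
        have h2 : 0 ≤ 1 - η := by linarith
        gcongr
        · exact min_le_left _ _
        · exact min_le_right _ _

theorem sqMoment_centredQuad_zero (hZ : IsModeFamily P G Z ρ C) (F : Finset (ℤ × ℤ))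
    {a : ℤ × ℤ → ℂ} (ha : ∀ p, p.1 = 0 ∨ p.2 = 0 → a p = 0) (i j : Fin n) :
    sqMoment P (centredQuad P Z F a 0 i j) ≤ 0 := by
  have h0 : ∀ k i, k ≠ 0 → sqMoment P (Z k 0 i) ≤ (fun _ : ℤ => (0 : ℝ)) k := fun k i hk => by
    rw [hZ.sqMoment_eq k 0 i hk le_rfl, hZ.zero k hk]
  refine (hZ.sqMoment_bilinear_le
    (U := fun k => Z k 0 i) (V := fun k => Z k 0 j) (fun _ => hZ.mem _ _ _) (fun _ => hZ.mem _ _ _)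
    (fun k l => hZ.orthogonal k l 0 0 i i le_rfl le_rfl)
    (fun k l => hZ.orthogonal k l 0 0 j j le_rfl le_rfl)
    (fun k l => hZ.orthogonal k l 0 0 i j le_rfl le_rfl) F ha (fun k hk => h0 k i hk)
    (fun k hk => h0 k j hk)).trans (le_of_eq ?_)
  simp

namespace IsAreaLimit

variable [IsFiniteMeasure ν] (hZ : IsModeFamily P G Z ρ C) (hV : IsAreaLimit P Z i j V)
  (hσm : Measurable σ) (hσ : ∀ z, |σ z| = 1) (hν : Integrable (fun z : ℝ => 1 + z ^ 2) ν)
  (hε : 0 < ε)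

include hZ hV hσm hσ hν hε

theorem ae_derivMode_zero (m : ℤ) : ∀ᵐ ω ∂P, derivMode ν σ ε m V 0 ω = 0 := by
  have hm := hV.aestronglyMeasurable_derivMode (ν := ν) (ε := ε) hσm m le_rfl
  have h1 := lintegral_enorm_rpow_le_of_tendsto hZ.gaussian hZ.centred
    (fun N => hZ.centredQuad_mem (freqBox N) (derivCoeff ν σ ε m) 0 i j) hm
    (hV.tendsto_derivMode hZ hσm hσ hν hε m le_rfl)
    (fun N => sqMoment_centredQuad_zero hZ (freqBox N) (derivCoeff_eq_zero m) i j) (q := 1) le_rfl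
  rw [pow_one, ENNReal.ofReal_zero, mul_zero, nonpos_iff_eq_zero,
    lintegral_eq_zero_iff' (hm.enorm.pow_const _)] at h1
  filter_upwards [h1] with ω hω
  simpa using hω

theorem lintegral_derivMode_sub_le (hε1 : ε ≤ 1) (m : ℤ) {t s : ℝ} (ht : 0 ≤ t) (hs : 0 ≤ s)
    {q : ℕ} (hq : 1 ≤ q) :
    ∫⁻ ω, ‖derivMode ν σ ε m V t ω - derivMode ν σ ε m V s ω‖ₑ ^ (2 * q : ℝ) ∂P
      ≤ (2 * chaosConst q : ℝ≥0∞) ^ (2 * q : ℝ) * ENNReal.ofReal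
        ((1024 * C ^ 2 * (∫ z, (1 + z ^ 2) ∂ν) ^ 2 * (1 + ∑' k : ℤ, |(k : ℝ)| ^ (-(7 / 4) : ℝ))
          * min (modeBound ε m) (|t - s| ^ (1 / 8 : ℝ) * bracket m ^ (1 / 4 : ℝ))) ^ q) := by
  have hm := fun {t : ℝ} (ht : 0 ≤ t) =>
    hV.aestronglyMeasurable_derivMode (ν := ν) (ε := ε) hσm m ht
  set Q : ℕ → ℝ → Ω → ℂ := fun N t => centredQuad P Z (freqBox N) (derivCoeff ν σ ε m) t i j with hQ
  have hQm : ∀ N t, Q N t ∈ chaosTwo G := fun N t => hZ.centredQuad_mem _ _ t i j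
  have hQL : ∀ N t, MemLp (Q N t) 2 P := fun N t =>
    memLp_chaosTwo hZ.gaussian hZ.centred (hQm N t)
  set S : ℝ := ∑' k : ℤ, |(k : ℝ)| ^ (-(7 / 4) : ℝ) with hS
  have hS0 : 0 ≤ S := tsum_nonneg fun k => by positivity
  set M : ℝ := ∫ z, (1 + z ^ 2) ∂ν
  have hb := (bracket_pos m).le
  have hθ := (modeBound_pos hε m).le
  refine lintegral_enorm_rpow_le_of_tendsto hZ.gaussian hZ.centred
    (V := fun N ω => Q N t ω - Q N s ω)
    (fun N => Submodule.sub_mem _ (hQm N t) (hQm N s)) ((hm ht).sub (hm hs)) ?_ (fun N => ?_) hq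
  · have hsum := (hV.tendsto_derivMode hZ hσm hσ hν hε m ht).add
      (hV.tendsto_derivMode hZ hσm hσ hν hε m hs)
    rw [add_zero] at hsum
    refine tendsto_of_tendsto_of_tendsto_of_le_of_le tendsto_const_nhds hsum
      (fun _ => zero_le) fun N => ?_
    refine le_trans (le_of_eq ?_) (MeasureTheory.eLpNorm_sub_le ((hQL N t).1.sub (hm ht))
      ((hQL N s).1.sub (hm hs)) (by norm_num))
    congr 1
    funext ω
    simp only [Pi.sub_apply]
    ring
  · rw [mul_min_of_nonneg _ _ (by positivity), le_min_iff]
    constructor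
    -- The two times are estimated separately; `1024 = 2 * 256 + 2 * 256` comes from the square of a
    -- sum.
    · have e : (fun ω => Q N t ω - Q N s ω) = fun ω => Q N t ω + (-Q N s) ω := by
        funext ω
        simp only [Pi.neg_apply]
        ring
      have hneg : sqMoment P (-Q N s) = sqMoment P (Q N s) := by simp [sqMoment]
      rw [e]
      refine (sqMoment_add_le (hQL N t) (hQL N s).neg).trans ?_
      rw [hneg]
      have b1 := hZ.sqMoment_derivCoeff_le hσ hν hε hε1 m (freqBox N) ht i j
      have b2 := hZ.sqMoment_derivCoeff_le hσ hν hε hε1 m (freqBox N) hs i j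
      calc _ ≤ 2 * (256 * C ^ 2 * M ^ 2 * modeBound ε m)
            + 2 * (256 * C ^ 2 * M ^ 2 * modeBound ε m) := by gcongr
        _ = 1024 * C ^ 2 * M ^ 2 * modeBound ε m := by ring
        _ ≤ 1024 * C ^ 2 * M ^ 2 * modeBound ε m
            + 1024 * C ^ 2 * M ^ 2 * modeBound ε m * S := le_add_of_nonneg_right (by positivity)
        _ = _ := by ring
    · refine (hZ.sqMoment_derivCoeff_incr_le hσ hν hε m (freqBox N) ht hs i j).trans ?_
      rw [mul_assoc _ _ (bracket m ^ (1 / 4 : ℝ))]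
      refine mul_le_mul_of_nonneg_right ?_ (by positivity)
      have hc : 0 ≤ C ^ 2 * M ^ 2 := by positivity
      linarith [mul_nonneg hc hS0]

/-- The minimum of the static variance and the increment variance is at most their geometric mean
with weights `1 - η` and `η`. This retains almost all the smallness in `ε` and in `1 / |m|` and
still gives a Hölder modulus in time. The interval `[0, T]` is rescaled to the unit interval. -/
theorem exists_bound (hε1 : ε ≤ 1) {T : ℝ} (hT : 0 ≤ T) {η : ℝ} (hη0 : 0 ≤ η) (hη1 : η ≤ 1) {q : ℕ}
    (hq : 1 ≤ q) (hqη : 16 ≤ η * q) {D : ℝ≥0∞}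
    (hD : ∀ (K : ℝ≥0∞) (Y : ℝ → Ω → ℂ), (∀ t ∈ Icc (0 : ℝ) 1, AEStronglyMeasurable (Y t) P) →
      (∀ s ∈ Icc (0 : ℝ) 1, ∀ t ∈ Icc (0 : ℝ) 1,
        ∫⁻ ω, ‖Y s ω - Y t ω‖ₑ ^ (2 * q : ℝ) ∂P ≤ K * ENNReal.ofReal (|s - t| ^ 2)) →
      (∀ᵐ ω ∂P, ContinuousOn (fun t => Y t ω) (Icc 0 1)) → (∀ᵐ ω ∂P, Y 0 ω = 0) →
      ∃ S : Ω → ℝ≥0∞, AEMeasurable S P ∧ (∀ᵐ ω ∂P, ∀ t ∈ Icc (0 : ℝ) 1, ‖Y t ω‖ₑ ≤ S ω) ∧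
        (∫⁻ ω, S ω ^ (2 * q : ℝ) ∂P) ^ (1 / (2 * q : ℝ)) ≤ D * K ^ (1 / (2 * q : ℝ))) (m : ℤ) :
    ∃ S : Ω → ℝ≥0∞, AEMeasurable S P ∧
      (∀ᵐ ω ∂P, ∀ t ∈ Icc (0 : ℝ) T, ‖derivMode ν σ ε m V t ω‖ₑ ≤ S ω) ∧
      (∫⁻ ω, S ω ^ (2 * q : ℝ) ∂P) ^ (1 / (2 * q : ℝ)) ≤ D * (2 * chaosConst q) * ENNReal.ofReal
        √(1024 * C ^ 2 * (∫ z, (1 + z ^ 2) ∂ν) ^ 2 * (1 + ∑' k : ℤ, |(k : ℝ)| ^ (-(7 / 4) : ℝ))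
          * T ^ (η / 8) * (modeBound ε m ^ (1 - η) * bracket m ^ (η / 4))) := by
  set K0 : ℝ := 1024 * C ^ 2 * (∫ z, (1 + z ^ 2) ∂ν) ^ 2
    * (1 + ∑' k : ℤ, |(k : ℝ)| ^ (-(7 / 4) : ℝ)) with hK0
  have hK00 : 0 ≤ K0 := by
    have : 0 ≤ ∑' k : ℤ, |(k : ℝ)| ^ (-(7 / 4) : ℝ) := tsum_nonneg fun k => by positivity
    positivity
  have hb := (bracket_pos m).le
  have hθ := (modeBound_pos hε m).le
  set B : ℝ := K0 * T ^ (η / 8) * (modeBound ε m ^ (1 - η) * bracket m ^ (η / 4)) with hB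
  have hB0 : 0 ≤ B := by positivity
  have hq0 : (0 : ℝ) < q := by exact_mod_cast hq
  have hinc : ∀ s ∈ Icc (0 : ℝ) 1, ∀ t ∈ Icc (0 : ℝ) 1,
      ∫⁻ ω, ‖derivMode ν σ ε m V (T * s) ω - derivMode ν σ ε m V (T * t) ω‖ₑ ^ (2 * q : ℝ) ∂P
        ≤ (2 * chaosConst q : ℝ≥0∞) ^ (2 * q : ℝ) * ENNReal.ofReal (B ^ q)
          * ENNReal.ofReal (|s - t| ^ 2) := by
    intro s hs t ht
    refine (hV.lintegral_derivMode_sub_le hZ hσm hσ hν hε hε1 m (mul_nonneg hT hs.1)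
      (mul_nonneg hT ht.1) hq).trans ?_
    rw [← hK0, mul_assoc ((2 * chaosConst q : ℝ≥0∞) ^ (2 * q : ℝ)),
      ← ENNReal.ofReal_mul (by positivity)]
    refine mul_le_mul_right (ENNReal.ofReal_le_ofReal ?_) _
    have hst : |s - t| ≤ 1 := by
      rw [abs_le]
      constructor <;> linarith [hs.1, hs.2, ht.1, ht.2]
    calc _ ≤ (K0 * (modeBound ε m ^ (1 - η)
          * (|T * s - T * t| ^ (1 / 8 : ℝ) * bracket m ^ (1 / 4 : ℝ)) ^ η)) ^ q := by
          gcongr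
          exact min_le_rpow_mul_rpow hθ (by positivity) hη0 hη1
      _ = (B * |s - t| ^ (η / 8)) ^ q := by
          congr 1
          rw [hB, ← mul_sub, abs_mul, abs_of_nonneg hT, Real.mul_rpow (by positivity) (by positivity),
            ← Real.rpow_mul (by positivity), ← Real.rpow_mul hb, Real.mul_rpow hT (abs_nonneg _),
            show 1 / 8 * η = η / 8 by ring, show 1 / 4 * η = η / 4 by ring]
          ring
      _ ≤ _ := by
          rw [mul_pow]
          gcongr
          -- The power of `|s - t|` is `η q / 8 ≥ 2`, as Kolmogorov's criterion requires in one
          -- dimension.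
          rw [← Real.rpow_natCast, ← Real.rpow_mul (abs_nonneg _), ← Real.rpow_natCast]
          refine Real.rpow_le_rpow_of_exponent_ge' (abs_nonneg _) hst (by norm_num) ?_
          push_cast
          linarith
  have hcont : ∀ᵐ ω ∂P, ContinuousOn (fun s => derivMode ν σ ε m V (T * s) ω) (Icc 0 1) := by
    filter_upwards [hV.ae_continuousOn_derivMode hZ hσm hσ hν hε m T] with ω hω
    exact hω.comp (f := fun s : ℝ => T * s) (by fun_prop) fun s hs =>
      ⟨mul_nonneg hT hs.1, mul_le_of_le_one_right hT hs.2⟩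
  have h0 : ∀ᵐ ω ∂P, derivMode ν σ ε m V (T * 0) ω = 0 := by
    simpa using hV.ae_derivMode_zero hZ hσm hσ hν hε m
  obtain ⟨S, hSm, hS, hSb⟩ := hD ((2 * chaosConst q : ℝ≥0∞) ^ (2 * q : ℝ) * ENNReal.ofReal (B ^ q))
    (fun s => derivMode ν σ ε m V (T * s))
    (fun t ht => hV.aestronglyMeasurable_derivMode hσm m (mul_nonneg hT ht.1)) hinc hcont h0
  refine ⟨S, hSm, ?_, hSb.trans (le_of_eq ?_)⟩
  · filter_upwards [hS, hV.ae_derivMode_zero hZ hσm hσ hν hε m] with ω hω hω0 t ht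
    -- The rescaling degenerates when `T = 0`; then only `t = 0` occurs, where the coefficient
    -- vanishes.
    rcases hT.eq_or_lt with hT0 | hT0
    · have : t = 0 := le_antisymm (by rw [hT0]; exact ht.2) ht.1
      rw [this, hω0]
      simp
    · have := hω (t / T) ⟨div_nonneg ht.1 hT, (div_le_one hT0).2 ht.2⟩
      simpa only [mul_div_cancel₀ _ hT0.ne'] using this
  · rw [ENNReal.mul_rpow_of_nonneg _ _ (by positivity), ← ENNReal.rpow_mul,
      mul_one_div_cancel (by positivity), ENNReal.rpow_one, mul_assoc D,
      ENNReal.ofReal_rpow_of_nonneg (by positivity) (by positivity)]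
    congr 3
    rw [Real.sqrt_eq_rpow, ← Real.rpow_natCast, ← Real.rpow_mul hB0]
    congr 1
    field_simp

end IsAreaLimit

end Sup

/-! ### Identification of the Fourier coefficients -/

section Fourier

variable {Ω : Type*} [MeasurableSpace Ω] {P : Measure Ω} [IsProbabilityMeasure P] {κ : Type*}
  {G : κ → Ω → ℝ} {n : ℕ} {C : ℝ} {W : Fin n → Lp ℝ 2 spaceTime → Ω → ℝ} {f : ℝ → ℝ≥0∞}
  {h : ℝ → ℝ} {ε : ℝ} {μ : SignedMeasure ℝ} {σ : ℝ → ℝ}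

/-- Since `2 sin² (θ / 2) = 1 - cos θ`, the constant to be subtracted is precisely the mean of the
area, so the renormalised area is centred. -/
theorem LambdaZ_eq (f : ℝ → ℝ≥0∞) (h : ℝ → ℝ) (ε t z : ℝ) : LambdaZ f h ε t z
    = ε⁻¹ * areaMean (fun k t => modeAmplitude f h ε k ^ 2 * modeVariance f ε k t) t (ε * z) := by
  rw [LambdaZ, areaMean, ← tsum_mul_left, ← tsum_mul_left]
  refine tsum_congr fun k => ?_
  rw [Real.sin_sq_eq_half_sub, show 2 * (k * ε * z / 2) = k * (ε * z) by ring]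
  ring

theorem fourierCoeffOn_eq_wave (u : ℝ → ℂ) (m : ℤ) :
    fourierCoeffOn (neg_lt_self Real.pi_pos) u m
      = ∫ x in Ioc (-Real.pi) Real.pi, (((2 * Real.pi)⁻¹ : ℝ) * wave (-m) x) * u x := by
  rw [fourierCoeffOn_eq_integral,
    intervalIntegral.integral_of_le (by linarith [Real.pi_pos] : -Real.pi ≤ Real.pi),
    ← integral_smul]
  refine integral_congr_ae (Eventually.of_forall fun x => ?_)
  simp only
  rw [fourier_coe_apply, wave, Complex.real_smul, smul_eq_mul, ← mul_assoc]
  have hpc : (Real.pi : ℂ) ≠ 0 := by exact_mod_cast Real.pi_ne_zero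
  congr 2
  · congr 1
    rw [one_div]
    congr 1
    ring
  · congr 1
    push_cast
    field_simp
    ring

/-- Both the centred area and its bounded mean are integrable in the shift, so the renormalisation
constant can be moved under the integral; Fubini's theorem then exchanges base point and shift. The
exceptional null set is common to all times in `[0, T]`. -/
theorem IsAreaProcess.ae_fourierCoeffOn_eq
    (hZ : IsModeFamily P G (fun k t i => modeCoeff W f h ε k t i)
      (fun k t => modeAmplitude f h ε k ^ 2 * modeVariance f ε k t) C)
    {A : ℝ → ℝ → ℝ → Ω → Matrix (Fin n) (Fin n) ℝ} (hA : IsAreaProcess P W f h ε A)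
    (hσm : Measurable σ) (hσ : ∀ z, |σ z| = 1)
    (hμ : ∀ g : ℝ → ℝ, ∫ᵛ x, g x ∂<•μ = ∫ x, σ x * g x ∂μ.totalVariation)
    (hν : Integrable (fun z : ℝ => 1 + z ^ 2) μ.totalVariation) (hε : 0 < ε) (T : ℝ) (m : ℤ)
    (i j : Fin n) :
    ∀ᵐ ω ∂P, ∀ t ∈ Icc 0 T, fourierCoeffOn (neg_lt_self Real.pi_pos)
      (fun x => (((areaDerivative μ ε A t x ω
        - LambdaEps f h μ ε t • (1 : Matrix (Fin n) (Fin n) ℝ)) i j : ℝ) : ℂ)) m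
      = derivMode μ.totalVariation σ ε m (centredPath A
        (fun k t => modeAmplitude f h ε k ^ 2 * modeVariance f ε k t) i j) t ω := by
  set ρ : ℤ → ℝ → ℝ := fun k t => modeAmplitude f h ε k ^ 2 * modeVariance f ε k t with hρ
  set ν := μ.totalVariation with hνdef
  have hV := hA.isAreaLimit hZ i j
  obtain ⟨hmc, -⟩ := continuousOn_areaMean_of_summable hZ.continuousOn hZ.nonneg hZ.le
    hZ.const_nonneg
  filter_upwards [hV.ae_exists_bound hZ T, hV.ae_integrable hZ hσm hσ hν hε m T,
    hV.ae_continuous_slice (ε := ε)] with ω hb hi hc t ht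
  obtain ⟨K, hK0, hK⟩ := hb
  rw [derivMode, modeMeasure, integral_prod _ (hi t ht), fourierCoeffOn_eq_wave]
  refine setIntegral_congr_fun measurableSet_Ioc fun x hx => ?_
  simp only [modeWeight, mul_assoc]
  rw [integral_const_mul, integral_const_mul]
  congr 2
  have hmean_int : Integrable (fun z => σ z * if i = j then areaMean ρ t (ε * z) else 0) ν := by
    refine Integrable.bdd_mul (c := 1) (f := σ) ?_ hσm.aestronglyMeasurable
      (Eventually.of_forall fun z => (hσ z).le)
    split_ifs
    · refine Integrable.of_bound (C := ∑' k : ℤ, 2 * C * |(k : ℝ)| ^ (-2 : ℝ)) ?_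
        (Eventually.of_forall fun z => ?_)
      · refine Continuous.aestronglyMeasurable ?_
        exact hmc.comp_continuous (f := fun z : ℝ => (t, ε * z)) (by fun_prop)
          fun z => ⟨ht.1, mem_univ _⟩
      · exact tsum_of_norm_bounded
          ((summable_abs_rpow (by norm_num : (1 : ℝ) < 2)).mul_left (2 * C)).hasSum
          fun k => norm_mul_one_sub_cos_le hZ.nonneg hZ.le hZ.const_nonneg k ht.1 _
    · exact integrable_zero _ _ _
  have hpath : ∀ z, (centredPath A ρ i j t x (x + ε * z) ω).re
      = A t x (x + ε * z) ω i j - if i = j then areaMean ρ t (ε * z) else 0 := fun z => by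
    rw [centredPath, Complex.ofReal_re, add_sub_cancel_left]
  have hV_int : Integrable (fun z => σ z * (centredPath A ρ i j t x (x + ε * z) ω).re) ν := by
    have hcz : Continuous fun z => (centredPath A ρ i j t x (x + ε * z) ω).re :=
      Complex.continuous_re.comp ((hc t ht.1).comp (f := fun z : ℝ => (x, z)) (by fun_prop))
    refine (hν.const_mul (K * (1 + ε))).mono'
      (hσm.aestronglyMeasurable.mul hcz.aestronglyMeasurable) (Eventually.of_forall fun z => ?_)
    rw [norm_mul, Real.norm_eq_abs (σ z), hσ, one_mul]
    refine (Complex.abs_re_le_norm _).trans ((hK t ht x (Ioc_subset_Icc_self hx) (ε * z)).trans ?_)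
    rw [abs_mul, abs_of_pos hε, mul_assoc]
    refine mul_le_mul_of_nonneg_left ?_ hK0
    nlinarith [abs_le_one_add_sq z, sq_nonneg z]
  have hreal : (areaDerivative μ ε A t x ω - LambdaEps f h μ ε t • (1 : Matrix (Fin n) (Fin n) ℝ)) i j
      = ∫ z, ε⁻¹ * (σ z * (centredPath A ρ i j t x (x + ε * z) ω).re) ∂ν := by
    have hA_int : Integrable (fun z => σ z * A t x (x + ε * z) ω i j) ν := by
      refine (hV_int.add hmean_int).congr (Eventually.of_forall fun z => ?_)
      simp only [Pi.add_apply, hpath]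
      ring
    have hL : (LambdaEps f h μ ε t • (1 : Matrix (Fin n) (Fin n) ℝ)) i j
        = ε⁻¹ * ∫ z, σ z * (if i = j then areaMean ρ t (ε * z) else 0) ∂ν := by
      rw [Matrix.smul_apply, Matrix.one_apply]
      split_ifs
      · rw [LambdaEps, hμ, smul_eq_mul, mul_one, ← integral_const_mul]
        refine integral_congr_ae (Eventually.of_forall fun z => ?_)
        simp only [LambdaZ_eq, ← hρ]
        ring
      · simp
    rw [Matrix.sub_apply, hL, areaDerivative, Matrix.of_apply, hμ, ← mul_sub,
      ← integral_sub hA_int hmean_int, integral_const_mul]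
    simp only [hpath, mul_sub]
  rw [hreal, ← integral_complex_ofReal]
  refine integral_congr_ae (Eventually.of_forall fun z => ?_)
  simp only [centredPath, Complex.ofReal_re]
  push_cast
  ring

end Fourier

/-! ### The bound in the negative Sobolev space -/

/-- In `min ε (1 / ⟨m⟩)` to the power `1 - k`, the share `2 (α - k)` is spent on `ε` and the rest,
`1 - 2α + k ≥ 0`, on `1 / ⟨m⟩`. Together with the Sobolev weight `⟨m⟩^{-2α}` and the loss
`⟨m⟩^{k/4}` the total exponent is `-(1 + 3k/4)`, just beyond the threshold of summability. -/
theorem sobolevWeight_mul_le {ε α k : ℝ} (hε : 0 < ε) (hα : α < 1 / 2) (hk : 0 < k) (hkα : k ≤ α)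
    (m : ℤ) :
    (1 + (m : ℝ) ^ 2) ^ (-α) * (modeBound ε m ^ (1 - k) * bracket m ^ (k / 4))
      ≤ ε ^ (2 * (α - k)) * bracket m ^ (-(1 + 3 * k / 4)) := by
  have hb := bracket_pos m
  have hθ := modeBound_pos hε m
  have hα0 : 0 < α := hk.trans_le hkα
  have h1 : (1 + (m : ℝ) ^ 2) ^ (-α) ≤ bracket m ^ (-2 * α) := by
    rw [show -2 * α = 2 * (-α) by ring, Real.rpow_mul hb.le, Real.rpow_two]
    refine Real.rpow_le_rpow_of_nonpos (by positivity) ?_ (by linarith)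
    rcases max_choice (1 : ℝ) |(m : ℝ)| with h | h
    · rw [bracket, h]
      nlinarith [sq_nonneg (m : ℝ)]
    · rw [bracket, h, sq_abs]
      linarith
  have h2 : modeBound ε m ^ (1 - k)
      ≤ ε ^ (2 * (α - k)) * bracket m ^ (-(1 - 2 * α + k)) := by
    rw [show 1 - k = 2 * (α - k) + (1 - 2 * α + k) by ring, Real.rpow_add hθ,
      Real.rpow_neg hb.le, ← Real.inv_rpow hb.le]
    have e1 : 0 ≤ 2 * (α - k) := by linarith
    have e2 : 0 ≤ 1 - 2 * α + k := by linarith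
    gcongr
    · exact min_le_left _ _
    · exact (min_le_right _ _).trans (le_of_eq (one_div _))
  calc _ ≤ bracket m ^ (-2 * α) * ((ε ^ (2 * (α - k)) * bracket m ^ (-(1 - 2 * α + k)))
        * bracket m ^ (k / 4)) := by gcongr
    _ = ε ^ (2 * (α - k)) * (bracket m ^ (-2 * α) * bracket m ^ (-(1 - 2 * α + k))
        * bracket m ^ (k / 4)) := by ring
    _ = _ := by
        rw [← Real.rpow_add hb, ← Real.rpow_add hb]
        congr 2
        ring

theorem integrable_one_add_sq {ν : Measure ℝ} [IsFiniteMeasure ν]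
    (h : ∫⁻ x, ‖x‖ₑ ^ 2 ∂ν < ⊤) : Integrable (fun z : ℝ => 1 + z ^ 2) ν := by
  refine (integrable_const 1).add ⟨by fun_prop, ?_⟩
  refine lt_of_le_of_lt (lintegral_mono fun x => ?_) h
  rw [enorm_pow]

section Moment

variable {Ω : Type*} [MeasurableSpace Ω] {P : Measure Ω} [IsProbabilityMeasure P] {n : ℕ}

/-- The supremum over time is taken inside the sum over frequencies and matrix entries. The squares
of the coefficients are then summed by Minkowski's inequality in `L^q`, so only moments of single
coefficients are needed. -/
theorem lintegral_sup_sobolevNorm_le {S : ℤ × (Fin n × Fin n) → Ω → ℝ≥0∞}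
    (hSm : ∀ a, AEMeasurable (S a) P) {u : ℝ → Ω → ℝ → Matrix (Fin n) (Fin n) ℝ} {T α p : ℝ}
    (hS : ∀ a, ∀ᵐ ω ∂P, ∀ t ∈ Icc (0 : ℝ) T, ‖fourierCoeffOn (neg_lt_self Real.pi_pos)
      (fun x => (u t ω x a.2.1 a.2.2 : ℂ)) a.1‖ₑ ≤ S a ω)
    {q : ℕ} (hq : 1 ≤ q) (hp : 0 < p) (hpq : p ≤ 2 * q) {B : ℤ → ℝ≥0∞}
    (hB : ∀ a, (∫⁻ ω, S a ω ^ (2 * q : ℝ) ∂P) ^ (1 / (2 * q : ℝ)) ≤ B a.1) :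
    (∫⁻ ω, (⨆ t ∈ Icc (0 : ℝ) T, sobolevNorm (-α) (u t ω)) ^ p ∂P) ^ (1 / p)
      ≤ ((n : ℝ≥0∞) ^ 2 * ∑' m : ℤ, ENNReal.ofReal ((1 + (m : ℝ) ^ 2) ^ (-α)) * B m ^ 2)
        ^ (1 / 2 : ℝ) := by
  have hq0 : (0 : ℝ) < q := by exact_mod_cast hq
  set w : ℤ → ℝ≥0∞ := fun m => ENNReal.ofReal ((1 + (m : ℝ) ^ 2) ^ (-α)) with hw
  have hwtop : ∀ m, w m ≠ ⊤ := fun m => ENNReal.ofReal_ne_top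
  set R : Ω → ℝ≥0∞ := fun ω => ∑' a : ℤ × (Fin n × Fin n), w a.1 * S a ω ^ 2 with hR
  have hRm : AEMeasurable R P :=
    AEMeasurable.tsum fun a => ((hSm a).pow_const 2).const_mul _
  have hsup : ∀ᵐ ω ∂P, ⨆ t ∈ Icc (0 : ℝ) T, sobolevNorm (-α) (u t ω) ≤ R ω ^ (1 / 2 : ℝ) := by
    filter_upwards [ae_all_iff.2 hS] with ω hω
    refine iSup₂_le fun t ht => ?_
    rw [sobolevNorm]
    refine ENNReal.rpow_le_rpow ?_ (by norm_num)
    simp only [hR]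
    rw [ENNReal.tsum_prod']
    refine ENNReal.tsum_le_tsum fun m => ?_
    rw [tsum_fintype, Fintype.sum_prod_type, Finset.mul_sum]
    refine Finset.sum_le_sum fun i _ => ?_
    rw [Finset.mul_sum]
    refine Finset.sum_le_sum fun j _ => ?_
    exact mul_le_mul_right (pow_le_pow_left' (hω (m, (i, j)) t ht) 2) _
  -- On a probability space the norms increase with the exponent, so `p` may be raised to `2q`.
  have hLyap : (∫⁻ ω, (R ω ^ (1 / 2 : ℝ)) ^ p ∂P) ^ (1 / p)
      ≤ (∫⁻ ω, (R ω ^ (1 / 2 : ℝ)) ^ (2 * q : ℝ) ∂P) ^ (1 / (2 * q : ℝ)) := by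
    have := eLpNorm'_le_eLpNorm'_of_exponent_le (f := fun ω => R ω ^ (1 / 2 : ℝ)) hp hpq P
      (hRm.pow_const _).aestronglyMeasurable
    simpa [eLpNorm'] using this
  calc _ ≤ (∫⁻ ω, (R ω ^ (1 / 2 : ℝ)) ^ p ∂P) ^ (1 / p) := by
        refine ENNReal.rpow_le_rpow (lintegral_mono_ae ?_) (by positivity)
        filter_upwards [hsup] with ω hω
        exact ENNReal.rpow_le_rpow hω hp.le
    _ ≤ (∫⁻ ω, (R ω ^ (1 / 2 : ℝ)) ^ (2 * q : ℝ) ∂P) ^ (1 / (2 * q : ℝ)) := hLyap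
    _ = ((∫⁻ ω, R ω ^ (q : ℝ) ∂P) ^ (1 / (q : ℝ))) ^ (1 / 2 : ℝ) := by
        rw [← ENNReal.rpow_mul]
        congr 1
        · refine lintegral_congr fun ω => ?_
          rw [← ENNReal.rpow_mul]
          congr 1
          ring
        · field_simp
    _ ≤ (∑' a : ℤ × (Fin n × Fin n), w a.1 * B a.1 ^ 2) ^ (1 / 2 : ℝ) := by
        refine ENNReal.rpow_le_rpow ?_ (by norm_num)
        refine (lintegral_Lp_tsum_le (fun a => ((hSm a).pow_const 2).const_mul _)
          (by exact_mod_cast hq)).trans (ENNReal.tsum_le_tsum fun a => ?_)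
        calc _ = w a.1 * ((∫⁻ ω, S a ω ^ (2 * q : ℝ) ∂P) ^ (1 / (2 * q : ℝ))) ^ 2 := by
              have e : ∀ ω, (w a.1 * S a ω ^ 2) ^ (q : ℝ)
                  = w a.1 ^ (q : ℝ) * S a ω ^ (2 * q : ℝ) := fun ω => by
                rw [ENNReal.mul_rpow_of_nonneg _ _ hq0.le, ENNReal.rpow_mul, ENNReal.rpow_two]
              simp only [e]
              rw [lintegral_const_mul' _ _ (ENNReal.rpow_ne_top_of_nonneg hq0.le (hwtop _)),
                ENNReal.mul_rpow_of_nonneg _ _ (by positivity), ← ENNReal.rpow_mul,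
                mul_one_div_cancel hq0.ne', ENNReal.rpow_one, ← ENNReal.rpow_two,
                ← ENNReal.rpow_mul]
              congr 2
              field_simp
          _ ≤ _ := mul_le_mul_right (pow_le_pow_left' (hB a) 2) _
    _ = _ := by
        congr 1
        rw [ENNReal.tsum_prod', ← ENNReal.tsum_mul_left]
        refine tsum_congr fun m => ?_
        rw [tsum_fintype]
        simp only [Finset.sum_const, Finset.card_univ, Fintype.card_prod, Fintype.card_fin,
          nsmul_eq_mul]
        push_cast
        ring

theorem exists_bound_areaDerivative {W : Fin n → Lp ℝ 2 spaceTime → Ω → ℝ}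
    (hW : IsWhiteNoise P W) {f : ℝ → ℝ≥0∞} {h : ℝ → ℝ} {μ : SignedMeasure ℝ}
    (hyp : CutoffAssumptions f h μ) {p α T κ : ℝ} (hp : 1 ≤ p) (hα0 : 0 < α) (hα : α < 1 / 2)
    (hT : 0 < T) (hκ : 0 < κ) :
    ∃ C > 0, ∀ ε ∈ Ioc (0 : ℝ) 1, ∀ A, IsAreaProcess P W f h ε A →
      (∫⁻ ω, (⨆ t ∈ Icc (0 : ℝ) T, sobolevNorm (-α) (fun x => areaDerivative μ ε A t x ω -
        LambdaEps f h μ ε t • (1 : Matrix (Fin n) (Fin n) ℝ))) ^ p ∂P) ^ (1 / p)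
        ≤ ENNReal.ofReal (C * ε ^ (α - κ)) := by
  obtain ⟨C, hC, hZ⟩ := exists_isModeFamily hW hyp
  obtain ⟨σ, hσm, hσ, hμ⟩ := exists_sign_integral μ
  have hν := integrable_one_add_sq hyp.mu_second_moment
  -- The loss is capped at `α` so that the exponent `α - k` stays nonnegative; a smaller loss only
  -- improves the rate because `ε ≤ 1`.
  set k := min κ α with hk
  have hk0 : 0 < k := lt_min hκ hα0
  have hkα : k ≤ α := min_le_right _ _
  have hk1 : k ≤ 1 := by linarith
  -- Three demands on `q`: `k q ≥ 16` for Kolmogorov's criterion, `p ≤ 2q` for the comparison of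
  -- norms, and `q ≥ 1` for Minkowski's inequality.
  obtain ⟨q, hq⟩ := exists_nat_ge (max (16 / k) (max p 1))
  have hq1 : 1 ≤ q := by
    have : (1 : ℝ) ≤ q := (le_max_right _ _).trans ((le_max_right _ _).trans hq)
    exact_mod_cast this
  have hpq : p ≤ 2 * q := by
    have h1 : p ≤ q := (le_max_left _ _).trans ((le_max_right _ _).trans hq)
    have h2 : (0 : ℝ) ≤ q := by positivity
    linarith
  have hqk : 16 ≤ k * q := by
    have := (div_le_iff₀ hk0).1 ((le_max_left _ _).trans hq)
    linarith
  have hq1' : (1 : ℝ) ≤ q := by exact_mod_cast hq1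
  obtain ⟨D, hDtop, hD⟩ := exists_bound_of_kolmogorov (P := P) (E := ℂ) (p := 2 * q) (by linarith)
  set K : ℝ := 1024 * C ^ 2 * (∫ z, (1 + z ^ 2) ∂μ.totalVariation) ^ 2
    * (1 + ∑' k : ℤ, |(k : ℝ)| ^ (-(7 / 4) : ℝ)) * T ^ (k / 8) with hK
  have hK0 : 0 ≤ K := by
    have : 0 ≤ ∑' k : ℤ, |(k : ℝ)| ^ (-(7 / 4) : ℝ) := tsum_nonneg fun k => by positivity
    positivity
  have hsum : Summable fun m : ℤ => bracket m ^ (-(1 + 3 * k / 4)) :=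
    summable_bracket_rpow (by linarith)
  set bsum : ℝ := ∑' m : ℤ, bracket m ^ (-(1 + 3 * k / 4)) with hbsum
  set E : ℝ≥0∞ := ((n : ℝ≥0∞) ^ 2 * ((D * (2 * chaosConst q)) ^ 2 * ENNReal.ofReal (K * bsum)))
    ^ (1 / 2 : ℝ) with hE
  have hEtop : E ≠ ⊤ := by
    refine ENNReal.rpow_ne_top_of_nonneg (by norm_num) (ENNReal.mul_ne_top (by simp)
      (ENNReal.mul_ne_top (ENNReal.pow_ne_top ?_) ENNReal.ofReal_ne_top))
    exact ENNReal.mul_ne_top hDtop.ne (ENNReal.mul_ne_top (by simp) (by simp))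
  -- The summand `1` only makes the constant strictly positive.
  refine ⟨E.toReal + 1, by positivity, fun ε hε A hA => ?_⟩
  have hZε := hZ ε hε
  have hex : ∀ a : ℤ × (Fin n × Fin n), ∃ S : Ω → ℝ≥0∞, AEMeasurable S P ∧
      (∀ᵐ ω ∂P, ∀ t ∈ Icc (0 : ℝ) T, ‖derivMode μ.totalVariation σ ε a.1 (centredPath A
        (fun k t => modeAmplitude f h ε k ^ 2 * modeVariance f ε k t) a.2.1 a.2.2) t ω‖ₑ ≤ S ω) ∧
      (∫⁻ ω, S ω ^ (2 * q : ℝ) ∂P) ^ (1 / (2 * q : ℝ)) ≤ D * (2 * chaosConst q) * ENNReal.ofReal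
        √(K * (modeBound ε a.1 ^ (1 - k) * bracket a.1 ^ (k / 4))) := fun a =>
    (hA.isAreaLimit hZε a.2.1 a.2.2).exists_bound hZε hσm hσ hν hε.1 hε.2 hT.le hk0.le hk1 hq1 hqk
      hD a.1
  choose S hSm hS hSb using hex
  have hmain := lintegral_sup_sobolevNorm_le (u := fun t ω x => areaDerivative μ ε A t x ω -
    LambdaEps f h μ ε t • (1 : Matrix (Fin n) (Fin n) ℝ)) (T := T) (α := α) hSm (fun a => by
      filter_upwards [hS a, hA.ae_fourierCoeffOn_eq hZε hσm hσ hμ hν hε.1 T a.1 a.2.1 a.2.2]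
        with ω h1 h2 t ht
      rw [h2 t ht]
      exact h1 t ht) hq1 (by linarith) hpq (B := fun m => D * (2 * chaosConst q) * ENNReal.ofReal
        √(K * (modeBound ε m ^ (1 - k) * bracket m ^ (k / 4)))) hSb
  refine hmain.trans ?_
  have hterm : ∀ m : ℤ, ENNReal.ofReal ((1 + (m : ℝ) ^ 2) ^ (-α)) * (D * (2 * chaosConst q) *
      ENNReal.ofReal √(K * (modeBound ε m ^ (1 - k) * bracket m ^ (k / 4)))) ^ 2
      ≤ (D * (2 * chaosConst q)) ^ 2 * ENNReal.ofReal
        (K * ε ^ (2 * (α - k)) * bracket m ^ (-(1 + 3 * k / 4))) := by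
    intro m
    have hθ := (modeBound_pos hε.1 m).le
    have hb := (bracket_pos m).le
    rw [mul_pow, mul_left_comm, ← ENNReal.ofReal_pow (Real.sqrt_nonneg _),
      Real.sq_sqrt (by positivity), ← ENNReal.ofReal_mul (by positivity)]
    refine mul_le_mul_right (ENNReal.ofReal_le_ofReal ?_) _
    have := mul_le_mul_of_nonneg_left (sobolevWeight_mul_le hε.1 hα hk0 hkα m) hK0
    linarith
  have hε0 := hε.1
  have hbound : (n : ℝ≥0∞) ^ 2 * ∑' m : ℤ, ENNReal.ofReal ((1 + (m : ℝ) ^ 2) ^ (-α)) *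
      (D * (2 * chaosConst q) *
        ENNReal.ofReal √(K * (modeBound ε m ^ (1 - k) * bracket m ^ (k / 4)))) ^ 2
      ≤ (n : ℝ≥0∞) ^ 2 * ((D * (2 * chaosConst q)) ^ 2 * ENNReal.ofReal (K * bsum))
        * ENNReal.ofReal (ε ^ (2 * (α - k))) := by
    rw [mul_assoc]
    refine mul_le_mul_right ((ENNReal.tsum_le_tsum hterm).trans (le_of_eq ?_)) _
    have hb : ∀ m, 0 ≤ bracket m := fun m => (bracket_pos m).le
    have hKb : 0 ≤ K * bsum := mul_nonneg hK0 (tsum_nonneg fun m => Real.rpow_nonneg (hb m) _)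
    rw [ENNReal.tsum_mul_left, ← ENNReal.ofReal_tsum_of_nonneg
      (fun m => by have := hb m; positivity) (hsum.mul_left _), tsum_mul_left,
      mul_assoc ((D * (2 * chaosConst q : ℝ≥0∞)) ^ 2), ← ENNReal.ofReal_mul hKb]
    congr 2
    ring
  calc _ ≤ ((n : ℝ≥0∞) ^ 2 * ((D * (2 * chaosConst q)) ^ 2 * ENNReal.ofReal (K * bsum))
        * ENNReal.ofReal (ε ^ (2 * (α - k)))) ^ (1 / 2 : ℝ) :=
        ENNReal.rpow_le_rpow hbound (by norm_num)
    _ = E * ENNReal.ofReal (ε ^ (α - k)) := by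
        rw [ENNReal.mul_rpow_of_nonneg _ _ (by norm_num), ← hE,
          ENNReal.ofReal_rpow_of_nonneg (by positivity) (by norm_num), ← Real.rpow_mul hε0.le]
        congr 3
        ring
    _ ≤ _ := by
        nth_rewrite 1 [← ENNReal.ofReal_toReal hEtop]
        rw [← ENNReal.ofReal_mul ENNReal.toReal_nonneg]
        refine ENNReal.ofReal_le_ofReal ?_
        have h1 : ε ^ (α - k) ≤ ε ^ (α - κ) :=
          Real.rpow_le_rpow_of_exponent_ge hε0 hε.2 (by linarith [min_le_left κ α])
        have h2 : 0 ≤ ε ^ (α - k) := by positivity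
        have h3 : 0 ≤ E.toReal := ENNReal.toReal_nonneg
        calc _ ≤ (E.toReal + 1) * ε ^ (α - k) := by gcongr; linarith
          _ ≤ _ := by gcongr

end Moment

/-! ### A Riemann sum estimate -/

/-- The function `x ↦ sin² (x z / 2) / x²`. -/
def sincSq (z x : ℝ) : ℝ := Real.sin (x * z / 2) ^ 2 / x ^ 2

theorem sincSq_nonneg (z x : ℝ) : 0 ≤ sincSq z x := by
  unfold sincSq
  positivity

theorem measurable_sincSq : Measurable fun q : ℝ × ℝ => sincSq q.1 q.2 := by
  unfold sincSq
  fun_prop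

theorem sincSq_le_sq (z x : ℝ) : sincSq z x ≤ z ^ 2 / 4 := by
  unfold sincSq
  by_cases hx : x = 0
  · simp only [hx, zero_mul, zero_div, Real.sin_zero, ne_eq, OfNat.ofNat_ne_zero, not_false_eq_true,
      zero_pow, div_zero]
    positivity
  · rw [div_le_iff₀ (by positivity)]
    calc Real.sin (x * z / 2) ^ 2 ≤ (x * z / 2) ^ 2 := Real.sin_sq_le_sq
      _ = _ := by ring

theorem sincSq_le (z x : ℝ) : sincSq z x ≤ 2 * (1 + z ^ 2) * (1 + x ^ 2)⁻¹ := by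
  rw [← div_eq_mul_inv, le_div_iff₀ (by positivity)]
  have h1 := sincSq_le_sq z x
  have h2 : sincSq z x * x ^ 2 ≤ 1 := by
    unfold sincSq
    by_cases hx : x = 0
    · simp [hx]
    · rw [div_mul_cancel₀ _ (by positivity)]
      exact Real.sin_sq_le_one _
  nlinarith [sq_nonneg z]

/-- The difference is split into a change of the numerator and a change of the denominator, each
contributing half of the bound. -/
theorem abs_sin_div_sub_le (z : ℝ) {a b : ℝ} (hb : 0 < b) (hba : b ≤ a) :
    |Real.sin (a * z / 2) / a - Real.sin (b * z / 2) / b| ≤ (a - b) * |z| / a := by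
  have ha : 0 < a := hb.trans_le hba
  have h1 : |Real.sin (a * z / 2) - Real.sin (b * z / 2)| ≤ (a - b) * |z| / 2 := by
    refine (Real.abs_sin_sub_sin_le _ _).trans (le_of_eq ?_)
    rw [show a * z / 2 - b * z / 2 = (a - b) * z / 2 by ring, abs_div, abs_mul,
      abs_of_nonneg (sub_nonneg.2 hba), abs_two]
  have h2 : |Real.sin (b * z / 2)| ≤ b * |z| / 2 := by
    refine Real.abs_sin_le_abs.trans (le_of_eq ?_)
    rw [abs_div, abs_mul, abs_of_pos hb, abs_two]
  have e : Real.sin (a * z / 2) / a - Real.sin (b * z / 2) / b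
      = (Real.sin (a * z / 2) - Real.sin (b * z / 2)) / a
        - Real.sin (b * z / 2) * ((a - b) / (a * b)) := by
    field_simp
    ring
  have h3 : 0 ≤ (a - b) / (a * b) := div_nonneg (sub_nonneg.2 hba) (by positivity)
  rw [e]
  calc _ ≤ |(Real.sin (a * z / 2) - Real.sin (b * z / 2)) / a|
        + |Real.sin (b * z / 2) * ((a - b) / (a * b))| := abs_sub _ _
    _ = |Real.sin (a * z / 2) - Real.sin (b * z / 2)| / a
        + |Real.sin (b * z / 2)| * ((a - b) / (a * b)) := by
        rw [abs_div, abs_mul, abs_of_pos ha, abs_of_nonneg h3]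
    _ ≤ (a - b) * |z| / 2 / a + b * |z| / 2 * ((a - b) / (a * b)) := by gcongr
    _ = _ := by
        field_simp
        ring

theorem abs_sin_div_le (z : ℝ) {a : ℝ} (ha : 0 < a) :
    |Real.sin (a * z / 2) / a| ≤ |z| / 2 ∧ |Real.sin (a * z / 2) / a| ≤ 1 / a := by
  rw [abs_div, abs_of_pos ha]
  constructor
  · rw [div_le_iff₀ ha]
    refine Real.abs_sin_le_abs.trans (le_of_eq ?_)
    rw [abs_div, abs_mul, abs_of_pos ha, abs_two]
    ring
  · gcongr
    exact Real.abs_sin_le_one _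

/-- With `v x = sin (x z / 2) / x` the difference is `(v a - v b)(v a + v b)`. The first factor is
at most `|z| / n`. The second is at most both `|z|` and `3 / a`, hence at most the geometric mean of
the two. At `a = ε n` this gives `ε^{-1/2} n^{-3/2}`, which is summable in `n`. -/
theorem abs_sincSq_sub_le {ε : ℝ} (hε : 0 < ε) (hε1 : ε ≤ 1) (z : ℝ) (k : ℕ) {b : ℝ}
    (hb : ε * k < b) (hb' : b ≤ ε * (k + 1)) :
    |sincSq z (ε * (k + 1)) - sincSq z b|
      ≤ 4 * (1 + z ^ 2) * (ε ^ (-(1 / 2) : ℝ) * ((k : ℝ) + 1) ^ (-(3 / 2) : ℝ)) := by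
  have hb0 : 0 < b := lt_of_le_of_lt (by positivity) hb
  -- In the first cell `b` may be arbitrarily close to `0`, so the uniform bound `z² / 4` is used
  -- instead; it suffices because `ε^{-1/2} ≥ 1`.
  rcases Nat.eq_zero_or_pos k with rfl | hk
  · have h1 : 1 ≤ ε ^ (-(1 / 2) : ℝ) :=
      Real.one_le_rpow_of_pos_of_le_one_of_nonpos hε hε1 (by norm_num)
    simp only [Nat.cast_zero, zero_add, Real.one_rpow, mul_one]
    have h2 : |sincSq z ε - sincSq z b| ≤ z ^ 2 / 4 := by
      rw [abs_le]
      constructor <;>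
        linarith [sincSq_nonneg z ε, sincSq_nonneg z b, sincSq_le_sq z ε, sincSq_le_sq z b]
    nlinarith [sq_nonneg z]
  set n : ℝ := (k : ℝ) + 1 with hn
  have hk1 : (1 : ℝ) ≤ k := by exact_mod_cast hk
  have hn0 : 0 < n := by linarith
  set a := ε * n with ha
  have ha0 : 0 < a := by positivity
  have hab : a ≤ 2 * b := by nlinarith
  set v := fun x : ℝ => Real.sin (x * z / 2) / x with hv
  have hs : ∀ x, sincSq z x = v x ^ 2 := fun x => by rw [sincSq, hv, div_pow]
  have hdiff : |v a - v b| ≤ |z| / n := by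
    refine (abs_sin_div_sub_le z hb0 hb').trans ?_
    rw [div_le_div_iff₀ ha0 hn0, ha]
    have : a - b ≤ ε := by nlinarith
    have h2 : (a - b) * (|z| * n) ≤ ε * (|z| * n) := by gcongr
    linarith
  have hsum : |v a + v b| ≤ min |z| (3 / a) := by
    obtain ⟨a1, a2⟩ := abs_sin_div_le z ha0
    obtain ⟨b1, b2⟩ := abs_sin_div_le z hb0
    refine (abs_add_le _ _).trans (le_min (by linarith) ?_)
    have : 1 / b ≤ 2 / a := by
      rw [div_le_div_iff₀ hb0 ha0]
      linarith
    calc _ ≤ 1 / a + 2 / a := add_le_add a2 (b2.trans this)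
      _ = _ := by ring
  have hmin : min |z| (3 / a) ≤ |z| ^ (1 / 2 : ℝ) * (3 / a) ^ (1 / 2 : ℝ) := by
    have := min_le_rpow_mul_rpow (abs_nonneg z) (by positivity : 0 ≤ 3 / a)
      (by norm_num : (0 : ℝ) ≤ 1 / 2) (by norm_num)
    norm_num at this ⊢
    exact this
  have hz : |z| * |z| ^ (1 / 2 : ℝ) ≤ 1 + z ^ 2 := by
    rcases le_total |z| 1 with h | h
    · have h1 : |z| ^ (1 / 2 : ℝ) ≤ 1 := Real.rpow_le_one (abs_nonneg _) h (by norm_num)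
      nlinarith [sq_nonneg z, abs_nonneg z]
    · have h1 : |z| ^ (1 / 2 : ℝ) ≤ |z| ^ (1 : ℝ) :=
        Real.rpow_le_rpow_of_exponent_le h (by norm_num)
      rw [Real.rpow_one] at h1
      calc |z| * |z| ^ (1 / 2 : ℝ) ≤ |z| * |z| := by gcongr
        _ = z ^ 2 := by rw [← sq, sq_abs]
        _ ≤ _ := by linarith
  have hthree : (3 : ℝ) ^ (1 / 2 : ℝ) ≤ 4 := by
    calc (3 : ℝ) ^ (1 / 2 : ℝ) ≤ 3 ^ (1 : ℝ) :=
          Real.rpow_le_rpow_of_exponent_le (by norm_num) (by norm_num)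
      _ ≤ 4 := by norm_num
  calc _ = |v a - v b| * |v a + v b| := by rw [hs, hs, ← abs_mul]; congr 1; ring
    _ ≤ |z| / n * (|z| ^ (1 / 2 : ℝ) * (3 / a) ^ (1 / 2 : ℝ)) := by
        gcongr
        exact hsum.trans hmin
    _ = 3 ^ (1 / 2 : ℝ) * (|z| * |z| ^ (1 / 2 : ℝ))
        * (ε ^ (-(1 / 2) : ℝ) * (n ^ (-1 : ℝ) * n ^ (-(1 / 2) : ℝ))) := by
        rw [Real.div_rpow (by norm_num) ha0.le, ha, Real.mul_rpow hε.le hn0.le,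
          Real.rpow_neg hε.le, Real.rpow_neg hn0.le, Real.rpow_neg hn0.le, Real.rpow_one]
        field_simp
    _ ≤ 4 * (1 + z ^ 2) * (ε ^ (-(1 / 2) : ℝ) * (n ^ (-1 : ℝ) * n ^ (-(1 / 2) : ℝ))) := by gcongr
    _ = _ := by
        rw [← Real.rpow_add hn0]
        norm_num

/-! ### Riemann sums with a weight of bounded variation -/

section Riemann

variable {g : ℝ → ℝ} {G : ℝ}

theorem measurable_of_eVariationOn_lt_top (hg : eVariationOn g univ < ⊤) : Measurable g := by
  have hbv : BoundedVariationOn g univ := hg.ne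
  obtain ⟨p, q, hp, hq, hpq⟩ := hbv.locallyBoundedVariationOn.exists_monotoneOn_sub_monotoneOn
  rw [hpq]
  exact (monotoneOn_univ.1 hp).measurable.sub (monotoneOn_univ.1 hq).measurable

variable (hg : eVariationOn g univ < ⊤) (h0 : ∀ x, 0 ≤ g x) (hG : ∀ x > 0, g x ≤ G)

include hg h0 hG

theorem integrableOn_mul_sincSq (z : ℝ) : IntegrableOn (fun x => g x * sincSq z x) (Ioi 0) := by
  refine (((integrable_inv_one_add_sq.const_mul (2 * (1 + z ^ 2))).const_mul G).integrableOn).mono'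
    ?_ ?_
  · exact ((measurable_of_eVariationOn_lt_top hg).mul
      (measurable_sincSq.comp measurable_prodMk_left)).aestronglyMeasurable
  · filter_upwards [ae_restrict_mem measurableSet_Ioi] with x hx
    rw [Real.norm_of_nonneg (mul_nonneg (h0 x) (sincSq_nonneg z x))]
    exact mul_le_mul (hG x hx) (sincSq_le z x) (sincSq_nonneg z x) ((h0 x).trans (hG x hx))

theorem summable_mul_sincSq {ε : ℝ} (hε : 0 < ε) (z : ℝ) :
    Summable fun k : ℕ => g (ε * (k + 1)) * sincSq z (ε * (k + 1)) := by
  have hG0 : 0 ≤ G := (h0 1).trans (hG 1 one_pos)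
  have hs : Summable fun k : ℕ => G / ε ^ 2 * (1 / ((k : ℝ) + 1) ^ 2) := by
    refine Summable.mul_left _ ?_
    have := (summable_nat_add_iff 1).2 (Real.summable_one_div_nat_pow.2 one_lt_two)
    simpa using this
  refine Summable.of_nonneg_of_le (fun k => mul_nonneg (h0 _) (sincSq_nonneg _ _)) (fun k => ?_) hs
  calc _ ≤ G * (1 / (ε * (k + 1)) ^ 2) := by
        refine mul_le_mul (hG _ (by positivity)) ?_ (sincSq_nonneg _ _) hG0
        rw [sincSq]
        gcongr
        exact Real.sin_sq_le_one _
    _ = _ := by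
        field_simp

/-- On each cell of length `ε` the error is the variation of `g` there plus the oscillation of
`sincSq`. The variations add up to at most the total variation, at the cost `ε`. The oscillations
sum to order `ε^{-1/2}`, which the mesh turns into `ε^{1/2}`. -/
theorem abs_riemann_sum_sub_le {ε : ℝ} (hε : 0 < ε) (hε1 : ε ≤ 1) (z : ℝ) :
    |ε * ∑' k : ℕ, g (ε * (k + 1)) * sincSq z (ε * (k + 1)) - ∫ x in Ioi 0, g x * sincSq z x|
      ≤ ((eVariationOn g univ).toReal + 4 * G * ∑' k : ℕ, ((k : ℝ) + 1) ^ (-(3 / 2) : ℝ))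
        * (1 + z ^ 2) * ε ^ (1 / 2 : ℝ) := by
  have hG0 : 0 ≤ G := (h0 1).trans (hG 1 one_pos)
  set F : ℝ → ℝ := fun x => g x * sincSq z x with hF
  have hFi := integrableOn_mul_sincSq hg h0 hG z
  set Y : ℝ := ∑' k : ℕ, ((k : ℝ) + 1) ^ (-(3 / 2) : ℝ) with hY
  have hYs : Summable fun k : ℕ => ((k : ℝ) + 1) ^ (-(3 / 2) : ℝ) := by
    have := (summable_nat_add_iff 1).2 (Real.summable_nat_rpow.2 (by norm_num : -(3 / 2 : ℝ) < -1))
    simpa using this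
  set I : ℕ → ℝ := fun k => ε * k with hI
  have hIm : Monotone I := fun k l hkl => by
    have : (k : ℝ) ≤ l := by exact_mod_cast hkl
    exact mul_le_mul_of_nonneg_left this hε.le
  have hI0 : I 0 = 0 := by simp [hI]
  have hIs : ∀ k, I (k + 1) = ε * (k + 1) := fun k => by simp [hI]
  have hvar : ∀ k, eVariationOn g (Icc (I k) (I (k + 1))) ≠ ⊤ := fun k =>
    ((eVariationOn.mono g (subset_univ _)).trans_lt hg).ne
  have hcell : ∀ k : ℕ, ∀ x ∈ uIoc (I k) (I (k + 1)), ‖F (ε * (k + 1)) - F x‖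
      ≤ (eVariationOn g (Icc (I k) (I (k + 1)))).toReal * (1 + z ^ 2)
        + G * (4 * (1 + z ^ 2) * (ε ^ (-(1 / 2) : ℝ) * ((k : ℝ) + 1) ^ (-(3 / 2) : ℝ))) := by
    intro k x hx
    rw [uIoc_of_le (hIm k.le_succ)] at hx
    rw [← hIs]
    have hx1 : I k < x := hx.1
    have hx2 : x ≤ ε * (k + 1) := by rw [← hIs]; exact hx.2
    have hv : |g (I (k + 1)) - g x| ≤ (eVariationOn g (Icc (I k) (I (k + 1)))).toReal := by
      rw [← Real.dist_eq, dist_edist]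
      exact ENNReal.toReal_mono (hvar k) (eVariationOn.edist_le g (right_mem_Icc.2 (hIm k.le_succ))
        (Ioc_subset_Icc_self hx))
    have hs := abs_sincSq_sub_le hε hε1 z k hx1 hx2
    have hpos : 0 < I (k + 1) := by rw [hIs]; positivity
    have e : F (I (k + 1)) - F x = (g (I (k + 1)) - g x) * sincSq z x
        + g (I (k + 1)) * (sincSq z (ε * (k + 1)) - sincSq z x) := by
      simp only [hF, hIs]
      ring
    rw [e, Real.norm_eq_abs]
    refine (abs_add_le _ _).trans (add_le_add ?_ ?_)
    · rw [abs_mul, abs_of_nonneg (sincSq_nonneg z x)]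
      refine mul_le_mul hv ((sincSq_le_sq z x).trans ?_) (sincSq_nonneg z x) ENNReal.toReal_nonneg
      nlinarith [sq_nonneg z]
    · rw [abs_mul, abs_of_nonneg (h0 _)]
      exact mul_le_mul (hG _ hpos) hs (abs_nonneg _) hG0
  have hFint : ∀ k : ℕ, IntervalIntegrable F volume (I k) (I (k + 1)) := fun k => by
    rw [intervalIntegrable_iff_integrableOn_Ioc_of_le (hIm k.le_succ)]
    refine hFi.mono_set fun x hx => ?_
    exact lt_of_le_of_lt (by simp only [hI]; positivity) hx.1
  have hfinite : ∀ N : ℕ, |∑ k ∈ Finset.range N, ε * F (ε * (k + 1)) - ∫ x in (0 : ℝ)..I N, F x|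
      ≤ ((eVariationOn g univ).toReal + 4 * G * Y) * (1 + z ^ 2) * ε ^ (1 / 2 : ℝ) := by
    intro N
    have hadj := intervalIntegral.sum_integral_adjacent_intervals (f := F) (μ := volume) (a := I)
      (n := N) fun k _ => hFint k
    rw [hI0] at hadj
    rw [← hadj, ← Finset.sum_sub_distrib]
    have hone : ∀ k : ℕ, |ε * F (ε * (k + 1)) - ∫ x in I k..I (k + 1), F x|
        ≤ ((eVariationOn g (Icc (I k) (I (k + 1)))).toReal * (1 + z ^ 2)
        + G * (4 * (1 + z ^ 2) * (ε ^ (-(1 / 2) : ℝ) * ((k : ℝ) + 1) ^ (-(3 / 2) : ℝ)))) * ε := by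
      intro k
      have hlen : I (k + 1) - I k = ε := by
        rw [hIs]
        simp only [hI]
        ring
      have e : ε * F (ε * (k + 1)) - ∫ x in I k..I (k + 1), F x
          = ∫ x in I k..I (k + 1), (F (ε * (k + 1)) - F x) := by
        rw [intervalIntegral.integral_sub intervalIntegrable_const (hFint k),
          intervalIntegral.integral_const, hlen, smul_eq_mul]
      rw [e]
      have := intervalIntegral.norm_integral_le_of_norm_le_const (hcell k)
      rwa [hlen, abs_of_pos hε] at this
    have hvsum : ∑ k ∈ Finset.range N, (eVariationOn g (Icc (I k) (I (k + 1)))).toReal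
        ≤ (eVariationOn g univ).toReal := by
      rw [← ENNReal.toReal_sum fun k _ => hvar k, eVariationOn.sum' g hIm]
      exact ENNReal.toReal_mono hg.ne (eVariationOn.mono g (subset_univ _))
    have hYsum : ∑ k ∈ Finset.range N, ((k : ℝ) + 1) ^ (-(3 / 2) : ℝ) ≤ Y :=
      hYs.sum_le_tsum _ fun k _ => by positivity
    have hε2 : ε ≤ ε ^ (1 / 2 : ℝ) := by
      calc ε = ε ^ (1 : ℝ) := (Real.rpow_one _).symm
        _ ≤ _ := Real.rpow_le_rpow_of_exponent_ge hε hε1 (by norm_num)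
    have hε3 : ε ^ (-(1 / 2) : ℝ) * ε = ε ^ (1 / 2 : ℝ) := by
      nth_rewrite 2 [← Real.rpow_one ε]
      rw [← Real.rpow_add hε]
      norm_num
    refine (Finset.abs_sum_le_sum_abs _ _).trans ((Finset.sum_le_sum fun k _ => hone k).trans ?_)
    rw [← Finset.sum_mul, Finset.sum_add_distrib, ← Finset.sum_mul, ← Finset.mul_sum,
      ← Finset.mul_sum, ← Finset.mul_sum, add_mul]
    have hA : (∑ k ∈ Finset.range N, (eVariationOn g (Icc (I k) (I (k + 1)))).toReal) * (1 + z ^ 2)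
        * ε ≤ (eVariationOn g univ).toReal * (1 + z ^ 2) * ε ^ (1 / 2 : ℝ) := by gcongr
    have hB : G * (4 * (1 + z ^ 2) * (ε ^ (-(1 / 2) : ℝ)
        * ∑ k ∈ Finset.range N, ((k : ℝ) + 1) ^ (-(3 / 2) : ℝ))) * ε
        ≤ 4 * G * Y * (1 + z ^ 2) * ε ^ (1 / 2 : ℝ) := by
      calc _ = G * (4 * (1 + z ^ 2)) * (∑ k ∈ Finset.range N, ((k : ℝ) + 1) ^ (-(3 / 2) : ℝ))
            * (ε ^ (-(1 / 2) : ℝ) * ε) := by ring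
        _ ≤ G * (4 * (1 + z ^ 2)) * Y * (ε ^ (-(1 / 2) : ℝ) * ε) := by gcongr
        _ = _ := by
            rw [hε3]
            ring
    linarith
  have hlim1 : Tendsto (fun N => ∑ k ∈ Finset.range N, ε * F (ε * (k + 1))) atTop
      (𝓝 (ε * ∑' k : ℕ, F (ε * (k + 1)))) := by
    rw [← tsum_mul_left]
    exact ((summable_mul_sincSq hg h0 hG hε z).mul_left ε).hasSum.tendsto_sum_nat
  have hlim2 : Tendsto (fun N => ∫ x in (0 : ℝ)..I N, F x) atTop (𝓝 (∫ x in Ioi 0, F x)) :=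
    intervalIntegral_tendsto_integral_Ioi 0 hFi
      (tendsto_natCast_atTop_atTop.const_mul_atTop hε)
  exact le_of_tendsto' (hlim1.sub hlim2).abs hfinite

end Riemann

/-! ### The convergence of the constants -/

theorem rpow_mul_exp_neg_le_one {y a : ℝ} (hy : 0 ≤ y) (ha : 0 ≤ a) (ha1 : a ≤ 1) :
    y ^ a * Real.exp (-y) ≤ 1 := by
  have h1 : y ^ a ≤ Real.exp y := by
    rcases le_total y 1 with h | h
    · exact (Real.rpow_le_one hy h ha).trans (Real.one_le_exp hy)
    · calc y ^ a ≤ y ^ (1 : ℝ) := Real.rpow_le_rpow_of_exponent_le h ha1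
        _ = y := Real.rpow_one y
        _ ≤ Real.exp y := by linarith [Real.add_one_le_exp y]
  rw [Real.exp_neg, ← div_eq_mul_inv, div_le_one (Real.exp_pos y)]
  exact h1

theorem sin_sq_le_rpow (z : ℝ) {x θ : ℝ} (hθ0 : 0 ≤ θ) (hθ2 : θ ≤ 2) :
    Real.sin (x * z / 2) ^ 2 ≤ |x| ^ θ * (1 + z ^ 2) := by
  rcases le_total |x| 1 with h | h
  · have h1 : x ^ 2 ≤ |x| ^ θ := by
      rw [← sq_abs, ← Real.rpow_two]
      exact Real.rpow_le_rpow_of_exponent_ge' (abs_nonneg _) h hθ0 hθ2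
    calc Real.sin (x * z / 2) ^ 2 ≤ (x * z / 2) ^ 2 := Real.sin_sq_le_sq
      _ = x ^ 2 * (z ^ 2 / 4) := by ring
      _ ≤ |x| ^ θ * (1 + z ^ 2) := by
          gcongr
          nlinarith [sq_nonneg z]
  · have h1 : 1 ≤ |x| ^ θ := Real.one_le_rpow h hθ0
    calc Real.sin (x * z / 2) ^ 2 ≤ 1 * 1 := by rw [one_mul]; exact Real.sin_sq_le_one _
      _ ≤ _ := by
          gcongr
          nlinarith [sq_nonneg z]

/-! ### Removal of the heat factor -/

section Heat

variable {f : ℝ → ℝ≥0∞} {h : ℝ → ℝ} {ε : ℝ} {c : ℝ}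

/-- The factor is at most `e^{-bt}` with `b = 2 c k²`, and `(b t)^{α/2} e^{-bt} ≤ 1`. The
singularity allowed at `t = 0` is thus traded for decay `|k|^{-α}`. -/
theorem rpow_mul_heatSymbol_le (hc : 0 < c) (hf : ∀ x ≠ 0, ENNReal.ofReal c ≤ f x) (hε : 0 < ε)
    {k : ℤ} (hk : k ≠ 0) {t : ℝ} (ht : 0 ≤ t) {α : ℝ} (hα0 : 0 ≤ α) (hα : α ≤ 1) :
    t ^ (α / 2) * heatSymbol f ε k (2 * t) ≤ (2 * c) ^ (-(α / 2)) * |(k : ℝ)| ^ (-α) := by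
  have hk' : 0 < |(k : ℝ)| := abs_pos.2 (by exact_mod_cast hk)
  have hx : ε * (k : ℝ) ≠ 0 := mul_ne_zero hε.ne' (by exact_mod_cast hk)
  have hheat : heatSymbol f ε k (2 * t) ≤ Real.exp (-(2 * c * |(k : ℝ)| ^ 2 * t)) := by
    unfold heatSymbol
    split_ifs with htop
    · positivity
    · have hcf : c ≤ (f (ε * k)).toReal :=
        (ENNReal.ofReal_le_iff_le_toReal htop).1 (hf _ hx)
      rw [Real.exp_le_exp, neg_le_neg_iff, sq_abs]
      calc 2 * c * (k : ℝ) ^ 2 * t = (k : ℝ) ^ 2 * c * (2 * t) := by ring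
        _ ≤ _ := by gcongr
  set b : ℝ := 2 * c * |(k : ℝ)| ^ 2 with hb
  have hb0 : 0 < b := by positivity
  have hbe : b ^ (-(α / 2)) = (2 * c) ^ (-(α / 2)) * |(k : ℝ)| ^ (-α) := by
    rw [hb, Real.mul_rpow (by positivity) (by positivity), ← Real.rpow_two,
      ← Real.rpow_mul hk'.le]
    congr 2
    ring
  calc _ ≤ t ^ (α / 2) * Real.exp (-(b * t)) := by gcongr
    _ = b ^ (-(α / 2)) * ((b * t) ^ (α / 2) * Real.exp (-(b * t))) := by
        rw [Real.mul_rpow hb0.le ht, Real.rpow_neg hb0.le]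
        field_simp
    _ ≤ b ^ (-(α / 2)) * 1 := by
        gcongr
        exact rpow_mul_exp_neg_le_one (by positivity) (by linarith) (by linarith)
    _ = _ := by rw [mul_one, hbe]

variable (f h) in
/-- The Riemann sum which `Λ_{z,ε}(t)` approaches for large times. -/
def riemannSum (ε z : ℝ) : ℝ :=
  1 / Real.pi *
    (ε * ∑' k : ℕ, noiseRatio f h (ε * (k + 1)) * sincSq z (ε * (k + 1)))

theorem LambdaZ_summand_eq (k : ℤ) (hε : ε ≠ 0) (t z : ℝ) :
    modeAmplitude f h ε k ^ 2 * modeVariance f ε k t * Real.sin (k * ε * z / 2) ^ 2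
      = ε ^ 2 / (4 * Real.pi) * (noiseRatio f h (ε * k) * sincSq z (ε * k)
        - noiseRatio f h (ε * k) * sincSq z (ε * k) * heatSymbol f ε k (2 * t)) := by
  by_cases hk : k = 0
  · simp [hk, sincSq]
  · have hk' : (k : ℝ) ≠ 0 := by exact_mod_cast hk
    have hpi := Real.pi_ne_zero
    rw [modeAmplitude_sq hk, modeVariance, if_neg hk, sincSq, mul_comm (k : ℝ) ε]
    field_simp

variable (heven : ∀ x, noiseRatio f h (-x) = noiseRatio f h x)
  (hbv : eVariationOn (noiseRatio f h) univ < ⊤) {G : ℝ} (hG : ∀ x > 0, noiseRatio f h x ≤ G)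

include heven hbv hG in
theorem hasSum_noiseRatio_mul_sincSq (hε : 0 < ε) (z : ℝ) :
    HasSum (fun k : ℤ => noiseRatio f h (ε * k) * sincSq z (ε * k))
      (2 * ∑' k : ℕ, noiseRatio f h (ε * (k + 1)) * sincSq z (ε * (k + 1))) := by
  have hs := (summable_mul_sincSq hbv noiseRatio_nonneg hG hε z).hasSum
  set Y := ∑' k : ℕ, noiseRatio f h (ε * (k + 1)) * sincSq z (ε * (k + 1))
  set F : ℤ → ℝ := fun k => noiseRatio f h (ε * k) * sincSq z (ε * k) with hF
  have e1 : (fun k : ℕ => F ((k : ℤ) + 1))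
      = fun k : ℕ => noiseRatio f h (ε * (k + 1)) * sincSq z (ε * (k + 1)) := by
    funext k
    simp [hF]
  have e2 : (fun k : ℕ => F (-((k : ℤ) + 1)))
      = fun k : ℕ => noiseRatio f h (ε * (k + 1)) * sincSq z (ε * (k + 1)) := by
    funext k
    have hc : ((-((k : ℤ) + 1) : ℤ) : ℝ) = -((k : ℝ) + 1) := by push_cast; ring
    simp only [hF, sincSq]
    rw [hc, mul_neg, heven, neg_mul, neg_div, Real.sin_neg, neg_sq, neg_sq]
  have h0 : F 0 = 0 := by simp [hF, sincSq]
  have h1 : HasSum (fun k : ℕ => F ((k : ℤ) + 1)) Y := by rw [e1]; exact hs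
  have h2 : HasSum (fun k : ℕ => F (-((k : ℤ) + 1))) Y := by rw [e2]; exact hs
  have h3 := HasSum.of_add_one_of_neg_add_one h1 h2
  rwa [h0, add_zero, ← two_mul] at h3

-- The difference is exactly the part of the sum that carries the heat factor, which contributes
-- `|k|^{-α}`. The bound `sin² ≤ |εk|^{1+α-k'} (1 + z²)` contributes `|εk|^{α-1-k'}` after division
-- by `(εk)²`. The sum converges like that of `|k|^{-(1+k')}`, and the mesh restores `ε^{α-k'}`.
include heven hbv hG in
theorem rpow_mul_abs_LambdaZ_sub_le (hc : 0 < c) (hf : ∀ x ≠ 0, ENNReal.ofReal c ≤ f x)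
    (hε : 0 < ε) {t : ℝ} (ht : 0 ≤ t) {α k' : ℝ} (hα : α < 1 / 2) (hk0 : 0 < k') (hk' : k' ≤ α)
    (z : ℝ) :
    t ^ (α / 2) * |LambdaZ f h ε t z - riemannSum f h ε z|
      ≤ G * (2 * c) ^ (-(α / 2)) * (∑' k : ℤ, |(k : ℝ)| ^ (-(1 + k'))) * ε ^ (α - k')
        * (1 + z ^ 2) := by
  have hG0 : 0 ≤ G := (noiseRatio_nonneg 1).trans (hG 1 one_pos)
  set F : ℤ → ℝ := fun k => noiseRatio f h (ε * k) * sincSq z (ε * k) with hF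
  have hF0 : ∀ k, 0 ≤ F k := fun k => mul_nonneg (noiseRatio_nonneg _) (sincSq_nonneg _ _)
  have hFs := hasSum_noiseRatio_mul_sincSq heven hbv hG hε z
  have hHs : Summable fun k => F k * heatSymbol f ε k (2 * t) :=
    Summable.of_nonneg_of_le (fun k => mul_nonneg (hF0 k) (heatSymbol_nonneg _ _))
      (fun k => mul_le_of_le_one_right (hF0 k) (heatSymbol_le_one _ (by linarith))) hFs.summable
  have hpi := Real.pi_pos
  have hS : Summable fun k : ℤ => |(k : ℝ)| ^ (-(1 + k')) := summable_abs_rpow (by linarith)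
  have e : LambdaZ f h ε t z - riemannSum f h ε z
      = -(ε / (2 * Real.pi) * ∑' k, F k * heatSymbol f ε k (2 * t)) := by
    rw [LambdaZ, riemannSum]
    simp only [LambdaZ_summand_eq _ hε.ne']
    rw [tsum_mul_left, hFs.summable.tsum_sub hHs, hFs.tsum_eq]
    field_simp
    ring
  have hterm : ∀ k : ℤ, t ^ (α / 2) * (F k * heatSymbol f ε k (2 * t))
      ≤ G * (2 * c) ^ (-(α / 2)) * ε ^ (α - k' - 1) * (1 + z ^ 2) * |(k : ℝ)| ^ (-(1 + k')) := by
    intro k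
    by_cases hk : k = 0
    · have : F k = 0 := by simp [hF, hk, sincSq]
      rw [this, zero_mul, mul_zero]
      positivity
    have hk1 : 0 < |(k : ℝ)| := abs_pos.2 (by exact_mod_cast hk)
    have hεk : 0 < ε * |(k : ℝ)| := by positivity
    have habs : |ε * (k : ℝ)| = ε * |(k : ℝ)| := by rw [abs_mul, abs_of_pos hε]
    have hg : noiseRatio f h (ε * k) ≤ G := by
      rcases abs_choice (ε * (k : ℝ)) with hx | hx
      · rw [← hx, habs]
        exact hG _ hεk
      · rw [← heven, ← hx, habs]
        exact hG _ hεk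
    have hs : sincSq z (ε * k) ≤ (ε * |(k : ℝ)|) ^ (α - 1 - k') * (1 + z ^ 2) := by
      rw [sincSq, ← sq_abs (ε * (k : ℝ)), habs, div_le_iff₀ (by positivity)]
      refine (sin_sq_le_rpow z (θ := 1 + α - k') (by linarith) (by linarith)).trans (le_of_eq ?_)
      rw [habs, mul_right_comm, ← Real.rpow_two (ε * |(k : ℝ)|), ← Real.rpow_add hεk]
      congr 2
      ring
    have hF' : F k ≤ G * ((ε * |(k : ℝ)|) ^ (α - 1 - k') * (1 + z ^ 2)) :=
      mul_le_mul hg hs (sincSq_nonneg _ _) hG0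
    have hh := rpow_mul_heatSymbol_le hc hf hε hk ht (by linarith : 0 ≤ α) (by linarith : α ≤ 1)
    calc _ = F k * (t ^ (α / 2) * heatSymbol f ε k (2 * t)) := by ring
      _ ≤ G * ((ε * |(k : ℝ)|) ^ (α - 1 - k') * (1 + z ^ 2))
          * ((2 * c) ^ (-(α / 2)) * |(k : ℝ)| ^ (-α)) :=
          mul_le_mul hF' hh (mul_nonneg (by positivity) (heatSymbol_nonneg _ _)) (by positivity)
      _ = G * (2 * c) ^ (-(α / 2)) * ε ^ (α - 1 - k') * (1 + z ^ 2)
          * (|(k : ℝ)| ^ (α - 1 - k') * |(k : ℝ)| ^ (-α)) := by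
          rw [Real.mul_rpow hε.le hk1.le]
          ring
      _ = _ := by
          rw [← Real.rpow_add hk1]
          congr 2
          · congr 2
            ring
          · ring
  have hsum : t ^ (α / 2) * ∑' k, F k * heatSymbol f ε k (2 * t)
      ≤ G * (2 * c) ^ (-(α / 2)) * ε ^ (α - k' - 1) * (1 + z ^ 2)
        * ∑' k : ℤ, |(k : ℝ)| ^ (-(1 + k')) := by
    rw [← tsum_mul_left, ← tsum_mul_left]
    exact (hHs.mul_left _).tsum_le_tsum hterm (hS.mul_left _)
  have hS0 : 0 ≤ ∑' k : ℤ, |(k : ℝ)| ^ (-(1 + k')) := tsum_nonneg fun k => by positivity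
  have hH0 : 0 ≤ ∑' k, F k * heatSymbol f ε k (2 * t) :=
    tsum_nonneg fun k => mul_nonneg (hF0 k) (heatSymbol_nonneg _ _)
  have hεe : ε * ε ^ (α - k' - 1) = ε ^ (α - k') := by
    nth_rewrite 1 [← Real.rpow_one ε]
    rw [← Real.rpow_add hε]
    congr 1
    ring
  rw [e, abs_neg, abs_of_nonneg (mul_nonneg (by positivity) hH0)]
  calc _ = ε / (2 * Real.pi) * (t ^ (α / 2) * ∑' k, F k * heatSymbol f ε k (2 * t)) := by ring
    _ ≤ ε * (G * (2 * c) ^ (-(α / 2)) * ε ^ (α - k' - 1) * (1 + z ^ 2)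
        * ∑' k : ℤ, |(k : ℝ)| ^ (-(1 + k'))) := by
        refine mul_le_mul ?_ hsum (mul_nonneg (by positivity) hH0) hε.le
        refine div_le_self hε.le ?_
        linarith [Real.pi_gt_three]
    _ = G * (2 * c) ^ (-(α / 2)) * (∑' k : ℤ, |(k : ℝ)| ^ (-(1 + k'))) * (ε * ε ^ (α - k' - 1))
        * (1 + z ^ 2) := by ring
    _ = _ := by rw [hεe]

end Heat

section Limit

variable {f : ℝ → ℝ≥0∞} {h : ℝ → ℝ} {μ : SignedMeasure ℝ} {σ : ℝ → ℝ}
  (hbv : eVariationOn (noiseRatio f h) univ < ⊤) {G : ℝ} (hG : ∀ x > 0, noiseRatio f h x ≤ G)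
  (hσm : Measurable σ) (hσ : ∀ z, |σ z| = 1)
  (hμ : ∀ g : ℝ → ℝ, ∫ᵛ x, g x ∂<•μ = ∫ x, σ x * g x ∂μ.totalVariation)
  (hν : Integrable (fun z : ℝ => 1 + z ^ 2) μ.totalVariation)

variable (f h) in
/-- The limit of the Riemann sums. -/
def riemannLimit (z : ℝ) : ℝ := 1 / Real.pi * ∫ x in Ioi 0, noiseRatio f h x * sincSq z x

include hbv hG hσm hσ hμ hν

/-- The integrand is dominated by a multiple of `(1 + z²) / (1 + x²)`, a product of integrable
functions, so the order of integration may be exchanged. -/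
theorem LambdaLim_eq : Integrable (fun z => σ z * riemannLimit f h z) μ.totalVariation ∧
    LambdaLim f h μ = ∫ z, σ z * riemannLimit f h z ∂μ.totalVariation := by
  have hG0 : 0 ≤ G := (noiseRatio_nonneg 1).trans (hG 1 one_pos)
  have hgm := measurable_of_eVariationOn_lt_top hbv
  have hint : Integrable (fun q : ℝ × ℝ => σ q.2 * (noiseRatio f h q.1 * sincSq q.2 q.1))
      ((volume.restrict (Ioi 0)).prod μ.totalVariation) := by
    have hI : Integrable (fun x : ℝ => (1 + x ^ 2)⁻¹) (volume.restrict (Ioi 0)) :=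
      integrable_inv_one_add_sq.integrableOn
    have hdom := hI.mul_prod hν
    refine (hdom.const_mul (G * 2)).mono' ?_ ?_
    · have hs : Measurable fun q : ℝ × ℝ => sincSq q.2 q.1 :=
        measurable_sincSq.comp (f := fun q : ℝ × ℝ => (q.2, q.1)) (by fun_prop)
      have hgq : Measurable fun q : ℝ × ℝ => noiseRatio f h q.1 := hgm.comp measurable_fst
      have hσq : Measurable fun q : ℝ × ℝ => σ q.2 := hσm.comp measurable_snd
      exact (hσq.mul (hgq.mul hs)).aestronglyMeasurable
    · have hmem : ∀ᵐ q ∂((volume.restrict (Ioi (0 : ℝ))).prod μ.totalVariation), q.1 ∈ Ioi (0 : ℝ) :=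
        Measure.quasiMeasurePreserving_fst.ae (ae_restrict_mem measurableSet_Ioi)
      filter_upwards [hmem] with q hq
      rw [norm_mul, Real.norm_eq_abs, hσ, one_mul,
        Real.norm_of_nonneg (mul_nonneg (noiseRatio_nonneg _) (sincSq_nonneg _ _))]
      calc _ ≤ G * (2 * (1 + q.2 ^ 2) * (1 + q.1 ^ 2)⁻¹) :=
            mul_le_mul (hG _ hq) (sincSq_le _ _) (sincSq_nonneg _ _) hG0
        _ = _ := by ring
  have hz : ∀ z, ∫ x in Ioi 0, σ z * (noiseRatio f h x * sincSq z x)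
      = Real.pi * (σ z * riemannLimit f h z) := fun z => by
    rw [integral_const_mul, riemannLimit]
    field_simp
  constructor
  · have h1 := hint.integral_prod_right.const_mul (1 / Real.pi)
    refine h1.congr (Eventually.of_forall fun z => ?_)
    simp only [hz]
    field_simp
  · rw [LambdaLim]
    have e : ∀ t, ∫ᵛ y, (1 - Real.cos (y * t)) * noiseRatio f h t / t ^ 2 ∂<•μ
        = 2 * ∫ y, σ y * (noiseRatio f h t * sincSq y t) ∂μ.totalVariation := fun t => by
      rw [hμ, ← integral_const_mul]
      refine integral_congr_ae (Eventually.of_forall fun y => ?_)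
      simp only [sincSq]
      rw [Real.sin_sq_eq_half_sub, show 2 * (t * y / 2) = y * t by ring]
      ring
    simp only [e]
    rw [integral_const_mul, integral_integral_swap (f := fun t y =>
      σ y * (noiseRatio f h t * sincSq y t)) hint]
    simp only [hz]
    rw [integral_const_mul]
    field_simp

end Limit

section Main

variable {Ω : Type*} [MeasurableSpace Ω] {P : Measure Ω} {n : ℕ}

/-- The Riemann sum is the intermediate quantity: the distance of `Λ_{z,ε}(t)` to it is controlled
after multiplication by `t^{α/2}`, and its distance to the limit does not depend on time. The growth
`1 + z²` of both errors is integrable against the total variation. -/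
theorem exists_bound_LambdaEps {W : Fin n → Lp ℝ 2 spaceTime → Ω → ℝ}
    (hW : IsWhiteNoise P W) {f : ℝ → ℝ≥0∞} {h : ℝ → ℝ} {μ : SignedMeasure ℝ}
    (hyp : CutoffAssumptions f h μ) {α T κ : ℝ} (hα0 : 0 < α) (hα : α < 1 / 2)
    (hκ : 0 < κ) :
    ∃ C > 0, ∀ ε ∈ Ioc (0 : ℝ) 1, ∀ t ∈ Icc (0 : ℝ) T,
      t ^ (α / 2) * |LambdaEps f h μ ε t - LambdaLim f h μ| ≤ C * ε ^ (α - κ) := by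
  obtain ⟨C, hC, hZ⟩ := exists_isModeFamily hW hyp
  obtain ⟨σ, hσm, hσ, hμ⟩ := exists_sign_integral μ
  obtain ⟨c, hc, M, hM0, hcf, hM⟩ := hyp.exists_bounds
  have hν := integrable_one_add_sq hyp.mu_second_moment
  have hbv := hyp.h_ratio_bv
  have hG : ∀ x > 0, noiseRatio f h x ≤ M ^ 2 / c := fun x hx =>
    noiseRatio_le hc (hcf x hx.ne') (hM x)
  set G := M ^ 2 / c
  have heven : ∀ x, noiseRatio f h (-x) = noiseRatio f h x := fun x => by
    rw [noiseRatio, noiseRatio, hyp.h_even, hyp.f_even]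
  have hG0 : 0 ≤ G := by positivity
  set k := min κ α with hk
  have hk0 : 0 < k := lt_min hκ hα0
  have hkα : k ≤ α := min_le_right _ _
  obtain ⟨hLi, hLe⟩ := LambdaLim_eq hbv hG hσm hσ hμ hν
  set K1 : ℝ := G * (2 * c) ^ (-(α / 2)) * ∑' k_1 : ℤ, |(k_1 : ℝ)| ^ (-(1 + k)) with hK1
  set K2 : ℝ := (eVariationOn (noiseRatio f h) univ).toReal
    + 4 * G * ∑' k : ℕ, ((k : ℝ) + 1) ^ (-(3 / 2) : ℝ) with hK2
  have hK10 : 0 ≤ K1 := by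
    have : 0 ≤ ∑' k_1 : ℤ, |(k_1 : ℝ)| ^ (-(1 + k)) := tsum_nonneg fun _ => by positivity
    positivity
  have hK20 : 0 ≤ K2 := by
    have : 0 ≤ ∑' k : ℕ, ((k : ℝ) + 1) ^ (-(3 / 2) : ℝ) := tsum_nonneg fun _ => by positivity
    have := ENNReal.toReal_nonneg (a := eVariationOn (noiseRatio f h) univ)
    positivity
  set M2 : ℝ := ∫ z, (1 + z ^ 2) ∂μ.totalVariation with hM2
  have hM20 : 0 ≤ M2 := integral_nonneg fun z => by positivity
  set B : ℝ := K1 + |T| ^ (α / 2) * K2 with hB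
  have hB0 : 0 ≤ B := by positivity
  refine ⟨B * M2 + 1, by positivity, fun ε hε t ht => ?_⟩
  have hε0 := hε.1
  have hZε := hZ ε hε
  obtain ⟨hmc, -⟩ := continuousOn_areaMean_of_summable hZε.continuousOn hZε.nonneg hZε.le
    hZε.const_nonneg
  have hΛi : Integrable (fun z => σ z * LambdaZ f h ε t z) μ.totalVariation := by
    refine Integrable.bdd_mul (c := 1) (f := σ) ?_ hσm.aestronglyMeasurable
      (Eventually.of_forall fun z => (hσ z).le)
    have e : LambdaZ f h ε t = fun z => ε⁻¹ * areaMean (fun k t =>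
        modeAmplitude f h ε k ^ 2 * modeVariance f ε k t) t (ε * z) :=
      funext fun z => LambdaZ_eq f h ε t z
    rw [e]
    refine Integrable.const_mul ?_ _
    refine Integrable.of_bound (C := ∑' k : ℤ, 2 * C * |(k : ℝ)| ^ (-2 : ℝ)) ?_
      (Eventually.of_forall fun z => ?_)
    · refine Continuous.aestronglyMeasurable ?_
      exact hmc.comp_continuous (f := fun z : ℝ => (t, ε * z)) (by fun_prop)
        fun z => ⟨ht.1, mem_univ _⟩
    · exact tsum_of_norm_bounded
        ((summable_abs_rpow (by norm_num : (1 : ℝ) < 2)).mul_left (2 * C)).hasSum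
        fun k => norm_mul_one_sub_cos_le hZε.nonneg hZε.le hZε.const_nonneg k ht.1 _
  have hpt : ∀ z, t ^ (α / 2) * |LambdaZ f h ε t z - riemannLimit f h z|
      ≤ B * ε ^ (α - k) * (1 + z ^ 2) := by
    intro z
    have h1 := rpow_mul_abs_LambdaZ_sub_le heven hbv hG hc hcf hε0 ht.1 hα hk0 hkα z
    have h2 : |riemannSum f h ε z - riemannLimit f h z| ≤ K2 * (1 + z ^ 2) * ε ^ (α - k) := by
      rw [riemannSum, riemannLimit, ← mul_sub, abs_mul, abs_of_pos (by positivity)]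
      have h3 := abs_riemann_sum_sub_le hbv noiseRatio_nonneg hG hε0 hε.2 z
      calc _ ≤ 1 * _ := by
            refine mul_le_mul_of_nonneg_right ?_ (abs_nonneg _)
            rw [div_le_one Real.pi_pos]
            linarith [Real.pi_gt_three]
        _ ≤ K2 * (1 + z ^ 2) * ε ^ (1 / 2 : ℝ) := by
            rw [one_mul]
            exact h3
        _ ≤ _ := by
            refine mul_le_mul_of_nonneg_left ?_ (by positivity)
            -- Here `α < 1 / 2` enters: the rate `ε^{1/2}` of the Riemann sum is at least as good as
            -- `ε^{α-k}`.
            exact Real.rpow_le_rpow_of_exponent_ge hε0 hε.2 (by linarith)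
    have ht2 : t ^ (α / 2) ≤ |T| ^ (α / 2) :=
      Real.rpow_le_rpow ht.1 (ht.2.trans (le_abs_self T)) (by linarith)
    have ht0 : 0 ≤ t ^ (α / 2) := Real.rpow_nonneg ht.1 _
    calc _ ≤ t ^ (α / 2) * (|LambdaZ f h ε t z - riemannSum f h ε z|
          + |riemannSum f h ε z - riemannLimit f h z|) := by
          gcongr
          exact abs_sub_le _ _ _
      _ = t ^ (α / 2) * |LambdaZ f h ε t z - riemannSum f h ε z|
          + t ^ (α / 2) * |riemannSum f h ε z - riemannLimit f h z| := by ring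
      _ ≤ K1 * ε ^ (α - k) * (1 + z ^ 2) + |T| ^ (α / 2) * (K2 * (1 + z ^ 2) * ε ^ (α - k)) := by
          gcongr
      _ = _ := by
          rw [hB]
          ring
  rw [LambdaEps, hμ, hLe, ← integral_sub hΛi hLi]
  have ht0 : 0 ≤ t ^ (α / 2) := Real.rpow_nonneg ht.1 _
  calc _ = ‖∫ z, t ^ (α / 2) * (σ z * LambdaZ f h ε t z - σ z * riemannLimit f h z)
        ∂μ.totalVariation‖ := by
        rw [integral_const_mul, norm_mul, Real.norm_of_nonneg ht0, Real.norm_eq_abs]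
    _ ≤ ∫ z, B * ε ^ (α - k) * (1 + z ^ 2) ∂μ.totalVariation := by
        refine norm_integral_le_of_norm_le (hν.const_mul _) (Eventually.of_forall fun z => ?_)
        rw [← mul_sub, norm_mul, norm_mul, Real.norm_of_nonneg ht0, Real.norm_eq_abs,
          Real.norm_eq_abs, hσ, one_mul]
        exact hpt z
    _ = B * M2 * ε ^ (α - k) := by
        rw [integral_const_mul]
        ring
    _ ≤ (B * M2 + 1) * ε ^ (α - κ) := by
        have h1 : ε ^ (α - k) ≤ ε ^ (α - κ) :=
          Real.rpow_le_rpow_of_exponent_ge hε0 hε.2 (by linarith [min_le_left κ α])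
        gcongr
        linarith

end Main

end RoughBurgers

end

theorem proposition4p1 {Ω : Type*} [MeasurableSpace Ω] (P : Measure Ω) [IsProbabilityMeasure P]
    (n : ℕ) (W : Fin n → Lp ℝ 2 RoughBurgers.spaceTime → Ω → ℝ)
    (hW : RoughBurgers.IsWhiteNoise P W)
    (f : ℝ → ℝ≥0∞) (h : ℝ → ℝ) (μ : SignedMeasure ℝ)
    (hyp : RoughBurgers.CutoffAssumptions f h μ) :
    -- the area process exists (and is then unique up to indistinguishability)
    (∀ ε ∈ Ioc (0 : ℝ) 1, ∃ A, RoughBurgers.IsAreaProcess P W f h ε A) ∧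
    ∀ (p α T κ : ℝ), 1 ≤ p → 0 < α → α < 1 / 2 → 0 < T → 0 < κ →
      (∃ C > 0, ∀ ε ∈ Ioc (0 : ℝ) 1, ∀ A, RoughBurgers.IsAreaProcess P W f h ε A →
        (∫⁻ ω, (⨆ t ∈ Icc (0 : ℝ) T, RoughBurgers.sobolevNorm (-α)
            (fun x => RoughBurgers.areaDerivative μ ε A t x ω -
              RoughBurgers.LambdaEps f h μ ε t • (1 : Matrix (Fin n) (Fin n) ℝ))) ^ p ∂P) ^ (1 / p)
          ≤ ENNReal.ofReal (C * ε ^ (α - κ))) ∧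
      (∃ C > 0, ∀ ε ∈ Ioc (0 : ℝ) 1, ∀ t ∈ Icc (0 : ℝ) T,
        t ^ (α / 2) * |RoughBurgers.LambdaEps f h μ ε t - RoughBurgers.LambdaLim f h μ|
          ≤ C * ε ^ (α - κ)) := by
  refine ⟨fun ε hε => ?_, fun p α T κ hp hα0 hα hT hκ => ⟨?_, ?_⟩⟩
  · obtain ⟨C, -, hZ⟩ := RoughBurgers.exists_isModeFamily hW hyp
    exact RoughBurgers.exists_isAreaProcess (hZ ε hε)
  · exact RoughBurgers.exists_bound_areaDerivative hW hyp hp hα0 hα hT hκ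
  · exact RoughBurgers.exists_bound_LambdaEps hW hyp hα0 hα hκ
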